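/- Let $\mu>0$, $0<T<\infty$ and $u_0\in H^2(\mathbb{R}^3;\mathbb{R}^3)$. For an interval $I=[0,T)$ or $I=[0,T]$, call $u$ a smooth solution on $I$ of the three-dimensional incompressible Navier–Stokes equations with initial data $u_0$ if $u\in C(I;H^2(\mathbb{R}^3))$, $u(0)=u_0$, and there is a pressure $q$ such that $u$ and $q$ are $C^\infty$ in $(t,x)$ on $(I\setminus\{0\})\times\mathbb{R}^3$ (one-sidedly at $t=T$ if $T\in I$) and satisfy there $$u_t+u\cdot\nabla u+\nabla q=\mu\Delta u,\qquad \nabla\cdot u=0 .$$ Let $u$ be a smooth solution on $[0,T)$ and suppose that $$\int_0^T\frac{\|u(t,\cdot)\|_{L^p}^s}{1+\ln\big(e+\|u(t,\cdot)\|_{L^\infty}\big)}\,dt<\infty$$ for some pair $(p,s)$ with $3<p\le\infty$, $0<s<\infty$ and $\frac3p+\frac2s\le 1$. Then $u$ is smooth at time $t=T$: $\sup_{0<t<T}\|\nabla^2u(t,\cdot)\|_{L^2}<\infty$, and $u$ extends to a smooth solution on $[0,T]$ with the same initial data. -/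

import Mathlib

open MeasureTheory Set Filter Topology
open scoped ENNReal NNReal ContDiff

/-- Three-dimensional Euclidean space. -/
abbrev E3 : Type := EuclideanSpace ℝ (Fin 3)

/-- `g` is the weak (distributional) derivative of the locally integrable function `f` on `ℝ³`:
`∫ (∂_v φ) f = - ∫ φ (g · v)` for all real test functions `φ ∈ C_c^∞` and all directions `v`. -/
def IsWeakFDeriv {F : Type} [NormedAddCommGroup F] [NormedSpace ℝ F]
    (f : E3 → F) (g : E3 → E3 →L[ℝ] F) : Prop :=
  LocallyIntegrable f volume ∧ LocallyIntegrable g volume ∧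
    ∀ φ : E3 → ℝ, ContDiff ℝ ∞ φ → HasCompactSupport φ → ∀ v : E3,
      ∫ x, (fderiv ℝ φ x v) • f x = - ∫ x, φ x • g x v

/-- `f`, together with its weak derivatives `g = ∇f` and `h = ∇²f`, is square integrable. -/
structure IsH2Jet (f : E3 → E3) (g : E3 → E3 →L[ℝ] E3) (h : E3 → E3 →L[ℝ] E3 →L[ℝ] E3) :
    Prop where
  memLp_zero : MemLp f 2 volume
  memLp_one : MemLp g 2 volume
  memLp_two : MemLp h 2 volume
  weak_one : IsWeakFDeriv f g
  weak_two : IsWeakFDeriv g h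

/-- The Sobolev space `H²(ℝ³; ℝ³)`. -/
def MemH2 (f : E3 → E3) : Prop :=
  ∃ g h, IsH2Jet f g h

/-- `u ∈ C(I; H²(ℝ³))`: at each time of `I` the field is in `H²`, and `u`, `∇u`, `∇²u` depend
continuously on time with respect to the `L²` norm. -/
def ContinuousOnH2 (u : ℝ → E3 → E3) (I : Set ℝ) : Prop :=
  ∃ (g : ℝ → E3 → E3 →L[ℝ] E3) (h : ℝ → E3 → E3 →L[ℝ] E3 →L[ℝ] E3),
    (∀ t ∈ I, IsH2Jet (u t) (g t) (h t)) ∧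
    ∀ t₀ ∈ I,
      Tendsto (fun t => eLpNorm (fun x => u t x - u t₀ x) 2 volume) (𝓝[I] t₀) (𝓝 0) ∧
      Tendsto (fun t => eLpNorm (fun x => g t x - g t₀ x) 2 volume) (𝓝[I] t₀) (𝓝 0) ∧
      Tendsto (fun t => eLpNorm (fun x => h t x - h t₀ x) 2 volume) (𝓝[I] t₀) (𝓝 0)

/-- The divergence `∑ᵢ ∂ᵢ wᵢ` of a vector field. -/
noncomputable def divergence (w : E3 → E3) (x : E3) : ℝ :=
  ∑ i : Fin 3, (fderiv ℝ w x (EuclideanSpace.single i 1)) i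

/-- `u` and `q` solve `u_t + u·∇u + ∇q = μ Δu`, `∇·u = 0` in the classical, pointwise sense, at
all times in `J` and all points of `ℝ³`. The time derivative is taken within `J`, so that it is
one-sided at an end point of `J`. -/
def SolvesNavierStokes (μ : ℝ) (J : Set ℝ) (u : ℝ → E3 → E3) (q : ℝ → E3 → ℝ) : Prop :=
  ∀ t ∈ J, ∀ x : E3,
    derivWithin (fun τ => u τ x) J t + fderiv ℝ (u t) x (u t x) + gradient (q t) x
      = μ • Laplacian.laplacian (u t) x ∧
    divergence (u t) x = 0

/-- `u` is a smooth solution of the Navier–Stokes equations with viscosity `μ` and initial data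
`u₀` on the time interval `I`, an interval with left end point `0 ∈ I`: it is continuous in time
with values in `H²`, takes the initial data, and at positive times `u` and a pressure `q` are
`C^∞` in `(t, x)` and satisfy the equations pointwise. (At `t = 0` no smoothness beyond `H²` is
possible in general, as `u₀` is only in `H²`.) -/
structure IsSmoothSolution (μ : ℝ) (u₀ : E3 → E3) (I : Set ℝ) (u : ℝ → E3 → E3) : Prop where
  continuousOnH2 : ContinuousOnH2 u I
  initial : u 0 =ᵐ[volume] u₀
  smooth : ∃ q : ℝ → E3 → ℝ,
    ContDiffOn ℝ ∞ (fun z : ℝ × E3 => u z.1 z.2) ((I ∩ Ioi 0) ×ˢ univ) ∧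
    ContDiffOn ℝ ∞ (fun z : ℝ × E3 => q z.1 z.2) ((I ∩ Ioi 0) ×ˢ univ) ∧
    SolvesNavierStokes μ (I ∩ Ioi 0) u q

/-- `∫₀ᵀ ‖u(t)‖_{L^p}^s / (1 + ln (e + ‖u(t)‖_{L^∞})) dt`, as a number in `[0, ∞]`. (For fields in
`H²` all the norms that occur for `p ≥ 2` are finite.) -/
noncomputable def logSerrinIntegral (T : ℝ) (p : ℝ≥0∞) (s : ℝ) (u : ℝ → E3 → E3) : ℝ≥0∞ :=
  ∫⁻ t in Ioo 0 T, eLpNorm (u t) p volume ^ s /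
    ENNReal.ofReal (1 + Real.log (Real.exp 1 + (eLpNorm (u t) ⊤ volume).toReal))

/-!
# A logarithmically improved Serrin criterion

The heart of the matter is an energy estimate in `H²`. Let `Y` be the squared `H²` norm of the
velocity and `Z` that of its gradient. The pressure does no work (`sum_conj_mul_nonlin`), one
derivative of the convective term can be moved to the other factor, and the products `u_k u_j` are
bounded in `H²` by `‖u‖_p Y^{(1-3/p)/2} Z^{(3/p)/2}`: this is Hölder's inequality with the Sobolev
inequality `‖v‖_6 ≤ C ‖∇v‖_2` (`exists_eLpNorm_six_le`, `eLpNorm_mul_le_interpolate`), where products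
of two first derivatives reduce to products `u ∂²u` by the integration by parts
`∫ (∂f)⁴ = -3 ∫ f (∂f)² ∂²f` (`RapidDecay.eLpNorm_pderiv_sq_le`). Young's inequality absorbs `Z` in
the viscous term and leaves `Y' ≤ C ‖u‖_p^r Y` with `r = 2 / (1 - 3/p) ≤ s`
(`exists_energyRate_le`). Since `ln (e + ‖u‖_∞)` is at most a constant plus `ln (e + Y)`, the
derivative of `ln ln (e + Y)` is bounded by a constant times one plus the integrand of the hypothesis
(`div_mul_log_le`), so that `Y` stays bounded up to time `T` (`FourierFlow.exists_energy_le`).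

To justify this and to continue the solution, everything is carried out in frequency space, where
continuation costs nothing: at each fixed frequency the equation
`U' = -4π²μ|ξ|² U - 𝓕 (ℙ div (u ⊗ u))` is an ordinary differential equation that can be integrated
up to `T`. The pressure of the given solution is not assumed to decay. It is removed by testing the
curl of the momentum equation (`FlowData.hasDerivAt_curl`), which determines `|ξ|² U` weakly, hence
`U` almost everywhere. A uniqueness argument on band-limited test functions
(`eq_zero_of_deriv_chain`, `FlowData.ae_eq_duhamel`) shows that `U` is given by Duhamel's formula, and
thus has a representative that solves the equation at every frequency
(`FlowData.exists_fourierFlow`).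

In weighted `L²` norms the heat kernel gains half a derivative per application of Duhamel's formula
(`FourierFlow.exists_wnorm_succ_le`). A flow whose `H²` norm is bounded up to `T` is therefore
dominated, on every `[a,T]` with `a > 0`, by one rapidly decaying function, and has a limit at `T`
with the same bound (`FourierFlow.exists_closedFlow`). Differentiating under the integral sign, its
inverse Fourier transform is smooth in space-time up to `t = T` (`TimeSmooth.contDiffOn_fourierInv`),
solves the equations with the pressure `-∑ R_k R_l (u_k u_l)` in Fourier form
(`solvesNavierStokes_of_closedFlow`), and is continuous in time with values in `H²`
(`continuousOnH2_extend`). The bound on `∇²u` is then continuity on the compact interval `[0,T]`.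
-/

open scoped FourierTransform SchwartzMap

/-! ### Fourier pairs of square integrable functions -/

/-- `F` is (a representative of) the `L²` Fourier transform of `f`. -/
structure IsFourierPair (f F : E3 → ℂ) : Prop where
  memLp_left : MemLp f 2 volume
  memLp_right : MemLp F 2 volume
  fourier_eq : 𝓕 (memLp_left.toLp f) = memLp_right.toLp F

namespace IsFourierPair

variable {f g F G : E3 → ℂ}

lemma exists_of_memLp (hf : MemLp f 2 volume) : ∃ F, StronglyMeasurable F ∧ IsFourierPair f F := by
  refine ⟨(𝓕 (hf.toLp f) : Lp ℂ 2 (volume : Measure E3)), Lp.stronglyMeasurable _, hf,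
    Lp.memLp _, ?_⟩
  simp

lemma exists_of_memLp_right (hF : MemLp F 2 volume) : ∃ f, IsFourierPair f F := by
  refine ⟨(𝓕⁻ (hF.toLp F) : Lp ℂ 2 (volume : Measure E3)), Lp.memLp _, hF, ?_⟩
  simp

lemma integral_mul_fourier (h : IsFourierPair f F) (φ : 𝓢(E3, ℂ)) :
    ∫ x, f x * 𝓕 φ x = ∫ ξ, F ξ * φ ξ := by
  have h1 := Lp.fourier_toTemperedDistribution_eq (h.memLp_left.toLp f)
  rw [h.fourier_eq] at h1
  have h2 := congrArg (fun T => T φ) h1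
  simp only [TemperedDistribution.fourier_apply, Lp.toTemperedDistribution_apply] at h2
  have h3 : ∫ x, 𝓕 φ x • (h.memLp_left.toLp f) x = ∫ x, f x * 𝓕 φ x := by
    refine integral_congr_ae ?_
    filter_upwards [h.memLp_left.coeFn_toLp] with x hx
    rw [hx, smul_eq_mul, mul_comm]
  have h4 : ∫ x, φ x • (h.memLp_right.toLp F) x = ∫ x, F x * φ x := by
    refine integral_congr_ae ?_
    filter_upwards [h.memLp_right.coeFn_toLp] with x hx
    rw [hx, smul_eq_mul, mul_comm]
  rw [← h3, ← h4]; exact h2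

lemma congr_right (h : IsFourierPair f F) (hG : F =ᵐ[volume] G) : IsFourierPair f G := by
  refine ⟨h.memLp_left, h.memLp_right.ae_eq hG, ?_⟩
  rw [h.fourier_eq]
  exact (MemLp.toLp_eq_toLp_iff _ _).2 hG

lemma congr_left (h : IsFourierPair f F) (hG : f =ᵐ[volume] g) : IsFourierPair g F := by
  refine ⟨h.memLp_left.ae_eq hG, h.memLp_right, ?_⟩
  rw [← h.fourier_eq]
  congr 1
  exact (MemLp.toLp_eq_toLp_iff _ _).2 hG.symm

lemma ae_eq_right (h : IsFourierPair f F) (h' : IsFourierPair f G) : F =ᵐ[volume] G := by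
  rw [← MemLp.toLp_eq_toLp_iff h.memLp_right h'.memLp_right, ← h.fourier_eq, ← h'.fourier_eq]

lemma ae_eq_left (h : IsFourierPair f F) (h' : IsFourierPair g F) : f =ᵐ[volume] g := by
  rw [← MemLp.toLp_eq_toLp_iff h.memLp_left h'.memLp_left]
  have := h.fourier_eq.trans h'.fourier_eq.symm
  exact (Lp.fourierTransformₗᵢ E3 ℂ).injective this

lemma eLpNorm_eq (h : IsFourierPair f F) : eLpNorm f 2 volume = eLpNorm F 2 volume := by
  have := congrArg ENNReal.ofReal (congrArg norm h.fourier_eq)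
  rw [Lp.norm_fourier_eq, Lp.norm_toLp, Lp.norm_toLp,
    ENNReal.ofReal_toReal h.memLp_left.2.ne, ENNReal.ofReal_toReal h.memLp_right.2.ne] at this
  exact this

/-- Parseval's identity. -/
lemma integral_mul_conj (hf : IsFourierPair f F) (hg : IsFourierPair g G) :
    ∫ x, f x * (starRingEnd ℂ) (g x) = ∫ ξ, F ξ * (starRingEnd ℂ) (G ξ) := by
  have h1 := Lp.inner_fourier_eq (hg.memLp_left.toLp g) (hf.memLp_left.toLp f)
  rw [hg.fourier_eq, hf.fourier_eq, L2.inner_def, L2.inner_def] at h1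
  have key : ∀ {a b : E3 → ℂ} (ha : MemLp a 2 volume) (hb : MemLp b 2 volume),
      ∫ x, inner ℂ (hb.toLp b x) (ha.toLp a x) = ∫ x, a x * (starRingEnd ℂ) (b x) := by
    intro a b ha hb
    refine integral_congr_ae ?_
    filter_upwards [ha.coeFn_toLp, hb.coeFn_toLp] with x hx hy
    rw [hx, hy]; simp
  rw [key, key] at h1
  exact h1.symm

lemma of_forall_integral (hf : MemLp f 2 volume) (hF : MemLp F 2 volume)
    (h : ∀ φ : 𝓢(E3, ℂ), ∫ x, f x * 𝓕 φ x = ∫ ξ, F ξ * φ ξ) : IsFourierPair f F := by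
  obtain ⟨G, -, hG⟩ := exists_of_memLp hf
  refine hG.congr_right (ae_eq_of_integral_contDiff_smul_eq
    (hG.memLp_right.locallyIntegrable one_le_two) (hF.locallyIntegrable one_le_two) ?_)
  intro g hg hgc
  have hg₁ : HasCompactSupport (Complex.ofRealCLM ∘ g) := hgc.comp_left rfl
  have hg₂ : ContDiff ℝ ∞ (Complex.ofRealCLM ∘ g) := by fun_prop
  have := h (hg₁.toSchwartzMap hg₂)
  rw [hG.integral_mul_fourier] at this
  simpa [mul_comm] using this

/-- On `L¹ ∩ L²` the inverse Fourier integral is the inverse of the `L²` Fourier transform. -/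
lemma fourierInv (h1 : Integrable F volume) (h2 : MemLp F 2 volume) :
    IsFourierPair (𝓕⁻ F) F := by
  obtain ⟨f, hf⟩ := exists_of_memLp_right h2
  refine hf.congr_left (ae_eq_of_integral_contDiff_smul_eq
    (hf.memLp_left.locallyIntegrable one_le_two) ?_ ?_)
  · refine Continuous.locallyIntegrable ?_
    rw [Real.fourierInv_eq_fourier_comp_neg]
    exact VectorFourier.fourierIntegral_continuous Real.continuous_fourierChar
      (by exact continuous_inner) h1.comp_neg
  intro g hg hgc
  have hg₁ : HasCompactSupport (Complex.ofRealCLM ∘ g) := hgc.comp_left rfl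
  have hg₂ : ContDiff ℝ ∞ (Complex.ofRealCLM ∘ g) := by fun_prop
  set ψ : 𝓢(E3, ℂ) := hg₁.toSchwartzMap hg₂ with hψ
  have e1 := hf.integral_mul_fourier (𝓕⁻ ψ)
  rw [FourierTransform.fourier_fourierInv_eq] at e1
  have e2 : ∫ x, 𝓕⁻ F x * ψ x = ∫ ξ, F ξ * (𝓕⁻ ψ) ξ := by
    have := VectorFourier.integral_fourierIntegral_smul_eq_flip (μ := (volume : Measure E3))
      (ν := (volume : Measure E3)) (L := -(innerₗ E3)) (f := F) (g := ψ)
      Real.continuous_fourierChar (by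
        simp only [LinearMap.neg_apply, innerₗ_apply_apply]
        exact continuous_inner.neg) h1 ψ.integrable
    simp only [smul_eq_mul] at this
    rw [SchwartzMap.fourierInv_coe]
    convert! this using 3 with x x
    congr 1
    simp only [Real.fourierInv_eq, VectorFourier.fourierIntegral]
    simp [real_inner_comm]
  have e3 : ∀ a : E3 → ℂ, ∫ x, g x • a x = ∫ x, a x * ψ x := by
    intro a
    congr 1; ext x
    simp [hψ, mul_comm]
  rw [e3, e3, e1, e2]

end IsFourierPair

/-! ### Fourier calculus: derivatives and products -/

/-- The Fourier symbol `2πi ξ_a` of the partial derivative `∂_a`. -/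
noncomputable def symb (a : Fin 3) (ξ : E3) : ℂ := 2 * Real.pi * Complex.I * (ξ a : ℝ)

/-- The partial derivative `∂_a f`. -/
noncomputable def pderiv (a : Fin 3) (f : E3 → ℂ) (x : E3) : ℂ :=
  fderiv ℝ f x (EuclideanSpace.single a 1)

lemma measurable_symb (a : Fin 3) : Measurable (symb a) := by
  unfold symb; fun_prop

lemma continuous_symb (a : Fin 3) : Continuous (symb a) := by
  unfold symb; fun_prop

lemma norm_symb_le (a : Fin 3) (ξ : E3) : ‖symb a ξ‖ ≤ 2 * Real.pi * ‖ξ‖ := by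
  have : ‖ξ a‖ ≤ ‖ξ‖ := PiLp.norm_apply_le _ _
  have h := Real.pi_pos
  simp only [symb, norm_mul, Complex.norm_ofNat, Complex.norm_I, Complex.norm_real, mul_one]
  rw [Real.norm_of_nonneg h.le]
  gcongr

/-- Multiplication of a Schwartz function by the symbol of `∂_a`. -/
noncomputable def symbMul (a : Fin 3) (φ : 𝓢(E3, ℂ)) : 𝓢(E3, ℂ) :=
  SchwartzMap.smulLeftCLM ℂ (symb a) φ

lemma symb_hasTemperateGrowth (a : Fin 3) : (symb a).HasTemperateGrowth := by
  have : symb a = ⇑((2 * Real.pi * Complex.I) • (Complex.ofRealCLM.comp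
      (EuclideanSpace.proj a : E3 →L[ℝ] ℝ))) := by
    ext ξ; simp [symb]
  rw [this]
  exact ContinuousLinearMap.hasTemperateGrowth _

lemma symbMul_apply (a : Fin 3) (φ : 𝓢(E3, ℂ)) (ξ : E3) : symbMul a φ ξ = symb a ξ * φ ξ := by
  rw [symbMul, SchwartzMap.smulLeftCLM_apply_apply (symb_hasTemperateGrowth a), smul_eq_mul]

open LineDeriv in
/-- `∂_a 𝓕 φ = - 𝓕 (2πi ξ_a φ)`. -/
lemma pderiv_fourier_schwartz (a : Fin 3) (φ : 𝓢(E3, ℂ)) (x : E3) :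
    pderiv a (𝓕 φ : 𝓢(E3, ℂ)) x = - (𝓕 (symbMul a φ) : 𝓢(E3, ℂ)) x := by
  have h := SchwartzMap.lineDerivOp_fourier_eq φ (EuclideanSpace.single a (1 : ℝ))
  have h2 := congrArg (fun ψ : 𝓢(E3, ℂ) => ψ x) h
  simp only [SchwartzMap.lineDerivOp_apply_eq_fderiv] at h2
  rw [pderiv, h2]
  have h3 : (-(2 * Real.pi * Complex.I) •
      SchwartzMap.smulLeftCLM ℂ (fun y : E3 => inner ℝ y (EuclideanSpace.single a (1 : ℝ))) φ)
      = - symbMul a φ := by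
    ext ξ
    have : (fun y : E3 => inner ℝ y (EuclideanSpace.single a (1 : ℝ))).HasTemperateGrowth :=
      ((innerSL ℝ).flip _).hasTemperateGrowth
    rw [smul_apply, SchwartzMap.smulLeftCLM_apply_apply this, neg_apply, symbMul_apply]
    simp only [symb, EuclideanSpace.inner_single_right, Complex.real_smul, smul_eq_mul]
    simp only [conj_trivial, one_mul, neg_mul]
    ring
  rw [h3, FourierTransform.fourier_neg]
  simp

/-- For an `L²` function with `L²` partial derivative, differentiation is multiplication by the symbol. -/
lemma IsFourierPair.pderiv {f F : E3 → ℂ} (h : IsFourierPair f F) (hf : Differentiable ℝ f)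
    (a : Fin 3) (hd : MemLp (pderiv a f) 2 volume) :
    IsFourierPair (pderiv a f) (fun ξ => symb a ξ * F ξ) := by
  obtain ⟨G, -, hG⟩ := exists_of_memLp hd
  refine hG.congr_right (ae_eq_of_integral_contDiff_smul_eq
    (hG.memLp_right.locallyIntegrable one_le_two) ?_ ?_)
  · have := (h.memLp_right.locallyIntegrable one_le_two)
    rw [← locallyIntegrableOn_univ] at this ⊢
    exact this.continuousOn_mul (continuous_symb a).continuousOn isOpen_univ.isLocallyClosed
  intro g hg hgc
  have hg₁ : HasCompactSupport (Complex.ofRealCLM ∘ g) := hgc.comp_left rfl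
  have hg₂ : ContDiff ℝ ∞ (Complex.ofRealCLM ∘ g) := by fun_prop
  set ψ : 𝓢(E3, ℂ) := hg₁.toSchwartzMap hg₂ with hψ
  have e3 : ∀ a : E3 → ℂ, ∫ x, g x • a x = ∫ x, a x * ψ x := by
    intro a
    congr 1; ext x
    simp [hψ, mul_comm]
  rw [e3, e3, ← hG.integral_mul_fourier]
  have hint : ∀ {u : E3 → ℂ}, MemLp u 2 volume → ∀ φ : 𝓢(E3, ℂ),
      Integrable (fun x => u x * φ x) volume := fun hu φ => hu.integrable_mul (φ.memLp 2)
  set χ : 𝓢(E3, ℂ) := 𝓕 ψ with hχ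
  have hχd : ∀ x, fderiv ℝ χ x (EuclideanSpace.single a (1 : ℝ))
      = - (𝓕 (symbMul a ψ) : 𝓢(E3, ℂ)) x := fun x => pderiv_fourier_schwartz a ψ x
  have i1 : Integrable (fun x => f x * fderiv ℝ χ x (EuclideanSpace.single a (1 : ℝ))) volume := by
    simp only [hχd, mul_neg]
    exact (hint h.memLp_left _).neg
  have i2 : Integrable (fun x => fderiv ℝ f x (EuclideanSpace.single a (1 : ℝ)) * χ x) volume :=
    hint hd χ
  have e4 := integral_mul_fderiv_eq_neg_fderiv_mul_of_integrable i2 i1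
    (hint h.memLp_left χ) (fun x _ => hf x) (fun x _ => χ.differentiableAt)
  have e5 : ∫ x, _root_.pderiv a f x * χ x = ∫ x, f x * (𝓕 (symbMul a ψ) : 𝓢(E3, ℂ)) x := by
    rw [← neg_eq_iff_eq_neg] at e4
    refine e4.symm.trans ?_
    rw [← integral_neg]
    congr 1; ext x
    rw [hχd]; ring
  rw [e5, h.integral_mul_fourier]
  congr 1; ext ξ
  rw [symbMul_apply]; ring

/-- The Fourier transform of a product is the convolution of the transforms, at every frequency. -/
lemma fourier_fourierInv_mul {F G : E3 → ℂ} (hF1 : Integrable F volume) (hF2 : MemLp F 2 volume)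
    (hG1 : Integrable G volume) (hG2 : MemLp G 2 volume) (ξ : E3) :
    𝓕 (fun x => 𝓕⁻ F x * 𝓕⁻ G x) ξ = ∫ η, F η * G (ξ - η) := by
  have hH1 : Integrable (fun η => (starRingEnd ℂ) (G (ξ - η))) volume := by
    have := (hG1.comp_sub_left ξ)
    exact (Complex.conjCLE.toContinuousLinearMap.integrable_comp this)
  have hH2 : MemLp (fun η => (starRingEnd ℂ) (G (ξ - η))) 2 volume := by
    have h0 : MemLp (fun η => G (ξ - η)) 2 volume :=
      hG2.comp_measurePreserving (Measure.measurePreserving_sub_left volume ξ)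
    exact h0.star
  have hH := IsFourierPair.fourierInv hH1 hH2
  have hP := (IsFourierPair.fourierInv hF1 hF2).integral_mul_conj hH
  simp only [RingHomCompTriple.comp_apply, RingHom.id_apply] at hP
  rw [← hP, Real.fourier_eq]
  congr 1; ext x
  have h2 : 𝓕⁻ (fun η => (starRingEnd ℂ) (G (ξ - η))) x
      = (Real.fourierChar (inner ℝ ξ x) : ℂ) * (starRingEnd ℂ) (𝓕⁻ G x) := by
    rw [Real.fourierInv_eq, Real.fourierInv_eq, ← integral_conj, ← integral_const_mul,
      ← integral_sub_left_eq_self _ volume ξ]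
    congr 1; ext η
    simp only [Circle.smul_def, smul_eq_mul, map_mul, sub_sub_cancel, inner_sub_left]
    rw [sub_eq_add_neg, AddChar.map_add_eq_mul, Circle.coe_mul, mul_assoc,
      AddChar.map_neg_eq_inv, Circle.coe_inv_eq_conj]
  rw [h2, map_mul, Complex.conj_conj, Circle.smul_def, AddChar.map_neg_eq_inv,
    Circle.coe_inv_eq_conj, real_inner_comm]
  simp only [smul_eq_mul]; ring

lemma norm_fourierInv_le (F : E3 → ℂ) (x : E3) : ‖𝓕⁻ F x‖ ≤ ∫ ξ, ‖F ξ‖ := by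
  rw [Real.fourierInv_eq]
  refine (norm_integral_le_integral_norm _).trans_eq ?_
  congr 1; ext ξ; simp [Circle.norm_smul]

/-! ### Weak derivatives of classically differentiable fields -/

/-- The classical derivative of a `C¹` function is its weak derivative. -/
lemma IsWeakFDeriv.of_contDiff {F : Type} [NormedAddCommGroup F] [NormedSpace ℝ F]
    {f : E3 → F} (hf : ContDiff ℝ 1 f) : IsWeakFDeriv f (fderiv ℝ f) := by
  have hcont := hf.continuous_fderiv one_ne_zero
  refine ⟨hf.continuous.locallyIntegrable, hcont.locallyIntegrable, fun φ hφ hφc v => ?_⟩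
  have hdc : Continuous fun x => fderiv ℝ φ x v :=
    (hφ.continuous_fderiv (by simp)).clm_apply continuous_const
  have hdcs : HasCompactSupport fun x => fderiv ℝ φ x v := hφc.fderiv_apply ℝ v
  have h4 := integral_bilinear_hasFDerivAt_right_eq_neg_left_of_integrable
    (μ := (volume : Measure E3)) (f := φ) (f' := fderiv ℝ φ) (g := f) (g' := fderiv ℝ f)
    (B := ContinuousLinearMap.lsmul ℝ ℝ) (v := v) ?_ ?_ ?_
    (fun x _ => (hφ.differentiable (by simp) x).hasFDerivAt)
    (fun x _ => (hf.differentiable (by simp) x).hasFDerivAt)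
  · simp only [ContinuousLinearMap.lsmul_apply] at h4
    rw [h4, neg_neg]
  · exact (hdc.smul hf.continuous).integrable_of_hasCompactSupport hdcs.smul_right
  · exact (hφ.continuous.smul (hcont.clm_apply continuous_const)).integrable_of_hasCompactSupport
      hφc.smul_right
  · exact (hφ.continuous.smul hf.continuous).integrable_of_hasCompactSupport hφc.smul_right

lemma IsWeakFDeriv.ae_eq_fderiv {F : Type} [NormedAddCommGroup F] [NormedSpace ℝ F]
    [CompleteSpace F] {f : E3 → F} {g : E3 → E3 →L[ℝ] F} (h : IsWeakFDeriv f g)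
    (hf : ContDiff ℝ 1 f) : g =ᵐ[volume] fderiv ℝ f := by
  have h' := IsWeakFDeriv.of_contDiff hf
  refine ae_eq_of_integral_contDiff_smul_eq h.2.1 h'.2.1 fun φ hφ hφc => ?_
  have i1 : Integrable (fun x => φ x • fderiv ℝ f x) volume :=
    h'.2.1.integrable_smul_left_of_hasCompactSupport hφ.continuous hφc
  have i2 : Integrable (fun x => φ x • g x) volume :=
    h.2.1.integrable_smul_left_of_hasCompactSupport hφ.continuous hφc
  ext v
  rw [ContinuousLinearMap.integral_apply i2, ContinuousLinearMap.integral_apply i1]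
  exact neg_injective ((h.2.2 φ hφ hφc v).symm.trans (h'.2.2 φ hφ hφc v))

/-! ### Density of test functions in Schwartz space -/

/-- A smooth compactly supported function equal to `1` on the unit ball. -/
lemma exists_smooth_cutoff : ∃ θ : E3 → ℝ, ContDiff ℝ ∞ θ ∧ HasCompactSupport θ ∧
    (∀ x, ‖x‖ ≤ 1 → θ x = 1) ∧ ∀ x, |θ x| ≤ 1 := by
  let χ : ContDiffBump (0 : E3) := ⟨1, 2, one_pos, one_lt_two⟩
  refine ⟨χ, χ.contDiff, χ.hasCompactSupport, fun x hx => χ.one_of_mem_closedBall (by simpa using hx),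
    fun x => ?_⟩
  rw [abs_of_nonneg χ.nonneg]
  exact χ.le_one

/-- The derivatives of the dilates `θ(c ·)`, `0 ≤ c ≤ 1`, are bounded uniformly in `c`. -/
lemma exists_iteratedFDeriv_comp_smul_bound {θ : E3 → ℂ} (hs : ContDiff ℝ ∞ θ)
    (hc : HasCompactSupport θ) (i : ℕ) :
    ∃ C : ℝ, 0 ≤ C ∧ ∀ c : ℝ, 0 ≤ c → c ≤ 1 → ∀ x : E3,
      ‖iteratedFDeriv ℝ i (fun y => θ (c • y)) x‖ ≤ C := by
  have h0 : Continuous (iteratedFDeriv ℝ i θ) :=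
    hs.continuous_iteratedFDeriv (by exact_mod_cast le_top)
  obtain ⟨C, hC⟩ := h0.bounded_above_of_compact_support (hc.iteratedFDeriv i)
  refine ⟨max C 0, le_max_right _ _, fun c hc0 hc1 x => ?_⟩
  have h1 : (fun y => θ (c • y)) = θ ∘ (c • ContinuousLinearMap.id ℝ E3) := by
    ext y; simp
  rw [h1, ContinuousLinearMap.iteratedFDeriv_comp_right _ hs x (by exact_mod_cast le_top)]
  refine (ContinuousMultilinearMap.norm_compContinuousLinearMap_le _ _).trans ?_
  have h2 : ‖c • ContinuousLinearMap.id ℝ E3‖ ≤ 1 := by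
    rw [norm_smul, Real.norm_of_nonneg hc0]
    exact mul_le_one₀ hc1 (norm_nonneg _) ContinuousLinearMap.norm_id_le
  have h3 : ∏ _j : Fin i, ‖c • ContinuousLinearMap.id ℝ E3‖ ≤ 1 :=
    Finset.prod_le_one (fun _ _ => norm_nonneg _) (fun _ _ => h2)
  calc _ ≤ max C 0 * 1 := by
        gcongr
        exact (hC _).trans (le_max_left _ _)
    _ = _ := mul_one _

lemma SchwartzMap.exists_seq_hasCompactSupport_tendsto (ψ : 𝓢(E3, ℂ)) :
    ∃ ψs : ℕ → 𝓢(E3, ℂ), (∀ n, HasCompactSupport (ψs n)) ∧ Tendsto ψs atTop (𝓝 ψ) := by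
  obtain ⟨χ', hχ', hχ'c, hχ'1, -⟩ := exists_smooth_cutoff
  obtain ⟨χ, hχ, hχc, hχ1⟩ : ∃ χ : E3 → ℂ, ContDiff ℝ ∞ χ ∧ HasCompactSupport χ ∧
      ∀ x, ‖x‖ ≤ 1 → χ x = 1 :=
    ⟨Complex.ofRealCLM ∘ χ', Complex.ofRealCLM.contDiff.comp hχ',
      hχ'c.comp_left (map_zero _), fun x hx => by simp [hχ'1 x hx]⟩
  let c : ℕ → ℝ := fun n => ((n : ℝ) + 1)⁻¹
  have hc0 : ∀ n, 0 < c n := fun n => by positivity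
  have hc1 : ∀ n, c n ≤ 1 := fun n => inv_le_one_of_one_le₀ (by linarith [n.cast_nonneg (α := ℝ)])
  have hχs : ∀ n, ContDiff ℝ ∞ (fun y => χ (c n • y)) := fun n =>
    hχ.comp (contDiff_const_smul (c n))
  have hsm : ∀ n, ContDiff ℝ ∞ (fun y => χ (c n • y) * ψ y) := fun n =>
    (hχs n).mul (ψ.smooth ⊤)
  have hcs : ∀ n, HasCompactSupport (fun y => χ (c n • y) * ψ y) := fun n =>
    (hχc.comp_smul (hc0 n).ne').mul_right
  refine ⟨fun n => (hcs n).toSchwartzMap (hsm n), fun n => hcs n, ?_⟩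
  rw [(schwartz_withSeminorms ℂ E3 ℂ).tendsto_nhds]
  rintro ⟨k, m⟩ ε hε
  choose C hC0 hC using exists_iteratedFDeriv_comp_smul_bound hχ hχc
  set M : ℝ := ∑ i ∈ Finset.range (m + 1), (m.choose i : ℝ) * C i *
    SchwartzMap.seminorm ℂ (k + 1) (m - i) ψ + SchwartzMap.seminorm ℂ (k + 1) m ψ with hM
  have hM0 : 0 ≤ M := by
    refine add_nonneg (Finset.sum_nonneg fun i _ => ?_) (apply_nonneg _ _)
    exact mul_nonneg (mul_nonneg (Nat.cast_nonneg _) (hC0 i)) (apply_nonneg _ _)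
  -- inside the ball of radius `n + 1` the cutoff is `1`; outside, one extra power of `‖x‖` in the
  -- seminorm gains the factor `c n`
  have hbound : ∀ n, SchwartzMap.seminorm ℂ k m ((hcs n).toSchwartzMap (hsm n) - ψ) ≤ M * c n := by
    intro n
    refine SchwartzMap.seminorm_le_bound ℂ k m _ (mul_nonneg hM0 (hc0 n).le) fun x => ?_
    have hco : ⇑((hcs n).toSchwartzMap (hsm n) - ψ) = (fun y => χ (c n • y) * ψ y) - ⇑ψ := by
      ext y; simp
    rw [hco]
    by_cases hx : ‖x‖ < n + 1
    · have : ((fun y => χ (c n • y) * ψ y) - ⇑ψ) =ᶠ[𝓝 x] fun _ => 0 := by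
        filter_upwards [(isOpen_lt continuous_norm continuous_const).mem_nhds hx] with y hy
        have h1 : χ (c n • y) = 1 := hχ1 _ (by
          simp only [norm_smul, Real.norm_of_nonneg (hc0 n).le]
          change ((n : ℝ) + 1)⁻¹ * ‖y‖ ≤ 1
          rw [inv_mul_le_iff₀ (by positivity)]; simpa using hy.le)
        simp [h1]
      rw [(this.iteratedFDeriv ℝ m).eq_of_nhds, iteratedFDeriv_fun_zero]
      simp; positivity
    · push Not at hx
      rw [iteratedFDeriv_sub_apply ((hsm n).contDiffAt.of_le (by exact_mod_cast le_top))
        ((ψ.smooth m).contDiffAt)]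
      have hxc : 1 ≤ ‖x‖ * c n := by
        change 1 ≤ ‖x‖ * ((n : ℝ) + 1)⁻¹
        rwa [← div_eq_mul_inv, le_div_iff₀ (by positivity), one_mul]
      have hk : ∀ j, ‖x‖ ^ k * ‖iteratedFDeriv ℝ j ψ x‖ ≤
          SchwartzMap.seminorm ℂ (k + 1) j ψ * c n := fun j => by
        have h1 := SchwartzMap.le_seminorm ℂ (k + 1) j ψ x
        calc ‖x‖ ^ k * ‖iteratedFDeriv ℝ j ψ x‖
            ≤ (‖x‖ ^ k * ‖iteratedFDeriv ℝ j ψ x‖) * (‖x‖ * c n) :=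
              le_mul_of_one_le_right (by positivity) hxc
          _ = (‖x‖ ^ (k + 1) * ‖iteratedFDeriv ℝ j ψ x‖) * c n := by ring
          _ ≤ _ := by gcongr
      have h2 := norm_iteratedFDeriv_mul_le (hχs n) (ψ.smooth ⊤) x (n := m)
        (by exact_mod_cast le_top)
      calc ‖x‖ ^ k * ‖iteratedFDeriv ℝ m (fun y => χ (c n • y) * ψ y) x -
              iteratedFDeriv ℝ m (⇑ψ) x‖
          ≤ ‖x‖ ^ k * (∑ i ∈ Finset.range (m + 1), (m.choose i : ℝ) *
              ‖iteratedFDeriv ℝ i (fun y => χ (c n • y)) x‖ *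
              ‖iteratedFDeriv ℝ (m - i) ψ x‖ + ‖iteratedFDeriv ℝ m ψ x‖) := by
            gcongr
            exact (norm_sub_le _ _).trans (by gcongr)
        _ = ∑ i ∈ Finset.range (m + 1), (m.choose i : ℝ) *
              ‖iteratedFDeriv ℝ i (fun y => χ (c n • y)) x‖ *
              (‖x‖ ^ k * ‖iteratedFDeriv ℝ (m - i) ψ x‖)
              + ‖x‖ ^ k * ‖iteratedFDeriv ℝ m ψ x‖ := by
            rw [mul_add, Finset.mul_sum]
            congr 1
            exact Finset.sum_congr rfl fun i _ => by ring
        _ ≤ ∑ i ∈ Finset.range (m + 1), (m.choose i : ℝ) * C i *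
              (SchwartzMap.seminorm ℂ (k + 1) (m - i) ψ * c n)
              + SchwartzMap.seminorm ℂ (k + 1) m ψ * c n := by
            refine add_le_add (Finset.sum_le_sum fun i _ => mul_le_mul ?_ (hk _) (by positivity)
              (mul_nonneg (Nat.cast_nonneg _) (hC0 i))) (hk _)
            exact mul_le_mul_of_nonneg_left (hC i (c n) (hc0 n).le (hc1 n) x) (Nat.cast_nonneg _)
        _ = M * c n := by
            rw [hM, add_mul, Finset.sum_mul]
            congr 1
            exact Finset.sum_congr rfl fun i _ => by ring
  have hlim : Tendsto (fun n => M * c n) atTop (𝓝 0) := by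
    have := (tendsto_one_div_add_atTop_nhds_zero_nat (𝕜 := ℝ)).const_mul M
    simpa [c, one_div] using this
  filter_upwards [hlim.eventually (gt_mem_nhds hε)] with n hn
  exact (hbound n).trans_lt hn

/-! ### Differentiation of integrals within a convex set -/

/-- Differentiation under the integral sign within a convex set, possibly at a boundary point. -/
lemma hasFDerivWithinAt_integral_of_dominated {α : Type*} [MeasurableSpace α] {ν : Measure α}
    {H E : Type*} [NormedAddCommGroup H] [NormedSpace ℝ H] [NormedAddCommGroup E] [NormedSpace ℝ E]
    [CompleteSpace E] {F : H → α → E} {F' : H → α → H →L[ℝ] E} {s : Set H} {x₀ : H}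
    {bound : α → ℝ} (hs : Convex ℝ s) (hx₀ : x₀ ∈ s) (hF : ∀ x ∈ s, Integrable (F x) ν)
    (hF' : AEStronglyMeasurable (F' x₀) ν) (hb : Integrable bound ν)
    (hbound : ∀ x ∈ s, ∀ a, ‖F' x a‖ ≤ bound a)
    (hd : ∀ x ∈ s, ∀ a, HasFDerivWithinAt (fun x => F x a) (F' x a) s x) :
    HasFDerivWithinAt (fun x => ∫ a, F x a ∂ν) (∫ a, F' x₀ a ∂ν) s x₀ := by
  have hF'_int : Integrable (F' x₀) ν := hb.mono' hF' (ae_of_all _ (hbound x₀ hx₀))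
  have nneg : ∀ x, 0 ≤ ‖x - x₀‖⁻¹ := fun x ↦ inv_nonneg.mpr (norm_nonneg _)
  -- the mean value inequality on the convex set dominates the difference quotients
  have hlip : ∀ x ∈ s, ∀ a, ‖F x a - F x₀ a‖ ≤ bound a * ‖x - x₀‖ := fun x hx a =>
    hs.norm_image_sub_le_of_norm_hasFDerivWithin_le (fun y hy => hd y hy a)
      (fun y hy => hbound y hy a) hx₀ hx
  have : ∀ᶠ x in 𝓝[s] x₀, ‖x - x₀‖⁻¹ *
      ‖((∫ a, F x a ∂ν) - ∫ a, F x₀ a ∂ν) - (∫ a, F' x₀ a ∂ν) (x - x₀)‖ =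
      ‖∫ a, ‖x - x₀‖⁻¹ • (F x a - F x₀ a - F' x₀ a (x - x₀)) ∂ν‖ := by
    filter_upwards [self_mem_nhdsWithin] with x hx
    rw [← norm_smul_of_nonneg (nneg _), integral_smul, integral_sub, integral_sub,
      ← ContinuousLinearMap.integral_apply hF'_int]
    exacts [hF x hx, hF x₀ hx₀, (hF x hx).sub (hF x₀ hx₀), hF'_int.apply_continuousLinearMap _]
  rw [hasFDerivWithinAt_iff_tendsto, tendsto_congr' this, ← tendsto_zero_iff_norm_tendsto_zero]
  have h0 : ∫ _ : α, (0 : E) ∂ν = 0 := by simp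
  rw [← h0]
  apply tendsto_integral_filter_of_dominated_convergence (bound := fun a => bound a + ‖F' x₀ a‖)
  · filter_upwards [self_mem_nhdsWithin] with x hx
    exact (((hF x hx).1.sub (hF x₀ hx₀).1).sub (hF'.apply_continuousLinearMap _)).const_smul _
  · filter_upwards [self_mem_nhdsWithin] with x hx
    refine ae_of_all _ fun a => ?_
    rw [norm_smul_of_nonneg (nneg _)]
    have hb0 : 0 ≤ bound a := (norm_nonneg _).trans (hbound x₀ hx₀ a)
    calc ‖x - x₀‖⁻¹ * ‖F x a - F x₀ a - F' x₀ a (x - x₀)‖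
        ≤ ‖x - x₀‖⁻¹ * ((bound a + ‖F' x₀ a‖) * ‖x - x₀‖) := by
          gcongr
          refine (norm_sub_le _ _).trans ?_
          rw [add_mul]
          exact add_le_add (hlip x hx a) ((F' x₀ a).le_opNorm _)
      _ ≤ bound a + ‖F' x₀ a‖ := by
          rw [← div_eq_inv_mul]
          exact div_le_of_le_mul₀ (norm_nonneg _) (by positivity) le_rfl
  · exact hb.add hF'_int.norm
  · refine ae_of_all _ fun a => ?_
    have := (hasFDerivWithinAt_iff_tendsto.1 (hd x₀ hx₀ a))
    rw [tendsto_zero_iff_norm_tendsto_zero]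
    refine this.congr fun x => ?_
    rw [norm_smul_of_nonneg (nneg _)]

lemma hasDerivWithinAt_integral_of_dominated {α : Type*} [MeasurableSpace α] {ν : Measure α}
    {E : Type*} [NormedAddCommGroup E] [NormedSpace ℝ E]
    [CompleteSpace E] {F F' : ℝ → α → E} {s : Set ℝ} {x₀ : ℝ}
    {bound : α → ℝ} (hs : Convex ℝ s) (hx₀ : x₀ ∈ s) (hF : ∀ x ∈ s, Integrable (F x) ν)
    (hF' : AEStronglyMeasurable (F' x₀) ν) (hb : Integrable bound ν)
    (hbound : ∀ x ∈ s, ∀ a, ‖F' x a‖ ≤ bound a)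
    (hd : ∀ x ∈ s, ∀ a, HasDerivWithinAt (fun x => F x a) (F' x a) s x) :
    HasDerivWithinAt (fun x => ∫ a, F x a ∂ν) (∫ a, F' x₀ a ∂ν) s x₀ := by
  have h := hasFDerivWithinAt_integral_of_dominated (ν := ν) (F := F)
    (F' := fun x a => ContinuousLinearMap.toSpanSingleton ℝ (F' x a)) (bound := bound) hs hx₀ hF
    ((ContinuousLinearMap.toSpanSingletonCLE (𝕜 := ℝ) (E := E)).continuous.comp_aestronglyMeasurable hF') hb
    (fun x hx a => by rw [ContinuousLinearMap.norm_toSpanSingleton]; exact hbound x hx a)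
    (fun x hx a => (hd x hx a).hasFDerivWithinAt)
  have h2 := h.hasDerivWithinAt
  rw [ContinuousLinearMap.integral_apply] at h2
  · simpa using h2
  · exact (ContinuousLinearMap.toSpanSingletonCLE (𝕜 := ℝ) (E := E)).toContinuousLinearMap.integrable_comp
      (hb.mono' hF' (ae_of_all _ (hbound x₀ hx₀)))

/-! ### Weighted norms in frequency space -/

lemma ENNReal.sq_lintegral_mul_le {α : Type*} [MeasurableSpace α] {ν : Measure α}
    {f g : α → ℝ≥0∞} (hf : AEMeasurable f ν) (hg : AEMeasurable g ν) :
    (∫⁻ a, f a * g a ∂ν) ^ 2 ≤ (∫⁻ a, f a ^ 2 ∂ν) * ∫⁻ a, g a ^ 2 ∂ν := by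
  have h := ENNReal.lintegral_mul_le_Lp_mul_Lq ν Real.HolderConjugate.two_two hf hg
  have h2 := pow_le_pow_left' h 2
  refine h2.trans_eq ?_
  rw [mul_pow, ← ENNReal.rpow_natCast, ← ENNReal.rpow_natCast, ← ENNReal.rpow_mul,
    ← ENNReal.rpow_mul]
  simp

lemma ENNReal.sq_lintegral_mul_le' {α : Type*} [MeasurableSpace α] {ν : Measure α}
    {f g : α → ℝ≥0∞} (hf : Measurable f) (hg : Measurable g) :
    (∫⁻ a, f a * g a ∂ν) ^ 2 ≤ (∫⁻ a, g a ∂ν) * ∫⁻ a, f a ^ 2 * g a ∂ν := by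
  have h := ENNReal.sq_lintegral_mul_le (ν := ν.withDensity g) (f := f) (g := fun _ => 1)
    hf.aemeasurable measurable_const.aemeasurable
  simp only [mul_one, one_pow] at h
  rw [lintegral_withDensity_eq_lintegral_mul _ hg hf,
    lintegral_withDensity_eq_lintegral_mul _ hg (hf.pow_const 2),
    lintegral_withDensity_eq_lintegral_mul _ hg measurable_const] at h
  simp only [Pi.mul_apply, mul_one] at h
  calc _ = (∫⁻ a, g a * f a ∂ν) ^ 2 := by simp_rw [mul_comm]
    _ ≤ _ := h
    _ = _ := by rw [mul_comm]; simp_rw [mul_comm (g _)]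

/-- The frequency weight `1 + |ξ|`. -/
noncomputable def wt (ξ : E3) : ℝ≥0∞ := 1 + ‖ξ‖ₑ

@[fun_prop]
lemma measurable_wt : Measurable wt := by unfold wt; fun_prop

lemma wt_ne_top (ξ : E3) : wt ξ ≠ ⊤ := by simp [wt]

lemma one_le_wt (ξ : E3) : 1 ≤ wt ξ := le_self_add

lemma wt_ne_zero (ξ : E3) : wt ξ ≠ 0 := (zero_lt_one.trans_le (one_le_wt ξ)).ne'

lemma enorm_le_wt (ξ : E3) : ‖ξ‖ₑ ≤ wt ξ := le_add_self

lemma wt_eq_ofReal (ξ : E3) : wt ξ = ENNReal.ofReal (1 + ‖ξ‖) := by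
  rw [ENNReal.ofReal_add zero_le_one (norm_nonneg _), ofReal_norm]; simp [wt]

/-- The square of the weighted norm `‖(1+|ξ|)^{k/2} f‖_{L²}`. -/
noncomputable def wnorm (k : ℕ) (f : E3 → ℝ≥0∞) : ℝ≥0∞ := ∫⁻ ξ, wt ξ ^ k * f ξ ^ 2

lemma wnorm_mono {k : ℕ} {f g : E3 → ℝ≥0∞} (h : ∀ ξ, f ξ ≤ g ξ) : wnorm k f ≤ wnorm k g := by
  unfold wnorm; gcongr; exact h _

lemma wnorm_mono_left {k l : ℕ} (hkl : k ≤ l) (f : E3 → ℝ≥0∞) : wnorm k f ≤ wnorm l f := by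
  unfold wnorm; gcongr; exact one_le_wt _

lemma wnorm_add_le {k : ℕ} {f g : E3 → ℝ≥0∞} (hf : Measurable f) :
    wnorm k (fun ξ => f ξ + g ξ) ≤ 2 * (wnorm k f + wnorm k g) := by
  unfold wnorm
  rw [← lintegral_add_left (by fun_prop), ← lintegral_const_mul' _ _ (by simp)]
  refine lintegral_mono fun ξ => ?_
  have h : (f ξ + g ξ) ^ 2 ≤ 2 * (f ξ ^ 2 + g ξ ^ 2) := by
    have := ENNReal.rpow_add_le_mul_rpow_add_rpow (f ξ) (g ξ) (p := 2) (by norm_num)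
    have e : (2 : ℝ≥0∞) ^ ((2 : ℝ) - 1) = 2 := by norm_num
    rw [e] at this
    exact_mod_cast this
  calc wt ξ ^ k * (f ξ + g ξ) ^ 2 ≤ wt ξ ^ k * (2 * (f ξ ^ 2 + g ξ ^ 2)) := by gcongr
    _ = _ := by ring

lemma wnorm_const_mul {k : ℕ} {c : ℝ≥0∞} (hc : c ≠ ⊤) (f : E3 → ℝ≥0∞) :
    wnorm k (fun ξ => c * f ξ) = c ^ 2 * wnorm k f := by
  unfold wnorm
  rw [← lintegral_const_mul' _ _ (by finiteness)]
  congr 1; ext ξ; ring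

lemma wnorm_wt_mul (k l : ℕ) (f : E3 → ℝ≥0∞) :
    wnorm k (fun ξ => wt ξ ^ l * f ξ) = wnorm (k + 2 * l) f := by
  unfold wnorm
  congr 1; ext ξ; ring

/-- `∫ (1+|ξ|)^{-4} dξ`. -/
noncomputable def wtConst : ℝ≥0∞ := ∫⁻ ξ : E3, (wt ξ ^ 4)⁻¹

lemma wtConst_ne_top : wtConst ≠ ⊤ := by
  have h := finite_integral_one_add_norm (E := E3) (μ := volume) (r := 4)
    (by rw [finrank_euclideanSpace_fin]; norm_num)
  refine ((lintegral_mono fun ξ => ?_).trans_lt h).ne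
  rw [wt_eq_ofReal, Real.rpow_neg (by positivity), ENNReal.ofReal_inv_of_pos (by positivity),
    ← ENNReal.ofReal_pow (by positivity)]
  norm_cast

/-- Cauchy–Schwarz with the weight `(1+|ξ|)^{-4}`, which is integrable on `ℝ³`. -/
lemma sq_lintegral_wt_mul_le (k : ℕ) {f : E3 → ℝ≥0∞} (hf : Measurable f) :
    (∫⁻ ξ, wt ξ ^ k * f ξ) ^ 2 ≤ wtConst * wnorm (2 * k + 4) f := by
  have h := ENNReal.sq_lintegral_mul_le (ν := (volume : Measure E3))
    (f := fun ξ => (wt ξ ^ 2)⁻¹) (g := fun ξ => wt ξ ^ (k + 2) * f ξ)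
    (by fun_prop) (by fun_prop)
  refine le_trans (le_of_eq ?_) (h.trans (le_of_eq ?_))
  · congr 2; ext ξ
    have h1 : (wt ξ ^ 2)⁻¹ * wt ξ ^ 2 = 1 := ENNReal.inv_mul_cancel (pow_ne_zero _ (wt_ne_zero ξ))
      (ENNReal.pow_ne_top (wt_ne_top ξ))
    calc wt ξ ^ k * f ξ = ((wt ξ ^ 2)⁻¹ * wt ξ ^ 2) * (wt ξ ^ k * f ξ) := by rw [h1, one_mul]
      _ = _ := by ring
  · unfold wtConst wnorm
    congr 1
    · congr 1; ext ξ; rw [← ENNReal.inv_pow, ← pow_mul]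
    · congr 1; ext ξ; ring

lemma sq_lintegral_le {f : E3 → ℝ≥0∞} (hf : Measurable f) :
    (∫⁻ ξ, f ξ) ^ 2 ≤ wtConst * wnorm 4 f := by
  simpa using sq_lintegral_wt_mul_le 0 hf

/-! ### Convolution of nonnegative functions -/

/-- The convolution of two nonnegative functions on frequency space. -/
noncomputable def lconv (f g : E3 → ℝ≥0∞) (ξ : E3) : ℝ≥0∞ := ∫⁻ η, f η * g (ξ - η)

@[fun_prop]
lemma measurable_lconv {f g : E3 → ℝ≥0∞} (hf : Measurable f) (hg : Measurable g) :
    Measurable (lconv f g) := by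
  unfold lconv
  exact Measurable.lintegral_prod_right' (f := fun p : E3 × E3 => f p.2 * g (p.1 - p.2))
    (by fun_prop)

lemma lintegral_mul_lconv {f g : E3 → ℝ≥0∞} (hf : Measurable f) (hg : Measurable g) :
    ∫⁻ ξ, lconv f g ξ = (∫⁻ η, f η) * ∫⁻ η, g η := by
  unfold lconv
  rw [lintegral_lintegral_swap (by fun_prop)]
  have : ∀ η, ∫⁻ ξ, f η * g (ξ - η) = f η * ∫⁻ ξ, g ξ := fun η => by
    rw [lintegral_const_mul _ (by fun_prop), lintegral_sub_right_eq_self]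
  simp_rw [this]
  rw [lintegral_mul_const _ hf]

lemma wt_le_add (ξ η : E3) : wt ξ ≤ wt η + wt (ξ - η) := by
  unfold wt
  calc 1 + ‖ξ‖ₑ = 1 + ‖η + (ξ - η)‖ₑ := by rw [add_sub_cancel]
    _ ≤ 1 + (‖η‖ₑ + ‖ξ - η‖ₑ) := by gcongr; exact enorm_add_le _ _
    _ ≤ 1 + (‖η‖ₑ + ‖ξ - η‖ₑ) + 1 := le_self_add
    _ = _ := by ring

/-- The weighted norm of the part of a convolution where the first frequency dominates. -/
lemma wnorm_lconv_dominant (k : ℕ) {f g : E3 → ℝ≥0∞} (hf : Measurable f) (hg : Measurable g) :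
    wnorm k (fun ξ => ∫⁻ η, (if wt ξ ≤ 2 * wt η then f η else 0) * g (ξ - η)) ≤
      2 ^ k * (wnorm k f * (∫⁻ η, g η) ^ 2) := by
  have hpt : ∀ ξ, wt ξ ^ k * (∫⁻ η, (if wt ξ ≤ 2 * wt η then f η else 0) * g (ξ - η)) ^ 2 ≤
      (∫⁻ η, g η) * (2 ^ k * lconv (fun η => wt η ^ k * f η ^ 2) g ξ) := by
    intro ξ
    have hm : Measurable fun η => if wt ξ ≤ 2 * wt η then f η else 0 :=
      Measurable.ite (measurableSet_le measurable_const (by fun_prop)) hf measurable_const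
    have hm2 : Measurable fun η => g (ξ - η) := by fun_prop
    have h := ENNReal.sq_lintegral_mul_le' (ν := (volume : Measure E3)) hm hm2
    rw [lintegral_sub_left_eq_self] at h
    calc _ ≤ wt ξ ^ k * ((∫⁻ η, g η) *
          ∫⁻ η, (if wt ξ ≤ 2 * wt η then f η else 0) ^ 2 * g (ξ - η)) := by gcongr
      _ = (∫⁻ η, g η) * (∫⁻ η, wt ξ ^ k *
          ((if wt ξ ≤ 2 * wt η then f η else 0) ^ 2 * g (ξ - η))) := by
          rw [lintegral_const_mul' _ _ (ENNReal.pow_ne_top (wt_ne_top ξ))]; ring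
      _ ≤ (∫⁻ η, g η) * (∫⁻ η, 2 ^ k * (wt η ^ k * f η ^ 2 * g (ξ - η))) := by
          refine mul_le_mul_right (lintegral_mono fun η => ?_) _
          split_ifs with h
          · calc wt ξ ^ k * (f η ^ 2 * g (ξ - η)) ≤ (2 * wt η) ^ k * (f η ^ 2 * g (ξ - η)) := by
                  gcongr
              _ = _ := by ring
          · simp
      _ = _ := by rw [lintegral_const_mul' _ _ (by finiteness)]; rfl
  refine (lintegral_mono hpt).trans ?_
  rw [lintegral_const_mul _ (by fun_prop), lintegral_const_mul _ (by fun_prop),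
    lintegral_mul_lconv (by fun_prop) hg]
  unfold wnorm
  apply le_of_eq; ring

/-- The tame product estimate `‖fg‖_{H^σ} ≤ C (‖f‖_{H^σ} ‖g‖_∞ + ‖f‖_∞ ‖g‖_{H^σ})` on the Fourier side,
with the `L¹` norm of the Fourier transform in place of the sup norm. -/
lemma wnorm_lconv_le (k : ℕ) {f g : E3 → ℝ≥0∞} (hf : Measurable f) (hg : Measurable g) :
    wnorm k (lconv f g) ≤
      2 * 2 ^ k * (wnorm k f * (∫⁻ η, g η) ^ 2 + wnorm k g * (∫⁻ η, f η) ^ 2) := by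
  set I : (E3 → ℝ≥0∞) → (E3 → ℝ≥0∞) → E3 → ℝ≥0∞ := fun f g ξ =>
    ∫⁻ η, (if wt ξ ≤ 2 * wt η then f η else 0) * g (ξ - η) with hI
  have hIm : ∀ {f g : E3 → ℝ≥0∞}, Measurable f → Measurable g → Measurable (I f g) := by
    intro f g hf hg
    refine Measurable.lintegral_prod_right'
      (f := fun p : E3 × E3 => (if wt p.1 ≤ 2 * wt p.2 then f p.2 else 0) * g (p.1 - p.2)) ?_
    refine Measurable.mul (Measurable.ite (measurableSet_le (by fun_prop) (by fun_prop))
      (by fun_prop) measurable_const) (by fun_prop)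
  have hle : ∀ ξ, lconv f g ξ ≤ I f g ξ + I g f ξ := by
    intro ξ
    have h2 : I g f ξ = ∫⁻ η, f η * (if wt ξ ≤ 2 * wt (ξ - η) then g (ξ - η) else 0) := by
      rw [hI]
      simp only
      rw [← lintegral_sub_left_eq_self _ ξ]
      congr 1; ext η
      rw [sub_sub_cancel, mul_comm]
    rw [h2, hI, ← lintegral_add_left]
    · refine lintegral_mono fun η => ?_
      by_cases h : wt ξ ≤ 2 * wt η
      · simp [h]
      -- `ξ = η + (ξ - η)`, so one of the two frequencies carries at least half of the weight
      · have h' : wt ξ ≤ 2 * wt (ξ - η) := by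
          by_contra h''
          push Not at h h''
          have := wt_le_add ξ η
          have h3 : 2 * wt η + 2 * wt (ξ - η) < wt ξ + wt ξ := ENNReal.add_lt_add h h''
          have h4 : wt ξ + wt ξ ≤ 2 * wt η + 2 * wt (ξ - η) := by
            rw [← mul_add, two_mul]; gcongr
          exact absurd h3 (not_lt.2 h4)
        simp [h, h']
    · refine Measurable.mul (Measurable.ite (measurableSet_le measurable_const (by fun_prop)) hf
        measurable_const) (by fun_prop)
  calc wnorm k (lconv f g) ≤ wnorm k (fun ξ => I f g ξ + I g f ξ) := wnorm_mono hle
    _ ≤ 2 * (wnorm k (I f g) + wnorm k (I g f)) := wnorm_add_le (hIm hf hg)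
    _ ≤ 2 * (2 ^ k * (wnorm k f * (∫⁻ η, g η) ^ 2) + 2 ^ k * (wnorm k g * (∫⁻ η, f η) ^ 2)) := by
        gcongr
        · exact wnorm_lconv_dominant k hf hg
        · exact wnorm_lconv_dominant k hg hf
    _ = _ := by ring

lemma lconv_sq_le {f g : E3 → ℝ≥0∞} (hf : Measurable f) (hg : Measurable g) (ξ : E3) :
    lconv f g ξ ^ 2 ≤ wnorm 0 f * wnorm 0 g := by
  have h := ENNReal.sq_lintegral_mul_le (ν := (volume : Measure E3)) (f := f)
    (g := fun η => g (ξ - η)) hf.aemeasurable (by fun_prop)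
  rw [lintegral_sub_left_eq_self (fun η => g η ^ 2)] at h
  simpa [wnorm, lconv] using h

/-! ### Rapidly decaying envelopes -/

/-- A nonnegative function on frequency space all of whose weighted `L²` norms are finite. -/
structure RapidEnvelope (E : E3 → ℝ) : Prop where
  measurable : Measurable E
  nonneg : ∀ ξ, 0 ≤ E ξ
  wnorm_lt_top : ∀ k, wnorm k (fun ξ => ENNReal.ofReal (E ξ)) < ⊤

namespace RapidEnvelope

variable {E E' : E3 → ℝ}

lemma wt_mul (h : RapidEnvelope E) (l : ℕ) : RapidEnvelope fun ξ => (1 + ‖ξ‖) ^ l * E ξ where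
  measurable := by have := h.measurable; fun_prop
  nonneg ξ := mul_nonneg (by positivity) (h.nonneg ξ)
  wnorm_lt_top k := by
    have e : (fun ξ : E3 => ENNReal.ofReal ((1 + ‖ξ‖) ^ l * E ξ))
        = fun ξ => wt ξ ^ l * ENNReal.ofReal (E ξ) := by
      ext ξ
      rw [ENNReal.ofReal_mul (by positivity), ENNReal.ofReal_pow (by positivity), wt_eq_ofReal]
    rw [e, wnorm_wt_mul]
    exact h.wnorm_lt_top _

lemma add (h : RapidEnvelope E) (h' : RapidEnvelope E') : RapidEnvelope fun ξ => E ξ + E' ξ where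
  measurable := h.measurable.add h'.measurable
  nonneg ξ := add_nonneg (h.nonneg ξ) (h'.nonneg ξ)
  wnorm_lt_top k := by
    simp_rw [ENNReal.ofReal_add (h.nonneg _) (h'.nonneg _)]
    refine (wnorm_add_le h.measurable.ennreal_ofReal).trans_lt ?_
    have := h.wnorm_lt_top k
    have := h'.wnorm_lt_top k
    finiteness

lemma const_mul (h : RapidEnvelope E) {c : ℝ} (hc : 0 ≤ c) : RapidEnvelope fun ξ => c * E ξ where
  measurable := h.measurable.const_mul c
  nonneg ξ := mul_nonneg hc (h.nonneg ξ)
  wnorm_lt_top k := by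
    simp_rw [ENNReal.ofReal_mul hc]
    rw [wnorm_const_mul (by simp)]
    have := h.wnorm_lt_top k
    finiteness

lemma memLp (h : RapidEnvelope E) : MemLp E 2 volume := by
  refine ⟨h.measurable.aestronglyMeasurable, ?_⟩
  rw [eLpNorm_lt_top_iff_lintegral_rpow_enorm_lt_top (by simp) (by simp)]
  have := h.wnorm_lt_top 0
  simp only [wnorm, pow_zero, one_mul] at this
  refine (lintegral_congr fun ξ => ?_).trans_lt this
  rw [Real.enorm_of_nonneg (h.nonneg ξ)]
  norm_cast

lemma lintegral_lt_top (h : RapidEnvelope E) : ∫⁻ ξ, ENNReal.ofReal (E ξ) < ⊤ := by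
  have h1 := sq_lintegral_le h.measurable.ennreal_ofReal
  have h2 : (∫⁻ ξ, ENNReal.ofReal (E ξ)) ^ 2 < ⊤ := h1.trans_lt
    (ENNReal.mul_lt_top wtConst_ne_top.lt_top (h.wnorm_lt_top 4))
  by_contra h3
  rw [not_lt_top_iff] at h3
  simp [h3] at h2

lemma integrable (h : RapidEnvelope E) : Integrable E volume := by
  refine ⟨h.measurable.aestronglyMeasurable, ?_⟩
  rw [hasFiniteIntegral_iff_ofReal (ae_of_all _ h.nonneg)]
  exact h.lintegral_lt_top

lemma integrable_mul_sub (h : RapidEnvelope E) (h' : RapidEnvelope E') (ξ : E3) :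
    Integrable (fun η => E η * E' (ξ - η)) volume :=
  h.memLp.integrable_mul
    (h'.memLp.comp_measurePreserving (Measure.measurePreserving_sub_left volume ξ))

lemma conv (h : RapidEnvelope E) (h' : RapidEnvelope E') :
    RapidEnvelope fun ξ => ∫ η, E η * E' (ξ - η) where
  measurable := by
    have := h.measurable
    have := h'.measurable
    have h2 : StronglyMeasurable fun p : E3 × E3 => E p.2 * E' (p.1 - p.2) :=
      Measurable.stronglyMeasurable (by fun_prop)
    exact h2.integral_prod_right'.measurable
  nonneg ξ := integral_nonneg fun η => mul_nonneg (h.nonneg _) (h'.nonneg _)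
  wnorm_lt_top k := by
    have e : (fun ξ => ENNReal.ofReal (∫ η, E η * E' (ξ - η))) =
        lconv (fun ξ => ENNReal.ofReal (E ξ)) (fun ξ => ENNReal.ofReal (E' ξ)) := by
      ext ξ
      rw [ofReal_integral_eq_lintegral_ofReal (h.integrable_mul_sub h' ξ)
        (ae_of_all _ fun η => mul_nonneg (h.nonneg _) (h'.nonneg _))]
      simp_rw [ENNReal.ofReal_mul (h.nonneg _)]
      rfl
    rw [e]
    refine (wnorm_lconv_le k h.measurable.ennreal_ofReal h'.measurable.ennreal_ofReal).trans_lt ?_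
    have := h.wnorm_lt_top k
    have := h'.wnorm_lt_top k
    have := h.lintegral_lt_top
    have := h'.lintegral_lt_top
    finiteness

end RapidEnvelope

/-! ### The equations for the components -/

/-- The `j`-th component of a vector of `ℝ³`, as a complex number. -/
noncomputable def coordC (j : Fin 3) : E3 →L[ℝ] ℂ :=
  Complex.ofRealCLM.comp (EuclideanSpace.proj j : E3 →L[ℝ] ℝ)

@[simp] lemma coordC_apply (j : Fin 3) (x : E3) : coordC j x = ((x j : ℝ) : ℂ) := rfl

lemma norm_coordC_apply_le (j : Fin 3) (x : E3) : ‖coordC j x‖ ≤ ‖x‖ := by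
  rw [coordC_apply, Complex.norm_real]
  exact PiLp.norm_apply_le x j

lemma norm_coordC_le (j : Fin 3) : ‖coordC j‖ ≤ 1 :=
  ContinuousLinearMap.opNorm_le_bound _ zero_le_one fun x => by
    rw [one_mul]; exact norm_coordC_apply_le j x

/-- A smooth flow on `(0,T)` written in complex-valued components `f j`, with square integrable
spatial derivatives up to order two, continuous in time in `L²`, and solving the Navier–Stokes
equations with some pressure `q`. -/
structure FlowData (μ T : ℝ) (f : Fin 3 → ℝ → E3 → ℂ) (q : ℝ → E3 → ℂ) : Prop where
  smooth : ∀ j, ContDiffOn ℝ ∞ (fun z : ℝ × E3 => f j z.1 z.2) (Ioo 0 T ×ˢ univ)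
  smooth_pressure : ∀ t ∈ Ioo 0 T, ContDiff ℝ ∞ (q t)
  eqn : ∀ t ∈ Ioo 0 T, ∀ x j, deriv (fun τ => f j τ x) t
    + ∑ k, f k t x * pderiv k (f j t) x + pderiv j (q t) x
    = μ * ∑ a, pderiv a (pderiv a (f j t)) x
  div_free : ∀ t ∈ Ioo 0 T, ∀ x, ∑ j, pderiv j (f j t) x = 0
  memLp : ∀ t ∈ Ioo 0 T, ∀ j, MemLp (f j t) 2 volume
  memLp_one : ∀ t ∈ Ioo 0 T, ∀ j a, MemLp (pderiv a (f j t)) 2 volume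
  memLp_two : ∀ t ∈ Ioo 0 T, ∀ j a b, MemLp (pderiv a (pderiv b (f j t))) 2 volume
  tendsto : ∀ t₀ ∈ Ioo 0 T, ∀ j,
    Tendsto (fun t => eLpNorm (fun x => f j t x - f j t₀ x) 2 volume) (𝓝 t₀) (𝓝 0)
  bound : ∀ a b, 0 < a → b < T → ∃ M : ℝ≥0, ∀ t ∈ Icc a b, ∀ j,
    eLpNorm (f j t) 2 volume ≤ M ∧ (∀ a, eLpNorm (pderiv a (f j t)) 2 volume ≤ M) ∧
    ∀ a b, eLpNorm (pderiv a (pderiv b (f j t))) 2 volume ≤ M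

lemma two_le_infty : (2 : ℕ∞ω) ≤ (∞ : ℕ∞ω) := WithTop.coe_le_coe.2 (le_top : (2 : ℕ∞) ≤ ⊤)

lemma slice_contDiff {G : Type*} [NormedAddCommGroup G] [NormedSpace ℝ G] {s : Set ℝ}
    {w : ℝ → E3 → G} {n : ℕ∞ω} (h : ContDiffOn ℝ n (fun z : ℝ × E3 => w z.1 z.2) (s ×ˢ univ))
    {t : ℝ} (ht : t ∈ s) : ContDiff ℝ n (w t) := by
  rw [← contDiffOn_univ]
  exact h.comp (f := fun x : E3 => (t, x)) (by fun_prop) (fun x _ => ⟨ht, mem_univ _⟩)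

lemma pderiv_coordC {w : E3 → E3} {x : E3} (hw : DifferentiableAt ℝ w x) (a j : Fin 3) :
    pderiv a (fun y => coordC j (w y)) x
      = coordC j (fderiv ℝ w x (EuclideanSpace.single a 1)) := by
  have := ((coordC j).hasFDerivAt.comp x hw.hasFDerivAt).fderiv
  rw [pderiv]
  exact congrArg (fun L : E3 →L[ℝ] ℂ => L (EuclideanSpace.single a 1)) this

lemma pderiv_pderiv_coordC {w : E3 → E3} (hw : ContDiff ℝ 2 w) (a b j : Fin 3) (x : E3) :
    pderiv a (pderiv b (fun y => coordC j (w y))) x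
      = coordC j (fderiv ℝ (fderiv ℝ w) x (EuclideanSpace.single a 1)
          (EuclideanSpace.single b 1)) := by
  have h1 : pderiv b (fun y => coordC j (w y))
      = fun y => coordC j ((fun z => fderiv ℝ w z (EuclideanSpace.single b 1)) y) := by
    ext y
    exact pderiv_coordC (hw.differentiable (by norm_num) y) b j
  have h2 : Differentiable ℝ (fderiv ℝ w) :=
    (hw.fderiv_right (m := 1) (by norm_num)).differentiable one_ne_zero
  rw [h1, pderiv_coordC ((h2 x).clm_apply (differentiableAt_const _))]
  congr 1
  rw [fderiv_clm_apply (h2 x) (differentiableAt_const _)]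
  simp

lemma sum_coordC_mul_pderiv {w : E3 → E3} {x : E3} (hw : DifferentiableAt ℝ w x) (j : Fin 3) :
    ∑ k, coordC k (w x) * pderiv k (fun y => coordC j (w y)) x
      = coordC j (fderiv ℝ w x (w x)) := by
  simp_rw [pderiv_coordC hw]
  have : w x = ∑ k, (w x k) • (EuclideanSpace.single k (1 : ℝ) : E3) := by
    ext i; simp [Finset.sum_apply, Pi.single_apply]
  conv_rhs => rw [this]
  rw [map_sum, map_sum]
  refine Finset.sum_congr rfl fun k _ => ?_
  rw [map_smul, map_smul, Complex.real_smul]; rfl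

lemma coordC_gradient {q : E3 → ℝ} (j : Fin 3) (x : E3) :
    coordC j (gradient q x) = ((fderiv ℝ q x (EuclideanSpace.single j 1) : ℝ) : ℂ) := by
  rw [coordC_apply, ← inner_gradient_left, EuclideanSpace.inner_single_right]
  simp

lemma coordC_smul_laplacian {w : E3 → E3} (hw : ContDiff ℝ 2 w) (μ : ℝ) (j : Fin 3) (x : E3) :
    coordC j (μ • Laplacian.laplacian w x)
      = μ * ∑ a, pderiv a (pderiv a (fun y => coordC j (w y))) x := by
  rw [map_smul, Complex.real_smul]
  congr 1
  simp_rw [pderiv_pderiv_coordC hw]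
  rw [← map_sum]
  congr 1
  rw [InnerProductSpace.laplacian_eq_iteratedFDeriv_orthonormalBasis _
    (EuclideanSpace.basisFun (Fin 3) ℝ)]
  simp [iteratedFDeriv_two_apply]

lemma coordC_sum_eq_divergence {w : E3 → E3} {x : E3} (hw : DifferentiableAt ℝ w x) :
    ∑ j, pderiv j (fun y => coordC j (w y)) x = (divergence w x : ℝ) := by
  simp_rw [pderiv_coordC hw, coordC_apply]
  rw [← Complex.ofReal_sum]
  rfl

lemma exists_eLpNorm_bound {G : Type*} [NormedAddCommGroup G] {w : ℝ → E3 → G} {I K : Set ℝ}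
    (hw : ∀ t ∈ I, MemLp (w t) 2 volume)
    (hwc : ∀ t₀ ∈ I,
      Tendsto (fun t => eLpNorm (fun x => w t x - w t₀ x) 2 volume) (𝓝[I] t₀) (𝓝 0))
    (hK : IsCompact K) (hKI : K ⊆ I) :
    ∃ M : ℝ≥0, ∀ t ∈ K, eLpNorm (w t) 2 volume ≤ M := by
  refine hK.induction_on (p := fun s => ∃ M : ℝ≥0, ∀ t ∈ s, eLpNorm (w t) 2 volume ≤ M)
    ⟨0, by simp⟩ (fun s t hst ⟨M, hM⟩ => ⟨M, fun x hx => hM x (hst hx)⟩) ?_ ?_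
  · rintro s t ⟨M, hM⟩ ⟨M', hM'⟩
    refine ⟨max M M', fun x hx => hx.elim (fun hx => (hM x hx).trans ?_)
      fun hx => (hM' x hx).trans ?_⟩ <;> simp
  · intro t₀ ht₀
    have h1 := (hwc t₀ (hKI ht₀)).eventually (gt_mem_nhds (zero_lt_one))
    have h2 : ∀ᶠ t in 𝓝[K] t₀, eLpNorm (w t) 2 volume ≤ eLpNorm (w t₀) 2 volume + 1 := by
      filter_upwards [nhdsWithin_mono _ hKI h1, self_mem_nhdsWithin] with t ht htK
      have e : w t = (fun x => w t x - w t₀ x) + w t₀ := by ext x; simp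
      calc eLpNorm (w t) 2 volume = eLpNorm ((fun x => w t x - w t₀ x) + w t₀) 2 volume := by
            rw [← e]
        _ ≤ eLpNorm (fun x => w t x - w t₀ x) 2 volume + eLpNorm (w t₀) 2 volume :=
            eLpNorm_add_le ((hw t (hKI htK)).1.sub (hw t₀ (hKI ht₀)).1) (hw t₀ (hKI ht₀)).1
              one_le_two
        _ ≤ 1 + eLpNorm (w t₀) 2 volume := by gcongr
        _ = _ := add_comm _ _
    refine ⟨_, h2, (eLpNorm (w t₀) 2 volume).toNNReal + 1, fun t ht => ?_⟩
    have h3 : eLpNorm (w t) 2 volume ≤ eLpNorm (w t₀) 2 volume + 1 := ht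
    rwa [ENNReal.coe_add, ENNReal.coe_toNNReal (hw t₀ (hKI ht₀)).2.ne]

lemma ContinuousOnH2.exists_bound {u : ℝ → E3 → E3} {I : Set ℝ} {g : ℝ → E3 → E3 →L[ℝ] E3}
    {h : ℝ → E3 → E3 →L[ℝ] E3 →L[ℝ] E3} (hj : ∀ t ∈ I, IsH2Jet (u t) (g t) (h t))
    (hc : ∀ t₀ ∈ I,
      Tendsto (fun t => eLpNorm (fun x => u t x - u t₀ x) 2 volume) (𝓝[I] t₀) (𝓝 0) ∧
      Tendsto (fun t => eLpNorm (fun x => g t x - g t₀ x) 2 volume) (𝓝[I] t₀) (𝓝 0) ∧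
      Tendsto (fun t => eLpNorm (fun x => h t x - h t₀ x) 2 volume) (𝓝[I] t₀) (𝓝 0))
    {K : Set ℝ} (hK : IsCompact K) (hKI : K ⊆ I) :
    ∃ M : ℝ≥0, ∀ t ∈ K, eLpNorm (u t) 2 volume ≤ M ∧ eLpNorm (g t) 2 volume ≤ M ∧
      eLpNorm (h t) 2 volume ≤ M := by
  obtain ⟨M1, h1⟩ := exists_eLpNorm_bound (w := u) (fun t ht => (hj t ht).memLp_zero)
    (fun t ht => (hc t ht).1) hK hKI
  obtain ⟨M2, h2⟩ := exists_eLpNorm_bound (w := g) (fun t ht => (hj t ht).memLp_one)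
    (fun t ht => (hc t ht).2.1) hK hKI
  have m3 : ∀ t ∈ I, MemLp (h t) 2 volume := fun t ht => (hj t ht).memLp_two
  have c3 : ∀ t₀ ∈ I,
      Tendsto (fun t => eLpNorm (fun x => h t x - h t₀ x) 2 volume) (𝓝[I] t₀) (𝓝 0) :=
    fun t ht => (hc t ht).2.2
  have A := @exists_eLpNorm_bound (E3 →L[ℝ] E3 →L[ℝ] E3) _ h I K
  obtain ⟨M3, h3⟩ := A m3 c3 hK hKI
  refine ⟨M1 + M2 + M3, fun t ht => ⟨(h1 t ht).trans ?_, (h2 t ht).trans ?_, (h3 t ht).trans ?_⟩⟩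
  · push_cast; exact le_self_add.trans le_self_add
  · push_cast; exact le_add_self.trans le_self_add
  · push_cast; exact le_add_self

lemma IsH2Jet.ae_eq_fderiv {w : E3 → E3} {g : E3 → E3 →L[ℝ] E3} {h : E3 → E3 →L[ℝ] E3 →L[ℝ] E3}
    (hj : IsH2Jet w g h) (hw : ContDiff ℝ 2 w) :
    g =ᵐ[volume] fderiv ℝ w ∧ h =ᵐ[volume] fderiv ℝ (fderiv ℝ w) := by
  have h1 := hj.weak_one.ae_eq_fderiv (hw.of_le (by norm_num))
  refine ⟨h1, IsWeakFDeriv.ae_eq_fderiv ⟨?_, hj.weak_two.2.1, ?_⟩ (hw.fderiv_right (by norm_num))⟩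
  · exact (hw.continuous_fderiv (by norm_num)).locallyIntegrable
  · intro φ hφ hφc v
    rw [← hj.weak_two.2.2 φ hφ hφc v]
    refine integral_congr_ae ?_
    filter_upwards [h1] with x hx
    rw [hx]

/-- The weak derivatives in the definition of `H²` coincide with the classical ones at positive times. -/
lemma IsSmoothSolution.flowData {μ T : ℝ} {u₀ : E3 → E3} {u : ℝ → E3 → E3}
    (hu : IsSmoothSolution μ u₀ (Ico 0 T) u) :
    ∃ q, FlowData μ T (fun j t x => coordC j (u t x)) q := by
  obtain ⟨⟨g, h, hj, hc⟩, -, q, hsu, hsq, hns⟩ := hu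
  have hI : Ico 0 T ∩ Ioi 0 = Ioo 0 T := by
    ext t; simp only [mem_inter_iff, mem_Ico, mem_Ioi, mem_Ioo]; constructor <;> intro h <;> grind
  rw [hI] at hsu hsq hns
  have hsub : Ioo 0 T ⊆ Ico 0 T := Ioo_subset_Ico_self
  have hsl : ∀ t ∈ Ioo 0 T, ContDiff ℝ ∞ (u t) := fun t ht => slice_contDiff hsu ht
  have hsl2 : ∀ t ∈ Ioo 0 T, ContDiff ℝ 2 (u t) := fun t ht => (hsl t ht).of_le two_le_infty
  have hd1 : ∀ t ∈ Ioo 0 T, ∀ x, DifferentiableAt ℝ (u t) x := fun t ht x =>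
    (hsl t ht).differentiable (by simp) x
  have hp1 : ∀ t ∈ Ioo 0 T, ∀ j a, ∀ᵐ x, ‖pderiv a (fun y => coordC j (u t y)) x‖ ≤ ‖g t x‖ := by
    intro t ht j a
    filter_upwards [((hj t (hsub ht)).ae_eq_fderiv (hsl2 t ht)).1] with x hx
    rw [pderiv_coordC (hd1 t ht x), hx]
    refine (norm_coordC_apply_le _ _).trans ?_
    simpa using (fderiv ℝ (u t) x).le_opNorm (EuclideanSpace.single a 1)
  have hp2 : ∀ t ∈ Ioo 0 T, ∀ j a b, ∀ᵐ x,
      ‖pderiv a (pderiv b (fun y => coordC j (u t y))) x‖ ≤ ‖h t x‖ := by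
    intro t ht j a b
    filter_upwards [((hj t (hsub ht)).ae_eq_fderiv (hsl2 t ht)).2] with x hx
    rw [pderiv_pderiv_coordC (hsl2 t ht), hx]
    refine (norm_coordC_apply_le _ _).trans ?_
    simpa using (fderiv ℝ (fderiv ℝ (u t)) x).le_opNorm₂ (EuclideanSpace.single a 1)
      (EuclideanSpace.single b 1)
  have hcd : ∀ t ∈ Ioo 0 T, ∀ j, ContDiff ℝ ∞ (fun y => coordC j (u t y)) := fun t ht j =>
    (coordC j).contDiff.comp (hsl t ht)
  have hpc : ∀ {f : E3 → ℂ} {n : ℕ∞ω} (a : Fin 3), ContDiff ℝ (n + 1) f → ContDiff ℝ n (pderiv a f) :=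
    fun a hf => (hf.fderiv_right le_rfl).clm_apply contDiff_const
  refine ⟨fun t x => ((q t x : ℝ) : ℂ), ?_, ?_, ?_, ?_, ?_, ?_, ?_, ?_, ?_⟩
  · intro j
    exact (coordC j).contDiff.comp_contDiffOn hsu
  · intro t ht
    exact Complex.ofRealCLM.contDiff.comp (slice_contDiff hsq ht)
  · intro t ht x j
    have h1 := (hns t ht x).1
    have hz : DifferentiableAt ℝ (fun τ => u τ x) t := by
      have := (hsu.contDiffAt (x := (t, x)) ((isOpen_Ioo.prod isOpen_univ).mem_nhds ⟨ht, mem_univ x⟩)).differentiableAt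
        (by simp)
      exact this.comp (f := fun τ : ℝ => (τ, x)) t (by fun_prop)
    rw [derivWithin_of_isOpen isOpen_Ioo ht] at h1
    have h2 := congrArg (coordC j) h1
    rw [map_add, map_add] at h2
    have e1 : deriv (fun τ => coordC j (u τ x)) t = coordC j (deriv (fun τ => u τ x) t) :=
      ((coordC j).hasFDerivAt.comp_hasDerivAt t hz.hasDerivAt).deriv
    have e2 := sum_coordC_mul_pderiv (hd1 t ht x) j
    have hqd : DifferentiableAt ℝ (q t) x := (slice_contDiff hsq ht).differentiable (by simp) x
    have e3 : pderiv j (fun y => ((q t y : ℝ) : ℂ)) x = coordC j (gradient (q t) x) := by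
      have h4 := (Complex.ofRealCLM.hasFDerivAt.comp x hqd.hasFDerivAt).fderiv
      have h5 : pderiv j (fun y => ((q t y : ℝ) : ℂ)) x
          = Complex.ofReal (fderiv ℝ (q t) x (EuclideanSpace.single j 1)) :=
        congrArg (fun L : E3 →L[ℝ] ℂ => L (EuclideanSpace.single j 1)) h4
      rw [h5, coordC_gradient]
    have e4 := coordC_smul_laplacian (hsl2 t ht) μ j x
    rw [e1, e2, e3, h2, e4]
  · intro t ht x
    have h1 := (hns t ht x).2
    rw [coordC_sum_eq_divergence (hd1 t ht x)]
    exact_mod_cast h1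
  · intro t ht j
    exact (hj t (hsub ht)).memLp_zero.of_le ((coordC j).continuous.comp_aestronglyMeasurable
      (hj t (hsub ht)).memLp_zero.1) (ae_of_all _ fun x => norm_coordC_apply_le _ _)
  · intro t ht j a
    refine (hj t (hsub ht)).memLp_one.of_le ?_ (hp1 t ht j a)
    exact (hpc (n := 0) a ((hcd t ht j).of_le (by simp))).continuous.aestronglyMeasurable
  · intro t ht j a b
    have h0 : MemLp (h t) 2 volume := (hj t (hsub ht)).memLp_two
    refine MemLp.of_le (F := E3 →L[ℝ] E3 →L[ℝ] E3) (g := h t) h0 ?_ (hp2 t ht j a b)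
    exact (hpc (n := 0) a (hpc b ((hcd t ht j).of_le (by rw [zero_add, one_add_one_eq_two]; exact two_le_infty)))).continuous.aestronglyMeasurable
  · intro t₀ ht₀ j
    have h1 := (hc t₀ (hsub ht₀)).1
    rw [nhdsWithin_eq_nhds.2 (Ico_mem_nhds ht₀.1 ht₀.2)] at h1
    refine tendsto_of_tendsto_of_tendsto_of_le_of_le tendsto_const_nhds h1 (fun _ => bot_le)
      fun t => eLpNorm_mono fun x => ?_
    rw [← map_sub]
    exact norm_coordC_apply_le _ _
  · intro a b ha hb
    have hsub' : Icc a b ⊆ Ioo 0 T := fun t ht => ⟨ha.trans_le ht.1, ht.2.trans_lt hb⟩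
    obtain ⟨M, hM⟩ := ContinuousOnH2.exists_bound hj hc (isCompact_Icc (a := a) (b := b))
      (hsub'.trans hsub)
    refine ⟨M, fun t ht j => ⟨?_, fun a => ?_, fun a b => ?_⟩⟩
    · exact (eLpNorm_mono fun x => norm_coordC_apply_le _ _).trans (hM t ht).1
    · exact (eLpNorm_mono_ae (hp1 t (hsub' ht) j a)).trans (hM t ht).2.1
    · have h0 := eLpNorm_mono_ae (G := E3 →L[ℝ] E3 →L[ℝ] E3) (g := h t) (p := 2) (hp2 t (hsub' ht) j a b)
      exact h0.trans (hM t ht).2.2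

/-! ### Pairings of the flow with test functions -/

lemma enorm_integral_mul_le {f g : E3 → ℂ} (hf : MemLp f 2 volume) (hg : MemLp g 2 volume) :
    ‖∫ x, f x * g x‖ₑ ≤ eLpNorm f 2 volume * eLpNorm g 2 volume := by
  refine (enorm_integral_le_lintegral_enorm _).trans ?_
  have h := eLpNorm_smul_le_mul_eLpNorm (p := 2) (q := 2) (r := 1) hg.1 hf.1
  rw [eLpNorm_one_eq_lintegral_enorm] at h
  simpa using h

lemma enorm_integral_mul_mul_le {f g c : E3 → ℂ} {B : ℝ≥0∞} (hf : MemLp f 2 volume)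
    (hg : MemLp g 2 volume) (hB : ∀ x, ‖c x‖ₑ ≤ B) :
    ‖∫ x, f x * g x * c x‖ₑ ≤ B * (eLpNorm f 2 volume * eLpNorm g 2 volume) := by
  refine (enorm_integral_le_lintegral_enorm _).trans ?_
  have h := eLpNorm_smul_le_mul_eLpNorm (p := 2) (q := 2) (r := 1) hg.1 hf.1
  rw [eLpNorm_one_eq_lintegral_enorm] at h
  have hm : AEMeasurable (fun x => ‖f x • g x‖ₑ) volume := (hf.1.smul hg.1).enorm
  calc ∫⁻ x, ‖f x * g x * c x‖ₑ ≤ ∫⁻ x, B * ‖f x • g x‖ₑ := by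
        refine lintegral_mono fun x => ?_
        rw [enorm_mul, smul_eq_mul, mul_comm]
        exact mul_le_mul_left (hB x) _
    _ = B * ∫⁻ x, ‖f x • g x‖ₑ := lintegral_const_mul'' _ hm
    _ ≤ _ := mul_le_mul_right h _

/-- The partial derivative `∂_a` on Schwartz space. -/
noncomputable def sderiv (a : Fin 3) : 𝓢(E3, ℂ) →L[ℂ] 𝓢(E3, ℂ) :=
  LineDeriv.lineDerivOpCLM ℂ 𝓢(E3, ℂ) (EuclideanSpace.single a (1 : ℝ))

lemma sderiv_apply (a : Fin 3) (ψ : 𝓢(E3, ℂ)) (x : E3) : sderiv a ψ x = pderiv a ψ x :=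
  SchwartzMap.lineDerivOp_apply_eq_fderiv _ ψ x

lemma sderiv_fourier (a : Fin 3) (φ : 𝓢(E3, ℂ)) : sderiv a (𝓕 φ) = - 𝓕 (symbMul a φ) := by
  ext x
  rw [sderiv_apply, pderiv_fourier_schwartz, neg_apply]

lemma HasCompactSupport.sderiv {ψ : 𝓢(E3, ℂ)} (h : HasCompactSupport ψ) (a : Fin 3) :
    HasCompactSupport (sderiv a ψ) :=
  h.mono' ((subset_tsupport _).trans (SchwartzMap.tsupport_lineDerivOp_subset _ ψ))

lemma sderiv_comm (a b : Fin 3) (ψ : 𝓢(E3, ℂ)) : sderiv a (sderiv b ψ) = sderiv b (sderiv a ψ) := by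
  ext x
  have key : ∀ a b : Fin 3, sderiv a (sderiv b ψ) x
      = fderiv ℝ (fderiv ℝ ψ) x (EuclideanSpace.single a 1) (EuclideanSpace.single b 1) := by
    intro a b
    have h1 : ⇑(sderiv b ψ) = fun y => fderiv ℝ ψ y (EuclideanSpace.single b 1) := by
      ext y; exact sderiv_apply b ψ y
    have h2 : DifferentiableAt ℝ (fderiv ℝ ψ) x :=
      ((ψ.smooth 2).fderiv_right (m := 1) (by norm_num)).differentiable one_ne_zero x
    rw [sderiv_apply, pderiv, h1, fderiv_clm_apply h2 (differentiableAt_const _)]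
    simp
  rw [key, key]
  exact ((ψ.smooth 2).contDiffAt.isSymmSndFDerivAt (by simp)).eq _ _

lemma continuous_pderiv {f : E3 → ℂ} (hf : ContDiff ℝ 1 f) (a : Fin 3) : Continuous (pderiv a f) :=
  (hf.continuous_fderiv one_ne_zero).clm_apply continuous_const

/-- Integration by parts against a compactly supported test function. -/
lemma integral_pderiv_mul {f : E3 → ℂ} (hf : ContDiff ℝ 1 f) {χ : 𝓢(E3, ℂ)}
    (hχ : HasCompactSupport χ) (a : Fin 3) :
    ∫ x, pderiv a f x * χ x = - ∫ x, f x * sderiv a χ x := by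
  have hs : ∀ x, sderiv a χ x = fderiv ℝ χ x (EuclideanSpace.single a 1) := sderiv_apply a χ
  have h := integral_mul_fderiv_eq_neg_fderiv_mul_of_integrable (μ := (volume : Measure E3))
    (f := f) (g := χ) (v := EuclideanSpace.single a 1)
    (((continuous_pderiv hf a).mul χ.continuous).integrable_of_hasCompactSupport hχ.mul_left)
    (by
      simp_rw [← hs]
      exact (hf.continuous.mul (sderiv a χ).continuous).integrable_of_hasCompactSupport
        (hχ.sderiv a).mul_left)
    ((hf.continuous.mul χ.continuous).integrable_of_hasCompactSupport hχ.mul_left)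
    (fun x _ => hf.differentiable one_ne_zero x) (fun x _ => χ.differentiableAt)
  simp_rw [← hs] at h
  rw [h, neg_neg]; rfl

lemma integrable_mul_of_hasCompactSupport {f : E3 → ℂ} (hf : Continuous f) {χ : 𝓢(E3, ℂ)}
    (hχ : HasCompactSupport χ) : Integrable (fun x => f x * χ x) volume :=
  (hf.mul χ.continuous).integrable_of_hasCompactSupport hχ.mul_left

/-- Time differentiation of the pairing of a smooth function with a test function. -/
lemma hasDerivAt_integral_mul_test {T : ℝ} {w : ℝ → E3 → ℂ}
    (hw : ContDiffOn ℝ ∞ (fun z : ℝ × E3 => w z.1 z.2) (Ioo 0 T ×ˢ univ)) {χ : 𝓢(E3, ℂ)}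
    (hχ : HasCompactSupport χ) {t : ℝ} (ht : t ∈ Ioo 0 T) :
    HasDerivAt (fun t => ∫ x, w t x * χ x) (∫ x, deriv (fun τ => w τ x) t * χ x) t := by
  have hop : IsOpen (Ioo 0 T ×ˢ (univ : Set E3)) := isOpen_Ioo.prod isOpen_univ
  have hd : ∀ s ∈ Ioo 0 T, ∀ x, HasDerivAt (fun τ => w τ x)
      (fderiv ℝ (fun z : ℝ × E3 => w z.1 z.2) (s, x) (1, 0)) s := by
    intro s hs x
    have h1 := ((hw.contDiffAt (x := (s, x)) (hop.mem_nhds ⟨hs, mem_univ x⟩)).differentiableAt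
      (by simp)).hasFDerivAt
    exact h1.comp_hasDerivAt (f := fun τ : ℝ => (τ, x)) s
      ((hasDerivAt_id s).prodMk (hasDerivAt_const s x))
  have hcont : ContinuousOn (fun z : ℝ × E3 => fderiv ℝ (fun z : ℝ × E3 => w z.1 z.2) z (1, 0))
      (Ioo 0 T ×ˢ univ) :=
    (hw.continuousOn_fderiv_of_isOpen hop (by simp)).clm_apply continuousOn_const
  have heq : (fun x => deriv (fun τ => w τ x) t * χ x) =
      fun x => fderiv ℝ (fun z : ℝ × E3 => w z.1 z.2) (t, x) (1, 0) * χ x := by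
    ext x; rw [(hd t ht x).deriv]
  rw [heq]
  obtain ⟨δ, hδ, hsub⟩ := Metric.isOpen_iff.1 isOpen_Ioo t ht
  -- the time derivative is bounded on a compact space-time set that contains the support of `χ`
  have hK : IsCompact (Metric.closedBall t (δ / 2) ×ˢ tsupport χ) :=
    (isCompact_closedBall t (δ / 2)).prod hχ
  have hKsub : Metric.closedBall t (δ / 2) ×ˢ tsupport χ ⊆ Ioo 0 T ×ˢ univ := by
    rintro ⟨s, x⟩ ⟨hs, -⟩
    exact ⟨hsub (Metric.closedBall_subset_ball (by linarith) hs), mem_univ _⟩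
  obtain ⟨C, hC⟩ := hK.exists_bound_of_continuousOn (hcont.mono hKsub)
  have hsl : ∀ s ∈ Ioo 0 T, Continuous (w s) := fun s hs => (slice_contDiff hw hs).continuous
  have hcsl : Continuous fun x => fderiv ℝ (fun z : ℝ × E3 => w z.1 z.2) (t, x) (1, 0) := by
    rw [← continuousOn_univ]
    exact hcont.comp (f := fun x : E3 => (t, x)) (by fun_prop) fun x _ => ⟨ht, mem_univ _⟩
  refine (hasDerivAt_integral_of_dominated_loc_of_deriv_le
    (F := fun s x => w s x * χ x)
    (F' := fun s x => fderiv ℝ (fun z : ℝ × E3 => w z.1 z.2) (s, x) (1, 0) * χ x)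
    (bound := fun x => C * ‖χ x‖) (Metric.ball_mem_nhds t (half_pos hδ))
    ?_ (integrable_mul_of_hasCompactSupport (hsl t ht) hχ)
    (hcsl.mul χ.continuous).aestronglyMeasurable ?_ (χ.integrable.norm.const_mul C) ?_).2
  · filter_upwards [isOpen_Ioo.mem_nhds ht] with s hs
    exact ((hsl s hs).mul χ.continuous).aestronglyMeasurable
  · refine ae_of_all _ fun x s hs => ?_
    rw [norm_mul]
    by_cases hx : x ∈ tsupport χ
    · exact mul_le_mul_of_nonneg_right (hC (s, x) ⟨Metric.ball_subset_closedBall hs, hx⟩)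
        (norm_nonneg _)
    · simp [image_eq_zero_of_notMem_tsupport hx]
  · refine ae_of_all _ fun x s hs => ?_
    exact (hd s (hsub (Metric.ball_subset_ball (by linarith) hs)) x).mul_const _

/-- The viscous and convective parts of the momentum equation tested with `χ`. -/
noncomputable def momentum (μ : ℝ) (f : Fin 3 → ℝ → E3 → ℂ) (j : Fin 3) (t : ℝ) (χ : 𝓢(E3, ℂ)) : ℂ :=
  (μ * ∑ a, ∫ x, f j t x * sderiv a (sderiv a χ) x) +
    ∑ k, ∫ x, f k t x * f j t x * sderiv k χ x

namespace FlowData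

variable {μ T : ℝ} {f : Fin 3 → ℝ → E3 → ℂ} {q : ℝ → E3 → ℂ}

lemma contDiff (h : FlowData μ T f q) {t : ℝ} (ht : t ∈ Ioo 0 T) (j : Fin 3) :
    ContDiff ℝ ∞ (f j t) := slice_contDiff (h.smooth j) ht

lemma contDiff_pderiv {g : E3 → ℂ} (hg : ContDiff ℝ ∞ g) (a : Fin 3) :
    ContDiff ℝ ∞ (pderiv a g) :=
  (hg.fderiv_right (m := ∞) (by simp)).clm_apply contDiff_const

/-- The momentum equation tested with `χ`, all spatial derivatives falling on `χ`. -/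
lemma integral_deriv_mul (h : FlowData μ T f q) {t : ℝ} (ht : t ∈ Ioo 0 T) (j : Fin 3)
    {χ : 𝓢(E3, ℂ)} (hχ : HasCompactSupport χ) :
    ∫ x, deriv (fun τ => f j τ x) t * χ x
      = momentum μ f j t χ + ∫ x, q t x * sderiv j χ x := by
  have one : (1 : ℕ∞ω) ≤ (∞ : ℕ∞ω) := by simp
  have hc := fun k => h.contDiff ht k
  have e : ∀ x, deriv (fun τ => f j τ x) t * χ x =
      (∑ a, (μ : ℂ) * (pderiv a (pderiv a (f j t)) x * χ x)) -
      (∑ k, pderiv k (fun y => f k t y * f j t y) x * χ x) - pderiv j (q t) x * χ x := by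
    intro x
    have h1 := h.eqn t ht x j
    -- by incompressibility the convective term is a divergence
    have h2 : ∑ k, pderiv k (fun y => f k t y * f j t y) x = ∑ k, f k t x * pderiv k (f j t) x := by
      have : ∀ k, pderiv k (fun y => f k t y * f j t y) x
          = f k t x * pderiv k (f j t) x + f j t x * pderiv k (f k t) x := by
        intro k
        have hd := fun i => (hc i).differentiable (by simp) x
        have := fderiv_fun_mul (hd k) (hd j)
        simp only [pderiv]
        rw [this]
        simp
      simp_rw [this, Finset.sum_add_distrib, ← Finset.mul_sum, h.div_free t ht x, mul_zero, add_zero]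
    have h3 : deriv (fun τ => f j τ x) t = μ * ∑ a, pderiv a (pderiv a (f j t)) x
        - ∑ k, f k t x * pderiv k (f j t) x - pderiv j (q t) x := by
      rw [← h1]; ring
    rw [h3, ← h2, sub_mul, sub_mul, Finset.sum_mul, ← Finset.mul_sum, mul_assoc, Finset.sum_mul]
  have i1 : ∀ a, Integrable (fun x => (μ : ℂ) * (pderiv a (pderiv a (f j t)) x * χ x)) volume :=
    fun a => (integrable_mul_of_hasCompactSupport
      (contDiff_pderiv (contDiff_pderiv (hc j) a) a).continuous hχ).const_mul _
  have hprod : ∀ k, ContDiff ℝ ∞ (fun y => f k t y * f j t y) := fun k => (hc k).mul (hc j)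
  have i2 : ∀ k, Integrable (fun x => pderiv k (fun y => f k t y * f j t y) x * χ x) volume :=
    fun k => integrable_mul_of_hasCompactSupport (contDiff_pderiv (hprod k) k).continuous hχ
  have i3 : Integrable (fun x => pderiv j (q t) x * χ x) volume :=
    integrable_mul_of_hasCompactSupport (contDiff_pderiv (h.smooth_pressure t ht) j).continuous hχ
  simp_rw [e]
  have i12 : Integrable (fun x => (∑ a, (μ : ℂ) * (pderiv a (pderiv a (f j t)) x * χ x)) -
      ∑ k, pderiv k (fun y => f k t y * f j t y) x * χ x) volume :=
    (integrable_finsetSum _ fun a _ => i1 a).sub (integrable_finsetSum _ fun k _ => i2 k)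
  rw [integral_sub i12 i3, integral_sub (integrable_finsetSum _ fun a _ => i1 a) (integrable_finsetSum _ fun k _ => i2 k),
    integral_finsetSum _ fun a _ => i1 a, integral_finsetSum _ fun k _ => i2 k]
  rw [integral_pderiv_mul ((h.smooth_pressure t ht).of_le one) hχ]
  have e1 : ∀ a, ∫ x, (μ : ℂ) * (pderiv a (pderiv a (f j t)) x * χ x)
      = μ * ∫ x, f j t x * sderiv a (sderiv a χ) x := by
    intro a
    rw [integral_const_mul, integral_pderiv_mul ((contDiff_pderiv (hc j) a).of_le one) hχ,
      integral_pderiv_mul ((hc j).of_le one) (hχ.sderiv a), neg_neg]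
  simp_rw [e1, fun k => integral_pderiv_mul ((hprod k).of_le one) hχ k]
  rw [← Finset.mul_sum, Finset.sum_neg_distrib, momentum]
  ring

/-- The weak form of the vorticity equation: the pressure disappears. -/
lemma hasDerivAt_curl (h : FlowData μ T f q) {t : ℝ} (ht : t ∈ Ioo 0 T) (i j : Fin 3)
    {ψ : 𝓢(E3, ℂ)} (hψ : HasCompactSupport ψ) :
    HasDerivAt (fun t => (∫ x, f j t x * sderiv i ψ x) - ∫ x, f i t x * sderiv j ψ x)
      (momentum μ f j t (sderiv i ψ) - momentum μ f i t (sderiv j ψ)) t := by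
  have h1 := (hasDerivAt_integral_mul_test (h.smooth j) (hψ.sderiv i) ht).sub
    (hasDerivAt_integral_mul_test (h.smooth i) (hψ.sderiv j) ht)
  rw [h.integral_deriv_mul ht j (hψ.sderiv i), h.integral_deriv_mul ht i (hψ.sderiv j),
    sderiv_comm i j] at h1
  exact h1.congr_deriv (by ring)

/-- Uniform `L²` continuity in time of quadratic expressions in the flow. -/
lemma exists_modulus (h : FlowData μ T f q) {t₀ : ℝ} (ht₀ : t₀ ∈ Ioo 0 T) (k j : Fin 3) :
    ∃ κ : ℝ → ℝ≥0∞, Tendsto κ (𝓝 t₀) (𝓝 0) ∧ ∀ᶠ t in 𝓝 t₀, ∀ (c : E3 → ℂ) (B : ℝ≥0),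
      AEStronglyMeasurable c volume → (∀ x, ‖c x‖ₑ ≤ B) →
      ‖(∫ x, f k t x * f j t x * c x) - ∫ x, f k t₀ x * f j t₀ x * c x‖ₑ ≤ B * κ t := by
  obtain ⟨δ, hδ, hsub⟩ := Metric.isOpen_iff.1 isOpen_Ioo t₀ ht₀
  have hIcc : Icc (t₀ - δ / 2) (t₀ + δ / 2) ⊆ Ioo 0 T := by
    rw [← Real.closedBall_eq_Icc]
    exact (Metric.closedBall_subset_ball (by linarith)).trans hsub
  obtain ⟨M, hM⟩ := h.bound (t₀ - δ / 2) (t₀ + δ / 2)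
    (hIcc (left_mem_Icc.2 (by linarith))).1 (hIcc (right_mem_Icc.2 (by linarith))).2
  refine ⟨fun t => eLpNorm (fun x => f k t x - f k t₀ x) 2 volume * M
    + M * eLpNorm (fun x => f j t x - f j t₀ x) 2 volume, ?_, ?_⟩
  · have h1 := ENNReal.Tendsto.mul_const (b := (M : ℝ≥0∞)) (h.tendsto t₀ ht₀ k) (by simp)
    have h2 := ENNReal.Tendsto.const_mul (a := (M : ℝ≥0∞)) (h.tendsto t₀ ht₀ j) (by simp)
    simpa using h1.add h2
  · filter_upwards [Icc_mem_nhds (show t₀ - δ / 2 < t₀ by linarith)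
      (show t₀ < t₀ + δ / 2 by linarith)] with t ht c B hc hB
    have ht' := hIcc ht
    have mt := fun i => h.memLp t ht' i
    have m0 := fun i => h.memLp t₀ ht₀ i
    have hint : ∀ {a b : E3 → ℂ}, MemLp a 2 volume → MemLp b 2 volume →
        Integrable (fun x => a x * b x * c x) volume := fun ha hb =>
      (ha.integrable_mul hb).mul_bdd (c := (B : ℝ)) hc (ae_of_all _ fun x => by
        have := hB x
        rw [← ofReal_norm, ← ENNReal.ofReal_coe_nnreal] at this
        exact (ENNReal.ofReal_le_ofReal_iff B.2).1 this)
    -- the difference of products telescopes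
    have e : (∫ x, f k t x * f j t x * c x) - ∫ x, f k t₀ x * f j t₀ x * c x =
        (∫ x, (f k t x - f k t₀ x) * f j t x * c x)
          + ∫ x, f k t₀ x * (f j t x - f j t₀ x) * c x := by
      have i1 := hint ((mt k).sub (m0 k)) (mt j)
      have i2 := hint (m0 k) ((mt j).sub (m0 j))
      simp only [Pi.sub_apply] at i1 i2
      rw [← integral_sub (hint (mt k) (mt j)) (hint (m0 k) (m0 j)), ← integral_add i1 i2]
      congr 1; ext x; ring
    rw [e]
    refine (enorm_add_le _ _).trans ?_
    rw [mul_add]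
    have b1 := enorm_integral_mul_mul_le ((mt k).sub (m0 k)) (mt j) hB
    have b2 := enorm_integral_mul_mul_le (m0 k) ((mt j).sub (m0 j)) hB
    simp only [Pi.sub_apply] at b1 b2
    refine add_le_add (b1.trans ?_) (b2.trans ?_)
    · gcongr
      · exact le_rfl
      · exact (hM t ht j).1
    · gcongr
      · exact (hM t₀ ⟨by linarith, by linarith⟩ k).1
      · exact le_rfl

end FlowData

/-- A continuous seminorm on test functions that controls pairings with products of at most two
`L²` functions. -/
noncomputable def testNorm (χ : 𝓢(E3, ℂ)) : ℝ :=
  ‖SchwartzMap.toLpCLM ℂ ℂ 2 (volume : Measure E3) χ‖ +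
    ‖SchwartzMap.toBoundedContinuousFunctionCLM ℂ E3 ℂ χ‖

lemma continuous_testNorm : Continuous testNorm := by
  unfold testNorm; fun_prop

@[simp] lemma testNorm_zero : testNorm 0 = 0 := by
  rw [testNorm, map_zero, map_zero, norm_zero, norm_zero, add_zero]

lemma testNorm_nonneg (χ : 𝓢(E3, ℂ)) : 0 ≤ testNorm χ := by
  unfold testNorm; positivity

lemma eLpNorm_le_testNorm (χ : 𝓢(E3, ℂ)) :
    eLpNorm χ 2 volume ≤ ENNReal.ofReal (testNorm χ) := by
  have h : ENNReal.ofReal ‖SchwartzMap.toLpCLM ℂ ℂ 2 (volume : Measure E3) χ‖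
      = eLpNorm χ 2 volume := by
    rw [ofReal_norm, Lp.enorm_def]
    exact eLpNorm_congr_ae (SchwartzMap.coeFn_toLp χ 2 volume)
  rw [← h]
  exact ENNReal.ofReal_le_ofReal (le_add_of_nonneg_right (norm_nonneg _))

lemma enorm_le_testNorm (χ : 𝓢(E3, ℂ)) (x : E3) : ‖χ x‖ₑ ≤ ENNReal.ofReal (testNorm χ) := by
  rw [← ofReal_norm]
  refine ENNReal.ofReal_le_ofReal (le_trans ?_ (le_add_of_nonneg_left (norm_nonneg _)))
  exact (SchwartzMap.toBoundedContinuousFunctionCLM ℂ E3 ℂ χ).norm_coe_le_norm x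

lemma norm_integral_mul_le {f : E3 → ℂ} {M : ℝ≥0} (hf : MemLp f 2 volume)
    (hM : eLpNorm f 2 volume ≤ M) (χ : 𝓢(E3, ℂ)) : ‖∫ x, f x * χ x‖ ≤ M * testNorm χ := by
  have h := enorm_integral_mul_le hf (χ.memLp 2 volume)
  have h2 : ‖∫ x, f x * χ x‖ₑ ≤ ENNReal.ofReal (M * testNorm χ) := by
    rw [ENNReal.ofReal_mul M.coe_nonneg, ENNReal.ofReal_coe_nnreal]
    exact h.trans (mul_le_mul' hM (eLpNorm_le_testNorm χ))
  rw [← ofReal_norm] at h2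
  exact (ENNReal.ofReal_le_ofReal_iff (mul_nonneg M.coe_nonneg (testNorm_nonneg χ))).1 h2

lemma norm_integral_mul_mul_le {f g : E3 → ℂ} {M : ℝ≥0} (hf : MemLp f 2 volume)
    (hM : eLpNorm f 2 volume ≤ M) (hg : MemLp g 2 volume) (hMg : eLpNorm g 2 volume ≤ M)
    (χ : 𝓢(E3, ℂ)) : ‖∫ x, f x * g x * χ x‖ ≤ M ^ 2 * testNorm χ := by
  have h := enorm_integral_mul_mul_le hf hg (enorm_le_testNorm χ)
  have h2 : ‖∫ x, f x * g x * χ x‖ₑ ≤ ENNReal.ofReal (M ^ 2 * testNorm χ) := by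
    rw [ENNReal.ofReal_mul (by positivity), ENNReal.ofReal_pow M.coe_nonneg, ENNReal.ofReal_coe_nnreal,
      mul_comm]
    refine h.trans (mul_le_mul' le_rfl ?_)
    rw [sq]
    exact mul_le_mul' hM hMg
  rw [← ofReal_norm] at h2
  exact (ENNReal.ofReal_le_ofReal_iff (mul_nonneg (by positivity) (testNorm_nonneg χ))).1 h2

lemma integrable_mul_schwartz {f : E3 → ℂ} (hf : MemLp f 2 volume) (χ : 𝓢(E3, ℂ)) :
    Integrable (fun x => f x * χ x) volume := hf.integrable_mul (χ.memLp 2 volume)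

lemma integrable_mul_mul_schwartz {f g : E3 → ℂ} (hf : MemLp f 2 volume) (hg : MemLp g 2 volume)
    (χ : 𝓢(E3, ℂ)) : Integrable (fun x => f x * g x * χ x) volume := by
  refine (hf.integrable_mul hg).mul_bdd (c := testNorm χ) χ.continuous.aestronglyMeasurable
    (ae_of_all _ fun x => ?_)
  have := enorm_le_testNorm χ x
  rw [← ofReal_norm] at this
  exact (ENNReal.ofReal_le_ofReal_iff (testNorm_nonneg χ)).1 this

namespace FlowData

variable {μ T : ℝ} {f : Fin 3 → ℝ → E3 → ℂ} {q : ℝ → E3 → ℂ}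

lemma momentum_sub (h : FlowData μ T f q) {t : ℝ} (ht : t ∈ Ioo 0 T) (j : Fin 3)
    (χ χ' : 𝓢(E3, ℂ)) : momentum μ f j t (χ - χ') = momentum μ f j t χ - momentum μ f j t χ' := by
  have e1 : ∀ a, ∫ x, f j t x * sderiv a (sderiv a (χ - χ')) x =
      (∫ x, f j t x * sderiv a (sderiv a χ) x) - ∫ x, f j t x * sderiv a (sderiv a χ') x := by
    intro a
    rw [← integral_sub (integrable_mul_schwartz (h.memLp t ht j) _)
      (integrable_mul_schwartz (h.memLp t ht j) _)]
    simp [map_sub, mul_sub]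
  have e2 : ∀ k, ∫ x, f k t x * f j t x * sderiv k (χ - χ') x =
      (∫ x, f k t x * f j t x * sderiv k χ x) - ∫ x, f k t x * f j t x * sderiv k χ' x := by
    intro k
    rw [← integral_sub (integrable_mul_mul_schwartz (h.memLp t ht k) (h.memLp t ht j) _)
      (integrable_mul_mul_schwartz (h.memLp t ht k) (h.memLp t ht j) _)]
    simp [map_sub, mul_sub]
  simp_rw [momentum, e1, e2, Finset.sum_sub_distrib]
  ring

lemma exists_norm_momentum_le (h : FlowData μ T f q) {a b : ℝ} (ha : 0 < a) (hb : b < T) :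
    ∃ C : ℝ, 0 ≤ C ∧ ∀ t ∈ Icc a b, ∀ j χ, ‖momentum μ f j t χ‖ ≤
      C * ((∑ a, testNorm (sderiv a (sderiv a χ))) + ∑ k, testNorm (sderiv k χ)) := by
  obtain ⟨M, hM⟩ := h.bound a b ha hb
  refine ⟨|μ| * M + M ^ 2, by positivity, fun t ht j χ => ?_⟩
  have ht' : t ∈ Ioo 0 T := ⟨ha.trans_le ht.1, ht.2.trans_lt hb⟩
  have p1 : 0 ≤ ∑ a, testNorm (sderiv a (sderiv a χ)) := Finset.sum_nonneg fun _ _ => testNorm_nonneg _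
  have p2 : 0 ≤ ∑ k, testNorm (sderiv k χ) := Finset.sum_nonneg fun _ _ => testNorm_nonneg _
  have h1 : ‖(μ : ℂ) * ∑ a, ∫ x, f j t x * sderiv a (sderiv a χ) x‖
      ≤ |μ| * (M * ∑ a, testNorm (sderiv a (sderiv a χ))) := by
    rw [norm_mul, Complex.norm_real, Real.norm_eq_abs, Finset.mul_sum]
    gcongr
    exact norm_sum_le_of_le _ fun a _ => norm_integral_mul_le (h.memLp t ht' j) (hM t ht j).1 _
  have h2 : ‖∑ k, ∫ x, f k t x * f j t x * sderiv k χ x‖ ≤ M ^ 2 * ∑ k, testNorm (sderiv k χ) := by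
    rw [Finset.mul_sum]
    exact norm_sum_le_of_le _ fun k _ => norm_integral_mul_mul_le (h.memLp t ht' k) (hM t ht k).1
      (h.memLp t ht' j) (hM t ht j).1 _
  calc ‖momentum μ f j t χ‖ ≤ _ := (norm_add_le _ _).trans (add_le_add h1 h2)
    _ ≤ _ := by
      have : 0 ≤ (M : ℝ) ^ 2 * ∑ a, testNorm (sderiv a (sderiv a χ)) := by positivity
      have : 0 ≤ |μ| * M * ∑ k, testNorm (sderiv k χ) := by positivity
      nlinarith

lemma continuousOn_integral_mul (h : FlowData μ T f q) (j : Fin 3) (χ : 𝓢(E3, ℂ)) :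
    ContinuousOn (fun t => ∫ x, f j t x * χ x) (Ioo 0 T) := by
  intro t₀ ht₀
  refine ContinuousAt.continuousWithinAt ?_
  rw [ContinuousAt, tendsto_iff_edist_tendsto_0]
  have h1 := ENNReal.Tendsto.mul_const (b := eLpNorm χ 2 volume) (h.tendsto t₀ ht₀ j)
    (Or.inr (χ.memLp 2 volume).2.ne)
  rw [zero_mul] at h1
  refine tendsto_of_tendsto_of_tendsto_of_le_of_le' tendsto_const_nhds h1
    (Eventually.of_forall fun _ => bot_le) ?_
  filter_upwards [isOpen_Ioo.mem_nhds ht₀] with t ht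
  rw [edist_eq_enorm_sub, ← integral_sub (integrable_mul_schwartz (h.memLp t ht j) _)
    (integrable_mul_schwartz (h.memLp t₀ ht₀ j) _)]
  simp_rw [← sub_mul]
  exact enorm_integral_mul_le ((h.memLp t ht j).sub (h.memLp t₀ ht₀ j)) (χ.memLp 2 volume)

lemma continuousOn_integral_mul_mul (h : FlowData μ T f q) (k j : Fin 3) (χ : 𝓢(E3, ℂ)) :
    ContinuousOn (fun t => ∫ x, f k t x * f j t x * χ x) (Ioo 0 T) := by
  intro t₀ ht₀
  refine ContinuousAt.continuousWithinAt ?_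
  rw [ContinuousAt, tendsto_iff_edist_tendsto_0]
  obtain ⟨m, hm, hm2⟩ := h.exists_modulus ht₀ k j
  have h1 := ENNReal.Tendsto.const_mul (a := ((testNorm χ).toNNReal : ℝ≥0∞)) hm (by simp)
  rw [mul_zero] at h1
  refine tendsto_of_tendsto_of_tendsto_of_le_of_le' tendsto_const_nhds h1
    (Eventually.of_forall fun _ => bot_le) ?_
  filter_upwards [hm2] with t ht
  rw [edist_eq_enorm_sub]
  exact ht χ _ χ.continuous.aestronglyMeasurable (enorm_le_testNorm χ)

lemma continuousOn_momentum (h : FlowData μ T f q) (j : Fin 3) (χ : 𝓢(E3, ℂ)) :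
    ContinuousOn (fun t => momentum μ f j t χ) (Ioo 0 T) := by
  unfold momentum
  exact (continuousOn_const.mul (continuousOn_finsetSum _ fun a _ =>
    h.continuousOn_integral_mul j _)).add
    (continuousOn_finsetSum _ fun k _ => h.continuousOn_integral_mul_mul k j _)

/-- The vorticity equation tested with Schwartz functions, in time-integrated form. -/
lemma integral_curl (h : FlowData μ T f q) {t₁ t₂ : ℝ} (ht₁ : t₁ ∈ Ioo 0 T) (ht₂ : t₂ ∈ Ioo 0 T)
    (i j : Fin 3) (ψ : 𝓢(E3, ℂ)) :
    ∫ s in t₁..t₂, (momentum μ f j s (sderiv i ψ) - momentum μ f i s (sderiv j ψ)) =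
      ((∫ x, f j t₂ x * sderiv i ψ x) - ∫ x, f i t₂ x * sderiv j ψ x) -
        ((∫ x, f j t₁ x * sderiv i ψ x) - ∫ x, f i t₁ x * sderiv j ψ x) := by
  have hsub : uIcc t₁ t₂ ⊆ Ioo 0 T := by
    rcases le_total t₁ t₂ with h | h
    · rw [uIcc_of_le h]; exact Icc_subset_Ioo ht₁.1 ht₂.2
    · rw [uIcc_of_ge h]; exact Icc_subset_Ioo ht₂.1 ht₁.2
  have hcont : ∀ ψ : 𝓢(E3, ℂ), ContinuousOn
      (fun s => momentum μ f j s (sderiv i ψ) - momentum μ f i s (sderiv j ψ)) (Ioo 0 T) := fun ψ =>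
    (h.continuousOn_momentum j _).sub (h.continuousOn_momentum i _)
  -- both sides of the identity for compactly supported `ψs n` converge, the left one uniformly in time
  obtain ⟨ψs, hsupp, hlim⟩ := SchwartzMap.exists_seq_hasCompactSupport_tendsto ψ
  have hsm : ∀ t ∈ Ioo 0 T, ∀ (j i : Fin 3), Tendsto (fun n => ∫ x, f j t x * sderiv i (ψs n) x) atTop
      (𝓝 (∫ x, f j t x * sderiv i ψ x)) := by
    intro t ht j i
    rw [tendsto_iff_norm_sub_tendsto_zero]
    have h0 : Tendsto (fun n => (eLpNorm (f j t) 2 volume).toNNReal * testNorm (sderiv i (ψs n - ψ)))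
        atTop (𝓝 0) := by
      have h1 : Tendsto (fun n => testNorm (sderiv i (ψs n - ψ))) atTop
          (𝓝 (testNorm (sderiv i (ψ - ψ)))) :=
        ((continuous_testNorm.comp (sderiv i).continuous).tendsto _).comp (hlim.sub_const ψ)
      have e : testNorm (sderiv i (ψ - ψ)) = 0 := by simp
      rw [e] at h1
      simpa using h1.const_mul ((eLpNorm (f j t) 2 volume).toNNReal : ℝ)
    refine squeeze_zero (fun _ => norm_nonneg _) (fun n => ?_) h0
    rw [← integral_sub (integrable_mul_schwartz (h.memLp t ht j) _)
      (integrable_mul_schwartz (h.memLp t ht j) _)]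
    simp_rw [← mul_sub]
    have := norm_integral_mul_le (h.memLp t ht j) (M := (eLpNorm (f j t) 2 volume).toNNReal)
      (by rw [ENNReal.coe_toNNReal (h.memLp t ht j).2.ne]) (sderiv i (ψs n - ψ))
    simpa [map_sub] using this
  obtain ⟨C, hC0, hC⟩ := h.exists_norm_momentum_le (a := min t₁ t₂) (b := max t₁ t₂)
    (lt_min ht₁.1 ht₂.1) (max_lt ht₁.2 ht₂.2)
  let p : 𝓢(E3, ℂ) → ℝ := fun χ =>
    (∑ a, testNorm (sderiv a (sderiv a χ))) + ∑ k, testNorm (sderiv k χ)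
  have hp : Continuous p := by
    refine (continuous_finsetSum _ fun a _ => ?_).add (continuous_finsetSum _ fun a _ => ?_)
    · exact continuous_testNorm.comp ((sderiv a).continuous.comp (sderiv a).continuous)
    · exact continuous_testNorm.comp (sderiv a).continuous
  have hp0 : p 0 = 0 := by simp [p]
  have hplim : ∀ i, Tendsto (fun n => C * p (sderiv i (ψs n - ψ))) atTop (𝓝 0) := by
    intro i
    have h1 := ((hp.comp (sderiv i).continuous).tendsto _).comp (hlim.sub_const ψ)
    have h2 : p (sderiv i (ψ - ψ)) = 0 := by simp [hp0]
    simp only [Function.comp_apply] at h1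
    rw [h2] at h1
    simpa using h1.const_mul C
  have hL : Tendsto (fun n => ∫ s in t₁..t₂,
      (momentum μ f j s (sderiv i (ψs n)) - momentum μ f i s (sderiv j (ψs n)))) atTop
      (𝓝 (∫ s in t₁..t₂, (momentum μ f j s (sderiv i ψ) - momentum μ f i s (sderiv j ψ)))) := by
    rw [tendsto_iff_norm_sub_tendsto_zero]
    have h0 := ((hplim i).add (hplim j)).mul_const |t₂ - t₁|
    rw [add_zero, zero_mul] at h0
    refine squeeze_zero (fun _ => norm_nonneg _) (fun n => ?_) h0
    rw [← intervalIntegral.integral_sub ((hcont _).mono hsub).intervalIntegrable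
      ((hcont _).mono hsub).intervalIntegrable]
    refine intervalIntegral.norm_integral_le_of_norm_le_const fun s hs => ?_
    have hs1 : s ∈ Icc (min t₁ t₂) (max t₁ t₂) := uIoc_subset_uIcc hs
    have hs2 := hsub (uIoc_subset_uIcc hs)
    have e : (momentum μ f j s (sderiv i (ψs n)) - momentum μ f i s (sderiv j (ψs n))) -
        (momentum μ f j s (sderiv i ψ) - momentum μ f i s (sderiv j ψ)) =
        momentum μ f j s (sderiv i (ψs n - ψ)) - momentum μ f i s (sderiv j (ψs n - ψ)) := by
      rw [map_sub, map_sub, h.momentum_sub hs2, h.momentum_sub hs2]; ring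
    rw [e]
    exact (norm_sub_le _ _).trans (add_le_add (hC s hs1 j _) (hC s hs1 i _))
  have hR := ((hsm t₂ ht₂ j i).sub (hsm t₂ ht₂ i j)).sub ((hsm t₁ ht₁ j i).sub (hsm t₁ ht₁ i j))
  refine tendsto_nhds_unique hL (hR.congr fun n => ?_)
  rw [intervalIntegral.integral_eq_sub_of_hasDerivAt
    (fun t ht => h.hasDerivAt_curl (hsub ht) i j (hsupp n)) ((hcont _).mono hsub).intervalIntegrable]

/-- The vorticity equation tested with a Schwartz function. -/
lemma hasDerivAt_curl_schwartz (h : FlowData μ T f q) {t : ℝ} (ht : t ∈ Ioo 0 T) (i j : Fin 3)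
    (ψ : 𝓢(E3, ℂ)) :
    HasDerivAt (fun t => (∫ x, f j t x * sderiv i ψ x) - ∫ x, f i t x * sderiv j ψ x)
      (momentum μ f j t (sderiv i ψ) - momentum μ f i t (sderiv j ψ)) t := by
  have hcont : ContinuousOn
      (fun s => momentum μ f j s (sderiv i ψ) - momentum μ f i s (sderiv j ψ)) (Ioo 0 T) :=
    (h.continuousOn_momentum j _).sub (h.continuousOn_momentum i _)
  have h1 := intervalIntegral.integral_hasDerivAt_right (a := t) (b := t)
    (f := fun s => momentum μ f j s (sderiv i ψ) - momentum μ f i s (sderiv j ψ)) (by simp)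
    (hcont.stronglyMeasurableAtFilter isOpen_Ioo t ht)
    (hcont.continuousAt (isOpen_Ioo.mem_nhds ht))
  have h2 := h1.add_const ((∫ x, f j t x * sderiv i ψ x) - ∫ x, f i t x * sderiv j ψ x)
  refine h2.congr_of_eventuallyEq ?_
  filter_upwards [isOpen_Ioo.mem_nhds ht] with s hs
  rw [h.integral_curl ht hs]; ring

end FlowData

/-! ### The Leray projection and the quadratic term in frequency space -/

/-- The Fourier symbol `4π²μ|ξ|²` of `-μΔ`. -/
noncomputable def damp (μ : ℝ) (ξ : E3) : ℝ := 4 * Real.pi ^ 2 * μ * ‖ξ‖ ^ 2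

lemma continuous_damp (μ : ℝ) : Continuous (damp μ) := by unfold damp; fun_prop

lemma damp_nonneg {μ : ℝ} (hμ : 0 ≤ μ) (ξ : E3) : 0 ≤ damp μ ξ := by unfold damp; positivity

lemma sum_symb_sq (ξ : E3) : ∑ a, symb a ξ * symb a ξ = -(4 * Real.pi ^ 2 * ‖ξ‖ ^ 2 : ℝ) := by
  rw [EuclideanSpace.norm_sq_eq]
  push_cast
  rw [Finset.mul_sum, ← Finset.sum_neg_distrib]
  refine Finset.sum_congr rfl fun a _ => ?_
  rw [symb, Real.norm_eq_abs, ← Complex.ofReal_pow |ξ.ofLp a|, sq_abs]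
  push_cast
  linear_combination (4 * (Real.pi : ℂ) ^ 2 * (ξ a : ℂ) ^ 2) * Complex.I_sq

lemma damp_eq (μ : ℝ) (ξ : E3) : (damp μ ξ : ℂ) = -μ * ∑ a, symb a ξ * symb a ξ := by
  rw [sum_symb_sq, damp]; push_cast; ring

/-- The symbol `ξ_j ξ_l / |ξ|²` of a product of two Riesz transforms (`0` at `ξ = 0`). -/
noncomputable def riesz (j l : Fin 3) (ξ : E3) : ℝ := ξ j * ξ l / ‖ξ‖ ^ 2

lemma measurable_riesz (j l : Fin 3) : Measurable (riesz j l) := by unfold riesz; fun_prop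

lemma abs_riesz_le (j l : Fin 3) (ξ : E3) : |riesz j l ξ| ≤ 1 := by
  unfold riesz
  rw [abs_div, abs_mul, abs_of_nonneg (sq_nonneg ‖ξ‖), sq]
  refine div_le_one_of_le₀ ?_ (by positivity)
  exact mul_le_mul (PiLp.norm_apply_le ξ j) (PiLp.norm_apply_le ξ l) (abs_nonneg _) (norm_nonneg _)

lemma damp_mul_riesz (μ : ℝ) (j l : Fin 3) (ξ : E3) :
    (damp μ ξ : ℂ) * riesz j l ξ = -μ * (symb j ξ * symb l ξ) := by
  rcases eq_or_ne ξ 0 with rfl | h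
  · simp [damp, symb]
  · have : (‖ξ‖ : ℂ) ≠ 0 := by simpa using h
    rw [damp, riesz, symb, symb]
    push_cast
    field_simp
    linear_combination (4 * (μ : ℂ) * (ξ j : ℂ) * (ξ l : ℂ)) * Complex.I_sq

/-- The matrix `riesz` projects onto gradients and preserves the divergence. -/
lemma sum_symb_mul_riesz (l : Fin 3) (ξ : E3) : ∑ j, symb j ξ * riesz j l ξ = symb l ξ := by
  rcases eq_or_ne ξ 0 with rfl | h
  · simp [symb]
  · have h1 : (‖ξ‖ : ℂ) ≠ 0 := by simpa using h
    have h2 : ((∑ j, ξ j * ξ j : ℝ) : ℂ) = (‖ξ‖ : ℂ) ^ 2 := by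
      rw [← Complex.ofReal_pow, EuclideanSpace.norm_sq_eq]
      congr 1
      exact Finset.sum_congr rfl fun a _ => by rw [Real.norm_eq_abs, sq_abs, sq]
    have h3 : ∀ j, symb j ξ * riesz j l ξ
        = ((ξ j * ξ j : ℝ) : ℂ) * (symb l ξ / (‖ξ‖ : ℂ) ^ 2) := by
      intro j; rw [riesz, symb, symb]; push_cast; ring
    simp_rw [h3]
    rw [← Finset.sum_mul, ← Complex.ofReal_sum, h2]
    field_simp

/-- The Fourier transform of `-ℙ div (u ⊗ u)`, where `N k j` is that of `u_k u_j`. -/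
noncomputable def nonlin (N : Fin 3 → Fin 3 → ℂ) (j : Fin 3) (ξ : E3) : ℂ :=
  -∑ k, symb k ξ * (N k j - ∑ l, riesz j l ξ * N k l)

lemma norm_nonlin_le (N : Fin 3 → Fin 3 → ℂ) (j : Fin 3) (ξ : E3) :
    ‖nonlin N j ξ‖ ≤ 4 * Real.pi * ‖ξ‖ * ∑ k, ∑ l, ‖N k l‖ := by
  rw [nonlin, norm_neg, Finset.mul_sum]
  refine norm_sum_le_of_le _ fun k _ => ?_
  have h1 : ‖N k j‖ ≤ ∑ l, ‖N k l‖ :=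
    Finset.single_le_sum (f := fun l => ‖N k l‖) (fun _ _ => norm_nonneg _) (Finset.mem_univ j)
  have h2 : ‖∑ l, (riesz j l ξ : ℂ) * N k l‖ ≤ ∑ l, ‖N k l‖ := by
    refine norm_sum_le_of_le _ fun l _ => ?_
    rw [norm_mul, Complex.norm_real]
    exact mul_le_of_le_one_left (norm_nonneg _) (abs_riesz_le j l ξ)
  rw [norm_mul]
  calc ‖symb k ξ‖ * ‖N k j - ∑ l, riesz j l ξ * N k l‖
      ≤ (2 * Real.pi * ‖ξ‖) * (∑ l, ‖N k l‖ + ∑ l, ‖N k l‖) := by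
        gcongr
        · exact norm_symb_le k ξ
        · exact (norm_sub_le _ _).trans (add_le_add h1 h2)
    _ = _ := by ring

lemma sum_symb_mul_nonlin (N : Fin 3 → Fin 3 → ℂ) (ξ : E3) :
    ∑ j, symb j ξ * nonlin N j ξ = 0 := by
  have h1 : ∀ k, ∑ j, symb j ξ * ∑ l, riesz j l ξ * N k l = ∑ l, symb l ξ * N k l := by
    intro k
    simp_rw [Finset.mul_sum]
    rw [Finset.sum_comm]
    refine Finset.sum_congr rfl fun l _ => ?_
    simp_rw [← mul_assoc]
    rw [← Finset.sum_mul, sum_symb_mul_riesz]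
  have h2 : ∑ j, symb j ξ * nonlin N j ξ = -∑ k, symb k ξ *
      (∑ j, symb j ξ * N k j - ∑ j, symb j ξ * ∑ l, riesz j l ξ * N k l) := by
    simp_rw [nonlin, mul_neg, Finset.sum_neg_distrib, ← Finset.sum_sub_distrib, Finset.mul_sum]
    rw [Finset.sum_comm]
    congr 1
    refine Finset.sum_congr rfl fun k _ => Finset.sum_congr rfl fun j _ => ?_
    rw [← Finset.mul_sum]; ring
  rw [h2]
  simp [h1]

/-- Multiplication by `|ξ|²` removes the denominator of the Leray projection. -/
lemma damp_mul_nonlin (μ : ℝ) (N : Fin 3 → Fin 3 → ℂ) (j : Fin 3) (ξ : E3) :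
    damp μ ξ * nonlin N j ξ = -μ * ∑ k, ∑ i,
      (symb k ξ * symb j ξ * symb i ξ * N k i - symb k ξ * symb i ξ * symb i ξ * N k j) := by
  have h1 : ∀ k, damp μ ξ * (symb k ξ * (N k j - ∑ l, riesz j l ξ * N k l)) = -μ * ∑ i,
      (symb k ξ * symb i ξ * symb i ξ * N k j - symb k ξ * symb j ξ * symb i ξ * N k i) := by
    intro k
    have e1 : (damp μ ξ : ℂ) * ∑ l, riesz j l ξ * N k l = -μ * ∑ l, symb j ξ * symb l ξ * N k l := by
      rw [Finset.mul_sum, Finset.mul_sum]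
      refine Finset.sum_congr rfl fun l _ => ?_
      rw [← mul_assoc, damp_mul_riesz]; ring
    calc _ = symb k ξ * (damp μ ξ * N k j - damp μ ξ * ∑ l, riesz j l ξ * N k l) := by ring
      _ = _ := by
        rw [e1, damp_eq]
        simp only [Fin.sum_univ_three]
        ring
  rw [nonlin, mul_neg, Finset.mul_sum]
  simp_rw [h1]
  rw [← Finset.mul_sum, ← mul_neg, ← Finset.sum_neg_distrib]
  congr 1
  refine Finset.sum_congr rfl fun k _ => ?_
  rw [← Finset.sum_neg_distrib]
  exact Finset.sum_congr rfl fun i _ => by ring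

/-- Multiplication of a Schwartz function by the symbol of `-μΔ`. -/
noncomputable def dampMul (μ : ℝ) (φ : 𝓢(E3, ℂ)) : 𝓢(E3, ℂ) :=
  (-μ : ℂ) • ∑ i, symbMul i (symbMul i φ)

lemma dampMul_apply (μ : ℝ) (φ : 𝓢(E3, ℂ)) (ξ : E3) : dampMul μ φ ξ = damp μ ξ * φ ξ := by
  rw [dampMul, smul_apply, sum_apply, damp_eq]
  simp only [symbMul_apply, smul_eq_mul]
  rw [mul_assoc, Finset.sum_mul]
  simp_rw [mul_assoc]

/-- The Fourier transform of the product `u_k u_j`. -/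
noncomputable def quadFourier (f : Fin 3 → ℝ → E3 → ℂ) (k j : Fin 3) (t : ℝ) : E3 → ℂ :=
  𝓕 (fun x => f k t x * f j t x)

lemma integral_mul_fourier_schwartz {g : E3 → ℂ} (hg : Integrable g volume) (φ : 𝓢(E3, ℂ)) :
    ∫ x, g x * (𝓕 φ : 𝓢(E3, ℂ)) x = ∫ ξ, 𝓕 g ξ * φ ξ := by
  have h := VectorFourier.integral_fourierIntegral_smul_eq_flip (μ := (volume : Measure E3))
    (ν := (volume : Measure E3)) (e := Real.fourierChar) (L := innerₗ E3) (f := g) (g := φ)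
    Real.continuous_fourierChar continuous_inner hg φ.integrable
  rw [flip_innerₗ] at h
  exact h.symm

lemma sderiv_sderiv_fourier (a b : Fin 3) (φ : 𝓢(E3, ℂ)) :
    sderiv a (sderiv b (𝓕 φ)) = 𝓕 (symbMul a (symbMul b φ)) := by
  rw [sderiv_fourier, map_neg, sderiv_fourier, neg_neg]

namespace FlowData

variable {μ T : ℝ} {f : Fin 3 → ℝ → E3 → ℂ} {q : ℝ → E3 → ℂ}

lemma integrable_mul (h : FlowData μ T f q) (k j : Fin 3) {t : ℝ} (ht : t ∈ Ioo 0 T) :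
    Integrable (fun x => f k t x * f j t x) volume :=
  (h.memLp t ht k).integrable_mul (h.memLp t ht j)

lemma continuous_quadFourier (h : FlowData μ T f q) (k j : Fin 3) {t : ℝ} (ht : t ∈ Ioo 0 T) :
    Continuous (quadFourier f k j t) :=
  VectorFourier.fourierIntegral_continuous Real.continuous_fourierChar
    (L := innerₗ E3) continuous_inner (h.integrable_mul k j ht)

lemma quadFourier_eq (k j : Fin 3) (t : ℝ) (ξ : E3) : quadFourier f k j t ξ =
    ∫ x, f k t x * f j t x * (Real.fourierChar (-inner ℝ x ξ) : ℂ) := by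
  rw [quadFourier, Real.fourier_eq]
  congr 1; ext x
  rw [Circle.smul_def, smul_eq_mul, mul_comm]

lemma continuousOn_quadFourier (h : FlowData μ T f q) (k j : Fin 3) :
    ContinuousOn (fun z : ℝ × E3 => quadFourier f k j z.1 z.2) (Ioo 0 T ×ˢ univ) := by
  rintro ⟨t₀, ξ₀⟩ ⟨ht₀, -⟩
  refine ContinuousAt.continuousWithinAt ?_
  obtain ⟨m, hm, hm2⟩ := h.exists_modulus ht₀ k j
  have h1 : Tendsto (fun z : ℝ × E3 => quadFourier f k j z.1 z.2 - quadFourier f k j t₀ z.2)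
      (𝓝 (t₀, ξ₀)) (𝓝 0) := by
    rw [tendsto_iff_edist_tendsto_0]
    refine tendsto_of_tendsto_of_tendsto_of_le_of_le' tendsto_const_nhds
      (hm.comp (continuous_fst.tendsto' (t₀, ξ₀) t₀ rfl))
      (Eventually.of_forall fun _ => bot_le) ?_
    filter_upwards [(continuous_fst.tendsto' (t₀, ξ₀) t₀ rfl).eventually hm2] with z hz
    rw [edist_zero_right, quadFourier_eq, quadFourier_eq]
    have := hz (fun x => (Real.fourierChar (-inner ℝ x z.2) : ℂ)) 1
      (Continuous.aestronglyMeasurable (by fun_prop)) (fun x => by rw [← ofReal_norm, Circle.norm_coe]; simp)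
    simpa using this
  have h2 : Tendsto (fun z : ℝ × E3 => quadFourier f k j t₀ z.2) (𝓝 (t₀, ξ₀))
      (𝓝 (quadFourier f k j t₀ ξ₀)) :=
    ((h.continuous_quadFourier k j ht₀).comp continuous_snd).tendsto (t₀, ξ₀)
  have h3 := h1.add h2
  rw [zero_add] at h3
  exact h3.congr fun z => by simp

lemma exists_norm_quadFourier_le (h : FlowData μ T f q) {a b : ℝ} (ha : 0 < a) (hb : b < T) :
    ∃ C : ℝ, 0 ≤ C ∧ ∀ t ∈ Icc a b, ∀ k j ξ, ‖quadFourier f k j t ξ‖ ≤ C := by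
  obtain ⟨M, hM⟩ := h.bound a b ha hb
  refine ⟨M ^ 2, by positivity, fun t ht k j ξ => ?_⟩
  have ht' : t ∈ Ioo 0 T := ⟨ha.trans_le ht.1, ht.2.trans_lt hb⟩
  have h1 := enorm_integral_mul_mul_le (c := fun x => (Real.fourierChar (-inner ℝ x ξ) : ℂ)) (B := 1)
    (h.memLp t ht' k) (h.memLp t ht' j) (fun x => by rw [← ofReal_norm, Circle.norm_coe]; simp)
  rw [← quadFourier_eq, one_mul] at h1
  have h2 := h1.trans (mul_le_mul' (hM t ht k).1 (hM t ht j).1)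
  rw [← ofReal_norm, ← ENNReal.coe_mul, ← ENNReal.ofReal_coe_nnreal] at h2
  have := (ENNReal.ofReal_le_ofReal_iff (by positivity)).1 h2
  rw [sq]; exact_mod_cast this

/-- A choice of the Fourier transforms of the components of the flow. -/
lemma exists_fourier (h : FlowData μ T f q) : ∃ F : Fin 3 → ℝ → E3 → ℂ,
    ∀ j, ∀ t ∈ Ioo 0 T, StronglyMeasurable (F j t) ∧ IsFourierPair (f j t) (F j t) := by
  have : ∀ j t, ∃ F : E3 → ℂ, t ∈ Ioo 0 T → StronglyMeasurable F ∧ IsFourierPair (f j t) F := by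
    intro j t
    by_cases ht : t ∈ Ioo 0 T
    · obtain ⟨F, hF⟩ := IsFourierPair.exists_of_memLp (h.memLp t ht j)
      exact ⟨F, fun _ => hF⟩
    · exact ⟨0, fun h => absurd h ht⟩
  choose F hF using this
  exact ⟨F, fun j t ht => hF j t ht⟩

lemma sum_symb_mul_ae_eq_zero (h : FlowData μ T f q) {t : ℝ} (ht : t ∈ Ioo 0 T)
    {F : Fin 3 → E3 → ℂ} (hF : ∀ j, IsFourierPair (f j t) (F j)) :
    ∀ᵐ ξ, ∑ i, symb i ξ * F i ξ = 0 := by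
  have hp : ∀ i, IsFourierPair (pderiv i (f i t)) (fun ξ => symb i ξ * F i ξ) := fun i =>
    (hF i).pderiv ((h.contDiff ht i).differentiable (by simp)) i (h.memLp_one t ht i i)
  have h1 : IsFourierPair (fun x => ∑ i, pderiv i (f i t) x) (fun ξ => ∑ i, symb i ξ * F i ξ) := by
    refine IsFourierPair.of_forall_integral (memLp_finsetSum _ fun i _ => (hp i).memLp_left)
      (memLp_finsetSum _ fun i _ => (hp i).memLp_right) fun φ => ?_
    simp_rw [Finset.sum_mul]
    rw [integral_finsetSum _ fun i _ => integrable_mul_schwartz (hp i).memLp_left (𝓕 φ),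
      integral_finsetSum _ fun i _ => integrable_mul_schwartz (hp i).memLp_right φ]
    exact Finset.sum_congr rfl fun i _ => (hp i).integral_mul_fourier φ
  have h2 : IsFourierPair (fun x => ∑ i, pderiv i (f i t) x) (fun _ => 0) := by
    refine IsFourierPair.of_forall_integral h1.memLp_left MemLp.zero' fun φ => ?_
    simp [h.div_free t ht]
  exact h1.ae_eq_right h2

end FlowData

lemma symbMul_comm (a b : Fin 3) (φ : 𝓢(E3, ℂ)) :
    symbMul a (symbMul b φ) = symbMul b (symbMul a φ) := by
  ext ξ; simp only [symbMul_apply]; ring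

lemma dampMul_symbMul (μ : ℝ) (a : Fin 3) (φ : 𝓢(E3, ℂ)) :
    dampMul μ (symbMul a φ) = symbMul a (dampMul μ φ) := by
  ext ξ; simp only [symbMul_apply, dampMul_apply]; ring

lemma integral_mul_dampMul {F : E3 → ℂ} (hF : MemLp F 2 volume) (μ : ℝ) (φ : 𝓢(E3, ℂ)) :
    ∫ ξ, F ξ * dampMul μ φ ξ = -μ * ∑ i, ∫ ξ, F ξ * symbMul i (symbMul i φ) ξ := by
  rw [← integral_finsetSum _ fun i _ => integrable_mul_schwartz hF _, ← integral_const_mul]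
  congr 1; ext ξ
  rw [dampMul, smul_apply, sum_apply, smul_eq_mul, ← Finset.mul_sum]
  ring

namespace FlowData

variable {μ T : ℝ} {f : Fin 3 → ℝ → E3 → ℂ} {q : ℝ → E3 → ℂ}

lemma sum_integral_symbMul (h : FlowData μ T f q) {t : ℝ} (ht : t ∈ Ioo 0 T)
    {F : Fin 3 → E3 → ℂ} (hF : ∀ j, IsFourierPair (f j t) (F j)) (χ : 𝓢(E3, ℂ)) :
    ∑ i, ∫ ξ, F i ξ * symbMul i χ ξ = 0 := by
  rw [← integral_finsetSum _ fun i _ => integrable_mul_schwartz (hF i).memLp_right _]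
  refine integral_eq_zero_of_ae ?_
  filter_upwards [h.sum_symb_mul_ae_eq_zero ht hF] with ξ hξ
  have : ∑ i, F i ξ * symbMul i χ ξ = (∑ i, symb i ξ * F i ξ) * χ ξ := by
    rw [Finset.sum_mul]
    exact Finset.sum_congr rfl fun i _ => by rw [symbMul_apply]; ring
  rw [this, hξ, zero_mul]; rfl

lemma integrable_quadFourier_mul (h : FlowData μ T f q) {t : ℝ} (ht : t ∈ Ioo 0 T) (k j : Fin 3)
    (χ : 𝓢(E3, ℂ)) : Integrable (fun ξ => quadFourier f k j t ξ * χ ξ) volume := by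
  obtain ⟨C, -, hC⟩ := h.exists_norm_quadFourier_le ht.1 ht.2
  exact χ.integrable.bdd_mul (h.continuous_quadFourier k j ht).aestronglyMeasurable
    (ae_of_all _ fun ξ => hC t (left_mem_Icc.2 le_rfl) k j ξ)

lemma momentum_fourier (h : FlowData μ T f q) {t : ℝ} (ht : t ∈ Ioo 0 T)
    {F : Fin 3 → E3 → ℂ} (hF : ∀ j, IsFourierPair (f j t) (F j)) (j : Fin 3) (χ : 𝓢(E3, ℂ)) :
    momentum μ f j t (𝓕 χ) = -(∫ ξ, F j ξ * dampMul μ χ ξ)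
      - ∑ k, ∫ ξ, quadFourier f k j t ξ * symbMul k χ ξ := by
  rw [momentum, integral_mul_dampMul (hF j).memLp_right, neg_mul, neg_neg, sub_eq_add_neg,
    ← Finset.sum_neg_distrib]
  congr 1
  · congr 1
    refine Finset.sum_congr rfl fun a _ => ?_
    rw [sderiv_sderiv_fourier]
    exact (hF j).integral_mul_fourier _
  · refine Finset.sum_congr rfl fun k _ => ?_
    rw [sderiv_fourier, quadFourier, ← integral_mul_fourier_schwartz (h.integrable_mul k j ht),
      ← integral_neg]
    simp

/-- The Navier–Stokes equations in frequency space, tested with a Schwartz function. The factor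
`damp μ` comes from eliminating the pressure. -/
lemma hasDerivAt_integral_fourier (h : FlowData μ T f q) {F : Fin 3 → ℝ → E3 → ℂ}
    (hF : ∀ j, ∀ t ∈ Ioo 0 T, IsFourierPair (f j t) (F j t)) {t : ℝ} (ht : t ∈ Ioo 0 T) (j : Fin 3)
    (φ : 𝓢(E3, ℂ)) :
    HasDerivAt (fun t => ∫ ξ, F j t ξ * dampMul μ φ ξ)
      (-(∫ ξ, F j t ξ * dampMul μ (dampMul μ φ) ξ) +
        ∫ ξ, damp μ ξ * nonlin (fun k l => quadFourier f k l t ξ) j ξ * φ ξ) t := by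
  -- `-Δ u_j = -∑ᵢ ∂ᵢ (∂ᵢ u_j - ∂_j u_i)`: the vorticity equation with the test functions `∂ᵢ 𝓕 φ`
  have h1 : HasDerivAt (fun t => -(μ : ℂ) * ∑ i, ((∫ x, f j t x * sderiv i (sderiv i (𝓕 φ)) x) -
      ∫ x, f i t x * sderiv j (sderiv i (𝓕 φ)) x))
      (-(μ : ℂ) * ∑ i, (momentum μ f j t (sderiv i (sderiv i (𝓕 φ))) -
        momentum μ f i t (sderiv j (sderiv i (𝓕 φ))))) t :=
    (HasDerivAt.fun_sum fun i _ => h.hasDerivAt_curl_schwartz ht i j (sderiv i (𝓕 φ))).const_mul _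
  have h2 : (fun t => ∫ ξ, F j t ξ * dampMul μ φ ξ) =ᶠ[𝓝 t] fun t => -(μ : ℂ) *
      ∑ i, ((∫ x, f j t x * sderiv i (sderiv i (𝓕 φ)) x) -
        ∫ x, f i t x * sderiv j (sderiv i (𝓕 φ)) x) := by
    filter_upwards [isOpen_Ioo.mem_nhds ht] with s hs
    have e : ∀ i, ∫ x, f i s x * sderiv j (sderiv i (𝓕 φ)) x =
        ∫ ξ, F i s ξ * symbMul i (symbMul j φ) ξ := by
      intro i
      rw [sderiv_sderiv_fourier, symbMul_comm]
      exact (hF i s hs).integral_mul_fourier _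
    rw [integral_mul_dampMul (hF j s hs).memLp_right, Finset.sum_sub_distrib]
    simp_rw [e]
    -- the second half vanishes by incompressibility
    rw [h.sum_integral_symbMul hs (fun i => hF i s hs), sub_zero]
    congr 1
    refine Finset.sum_congr rfl fun i _ => ?_
    rw [sderiv_sderiv_fourier]
    exact ((hF j s hs).integral_mul_fourier _).symm
  refine (h1.congr_of_eventuallyEq h2).congr_deriv ?_
  have hF' : ∀ j, IsFourierPair (f j t) (F j t) := fun j => hF j t ht
  have hN := h.integrable_quadFourier_mul ht
  simp_rw [sderiv_sderiv_fourier, h.momentum_fourier ht hF']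
  have e1 : ∑ i, ∫ ξ, F i t ξ * dampMul μ (symbMul j (symbMul i φ)) ξ = 0 := by
    have : ∀ i, dampMul μ (symbMul j (symbMul i φ)) = symbMul i (dampMul μ (symbMul j φ)) :=
      fun i => by rw [symbMul_comm, dampMul_symbMul]
    simp_rw [this]
    exact h.sum_integral_symbMul ht hF' _
  have e2 : ∫ ξ, F j t ξ * dampMul μ (dampMul μ φ) ξ
      = -μ * ∑ i, ∫ ξ, F j t ξ * dampMul μ (symbMul i (symbMul i φ)) ξ := by
    rw [integral_mul_dampMul (hF' j).memLp_right]
    simp_rw [dampMul_symbMul]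
  have e3 : ∫ ξ, damp μ ξ * nonlin (fun k l => quadFourier f k l t ξ) j ξ * φ ξ =
      -μ * ∑ k, ∑ i, ((∫ ξ, quadFourier f k i t ξ * symbMul k (symbMul j (symbMul i φ)) ξ) -
        ∫ ξ, quadFourier f k j t ξ * symbMul k (symbMul i (symbMul i φ)) ξ) := by
    let g : Fin 3 → Fin 3 → E3 → ℂ := fun k i ξ =>
      quadFourier f k i t ξ * symbMul k (symbMul j (symbMul i φ)) ξ -
        quadFourier f k j t ξ * symbMul k (symbMul i (symbMul i φ)) ξ
    have hg : ∀ k i, Integrable (g k i) volume := fun k i => (hN _ _ _).sub (hN _ _ _)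
    have e4 : ∀ ξ, damp μ ξ * nonlin (fun k l => quadFourier f k l t ξ) j ξ * φ ξ =
        -μ * ∑ k, ∑ i, g k i ξ := by
      intro ξ
      rw [damp_mul_nonlin, mul_assoc, Finset.sum_mul]
      congr 1
      refine Finset.sum_congr rfl fun k _ => ?_
      rw [Finset.sum_mul]
      refine Finset.sum_congr rfl fun i _ => ?_
      simp only [g, symbMul_apply]; ring
    simp_rw [e4]
    rw [integral_const_mul, integral_finsetSum _ fun k _ => integrable_finsetSum _ fun i _ => hg k i]
    congr 1
    refine Finset.sum_congr rfl fun k _ => ?_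
    rw [integral_finsetSum _ fun i _ => hg k i]
    exact Finset.sum_congr rfl fun i _ => integral_sub (hN _ _ _) (hN _ _ _)
  rw [e2, e3]
  simp_rw [Finset.sum_sub_distrib, Finset.sum_neg_distrib, e1]
  rw [Finset.sum_comm (f := fun k i => ∫ ξ, quadFourier f k i t ξ * symbMul k (symbMul j (symbMul i φ)) ξ),
    Finset.sum_comm (f := fun k i => ∫ ξ, quadFourier f k j t ξ * symbMul k (symbMul i (symbMul i φ)) ξ)]
  ring

end FlowData

/-! ### Uniqueness and Duhamel's formula in frequency space -/

/-- The bounds on a chain of derivatives improve by a factor `1/2` with each integration in time, at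
the price of one exponential factor. -/
lemma norm_le_of_deriv_chain {g : ℕ → ℝ → ℂ} {K c t₀ b : ℝ} (hc : 0 ≤ c)
    (hg : ∀ n, ∀ t ∈ Icc t₀ b, HasDerivAt (g n) (-g (n + 1) t) t)
    (hK : ∀ n, ∀ t ∈ Icc t₀ b, ‖g n t‖ ≤ K * c ^ n) (h0 : ∀ n, g n t₀ = 0) (hK0 : 0 ≤ K) (m : ℕ) :
    ∀ n, ∀ t ∈ Icc t₀ b, ‖g n t‖ ≤ K * c ^ n * (1 / 2) ^ m * Real.exp (2 * c * (t - t₀)) := by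
  induction m with
  | zero =>
    intro n t ht
    refine (hK n t ht).trans ?_
    rw [pow_zero, mul_one]
    exact le_mul_of_one_le_right (by positivity)
      (Real.one_le_exp (mul_nonneg (by positivity) (sub_nonneg.2 ht.1)))
  | succ m ih =>
    intro n t ht
    refine image_norm_le_of_norm_deriv_right_le_deriv_boundary (f := g n)
      (f' := fun t => -g (n + 1) t)
      (B := fun t => K * c ^ n * (1 / 2) ^ (m + 1) * Real.exp (2 * c * (t - t₀)))
      (B' := fun t => K * c ^ (n + 1) * (1 / 2) ^ m * Real.exp (2 * c * (t - t₀)))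
      (fun t ht => (hg n t ht).continuousAt.continuousWithinAt)
      (fun t ht => (hg n t ⟨ht.1, ht.2.le⟩).hasDerivWithinAt) ?_ ?_ ?_ ht
    · rw [h0, norm_zero]; positivity
    · intro t
      have h1 : HasDerivAt (fun t => 2 * c * (t - t₀)) (2 * c) t := by
        simpa using ((hasDerivAt_id t).sub_const t₀).const_mul (2 * c)
      refine ((h1.exp).const_mul _).congr_deriv ?_
      ring
    · intro t ht
      rw [norm_neg]
      exact ih (n + 1) t ⟨ht.1, ht.2.le⟩

lemma eq_zero_of_deriv_chain_right {g : ℕ → ℝ → ℂ} {K c t₀ b : ℝ} (hc : 0 ≤ c)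
    (hg : ∀ n, ∀ t ∈ Icc t₀ b, HasDerivAt (g n) (-g (n + 1) t) t)
    (hK : ∀ n, ∀ t ∈ Icc t₀ b, ‖g n t‖ ≤ K * c ^ n) (h0 : ∀ n, g n t₀ = 0) {t : ℝ}
    (ht : t ∈ Icc t₀ b) : g 0 t = 0 := by
  have hK0 : 0 ≤ K := by simpa using (norm_nonneg _).trans (hK 0 t ht)
  have h1 : Tendsto (fun m : ℕ => K * c ^ 0 * (1 / 2) ^ m * Real.exp (2 * c * (t - t₀))) atTop
      (𝓝 (K * c ^ 0 * 0 * Real.exp (2 * c * (t - t₀)))) :=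
    ((tendsto_pow_atTop_nhds_zero_of_lt_one (by norm_num) (by norm_num)).const_mul _).mul_const _
  rw [mul_zero, zero_mul] at h1
  exact norm_le_zero_iff.1 (ge_of_tendsto' h1 fun m =>
    norm_le_of_deriv_chain hc hg hK h0 hK0 m 0 t ht)

/-- A sequence of functions, each minus the derivative of its predecessor, that vanish at one point
and grow at most geometrically, starts with the zero function. -/
lemma eq_zero_of_deriv_chain {g : ℕ → ℝ → ℂ} {K c a t₀ b : ℝ} (hc : 0 ≤ c) (ht₀ : t₀ ∈ Icc a b)
    (hg : ∀ n, ∀ t ∈ Icc a b, HasDerivAt (g n) (-g (n + 1) t) t)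
    (hK : ∀ n, ∀ t ∈ Icc a b, ‖g n t‖ ≤ K * c ^ n) (h0 : ∀ n, g n t₀ = 0) {t : ℝ}
    (ht : t ∈ Icc a b) : g 0 t = 0 := by
  rcases le_total t₀ t with h | h
  · exact eq_zero_of_deriv_chain_right hc (fun n t ht => hg n t ⟨ht₀.1.trans ht.1, ht.2⟩)
      (fun n t ht => hK n t ⟨ht₀.1.trans ht.1, ht.2⟩) h0 ⟨h, ht.2⟩
  · have hm : ∀ s ∈ Icc (-t₀) (-a), -s ∈ Icc a b := fun s hs =>
      ⟨by linarith [hs.2], by linarith [hs.1, ht₀.2]⟩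
    have := eq_zero_of_deriv_chain_right (g := fun n s => (-1) ^ n * g n (-s)) (K := K) (c := c)
      (t₀ := -t₀) (b := -a) (t := -t) hc ?_ ?_ ?_ ⟨by linarith, by linarith [ht.1]⟩
    · simpa using this
    · intro n s hs
      have h1 := ((hg n (-s) (hm s hs)).scomp s (hasDerivAt_neg s)).const_mul ((-1 : ℂ) ^ n)
      refine h1.congr_deriv ?_
      rw [pow_succ]; simp
    · intro n s hs
      simpa using hK n (-s) (hm s hs)
    · intro n; simp [h0]

/-- Duhamel's formula for `U' = -damp μ U + B`, `U(t₀) = U₀`. -/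
noncomputable def duhamel (μ t₀ : ℝ) (U₀ : E3 → ℂ) (B : ℝ → E3 → ℂ) (t : ℝ) (ξ : E3) : ℂ :=
  Real.exp (-damp μ ξ * (t - t₀)) *
    (U₀ ξ + ∫ s in t₀..t, Real.exp (damp μ ξ * (s - t₀)) * B s ξ)

section

variable {μ T t₀ : ℝ} {U₀ : E3 → ℂ} {B : ℝ → E3 → ℂ}

lemma uIcc_subset_Ioo_of_mem {t s : ℝ} (ht : t ∈ Ioo 0 T) (hs : s ∈ Ioo 0 T) :
    uIcc s t ⊆ Ioo 0 T := ordConnected_Ioo.uIcc_subset hs ht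

lemma hasDerivAt_duhamel (ht₀ : t₀ ∈ Ioo 0 T) {ξ : E3}
    (hB : ContinuousOn (fun s => B s ξ) (Ioo 0 T)) {t : ℝ} (ht : t ∈ Ioo 0 T) :
    HasDerivAt (fun t => duhamel μ t₀ U₀ B t ξ) (-damp μ ξ * duhamel μ t₀ U₀ B t ξ + B t ξ) t := by
  have hc : ContinuousOn (fun s => (Real.exp (damp μ ξ * (s - t₀)) : ℂ) * B s ξ) (Ioo 0 T) :=
    ContinuousOn.mul (Continuous.continuousOn (by fun_prop)) hB
  have h1 := intervalIntegral.integral_hasDerivAt_right (a := t₀) (b := t)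
    (f := fun s => (Real.exp (damp μ ξ * (s - t₀)) : ℂ) * B s ξ)
    (hc.mono (uIcc_subset_Ioo_of_mem ht ht₀)).intervalIntegrable
    (hc.stronglyMeasurableAtFilter isOpen_Ioo t ht)
    (hc.continuousAt (isOpen_Ioo.mem_nhds ht))
  have h2 : HasDerivAt (fun t => -damp μ ξ * (t - t₀)) (-damp μ ξ) t := by
    simpa using ((hasDerivAt_id t).sub_const t₀).const_mul (-damp μ ξ)
  have h3 := h2.exp.ofReal_comp.mul (h1.const_add (U₀ ξ))
  refine h3.congr_deriv ?_
  have h4 : ((Real.exp (-damp μ ξ * (t - t₀)) : ℝ) : ℂ) * (Real.exp (damp μ ξ * (t - t₀)) : ℝ) = 1 := by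
    rw [← Complex.ofReal_mul, ← Real.exp_add]; simp
  rw [duhamel]
  push_cast at h4 ⊢
  linear_combination (B t ξ) * h4

lemma duhamel_self (ξ : E3) : duhamel μ t₀ U₀ B t₀ ξ = U₀ ξ := by simp [duhamel]

lemma measurable_duhamel (hU₀ : Measurable U₀) (hB : Measurable (Function.uncurry B)) (t : ℝ) :
    Measurable (duhamel μ t₀ U₀ B t) := by
  have hd : Measurable (damp μ) := (continuous_damp μ).measurable
  have hm : StronglyMeasurable (Function.uncurry fun (ξ : E3) (s : ℝ) =>
      (Real.exp (damp μ ξ * (s - t₀)) : ℂ) * B s ξ) := by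
    refine Measurable.stronglyMeasurable (Measurable.mul (by fun_prop) ?_)
    exact hB.comp measurable_swap
  have h1 : Measurable fun ξ => ∫ s in t₀..t, (Real.exp (damp μ ξ * (s - t₀)) : ℂ) * B s ξ := by
    simp only [intervalIntegral]
    exact hm.integral_prod_right.measurable.sub hm.integral_prod_right.measurable
  unfold duhamel
  fun_prop

/-- On bounded frequencies the Duhamel formula grows at most like its data. -/
lemma exists_norm_duhamel_le (hμ : 0 ≤ μ)
    {a b : ℝ} (ht₀ : t₀ ∈ Icc a b) {C : ℝ} (hC : 0 ≤ C)
    (hB : ∀ s ∈ Icc a b, ∀ ξ, ‖B s ξ‖ ≤ C * ‖ξ‖) (R : ℝ) (hR : 0 ≤ R) :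
    ∃ A, 0 ≤ A ∧ ∀ t ∈ Icc a b, ∀ ξ, ‖ξ‖ ≤ R → ‖duhamel μ t₀ U₀ B t ξ‖ ≤ A * (‖U₀ ξ‖ + 1) := by
  set c := 4 * Real.pi ^ 2 * μ * R ^ 2 with hc
  have hc0 : 0 ≤ c := by positivity
  have hab : 0 ≤ b - a := by linarith [ht₀.1, ht₀.2]
  refine ⟨Real.exp (c * (b - a)) * (1 + Real.exp (c * (b - a)) * (C * R) * (b - a)), by positivity,
    fun t ht ξ hξ => ?_⟩
  have hd : damp μ ξ ≤ c := by unfold damp; rw [hc]; gcongr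
  have hd0 : 0 ≤ damp μ ξ := damp_nonneg hμ ξ
  have hab' : |t - t₀| ≤ b - a := abs_sub_le_of_le_of_le ht.1 ht.2 ht₀.1 ht₀.2
  have e1 : Real.exp (-damp μ ξ * (t - t₀)) ≤ Real.exp (c * (b - a)) := by
    refine Real.exp_le_exp.2 ((le_abs_self _).trans ?_)
    rw [abs_mul, abs_neg, abs_of_nonneg hd0]
    gcongr
  have e2 : ‖∫ s in t₀..t, (Real.exp (damp μ ξ * (s - t₀)) : ℂ) * B s ξ‖
      ≤ Real.exp (c * (b - a)) * (C * R) * (b - a) := by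
    refine (intervalIntegral.norm_integral_le_of_norm_le_const fun s hs => ?_).trans
      (mul_le_mul_of_nonneg_left hab' (by positivity))
    have hs' : s ∈ Icc a b := by
      have := uIoc_subset_uIcc hs
      exact ordConnected_Icc.uIcc_subset ht₀ ht this
    have hs2 : |s - t₀| ≤ b - a := abs_sub_le_of_le_of_le hs'.1 hs'.2 ht₀.1 ht₀.2
    rw [norm_mul, Complex.norm_real, Real.norm_of_nonneg (Real.exp_pos _).le]
    refine mul_le_mul (Real.exp_le_exp.2 ((le_abs_self _).trans ?_)) ((hB s hs' ξ).trans ?_)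
      (norm_nonneg _) (Real.exp_pos _).le
    · rw [abs_mul, abs_of_nonneg hd0]; gcongr
    · gcongr
  rw [duhamel, norm_mul, Complex.norm_real, Real.norm_of_nonneg (Real.exp_pos _).le, mul_assoc]
  refine mul_le_mul e1 ((norm_add_le _ _).trans ((add_le_add_right e2 _).trans ?_)) (norm_nonneg _)
    (Real.exp_pos _).le
  have : 0 ≤ Real.exp (c * (b - a)) * (C * R) * (b - a) := by positivity
  nlinarith [norm_nonneg (U₀ ξ)]

end

section

variable {μ T t₀ : ℝ} {U₀ : E3 → ℂ} {B : ℝ → E3 → ℂ}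

lemma integrable_mul_of_norm_le {G : E3 → ℂ} (hG : Measurable G) (hU₀ : MemLp U₀ 2 volume)
    {A R : ℝ} (hGA : ∀ ξ, ‖ξ‖ ≤ R → ‖G ξ‖ ≤ A * (‖U₀ ξ‖ + 1))
    (χ : 𝓢(E3, ℂ)) (hχ : ∀ ξ, R < ‖ξ‖ → χ ξ = 0) :
    Integrable (fun ξ => G ξ * χ ξ) volume ∧ ∀ ξ, ‖G ξ * χ ξ‖ ≤ A * (‖U₀ ξ‖ * ‖χ ξ‖ + ‖χ ξ‖) := by
  have hb : ∀ ξ, ‖G ξ * χ ξ‖ ≤ A * (‖U₀ ξ‖ * ‖χ ξ‖ + ‖χ ξ‖) := by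
    intro ξ
    rcases le_or_gt ‖ξ‖ R with h | h
    · rw [norm_mul]
      calc ‖G ξ‖ * ‖χ ξ‖ ≤ A * (‖U₀ ξ‖ + 1) * ‖χ ξ‖ := by gcongr; exact hGA ξ h
        _ = _ := by ring
    · simp [hχ ξ h]
  refine ⟨?_, hb⟩
  have h1 : Integrable (fun ξ => A * (‖U₀ ξ‖ * ‖χ ξ‖ + ‖χ ξ‖)) volume :=
    (((hU₀.norm.integrable_mul (χ.memLp 2 volume).norm).add χ.integrable.norm)).const_mul A
  exact h1.mono' (hG.mul χ.continuous.measurable).aestronglyMeasurable (ae_of_all _ hb)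

/-- The pairing of Duhamel's formula with a band-limited test function solves the same equation as
the pairing of the Fourier transform of the flow. -/
lemma hasDerivAt_integral_duhamel (hμ : 0 ≤ μ) (hU₀ : Measurable U₀) (hU₀2 : MemLp U₀ 2 volume)
    (hBm : Measurable (Function.uncurry B)) (hBc : ∀ ξ, ContinuousOn (fun s => B s ξ) (Ioo 0 T))
    {a b : ℝ} (ha : 0 < a) (hb : b < T) (ht₀ : t₀ ∈ Icc a b) {C : ℝ} (hC : 0 ≤ C)
    (hB : ∀ s ∈ Icc a b, ∀ ξ, ‖B s ξ‖ ≤ C * ‖ξ‖) {R : ℝ} (hR : 0 ≤ R) (χ : 𝓢(E3, ℂ))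
    (hχ : ∀ ξ, R < ‖ξ‖ → χ ξ = 0) {t : ℝ} (ht : t ∈ Ioo a b) :
    HasDerivAt (fun t => ∫ ξ, duhamel μ t₀ U₀ B t ξ * dampMul μ χ ξ)
      (-(∫ ξ, duhamel μ t₀ U₀ B t ξ * dampMul μ (dampMul μ χ) ξ) +
        ∫ ξ, damp μ ξ * B t ξ * χ ξ) t := by
  have hsub : Icc a b ⊆ Ioo 0 T := Icc_subset_Ioo ha hb
  have ht' : t ∈ Icc a b := Ioo_subset_Icc_self ht
  have hχ' : ∀ ξ, R < ‖ξ‖ → dampMul μ χ ξ = 0 := fun ξ h => by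
    rw [dampMul_apply, hχ ξ h, mul_zero]
  have hχ'' : ∀ ξ, R < ‖ξ‖ → dampMul μ (dampMul μ χ) ξ = 0 := fun ξ h => by
    rw [dampMul_apply, hχ' ξ h, mul_zero]
  obtain ⟨A, hA0, hA⟩ := exists_norm_duhamel_le (U₀ := U₀) hμ ht₀ hC hB R hR
  have hm : ∀ t, Measurable (duhamel μ t₀ U₀ B t) := fun t => measurable_duhamel hU₀ hBm t
  have hBt : ∀ t, Measurable (B t) := fun t => hBm.comp measurable_prodMk_left
  have hBR : ∀ s ∈ Icc a b, ∀ ξ, ‖ξ‖ ≤ R → ‖B s ξ‖ ≤ (C * R) * (‖U₀ ξ‖ + 1) := by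
    intro s hs ξ hξ
    calc ‖B s ξ‖ ≤ C * R := (hB s hs ξ).trans (by gcongr)
      _ ≤ _ := le_mul_of_one_le_right (by positivity) (by linarith [norm_nonneg (U₀ ξ)])
  have i1 := fun s hs => integrable_mul_of_norm_le (hm s) hU₀2 (hA s hs) _ hχ'
  have i2 := fun s hs => integrable_mul_of_norm_le (hm s) hU₀2 (hA s hs) _ hχ''
  have i3 := fun s hs => integrable_mul_of_norm_le (hBt s) hU₀2 (hBR s hs) _ hχ'
  have h := hasDerivWithinAt_integral_of_dominated (ν := (volume : Measure E3)) (s := Icc a b)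
    (x₀ := t) (F := fun s ξ => duhamel μ t₀ U₀ B s ξ * dampMul μ χ ξ)
    (F' := fun s ξ => -(duhamel μ t₀ U₀ B s ξ * dampMul μ (dampMul μ χ) ξ)
      + B s ξ * dampMul μ χ ξ)
    (bound := fun ξ => A * (‖U₀ ξ‖ * ‖dampMul μ (dampMul μ χ) ξ‖ + ‖dampMul μ (dampMul μ χ) ξ‖) +
      (C * R) * (‖U₀ ξ‖ * ‖dampMul μ χ ξ‖ + ‖dampMul μ χ ξ‖)) (convex_Icc a b) ht'
    (fun s hs => (i1 s hs).1) (((i2 t ht').1.neg).add (i3 t ht').1).aestronglyMeasurable ?_ ?_ ?_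
  · refine (h.hasDerivAt (Icc_mem_nhds ht.1 ht.2)).congr_deriv ?_
    have e : ∀ ξ, damp μ ξ * B t ξ * χ ξ = B t ξ * dampMul μ χ ξ := fun ξ => by
      rw [dampMul_apply]; ring
    simp_rw [e]
    rw [integral_add (i2 t ht').1.fun_neg (i3 t ht').1, integral_neg]
  · have hn : ∀ χ : 𝓢(E3, ℂ), Integrable (fun ξ => ‖U₀ ξ‖ * ‖χ ξ‖ + ‖χ ξ‖) volume := fun χ =>
      (hU₀2.norm.integrable_mul (χ.memLp 2 volume).norm).add χ.integrable.norm
    exact ((hn _).const_mul A).add ((hn _).const_mul (C * R))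
  · intro s hs ξ
    refine (norm_add_le _ _).trans (add_le_add ?_ ((i3 s hs).2 ξ))
    rw [norm_neg]
    exact (i2 s hs).2 ξ
  · intro s hs ξ
    refine (((hasDerivAt_duhamel (hsub ht₀) (hBc ξ) (hsub hs)).mul_const _).congr_deriv
      ?_).hasDerivWithinAt
    rw [dampMul_apply _ (dampMul μ χ)]; ring

end

lemma iterate_dampMul_apply (μ : ℝ) (n : ℕ) (φ : 𝓢(E3, ℂ)) (ξ : E3) :
    (dampMul μ)^[n] φ ξ = damp μ ξ ^ n * φ ξ := by
  induction n with
  | zero => simp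
  | succ n ih => rw [Function.iterate_succ_apply', dampMul_apply, ih]; ring

lemma norm_iterate_dampMul_le {μ : ℝ} (hμ : 0 ≤ μ) {R : ℝ} {φ : 𝓢(E3, ℂ)}
    (hφ : ∀ ξ, R < ‖ξ‖ → φ ξ = 0) (n : ℕ) (ξ : E3) :
    ‖(dampMul μ)^[n] φ ξ‖ ≤ (4 * Real.pi ^ 2 * μ * R ^ 2) ^ n * ‖φ ξ‖ := by
  rw [iterate_dampMul_apply]
  rcases le_or_gt ‖ξ‖ R with h | h
  · rw [norm_mul, norm_pow, Complex.norm_real, Real.norm_of_nonneg (damp_nonneg hμ ξ)]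
    have h1 := damp_nonneg hμ ξ
    have h2 : damp μ ξ ≤ 4 * Real.pi ^ 2 * μ * R ^ 2 := by unfold damp; gcongr
    gcongr
  · simp [hφ ξ h]

lemma norm_integral_mul_le_of_norm_le {F : E3 → ℂ} {M : ℝ≥0} (hF : MemLp F 2 volume)
    (hM : eLpNorm F 2 volume ≤ M) {φ χ : 𝓢(E3, ℂ)} {c : ℝ} (hc : 0 ≤ c)
    (h : ∀ ξ, ‖φ ξ‖ ≤ c * ‖χ ξ‖) : ‖∫ ξ, F ξ * φ ξ‖ ≤ M * (c * testNorm χ) := by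
  have h1 := enorm_integral_mul_le hF (φ.memLp 2 volume)
  have h2 : eLpNorm φ 2 volume ≤ ENNReal.ofReal c * ENNReal.ofReal (testNorm χ) :=
    (eLpNorm_le_mul_eLpNorm_of_ae_le_mul (ae_of_all _ h) 2).trans
      (mul_le_mul' le_rfl (eLpNorm_le_testNorm χ))
  have h3 := h1.trans (mul_le_mul' hM h2)
  rw [← ofReal_norm, ← ENNReal.ofReal_coe_nnreal, ← ENNReal.ofReal_mul hc,
    ← ENNReal.ofReal_mul M.coe_nonneg] at h3
  have := testNorm_nonneg χ
  exact (ENNReal.ofReal_le_ofReal_iff (by positivity)).1 h3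

/-- The quadratic term of the equations in frequency space, set to `0` outside the time
interval `(0,T)`. -/
noncomputable def forcing (T : ℝ) (f : Fin 3 → ℝ → E3 → ℂ) (j : Fin 3) (t : ℝ) (ξ : E3) : ℂ :=
  nonlin (fun k l => (Ioo 0 T ×ˢ univ).indicator
    (fun z : ℝ × E3 => quadFourier f k l z.1 z.2) (t, ξ)) j ξ

namespace FlowData

variable {μ T : ℝ} {f : Fin 3 → ℝ → E3 → ℂ} {q : ℝ → E3 → ℂ}

lemma _root_.forcing_eq {t : ℝ} (ht : t ∈ Ioo 0 T) (j : Fin 3) (ξ : E3) :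
    forcing T f j t ξ = nonlin (fun k l => quadFourier f k l t ξ) j ξ := by
  simp only [forcing]
  congr 1; ext k l
  rw [indicator_of_mem (show (t, ξ) ∈ Ioo 0 T ×ˢ univ from ⟨ht, mem_univ _⟩)]

lemma measurable_forcing (h : FlowData μ T f q) (j : Fin 3) :
    Measurable (Function.uncurry (forcing T f j)) := by
  have hN : ∀ k l, Measurable ((Ioo 0 T ×ˢ univ).indicator
      (fun z : ℝ × E3 => quadFourier f k l z.1 z.2)) := fun k l => by
    have := (h.continuousOn_quadFourier k l).measurable_piecewise (g := fun _ => 0)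
      continuousOn_const (measurableSet_Ioo.prod MeasurableSet.univ)
    rw [← piecewise_eq_indicator]
    exact this
  have hs := measurable_symb
  have hr := measurable_riesz
  unfold forcing nonlin Function.uncurry
  fun_prop

lemma continuousOn_forcing (h : FlowData μ T f q) (j : Fin 3) (ξ : E3) :
    ContinuousOn (fun s => forcing T f j s ξ) (Ioo 0 T) := by
  have hN : ∀ k l, ContinuousOn (fun s => quadFourier f k l s ξ) (Ioo 0 T) := fun k l =>
    (h.continuousOn_quadFourier k l).comp (f := fun s : ℝ => (s, ξ)) (by fun_prop)
      fun s hs => ⟨hs, mem_univ _⟩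
  refine ContinuousOn.congr (f := fun s => nonlin (fun k l => quadFourier f k l s ξ) j ξ) ?_
    fun s hs => forcing_eq hs j ξ
  unfold nonlin
  fun_prop

lemma exists_norm_forcing_le (h : FlowData μ T f q) {a b : ℝ} (ha : 0 < a) (hb : b < T) :
    ∃ C : ℝ, 0 ≤ C ∧ ∀ s ∈ Icc a b, ∀ j ξ, ‖forcing T f j s ξ‖ ≤ C * ‖ξ‖ := by
  obtain ⟨C, hC0, hC⟩ := h.exists_norm_quadFourier_le ha hb
  refine ⟨4 * Real.pi * (∑ _k : Fin 3, ∑ _l : Fin 3, C), by positivity, fun s hs j ξ => ?_⟩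
  rw [forcing_eq ⟨ha.trans_le hs.1, hs.2.trans_lt hb⟩]
  refine (norm_nonlin_le _ j ξ).trans ?_
  have : ∑ k, ∑ l, ‖quadFourier f k l s ξ‖ ≤ ∑ _k : Fin 3, ∑ _l : Fin 3, C :=
    Finset.sum_le_sum fun k _ => Finset.sum_le_sum fun l _ => hC s hs k l ξ
  calc _ ≤ 4 * Real.pi * ‖ξ‖ * (∑ _k : Fin 3, ∑ _l : Fin 3, C) := by gcongr
    _ = _ := by ring

/-- The Fourier transform of the flow is given by Duhamel's formula. -/
lemma ae_eq_duhamel (h : FlowData μ T f q) (hμ : 0 < μ) {F : Fin 3 → ℝ → E3 → ℂ}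
    (hF : ∀ j, ∀ t ∈ Ioo 0 T, IsFourierPair (f j t) (F j t)) {t₀ : ℝ} (ht₀ : t₀ ∈ Ioo 0 T)
    {U₀ : Fin 3 → E3 → ℂ} (hU₀ : ∀ j, Measurable (U₀ j)) (hUF : ∀ j, U₀ j =ᵐ[volume] F j t₀)
    (j : Fin 3) {t : ℝ} (ht : t ∈ Ioo 0 T) :
    F j t =ᵐ[volume] duhamel μ t₀ (U₀ j) (forcing T f j) t := by
  set a := min t t₀ / 2 with ha_def
  set b := (max t t₀ + T) / 2 with hb_def
  have hmin : 0 < min t t₀ := lt_min ht.1 ht₀.1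
  have hmax : max t t₀ < T := max_lt ht.2 ht₀.2
  have ha : 0 < a := by positivity
  have hb : b < T := by linarith
  have hI : Icc (min t t₀) (max t t₀) ⊆ Ioo a b := Icc_subset_Ioo (by linarith) (by linarith)
  have hIab : Icc a b ⊆ Ioo 0 T := Icc_subset_Ioo ha hb
  have hmt₀ : t₀ ∈ Icc (min t t₀) (max t t₀) := ⟨min_le_right _ _, le_max_right _ _⟩
  have hmt : t ∈ Icc (min t t₀) (max t t₀) := ⟨min_le_left _ _, le_max_left _ _⟩
  have ht₀ab : t₀ ∈ Icc a b := Ioo_subset_Icc_self (hI hmt₀)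
  obtain ⟨C, hC0, hC⟩ := h.exists_norm_forcing_le ha hb
  obtain ⟨M, hM⟩ := h.bound a b ha hb
  have hU₀2 : MemLp (U₀ j) 2 volume := (hF j t₀ ht₀).memLp_right.ae_eq (hUF j).symm
  have hBm := h.measurable_forcing j
  have hdm : ∀ t, Measurable (duhamel μ t₀ (U₀ j) (forcing T f j) t) := fun t =>
    measurable_duhamel (hU₀ j) hBm t
  -- before it is known to be the Fourier transform of the flow, Duhamel's formula is controlled on
  -- bounded frequencies only
  have hdl : LocallyIntegrable (duhamel μ t₀ (U₀ j) (forcing T f j) t) volume := by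
    rw [locallyIntegrable_iff]
    intro K hK
    obtain ⟨R, hR0, hR⟩ := hK.isBounded.subset_closedBall_lt 0 0
    obtain ⟨A, -, hA⟩ := exists_norm_duhamel_le (U₀ := U₀ j) hμ.le ht₀ab hC0
      (fun s hs ξ => hC s hs j ξ) R hR0.le
    have h1 : IntegrableOn (fun ξ => A * (‖U₀ j ξ‖ + 1)) K volume := by
      have h2 : IntegrableOn (fun ξ => ‖U₀ j ξ‖) K volume :=
        ((hU₀2.locallyIntegrable one_le_two).integrableOn_isCompact hK).norm
      exact (h2.add (integrableOn_const hK.measure_lt_top.ne)).const_mul A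
    refine Integrable.mono' h1 (hdm t).aestronglyMeasurable ?_
    refine (ae_restrict_iff' hK.measurableSet).2 (ae_of_all _ fun ξ hξ => ?_)
    exact hA t (Ioo_subset_Icc_self (hI hmt)) ξ (by simpa using hR hξ)
  have hcm : Continuous fun ξ => (damp μ ξ : ℂ) := Complex.continuous_ofReal.comp (continuous_damp μ)
  have hmul : ∀ {G : E3 → ℂ}, LocallyIntegrable G volume →
      LocallyIntegrable (fun ξ => (damp μ ξ : ℂ) * G ξ) volume := by
    intro G hG
    rw [← locallyIntegrableOn_univ] at hG ⊢
    exact hG.continuousOn_mul hcm.continuousOn isOpen_univ.isLocallyClosed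
  have key : (fun ξ => (damp μ ξ : ℂ) * F j t ξ) =ᵐ[volume]
      fun ξ => damp μ ξ * duhamel μ t₀ (U₀ j) (forcing T f j) t ξ := by
    refine ae_eq_of_integral_contDiff_smul_eq
      (hmul ((hF j t ht).memLp_right.locallyIntegrable one_le_two)) (hmul hdl) ?_
    intro g hg hgc
    have hg₁ : HasCompactSupport (Complex.ofRealCLM ∘ g) := hgc.comp_left rfl
    have hg₂ : ContDiff ℝ ∞ (Complex.ofRealCLM ∘ g) := by fun_prop
    set χ : 𝓢(E3, ℂ) := hg₁.toSchwartzMap hg₂ with hχ_def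
    obtain ⟨R, hR0, hR⟩ := hgc.isBounded.subset_closedBall_lt 0 0
    have hχ0 : ∀ ξ, R < ‖ξ‖ → χ ξ = 0 := by
      intro ξ hξ
      have : g ξ = 0 := by
        by_contra h0
        have := hR (subset_tsupport g h0)
        rw [mem_closedBall_zero_iff] at this
        linarith
      simp [hχ_def, this]
    set c := 4 * Real.pi ^ 2 * μ * R ^ 2 with hc_def
    have hc0 : 0 ≤ c := by positivity
    -- on the support of `χ` the symbol `damp μ` is at most `c`, so the pairings with `φ n` grow at most
    -- geometrically in `n`, and each is minus the time derivative of the one before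
    let φ : ℕ → 𝓢(E3, ℂ) := fun n => (dampMul μ)^[n] χ
    have hφs : ∀ n, φ (n + 1) = dampMul μ (φ n) := fun n => Function.iterate_succ_apply' _ _ _
    have hφ0 : ∀ n ξ, R < ‖ξ‖ → φ n ξ = 0 := fun n ξ hξ => by
      simp only [φ]; rw [iterate_dampMul_apply, hχ0 ξ hξ, mul_zero]
    have hφb : ∀ n ξ, ‖φ n ξ‖ ≤ c ^ n * ‖χ ξ‖ := norm_iterate_dampMul_le hμ.le hχ0
    obtain ⟨A, hA0, hA⟩ := exists_norm_duhamel_le (U₀ := U₀ j) hμ.le ht₀ab hC0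
      (fun s hs ξ => hC s hs j ξ) R hR0.le
    have hint := fun n s hs => integrable_mul_of_norm_le (hdm s) hU₀2 (hA s hs) (φ n) (hφ0 n)
    set J := ∫ ξ, A * (‖U₀ j ξ‖ * ‖χ ξ‖ + ‖χ ξ‖) with hJ
    have hJi : Integrable (fun ξ => A * (‖U₀ j ξ‖ * ‖χ ξ‖ + ‖χ ξ‖)) volume :=
      ((hU₀2.norm.integrable_mul (χ.memLp 2 volume).norm).add χ.integrable.norm).const_mul A
    have hg0 := eq_zero_of_deriv_chain (g := fun n s => (∫ ξ, F j s ξ * dampMul μ (φ n) ξ) -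
      ∫ ξ, duhamel μ t₀ (U₀ j) (forcing T f j) s ξ * dampMul μ (φ n) ξ)
      (K := c * (M * testNorm χ + J)) (c := c) (t := t) hc0 hmt₀ ?_ ?_ ?_ hmt
    · have e1 : ∀ G : E3 → ℂ, ∫ ξ, g ξ • ((damp μ ξ : ℂ) * G ξ) = ∫ ξ, G ξ * dampMul μ (φ 0) ξ := by
        intro G
        congr 1; ext ξ
        rw [dampMul_apply]
        simp [φ, hχ_def]; ring
      rw [e1, e1]
      exact sub_eq_zero.1 hg0
    · intro n s hs
      have hs' := hIab (Ioo_subset_Icc_self (hI hs))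
      have d1 := h.hasDerivAt_integral_fourier hF hs' j (φ n)
      have d2 := hasDerivAt_integral_duhamel hμ.le (hU₀ j) hU₀2 hBm (h.continuousOn_forcing j)
        ha hb ht₀ab hC0 (fun s hs ξ => hC s hs j ξ) hR0.le (φ n) (hφ0 n) (hI hs)
      refine (d1.sub d2).congr_deriv ?_
      simp_rw [forcing_eq hs']
      rw [hφs]; ring
    · intro n s hs
      have hs' := Ioo_subset_Icc_self (hI hs)
      have b1 : ‖∫ ξ, F j s ξ * dampMul μ (φ n) ξ‖ ≤ M * (c ^ (n + 1) * testNorm χ) := by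
        refine norm_integral_mul_le_of_norm_le (hF j s (hIab hs')).memLp_right ?_ (by positivity)
          fun ξ => ?_
        · rw [← (hF j s (hIab hs')).eLpNorm_eq]; exact (hM s hs' j).1
        · rw [← hφs]; exact hφb _ ξ
      have b2 : ‖∫ ξ, duhamel μ t₀ (U₀ j) (forcing T f j) s ξ * dampMul μ (φ n) ξ‖
          ≤ c ^ (n + 1) * J := by
        rw [hJ, ← integral_const_mul]
        refine norm_integral_le_of_norm_le (hJi.const_mul _) (ae_of_all _ fun ξ => ?_)
        rw [← hφs]
        refine ((hint (n + 1) s hs').2 ξ).trans ?_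
        have := hφb (n + 1) ξ
        calc A * (‖U₀ j ξ‖ * ‖φ (n + 1) ξ‖ + ‖φ (n + 1) ξ‖)
            ≤ A * (‖U₀ j ξ‖ * (c ^ (n + 1) * ‖χ ξ‖) + c ^ (n + 1) * ‖χ ξ‖) := by gcongr
          _ = _ := by ring
      refine (norm_sub_le _ _).trans ((add_le_add b1 b2).trans_eq ?_)
      ring
    · intro n
      rw [sub_eq_zero]
      refine integral_congr_ae ?_
      filter_upwards [hUF j] with ξ hξ
      rw [duhamel_self, hξ]
  -- the factor `damp μ ξ` vanishes only at the origin, a null set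
  have hne : ∀ᵐ ξ : E3, ξ ≠ 0 := by
    simp [ae_iff]
  filter_upwards [key, hne] with ξ h1 h2
  have : (damp μ ξ : ℂ) ≠ 0 := by
    rw [Complex.ofReal_ne_zero]
    unfold damp
    have := norm_pos_iff.2 h2
    positivity
  exact mul_left_cancel₀ this h1

end FlowData

/-! ### Fourier flows -/

lemma eLpNorm_two_sq (f : E3 → ℂ) : eLpNorm f 2 volume ^ 2 = ∫⁻ ξ, ‖f ξ‖ₑ ^ 2 := by
  have := eLpNorm_nnreal_pow_eq_lintegral (f := f) (μ := (volume : Measure E3)) (p := 2) (by norm_num)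
  simpa [ENNReal.rpow_two] using this

/-- The convolution of two complex-valued functions on frequency space. -/
noncomputable def cconv (F G : E3 → ℂ) (ξ : E3) : ℂ := ∫ η, F η * G (ξ - η)

/-- A solution of the Navier–Stokes equations in frequency space on `(0,T)`, whose weighted norms
that correspond to `H²` are locally bounded in time. -/
structure FourierFlow (μ T : ℝ) (U : Fin 3 → ℝ → E3 → ℂ) : Prop where
  measurable : ∀ j t, Measurable (U j t)
  bound : ∀ a b, 0 < a → b < T → ∃ M : ℝ≥0, ∀ t ∈ Icc a b, ∀ j,
    wnorm 4 (fun ξ => ‖U j t ξ‖ₑ) ≤ M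
  hasDerivAt : ∀ t ∈ Ioo 0 T, ∀ ξ j, HasDerivAt (fun t => U j t ξ)
    (-damp μ ξ * U j t ξ + nonlin (fun k l => cconv (U k t) (U l t) ξ) j ξ) t
  continuousOn_conv : ∀ k l,
    ContinuousOn (fun z : ℝ × E3 => cconv (U k z.1) (U l z.1) z.2) (Ioo 0 T ×ˢ univ)
  div_free : ∀ t ∈ Ioo 0 T, ∀ ξ, ∑ j, symb j ξ * U j t ξ = 0

lemma continuous_fourierInv {F : E3 → ℂ} (hF : Integrable F volume) : Continuous (𝓕⁻ F) := by
  have h : 𝓕⁻ F = fun x => 𝓕 F (-x) := by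
    ext x; exact Real.fourierInv_eq_fourier_neg F x
  rw [h]
  exact (VectorFourier.fourierIntegral_continuous Real.continuous_fourierChar
    (L := innerₗ E3) continuous_inner hF).comp continuous_neg

lemma memLp_of_wnorm {F : E3 → ℂ} (hF : Measurable F) {k : ℕ}
    (h : wnorm k (fun ξ => ‖F ξ‖ₑ) < ⊤) : MemLp F 2 volume := by
  refine ⟨hF.aestronglyMeasurable, ?_⟩
  have h1 := (wnorm_mono_left (Nat.zero_le k) (fun ξ => ‖F ξ‖ₑ)).trans_lt h
  have h2 : eLpNorm F 2 volume ^ 2 < ⊤ := by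
    rw [eLpNorm_two_sq]; simpa [wnorm] using h1
  by_contra h3
  rw [not_lt_top_iff] at h3
  simp [h3] at h2

lemma integrable_of_wnorm {F : E3 → ℂ} (hF : Measurable F)
    (h : wnorm 4 (fun ξ => ‖F ξ‖ₑ) < ⊤) : Integrable F volume := by
  refine ⟨hF.aestronglyMeasurable, ?_⟩
  have h1 := sq_lintegral_le hF.enorm
  have h2 : (∫⁻ ξ, ‖F ξ‖ₑ) ^ 2 < ⊤ := h1.trans_lt (ENNReal.mul_lt_top wtConst_ne_top.lt_top h)
  rw [HasFiniteIntegral]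
  by_contra h3
  rw [not_lt_top_iff] at h3
  simp [h3] at h2

lemma enorm_sq_le_sum_symb (ξ : E3) : ‖ξ‖ₑ ^ 2 ≤ ∑ a, ‖symb a ξ‖ₑ ^ 2 := by
  simp_rw [← ofReal_norm, ← ENNReal.ofReal_pow (norm_nonneg _)]
  rw [← ENNReal.ofReal_sum_of_nonneg fun _ _ => by positivity]
  refine ENNReal.ofReal_le_ofReal ?_
  rw [EuclideanSpace.norm_sq_eq]
  refine Finset.sum_le_sum fun a _ => ?_
  simp only [symb, norm_mul, Complex.norm_ofNat, Complex.norm_I, Complex.norm_real, mul_one, mul_pow]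
  rw [Real.norm_of_nonneg Real.pi_pos.le]
  have : 1 ≤ 2 ^ 2 * Real.pi ^ 2 := by nlinarith [Real.pi_gt_three]
  exact le_mul_of_one_le_left (by positivity) this

/-- The weighted norm of order four is controlled by the `L²` norms of the function and of its second
derivatives. -/
lemma wnorm_four_le (F : E3 → ℂ) (hF : Measurable F) : wnorm 4 (fun ξ => ‖F ξ‖ₑ) ≤
    8 * ((∫⁻ ξ, ‖F ξ‖ₑ ^ 2) + ∑ a, ∑ b, ∫⁻ ξ, ‖symb a ξ * (symb b ξ * F ξ)‖ₑ ^ 2) := by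
  have hs := measurable_symb
  have h1 : ∀ ξ : E3, wt ξ ^ 4 ≤ 8 * (1 + ‖ξ‖ₑ ^ 4) := by
    intro ξ
    have := ENNReal.rpow_add_le_mul_rpow_add_rpow 1 ‖ξ‖ₑ (p := 4) (by norm_num)
    have e : (2 : ℝ≥0∞) ^ ((4 : ℝ) - 1) = 8 := by
      rw [show (4 : ℝ) - 1 = (3 : ℕ) by norm_num, ENNReal.rpow_natCast]; norm_num
    rw [e, ENNReal.one_rpow] at this
    exact_mod_cast this
  have h2 : ∀ ξ : E3, ‖ξ‖ₑ ^ 4 ≤ ∑ a, ∑ b, ‖symb a ξ‖ₑ ^ 2 * ‖symb b ξ‖ₑ ^ 2 := by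
    intro ξ
    rw [← Finset.sum_mul_sum, ← sq, show 4 = 2 * 2 from rfl, pow_mul]
    gcongr
    exact enorm_sq_le_sum_symb ξ
  calc wnorm 4 (fun ξ => ‖F ξ‖ₑ)
      ≤ ∫⁻ ξ, 8 * (‖F ξ‖ₑ ^ 2 + ∑ a, ∑ b, ‖symb a ξ * (symb b ξ * F ξ)‖ₑ ^ 2) := by
        refine lintegral_mono fun ξ => ?_
        calc wt ξ ^ 4 * ‖F ξ‖ₑ ^ 2
            ≤ 8 * (1 + ∑ a, ∑ b, ‖symb a ξ‖ₑ ^ 2 * ‖symb b ξ‖ₑ ^ 2) * ‖F ξ‖ₑ ^ 2 := by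
              gcongr
              exact (h1 ξ).trans (by gcongr; exact h2 ξ)
          _ = _ := by
              rw [mul_assoc, add_mul, one_mul, Finset.sum_mul]
              simp_rw [Finset.sum_mul, enorm_mul, mul_pow, mul_assoc]
    _ = _ := by
        rw [lintegral_const_mul' _ _ (by norm_num), lintegral_add_left (by fun_prop),
          lintegral_finsetSum _ (fun a _ => by fun_prop)]
        congr 2
        refine Finset.sum_congr rfl fun a _ => ?_
        rw [lintegral_finsetSum _ (fun a _ => by fun_prop)]

namespace FlowData

variable {μ T : ℝ} {f : Fin 3 → ℝ → E3 → ℂ} {q : ℝ → E3 → ℂ}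

/-- The Fourier transform of a smooth flow is a Fourier flow. -/
theorem exists_fourierFlow (h : FlowData μ T f q) (hμ : 0 < μ) (hT : 0 < T) :
    ∃ U, FourierFlow μ T U ∧ ∀ j, ∀ t ∈ Ioo 0 T, f j t = 𝓕⁻ (U j t) := by
  obtain ⟨F, hF⟩ := h.exists_fourier
  have ht₀ : T / 2 ∈ Ioo 0 T := ⟨by linarith, by linarith⟩
  have hr := measurable_riesz
  have hFm : ∀ j, Measurable (F j (T / 2)) := fun j => (hF j _ ht₀).1.measurable
  -- the Leray projection of the transform at time `T / 2` is a representative that is divergence free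
  -- at every frequency; Duhamel's formula turns it into one representative for all times
  let U₀ : Fin 3 → E3 → ℂ := fun j ξ => F j (T / 2) ξ - ∑ l, riesz j l ξ * F l (T / 2) ξ
  have hU₀m : ∀ j, Measurable (U₀ j) := fun j => by fun_prop
  have hU₀F : ∀ j, U₀ j =ᵐ[volume] F j (T / 2) := by
    intro j
    filter_upwards [h.sum_symb_mul_ae_eq_zero ht₀ fun j => (hF j _ ht₀).2] with ξ hξ
    have : ∑ l, (riesz j l ξ : ℂ) * F l (T / 2) ξ = 0 := by
      have e : ∀ l, (riesz j l ξ : ℂ) * F l (T / 2) ξ =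
          (ξ j / ‖ξ‖ ^ 2 / (2 * Real.pi * Complex.I) : ℂ) * (symb l ξ * F l (T / 2) ξ) := by
        intro l
        have h1 : (2 * Real.pi * Complex.I : ℂ) ≠ 0 := by simp [Real.pi_ne_zero]
        rw [riesz, symb]
        push_cast
        field_simp
      simp_rw [e]
      rw [← Finset.mul_sum, hξ, mul_zero]
    simp only [U₀]
    rw [this, sub_zero]
  have hU₀d : ∀ ξ, ∑ j, symb j ξ * U₀ j ξ = 0 := by
    intro ξ
    simp only [U₀, mul_sub, Finset.sum_sub_distrib, Finset.mul_sum]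
    rw [Finset.sum_comm (f := fun j l => symb j ξ * (riesz j l ξ * F l (T / 2) ξ)), sub_eq_zero]
    refine Finset.sum_congr rfl fun l _ => ?_
    simp_rw [← mul_assoc]
    rw [← Finset.sum_mul, sum_symb_mul_riesz]
  let U : Fin 3 → ℝ → E3 → ℂ := fun j => duhamel μ (T / 2) (U₀ j) (forcing T f j)
  have hUm : ∀ j t, Measurable (U j t) := fun j t =>
    measurable_duhamel (hU₀m j) (h.measurable_forcing j) t
  have hpair : ∀ j, ∀ t ∈ Ioo 0 T, IsFourierPair (f j t) (U j t) := fun j t ht =>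
    (hF j t ht).2.congr_right
      (h.ae_eq_duhamel hμ (fun j t ht => (hF j t ht).2) ht₀ hU₀m hU₀F j ht)
  have hbound : ∀ a b, 0 < a → b < T → ∃ M : ℝ≥0, ∀ t ∈ Icc a b, ∀ j,
      wnorm 4 (fun ξ => ‖U j t ξ‖ₑ) ≤ M := by
    intro a b ha hb
    obtain ⟨M, hM⟩ := h.bound a b ha hb
    refine ⟨8 * (M ^ 2 + ∑ _a : Fin 3, ∑ _b : Fin 3, M ^ 2), fun t ht j => ?_⟩
    have ht' : t ∈ Ioo 0 T := ⟨ha.trans_le ht.1, ht.2.trans_lt hb⟩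
    have hsm := h.contDiff ht' j
    refine (wnorm_four_le _ (hUm j t)).trans ?_
    push_cast
    gcongr with a _ b _
    · rw [← eLpNorm_two_sq, ← (hpair j t ht').eLpNorm_eq]
      gcongr
      exact (hM t ht j).1
    · have hb := ((hpair j t ht').pderiv (hsm.differentiable (by simp)) b (h.memLp_one t ht' j b)).pderiv
        ((contDiff_pderiv hsm b).differentiable (by simp)) a (h.memLp_two t ht' j a b)
      rw [← eLpNorm_two_sq, ← hb.eLpNorm_eq]
      gcongr
      exact (hM t ht j).2.2 a b
  have hw : ∀ j, ∀ t ∈ Ioo 0 T, wnorm 4 (fun ξ => ‖U j t ξ‖ₑ) < ⊤ := by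
    intro j t ht
    obtain ⟨M, hM⟩ := hbound t t ht.1 ht.2
    exact (hM t (left_mem_Icc.2 le_rfl) j).trans_lt ENNReal.coe_lt_top
  -- both sides are continuous, so equality almost everywhere is equality
  have hinv : ∀ j, ∀ t ∈ Ioo 0 T, f j t = 𝓕⁻ (U j t) := by
    intro j t ht
    have hi := integrable_of_wnorm (hUm j t) (hw j t ht)
    have hl := memLp_of_wnorm (hUm j t) (hw j t ht)
    exact Measure.eq_of_ae_eq ((hpair j t ht).ae_eq_left (IsFourierPair.fourierInv hi hl))
      (h.contDiff ht j).continuous (continuous_fourierInv hi)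
  have hconv : ∀ k l, ∀ t ∈ Ioo 0 T, ∀ ξ, cconv (U k t) (U l t) ξ = quadFourier f k l t ξ := by
    intro k l t ht ξ
    rw [quadFourier, hinv k t ht, hinv l t ht]
    exact (fourier_fourierInv_mul (integrable_of_wnorm (hUm k t) (hw k t ht))
      (memLp_of_wnorm (hUm k t) (hw k t ht)) (integrable_of_wnorm (hUm l t) (hw l t ht))
      (memLp_of_wnorm (hUm l t) (hw l t ht)) ξ).symm
  refine ⟨U, ⟨hUm, hbound, ?_, ?_, ?_⟩, hinv⟩
  · intro t ht ξ j
    simp_rw [hconv _ _ t ht]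
    rw [← forcing_eq ht]
    exact hasDerivAt_duhamel ht₀ (h.continuousOn_forcing j ξ) ht
  · intro k l
    exact (h.continuousOn_quadFourier k l).congr fun z hz => hconv k l z.1 hz.1 z.2
  · intro t ht ξ
    have hc : ∀ j, IntervalIntegrable (fun s => (Real.exp (damp μ ξ * (s - T / 2)) : ℂ) *
        forcing T f j s ξ) volume (T / 2) t := fun j =>
      ((ContinuousOn.mul (Continuous.continuousOn (by fun_prop))
        (h.continuousOn_forcing j ξ)).mono (uIcc_subset_Ioo_of_mem ht ht₀)).intervalIntegrable
    have e : ∑ j, symb j ξ * ∫ s in (T / 2)..t, (Real.exp (damp μ ξ * (s - T / 2)) : ℂ) *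
        forcing T f j s ξ = 0 := by
      simp_rw [← intervalIntegral.integral_const_mul]
      rw [← intervalIntegral.integral_finsetSum fun j _ => (hc j).const_mul _]
      have : ∀ s, ∑ j, symb j ξ * ((Real.exp (damp μ ξ * (s - T / 2)) : ℂ) * forcing T f j s ξ) = 0 := by
        intro s
        have e1 := sum_symb_mul_nonlin (fun k l => (Ioo 0 T ×ˢ univ).indicator
          (fun z : ℝ × E3 => quadFourier f k l z.1 z.2) (s, ξ)) ξ
        have e2 : ∀ j, symb j ξ * ((Real.exp (damp μ ξ * (s - T / 2)) : ℂ) * forcing T f j s ξ) =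
          (Real.exp (damp μ ξ * (s - T / 2)) : ℂ) * (symb j ξ * forcing T f j s ξ) := fun j => by ring
        simp_rw [e2]
        rw [← Finset.mul_sum]
        simp only [forcing]
        rw [e1, mul_zero]
      rw [intervalIntegral.integral_congr (g := fun _ => 0) fun s _ => this s,
        intervalIntegral.integral_zero]
    simp only [U, duhamel]
    have e3 : ∀ (c : ℂ) (A : Fin 3 → ℂ), ∑ j, symb j ξ * (c * (U₀ j ξ + A j)) =
        c * (∑ j, symb j ξ * U₀ j ξ + ∑ j, symb j ξ * A j) := by
      intro c A
      rw [← Finset.sum_add_distrib, Finset.mul_sum]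
      exact Finset.sum_congr rfl fun j _ => by ring
    rw [e3, hU₀d, e]; simp

end FlowData

/-! ### Parabolic smoothing -/

/-- The amplitude `∑_j |U_j|` at time `t`. -/
noncomputable def amp (U : Fin 3 → ℝ → E3 → ℂ) (t : ℝ) (ξ : E3) : ℝ≥0∞ := ∑ j, ‖U j t ξ‖ₑ

/-- The size of the quadratic term at time `t`, set to `0` outside `(0,T)`. -/
noncomputable def quadAmp (T : ℝ) (U : Fin 3 → ℝ → E3 → ℂ) (t : ℝ) (ξ : E3) : ℝ≥0∞ :=
  ∑ k, ∑ l, ‖(Ioo 0 T ×ˢ univ).indicator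
    (fun z : ℝ × E3 => cconv (U k z.1) (U l z.1) z.2) (t, ξ)‖ₑ

/-- The heat kernel `e^{-4π²μ|ξ|²r}` in frequency space. -/
noncomputable def heat (μ r : ℝ) (ξ : E3) : ℝ≥0∞ := ENNReal.ofReal (Real.exp (-damp μ ξ * r))

lemma measurable_heat (μ : ℝ) : Measurable (Function.uncurry (heat μ)) := by
  have := (continuous_damp μ).measurable
  unfold heat Function.uncurry
  fun_prop

/-- The smoothing rate `1 + (4π²μr)^{-1/2}` of the heat kernel. -/
noncomputable def smoothRate (μ r : ℝ) : ℝ≥0∞ :=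
  ENNReal.ofReal (1 + (Real.sqrt (4 * Real.pi ^ 2 * μ))⁻¹ * r ^ (-(1 / 2) : ℝ))

lemma heat_le_one {μ r : ℝ} (hμ : 0 ≤ μ) (hr : 0 ≤ r) (ξ : E3) : heat μ r ξ ≤ 1 := by
  rw [heat, ← ENNReal.ofReal_one]
  refine ENNReal.ofReal_le_ofReal (Real.exp_le_one_iff.2 ?_)
  have := mul_nonneg (damp_nonneg hμ ξ) hr
  linarith

lemma wt_mul_heat_le {μ r : ℝ} (hμ : 0 < μ) (hr : 0 < r) (ξ : E3) :
    wt ξ * heat μ r ξ ≤ smoothRate μ r := by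
  have hπ := Real.pi_pos
  rw [wt_eq_ofReal, heat, smoothRate, ← ENNReal.ofReal_mul (by positivity)]
  refine ENNReal.ofReal_le_ofReal ?_
  set c := 4 * Real.pi ^ 2 * μ with hc
  have hc0 : 0 < c := by positivity
  have e1 : r ^ (-(1 / 2) : ℝ) = (Real.sqrt r)⁻¹ := by
    rw [Real.rpow_neg hr.le, Real.sqrt_eq_rpow]
  have e2 : damp μ ξ * r = (‖ξ‖ * Real.sqrt c * Real.sqrt r) ^ 2 := by
    rw [mul_pow, mul_pow, Real.sq_sqrt hc0.le, Real.sq_sqrt hr.le, damp]; ring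
  set y := ‖ξ‖ * Real.sqrt c * Real.sqrt r with hy
  have hcs : 0 < Real.sqrt c := Real.sqrt_pos.2 hc0
  have hrs : 0 < Real.sqrt r := Real.sqrt_pos.2 hr
  have hx : ‖ξ‖ = (Real.sqrt c)⁻¹ * (Real.sqrt r)⁻¹ * y := by rw [hy]; field_simp
  rw [e1, neg_mul, e2]
  have h1 : Real.exp (-y ^ 2) ≤ 1 := Real.exp_le_one_iff.2 (by nlinarith [sq_nonneg y])
  have h2 : y * Real.exp (-y ^ 2) ≤ 1 := by
    rw [Real.exp_neg, ← div_eq_mul_inv, div_le_one (Real.exp_pos _)]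
    nlinarith [Real.add_one_le_exp (y ^ 2), sq_nonneg (y - 1)]
  have h3 : 0 ≤ (Real.sqrt c)⁻¹ * (Real.sqrt r)⁻¹ := by positivity
  calc (1 + ‖ξ‖) * Real.exp (-y ^ 2)
      = Real.exp (-y ^ 2) + (Real.sqrt c)⁻¹ * (Real.sqrt r)⁻¹ * (y * Real.exp (-y ^ 2)) := by
        rw [hx]; ring
    _ ≤ 1 + (Real.sqrt c)⁻¹ * (Real.sqrt r)⁻¹ * 1 := by gcongr
    _ = _ := by ring

lemma lintegral_smoothRate_lt_top (μ T : ℝ) : ∫⁻ r in Ioc 0 T, smoothRate μ r < ⊤ := by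
  rcases le_total T 0 with h | h
  · simp [Ioc_eq_empty (not_lt.2 h)]
  have h1 : IntegrableOn (fun r : ℝ => r ^ (-(1 / 2) : ℝ)) (Ioc 0 T) volume :=
    (intervalIntegrable_iff_integrableOn_Ioc_of_le h).1
      (intervalIntegral.intervalIntegrable_rpow' (by norm_num))
  have h2 : IntegrableOn (fun r : ℝ => 1 + (Real.sqrt (4 * Real.pi ^ 2 * μ))⁻¹ * r ^ (-(1 / 2) : ℝ))
      (Ioc 0 T) volume := (integrableOn_const (by simp)).add (h1.const_mul _)
  refine lt_of_le_of_lt (lintegral_mono fun r => ?_) h2.2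
  exact Real.ofReal_le_enorm _

lemma lintegral_smoothRate_sub_le {μ T a t : ℝ} (ha : 0 ≤ a) (ht : t ≤ T) :
    ∫⁻ τ in Ioo a t, smoothRate μ (t - τ) ≤ ∫⁻ r in Ioc 0 T, smoothRate μ r := by
  rw [← lintegral_indicator measurableSet_Ioo, ← lintegral_indicator measurableSet_Ioc,
    ← lintegral_sub_left_eq_self _ t]
  refine lintegral_mono fun r => ?_
  by_cases h : t - r ∈ Ioo a t
  · have h' : r ∈ Ioc 0 T := ⟨by linarith [h.2], by linarith [h.1]⟩
    rw [indicator_of_mem h, indicator_of_mem h', sub_sub_cancel]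
  · rw [indicator_of_notMem h]; exact bot_le

/-- The time integral of the heat kernel gains two derivatives. -/
lemma enorm_sq_mul_lintegral_heat_le {μ a t : ℝ} (hμ : 0 < μ) (ξ : E3) :
    ‖ξ‖ₑ ^ 2 * ∫⁻ τ in Ioo a t, heat μ (t - τ) ξ ≤ ENNReal.ofReal (1 / (4 * Real.pi ^ 2 * μ)) := by
  have hπ := Real.pi_pos
  rcases eq_or_ne ξ 0 with rfl | h
  · simp
  rcases le_total t a with hta | hat
  · simp [Ioo_eq_empty (not_lt.2 hta)]
  have hn := norm_pos_iff.2 h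
  have hd : 0 < damp μ ξ := by unfold damp; positivity
  have hder : ∀ τ, HasDerivAt (fun τ => Real.exp (-damp μ ξ * (t - τ)) / damp μ ξ)
      (Real.exp (-damp μ ξ * (t - τ))) τ := by
    intro τ
    have h1 : HasDerivAt (fun τ => -damp μ ξ * (t - τ)) (damp μ ξ) τ := by
      simpa using ((hasDerivAt_id τ).const_sub t).const_mul (-damp μ ξ)
    refine (h1.exp.div_const _).congr_deriv ?_
    field_simp
  have hcont : Continuous fun τ => Real.exp (-damp μ ξ * (t - τ)) := by fun_prop
  have hi : ∫ τ in a..t, Real.exp (-damp μ ξ * (t - τ)) ≤ 1 / damp μ ξ := by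
    rw [intervalIntegral.integral_eq_sub_of_hasDerivAt (fun τ _ => hder τ)
      (hcont.intervalIntegrable _ _)]
    have := Real.exp_pos (-damp μ ξ * (t - a))
    rw [sub_self, mul_zero, Real.exp_zero]
    have : 0 ≤ Real.exp (-damp μ ξ * (t - a)) / damp μ ξ := by positivity
    linarith
  have h2 : ∫⁻ τ in Ioo a t, heat μ (t - τ) ξ ≤ ENNReal.ofReal (1 / damp μ ξ) := by
    rw [intervalIntegral.integral_of_le hat, integral_Ioc_eq_integral_Ioo] at hi
    unfold heat
    rw [← ofReal_integral_eq_lintegral_ofReal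
      (hcont.integrableOn_Icc.mono_set Ioo_subset_Icc_self)
      (ae_of_all _ fun _ => (Real.exp_pos _).le)]
    exact ENNReal.ofReal_le_ofReal hi
  calc ‖ξ‖ₑ ^ 2 * ∫⁻ τ in Ioo a t, heat μ (t - τ) ξ
      ≤ ‖ξ‖ₑ ^ 2 * ENNReal.ofReal (1 / damp μ ξ) := by gcongr
    _ = _ := by
      rw [← ofReal_norm, ← ENNReal.ofReal_pow hn.le, ← ENNReal.ofReal_mul (by positivity)]
      congr 1
      unfold damp
      field_simp

lemma lconv_amp (U : Fin 3 → ℝ → E3 → ℂ) (hU : ∀ j t, Measurable (U j t)) (t : ℝ) (ξ : E3) :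
    lconv (amp U t) (amp U t) ξ = ∑ k, ∑ l, ∫⁻ η, ‖U k t η‖ₑ * ‖U l t (ξ - η)‖ₑ := by
  unfold lconv amp
  simp_rw [Finset.sum_mul_sum]
  rw [lintegral_finsetSum _ fun k _ => by fun_prop]
  exact Finset.sum_congr rfl fun k _ => lintegral_finsetSum _ fun l _ => by fun_prop

lemma sum_enorm_cconv_le (U : Fin 3 → ℝ → E3 → ℂ) (hU : ∀ j t, Measurable (U j t)) (t : ℝ)
    (ξ : E3) : ∑ k, ∑ l, ‖cconv (U k t) (U l t) ξ‖ₑ ≤ lconv (amp U t) (amp U t) ξ := by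
  rw [lconv_amp U hU]
  refine Finset.sum_le_sum fun k _ => Finset.sum_le_sum fun l _ => ?_
  refine (enorm_integral_le_lintegral_enorm _).trans_eq ?_
  simp_rw [enorm_mul]

lemma quadAmp_le (T : ℝ) (U : Fin 3 → ℝ → E3 → ℂ) (hU : ∀ j t, Measurable (U j t)) (t : ℝ)
    (ξ : E3) : quadAmp T U t ξ ≤ lconv (amp U t) (amp U t) ξ := by
  refine le_trans ?_ (sum_enorm_cconv_le U hU t ξ)
  unfold quadAmp
  refine Finset.sum_le_sum fun k _ => Finset.sum_le_sum fun l _ => ?_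
  exact enorm_indicator_le_enorm_self _ _

lemma quadAmp_eq {T : ℝ} (U : Fin 3 → ℝ → E3 → ℂ) {t : ℝ} (ht : t ∈ Ioo 0 T) (ξ : E3) :
    quadAmp T U t ξ = ∑ k, ∑ l, ‖cconv (U k t) (U l t) ξ‖ₑ := by
  unfold quadAmp
  simp_rw [indicator_of_mem (show (t, ξ) ∈ Ioo 0 T ×ˢ univ from ⟨ht, mem_univ _⟩)]

lemma measurable_amp {U : Fin 3 → ℝ → E3 → ℂ} (hU : ∀ j t, Measurable (U j t)) (t : ℝ) :
    Measurable (amp U t) := by unfold amp; fun_prop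

lemma wnorm_amp_le {U : Fin 3 → ℝ → E3 → ℂ} (hU : ∀ j t, Measurable (U j t)) {t : ℝ} {k : ℕ}
    {M : ℝ≥0∞} (hM : ∀ j, wnorm k (fun ξ => ‖U j t ξ‖ₑ) ≤ M) : wnorm k (amp U t) ≤ 12 * M := by
  have e : amp U t = fun ξ => ‖U 0 t ξ‖ₑ + (‖U 1 t ξ‖ₑ + ‖U 2 t ξ‖ₑ) := by
    ext ξ; simp [amp, Fin.sum_univ_three, add_assoc]
  rw [e]
  have i1 := wnorm_add_le (k := k) (f := fun ξ => ‖U 0 t ξ‖ₑ)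
    (g := fun ξ => ‖U 1 t ξ‖ₑ + ‖U 2 t ξ‖ₑ) (by fun_prop)
  have i2 := wnorm_add_le (k := k) (f := fun ξ => ‖U 1 t ξ‖ₑ)
    (g := fun ξ => ‖U 2 t ξ‖ₑ) (by fun_prop)
  calc _ ≤ _ := i1
    _ ≤ 2 * (M + 2 * (M + M)) := by
        gcongr
        · exact hM 0
        · exact i2.trans (by gcongr; exacts [hM 1, hM 2])
    _ ≤ 2 * (2 * M + 2 * (M + M)) := by
        gcongr
        exact le_mul_of_one_le_left bot_le one_le_two
    _ = _ := by ring

lemma enorm_nonlin_le (N : Fin 3 → Fin 3 → ℂ) (j : Fin 3) (ξ : E3) :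
    ‖nonlin N j ξ‖ₑ ≤ ENNReal.ofReal (4 * Real.pi) * ‖ξ‖ₑ * ∑ k, ∑ l, ‖N k l‖ₑ := by
  have h := ENNReal.ofReal_le_ofReal (norm_nonlin_le N j ξ)
  rw [ofReal_norm] at h
  refine h.trans_eq ?_
  rw [ENNReal.ofReal_mul (by positivity), ENNReal.ofReal_mul (by positivity), ofReal_norm,
    ENNReal.ofReal_sum_of_nonneg fun _ _ => by positivity]
  simp_rw [ENNReal.ofReal_sum_of_nonneg fun _ _ => norm_nonneg _, ofReal_norm]

lemma wnorm_lconv_self_le {k : ℕ} (hk : 4 ≤ k) {f : E3 → ℝ≥0∞} (hf : Measurable f) {M : ℝ≥0∞}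
    (h : wnorm k f ≤ M) : wnorm k (lconv f f) ≤ 2 * 2 ^ k * (2 * (M * (wtConst * M))) := by
  refine (wnorm_lconv_le k hf hf).trans ?_
  rw [← two_mul]
  gcongr
  exact (sq_lintegral_le hf).trans (by gcongr; exact (wnorm_mono_left hk f).trans h)

attribute [irreducible] quadAmp heat

namespace FourierFlow

variable {μ T : ℝ} {U : Fin 3 → ℝ → E3 → ℂ}

lemma measurable_quadAmp (h : FourierFlow μ T U) : Measurable (Function.uncurry (quadAmp T U)) := by
  have hN : ∀ k l, Measurable ((Ioo 0 T ×ˢ univ).indicator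
      (fun z : ℝ × E3 => cconv (U k z.1) (U l z.1) z.2)) := fun k l => by
    have := (h.continuousOn_conv k l).measurable_piecewise (g := fun _ => 0)
      continuousOn_const (measurableSet_Ioo.prod MeasurableSet.univ)
    rw [← piecewise_eq_indicator]
    exact this
  unfold quadAmp Function.uncurry
  fun_prop

lemma continuousOn_nonlin (h : FourierFlow μ T U) (j : Fin 3) (ξ : E3) :
    ContinuousOn (fun t => nonlin (fun k l => cconv (U k t) (U l t) ξ) j ξ) (Ioo 0 T) := by
  have hN : ∀ k l, ContinuousOn (fun s => cconv (U k s) (U l s) ξ) (Ioo 0 T) := fun k l =>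
    (h.continuousOn_conv k l).comp (f := fun s : ℝ => (s, ξ)) (by fun_prop)
      fun s hs => ⟨hs, mem_univ _⟩
  unfold nonlin
  fun_prop

lemma duhamel_eq (h : FourierFlow μ T U) {a t : ℝ} (ha : a ∈ Ioo 0 T) (ht : t ∈ Ioo 0 T)
    (j : Fin 3) (ξ : E3) :
    U j t ξ = Real.exp (-damp μ ξ * (t - a)) * U j a ξ + ∫ τ in a..t,
      Real.exp (-damp μ ξ * (t - τ)) * nonlin (fun k l => cconv (U k τ) (U l τ) ξ) j ξ := by
  have hder : ∀ τ ∈ uIcc a t, HasDerivAt (fun τ => (Real.exp (-damp μ ξ * (t - τ)) : ℂ) * U j τ ξ)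
      (Real.exp (-damp μ ξ * (t - τ)) * nonlin (fun k l => cconv (U k τ) (U l τ) ξ) j ξ) τ := by
    intro τ hτ
    have h1 : HasDerivAt (fun τ => -damp μ ξ * (t - τ)) (damp μ ξ) τ := by
      simpa using ((hasDerivAt_id τ).const_sub t).const_mul (-damp μ ξ)
    refine (h1.exp.ofReal_comp.mul (h.hasDerivAt τ (uIcc_subset_Ioo_of_mem ht ha hτ) ξ j)).congr_deriv ?_
    push_cast; ring
  rw [intervalIntegral.integral_eq_sub_of_hasDerivAt hder]
  · simp
  · exact ((ContinuousOn.mul (Continuous.continuousOn (by fun_prop))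
      (h.continuousOn_nonlin j ξ)).mono (uIcc_subset_Ioo_of_mem ht ha)).intervalIntegrable

lemma enorm_le (h : FourierFlow μ T U) {a t : ℝ} (ha : 0 < a) (hat : a ≤ t) (ht : t < T)
    (j : Fin 3) (ξ : E3) :
    ‖U j t ξ‖ₑ ≤ heat μ (t - a) ξ * ‖U j a ξ‖ₑ + ENNReal.ofReal (4 * Real.pi) * ‖ξ‖ₑ *
      ∫⁻ τ in Ioo a t, heat μ (t - τ) ξ * quadAmp T U τ ξ := by
  rw [h.duhamel_eq ⟨ha, hat.trans_lt ht⟩ ⟨ha.trans_le hat, ht⟩ j ξ]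
  have he : ∀ r, ‖((Real.exp (-damp μ ξ * r) : ℝ) : ℂ)‖ₑ = heat μ r ξ := fun r => by
    rw [← ofReal_norm, Complex.norm_real, Real.norm_of_nonneg (Real.exp_pos _).le, heat]
  refine (enorm_add_le _ _).trans (add_le_add ?_ ?_)
  · rw [enorm_mul, he]
  · rw [intervalIntegral.integral_of_le hat, integral_Ioc_eq_integral_Ioo,
      ← lintegral_const_mul' _ _ (by finiteness)]
    refine (enorm_integral_le_lintegral_enorm _).trans (setLIntegral_mono' measurableSet_Ioo
      fun τ hτ => ?_)
    rw [enorm_mul, he, quadAmp_eq U ⟨ha.trans hτ.1, hτ.2.trans ht⟩]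
    calc _ ≤ heat μ (t - τ) ξ * (ENNReal.ofReal (4 * Real.pi) * ‖ξ‖ₑ *
          ∑ k, ∑ l, ‖cconv (U k τ) (U l τ) ξ‖ₑ) := by gcongr; exact enorm_nonlin_le _ j ξ
      _ = _ := by ring

lemma amp_le (h : FourierFlow μ T U) {a t : ℝ} (ha : 0 < a) (hat : a ≤ t) (ht : t < T) (ξ : E3) :
    amp U t ξ ≤ heat μ (t - a) ξ * amp U a ξ + ENNReal.ofReal (12 * Real.pi) * (‖ξ‖ₑ *
      ∫⁻ τ in Ioo a t, heat μ (t - τ) ξ * quadAmp T U τ ξ) := by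
  refine (Finset.sum_le_sum fun j _ => h.enorm_le ha hat ht j ξ).trans_eq ?_
  rw [Finset.sum_add_distrib, ← Finset.mul_sum, Finset.sum_const, Finset.card_univ, Fintype.card_fin,
    show (12 * Real.pi) = (3 : ℝ) * (4 * Real.pi) by ring, ENNReal.ofReal_mul (by norm_num)]
  simp [amp]; ring

/-- Half a derivative is gained under the heat flow. -/
lemma wnorm_heat_mul_le (hμ : 0 < μ) {k : ℕ} {f : E3 → ℝ≥0∞} {r r' : ℝ} (hr : 0 < r) (hrr' : r ≤ r') :
    wnorm (k + 1) (fun ξ => heat μ r' ξ * f ξ) ≤ smoothRate μ r * wnorm k f := by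
  have hsr : smoothRate μ r < ⊤ := ENNReal.ofReal_lt_top
  refine le_trans (lintegral_mono fun ξ => ?_) (lintegral_const_mul' _ _ hsr.ne).le
  have h1 : heat μ r' ξ ≤ heat μ r ξ := by
    rw [heat, heat]
    refine ENNReal.ofReal_le_ofReal (Real.exp_le_exp.2 ?_)
    have := damp_nonneg hμ.le ξ
    nlinarith
  calc wt ξ ^ (k + 1) * (heat μ r' ξ * f ξ) ^ 2
      = (wt ξ * heat μ r' ξ) * heat μ r' ξ * (wt ξ ^ k * f ξ ^ 2) := by ring
    _ ≤ (wt ξ * heat μ r ξ) * 1 * (wt ξ ^ k * f ξ ^ 2) := by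
        gcongr
        exact heat_le_one hμ.le (hr.le.trans hrr') ξ
    _ ≤ _ := by
        rw [mul_one]
        gcongr
        exact wt_mul_heat_le hμ hr ξ

/-- The Duhamel integral gains half a derivative over its forcing. -/
lemma wnorm_integral_heat_mul_le (h : FourierFlow μ T U) (hμ : 0 < μ) {k : ℕ} {a t : ℝ}
    (ha : 0 < a) (ht : t < T) {Q : ℝ≥0∞} (hQt : Q ≠ ⊤)
    (hQ : ∀ τ ∈ Ioo a T, wnorm k (quadAmp T U τ) ≤ Q) :
    wnorm (k + 1) (fun ξ => ‖ξ‖ₑ * ∫⁻ τ in Ioo a t, heat μ (t - τ) ξ * quadAmp T U τ ξ) ≤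
      ENNReal.ofReal (1 / (4 * Real.pi ^ 2 * μ)) * ((∫⁻ r in Ioc 0 T, smoothRate μ r) * Q) := by
  have hpt : ∀ ξ, wt ξ ^ (k + 1) *
      (‖ξ‖ₑ * ∫⁻ τ in Ioo a t, heat μ (t - τ) ξ * quadAmp T U τ ξ) ^ 2 ≤
      ENNReal.ofReal (1 / (4 * Real.pi ^ 2 * μ)) *
        ∫⁻ τ in Ioo a t, smoothRate μ (t - τ) * (wt ξ ^ k * quadAmp T U τ ξ ^ 2) := by
    intro ξ
    have hf : Measurable fun τ => quadAmp T U τ ξ := Measurable.of_uncurry_right h.measurable_quadAmp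
    have hg : Measurable fun τ => heat μ (t - τ) ξ := by unfold heat; fun_prop
    -- Cauchy–Schwarz in time: one factor `∫ heat` absorbs `|ξ|²`, the other gains one power of the
    -- weight through `wt_mul_heat_le`
    have h1 := ENNReal.sq_lintegral_mul_le' (ν := volume.restrict (Ioo a t)) hf hg
    simp_rw [mul_comm (heat _ _ _)]
    calc _ ≤ wt ξ ^ (k + 1) * (‖ξ‖ₑ ^ 2 * ((∫⁻ τ in Ioo a t, heat μ (t - τ) ξ) *
          ∫⁻ τ in Ioo a t, quadAmp T U τ ξ ^ 2 * heat μ (t - τ) ξ)) := by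
          rw [mul_pow]; gcongr
      _ = (‖ξ‖ₑ ^ 2 * ∫⁻ τ in Ioo a t, heat μ (t - τ) ξ) *
          (wt ξ ^ (k + 1) * ∫⁻ τ in Ioo a t, quadAmp T U τ ξ ^ 2 * heat μ (t - τ) ξ) := by ring
      _ ≤ _ := by
          rw [← lintegral_const_mul' _ _ (ENNReal.pow_ne_top (wt_ne_top ξ))]
          refine mul_le_mul' (enorm_sq_mul_lintegral_heat_le hμ ξ)
            (setLIntegral_mono' measurableSet_Ioo fun τ hτ => ?_)
          calc _ = (wt ξ * heat μ (t - τ) ξ) * (wt ξ ^ k * quadAmp T U τ ξ ^ 2) := by ring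
            _ ≤ _ := by gcongr; exact wt_mul_heat_le hμ (sub_pos.2 hτ.2) ξ
  refine (lintegral_mono hpt).trans ?_
  rw [lintegral_const_mul' _ _ (by finiteness)]
  gcongr
  have hsm : Measurable (smoothRate μ) := by unfold smoothRate; fun_prop
  have hmeas : Measurable (Function.uncurry fun (ξ : E3) (τ : ℝ) =>
      smoothRate μ (t - τ) * (wt ξ ^ k * quadAmp T U τ ξ ^ 2)) := by
    have h1 : Measurable fun p : E3 × ℝ => quadAmp T U p.2 p.1 :=
      h.measurable_quadAmp.comp measurable_swap
    unfold Function.uncurry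
    exact (hsm.comp (by fun_prop)).mul (((measurable_wt.comp measurable_fst).pow_const k).mul
      (h1.pow_const 2))
  rw [lintegral_lintegral_swap hmeas.aemeasurable]
  calc _ ≤ ∫⁻ τ in Ioo a t, smoothRate μ (t - τ) * Q := by
        refine setLIntegral_mono' measurableSet_Ioo fun τ hτ => ?_
        have hne : smoothRate μ (t - τ) ≠ ⊤ := ENNReal.ofReal_ne_top
        rw [lintegral_const_mul' _ _ hne]
        gcongr
        exact hQ τ ⟨hτ.1, hτ.2.trans ht⟩
    _ ≤ _ := by
        rw [lintegral_mul_const' _ _ hQt]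
        exact mul_le_mul' (lintegral_smoothRate_sub_le ha.le ht.le) le_rfl

/-- Each step of the smoothing iteration gains half a derivative. -/
lemma exists_wnorm_succ_le (h : FourierFlow μ T U) (hμ : 0 < μ) {k : ℕ} (hk : 4 ≤ k) {a a' : ℝ}
    (ha : 0 < a) (haa' : a < a') {M : ℝ≥0} (hM : ∀ t ∈ Ico a T, wnorm k (amp U t) ≤ M) :
    ∃ M' : ℝ≥0, ∀ t ∈ Ico a' T, wnorm (k + 1) (amp U t) ≤ M' := by
  obtain ⟨Q, hQ⟩ : ∃ Q : ℝ≥0, (Q : ℝ≥0∞) = 2 * 2 ^ k * (2 * (M * (wtConst * M))) :=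
    ⟨_, ENNReal.coe_toNNReal (by have := wtConst_ne_top; finiteness)⟩
  obtain ⟨S, hS⟩ : ∃ S : ℝ≥0, (S : ℝ≥0∞) = ∫⁻ r in Ioc 0 T, smoothRate μ r :=
    ⟨_, ENNReal.coe_toNNReal (lintegral_smoothRate_lt_top μ T).ne⟩
  obtain ⟨r, hr⟩ : ∃ r : ℝ≥0, (r : ℝ≥0∞) = smoothRate μ (a' - a) :=
    ⟨_, ENNReal.coe_toNNReal ENNReal.ofReal_ne_top⟩
  have hmA := measurable_amp h.measurable
  have hQb : ∀ τ ∈ Ioo a T, wnorm k (quadAmp T U τ) ≤ Q := fun τ hτ => by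
    rw [hQ]
    exact (wnorm_mono (quadAmp_le T U h.measurable τ)).trans
      (wnorm_lconv_self_le hk (hmA τ) (hM τ (Ioo_subset_Ico_self hτ)))
  refine ⟨2 * (r * M + (12 * Real.pi).toNNReal ^ 2 *
    ((1 / (4 * Real.pi ^ 2 * μ)).toNNReal * (S * Q))), fun t ht => ?_⟩
  have hat : a < t := haa'.trans_le ht.1
  have hm1 : Measurable fun ξ => heat μ (t - a) ξ * amp U a ξ :=
    (Measurable.of_uncurry_left (measurable_heat μ)).mul (hmA a)
  calc wnorm (k + 1) (amp U t) ≤ wnorm (k + 1) (fun ξ => heat μ (t - a) ξ * amp U a ξ +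
        ENNReal.ofReal (12 * Real.pi) *
          (‖ξ‖ₑ * ∫⁻ τ in Ioo a t, heat μ (t - τ) ξ * quadAmp T U τ ξ)) :=
        wnorm_mono fun ξ => h.amp_le ha hat.le ht.2 ξ
    _ ≤ _ := wnorm_add_le hm1
    _ ≤ _ := by
        rw [wnorm_const_mul (by finiteness)]
        push_cast
        rw [hS, hr]
        gcongr
        · exact (wnorm_heat_mul_le (r := a' - a) hμ (by linarith) (by linarith [ht.1])).trans
            (mul_le_mul' le_rfl (hM a ⟨le_rfl, hat.trans ht.2⟩))
        · exact le_rfl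
        · exact h.wnorm_integral_heat_mul_le hμ ha ht.2 (by simp) hQb

/-- If the `H²`-type norm stays bounded up to time `T`, so do all weighted norms. -/
lemma exists_wnorm_le (h : FourierFlow μ T U) (hμ : 0 < μ)
    (hM : ∀ a, 0 < a → ∃ M : ℝ≥0, ∀ t ∈ Ico a T, wnorm 4 (amp U t) ≤ M) (k : ℕ) {a : ℝ}
    (ha : 0 < a) : ∃ M : ℝ≥0, ∀ t ∈ Ico a T, wnorm k (amp U t) ≤ M := by
  have key : ∀ n : ℕ, ∀ a, 0 < a → ∃ M : ℝ≥0, ∀ t ∈ Ico a T, wnorm (4 + n) (amp U t) ≤ M := by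
    intro n
    induction n with
    | zero => exact hM
    | succ n ih =>
      intro a ha
      obtain ⟨M, hM⟩ := ih (a / 2) (by positivity)
      exact h.exists_wnorm_succ_le hμ (Nat.le_add_right 4 n) (by positivity) (half_lt_self ha) hM
  obtain ⟨M, hM⟩ := key k a ha
  exact ⟨M, fun t ht => (wnorm_mono_left (by omega) _).trans (hM t ht)⟩

end FourierFlow

/-- A solution of the Navier–Stokes equations in frequency space on a closed time interval, with a
rapidly decaying bound that is uniform in time. -/
structure ClosedFlow (μ a b : ℝ) (V : Fin 3 → ℝ → E3 → ℂ) : Prop where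
  measurable : ∀ j t, Measurable (V j t)
  envelope : ∃ E, RapidEnvelope E ∧ ∀ t ∈ Icc a b, ∀ j ξ, ‖V j t ξ‖ ≤ E ξ
  hasDeriv : ∀ t ∈ Icc a b, ∀ ξ j, HasDerivWithinAt (fun t => V j t ξ)
    (-damp μ ξ * V j t ξ + nonlin (fun k l => cconv (V k t) (V l t) ξ) j ξ) (Icc a b) t
  div_free : ∀ t ∈ Icc a b, ∀ ξ, ∑ j, symb j ξ * V j t ξ = 0

lemma ClosedFlow.mono {μ a b a' b' : ℝ} {V : Fin 3 → ℝ → E3 → ℂ} (h : ClosedFlow μ a b V)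
    (hs : Icc a' b' ⊆ Icc a b) : ClosedFlow μ a' b' V where
  measurable := h.measurable
  envelope := by
    obtain ⟨E, hE, hb⟩ := h.envelope
    exact ⟨E, hE, fun t ht => hb t (hs ht)⟩
  hasDeriv t ht ξ j := (h.hasDeriv t (hs ht) ξ j).mono hs
  div_free t ht := h.div_free t (hs ht)

lemma ClosedFlow.congr {μ a b : ℝ} {V W : Fin 3 → ℝ → E3 → ℂ} (h : ClosedFlow μ a b V)
    (hW : ∀ j t, Measurable (W j t)) (hVW : ∀ j, ∀ t ∈ Icc a b, W j t = V j t) :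
    ClosedFlow μ a b W where
  measurable := hW
  envelope := by
    obtain ⟨E, hE, hb⟩ := h.envelope
    exact ⟨E, hE, fun t ht j ξ => by rw [hVW j t ht]; exact hb t ht j ξ⟩
  hasDeriv t ht ξ j := by
    simp_rw [hVW _ t ht]
    exact (h.hasDeriv t ht ξ j).congr (fun s hs => by rw [hVW j s hs]) (by rw [hVW j t ht])
  div_free t ht ξ := by simp_rw [hVW _ t ht]; exact h.div_free t ht ξ

namespace FourierFlow

variable {μ T : ℝ} {U : Fin 3 → ℝ → E3 → ℂ}

lemma quadAmp_le_of_wnorm (h : FourierFlow μ T U) {t : ℝ} {M : ℝ≥0∞}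
    (hM : wnorm 0 (amp U t) ≤ M) (ξ : E3) : quadAmp T U t ξ ≤ M := by
  refine (quadAmp_le T U h.measurable t ξ).trans ?_
  have hm := measurable_amp h.measurable t
  have h1 := (lconv_sq_le hm hm ξ).trans (mul_le_mul' hM hM)
  rw [← sq] at h1
  exact (ENNReal.pow_le_pow_left_iff two_ne_zero).1 h1

/-- One rapidly decaying function dominates the flow at all times of `[a,T)`: the initial amplitude
plus the time integral of the quadratic term, from Duhamel's formula. -/
lemma exists_envelope (h : FourierFlow μ T U) (hμ : 0 < μ)
    (hM : ∀ a, 0 < a → ∃ M : ℝ≥0, ∀ t ∈ Ico a T, wnorm 4 (amp U t) ≤ M) {a : ℝ}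
    (ha : 0 < a) (haT : a < T) :
    ∃ E, RapidEnvelope E ∧ ∀ t ∈ Ico a T, ∀ j ξ, ‖U j t ξ‖ ≤ E ξ := by
  have hMk := fun k => h.exists_wnorm_le hμ hM k ha
  choose M hMk using hMk
  set c := ENNReal.ofReal (12 * Real.pi) with hc
  -- the heat factors in Duhamel's formula are at most `1`
  let G : E3 → ℝ≥0∞ := fun ξ => ∫⁻ τ in Ioo a T, quadAmp T U τ ξ
  have hGm : Measurable G := by
    refine Measurable.lintegral_prod_right' (f := fun p : E3 × ℝ => quadAmp T U p.2 p.1) ?_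
    exact h.measurable_quadAmp.comp measurable_swap
  have hAm := measurable_amp h.measurable a
  have hvol : volume (Ioo a T) ≠ ⊤ := by simp
  have hGfin : ∀ ξ, G ξ ≠ ⊤ := by
    intro ξ
    have : G ξ ≤ M 0 * volume (Ioo a T) := by
      rw [← setLIntegral_const]
      exact setLIntegral_mono' measurableSet_Ioo fun τ hτ =>
        h.quadAmp_le_of_wnorm (hMk 0 τ (Ioo_subset_Ico_self hτ)) ξ
    exact (this.trans_lt (by finiteness)).ne
  let e : E3 → ℝ≥0∞ := fun ξ => amp U a ξ + c * (‖ξ‖ₑ * G ξ)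
  have hefin : ∀ ξ, e ξ ≠ ⊤ := by
    intro ξ
    have h1 : amp U a ξ ≠ ⊤ := by simp [amp]
    have h2 := hGfin ξ
    simp only [e]
    finiteness
  have hem : Measurable e := by fun_prop
  refine ⟨fun ξ => (e ξ).toReal, ⟨hem.ennreal_toReal, fun _ => ENNReal.toReal_nonneg, fun k => ?_⟩,
    fun t ht j ξ => ?_⟩
  · simp_rw [ENNReal.ofReal_toReal (hefin _)]
    have hGk : wnorm k (fun ξ => ‖ξ‖ₑ * G ξ) < ⊤ := by
      set Q : ℝ≥0∞ := 2 * 2 ^ (k + 6) * (2 * (M (k + 6) * (wtConst * M (k + 6)))) with hQ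
      have hQt : Q ≠ ⊤ := by have := wtConst_ne_top; finiteness
      have hpt : ∀ ξ, wt ξ ^ k * (‖ξ‖ₑ * G ξ) ^ 2 ≤
          volume (Ioo a T) * ∫⁻ τ in Ioo a T, wt ξ ^ (k + 6) * quadAmp T U τ ξ ^ 2 := by
        intro ξ
        have h1 := ENNReal.sq_lintegral_mul_le (ν := volume.restrict (Ioo a T)) (f := fun _ => 1)
          (g := fun τ => quadAmp T U τ ξ) measurable_const.aemeasurable
          (Measurable.of_uncurry_right h.measurable_quadAmp).aemeasurable
        simp only [one_mul, one_pow, lintegral_const, Measure.restrict_apply MeasurableSet.univ,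
          univ_inter] at h1
        rw [lintegral_const_mul' _ _ (ENNReal.pow_ne_top (wt_ne_top ξ))]
        calc wt ξ ^ k * (‖ξ‖ₑ * G ξ) ^ 2 = (wt ξ ^ k * ‖ξ‖ₑ ^ 2) * G ξ ^ 2 := by ring
          _ ≤ wt ξ ^ (k + 6) *
            (volume (Ioo a T) * ∫⁻ τ in Ioo a T, quadAmp T U τ ξ ^ 2) := by
              gcongr
              calc wt ξ ^ k * ‖ξ‖ₑ ^ 2 ≤ wt ξ ^ k * wt ξ ^ 6 := by
                    refine mul_le_mul' le_rfl ?_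
                    exact (pow_le_pow_left' (enorm_le_wt ξ) 2).trans
                      (pow_le_pow_right₀ (one_le_wt ξ) (show 2 ≤ 6 by norm_num))
                _ = _ := by ring
          _ = _ := by ring
      refine (lintegral_mono hpt).trans_lt ?_
      rw [lintegral_const_mul' _ _ hvol]
      have hmeas : Measurable (Function.uncurry fun (ξ : E3) (τ : ℝ) =>
          wt ξ ^ (k + 6) * quadAmp T U τ ξ ^ 2) := by
        have h1 : Measurable fun p : E3 × ℝ => quadAmp T U p.2 p.1 :=
          h.measurable_quadAmp.comp measurable_swap
        exact ((measurable_wt.comp measurable_fst).pow_const _).mul (h1.pow_const 2)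
      rw [lintegral_lintegral_swap hmeas.aemeasurable]
      have h2 : ∫⁻ τ in Ioo a T, ∫⁻ ξ, wt ξ ^ (k + 6) * quadAmp T U τ ξ ^ 2 ≤
          Q * volume (Ioo a T) := by
        rw [← setLIntegral_const]
        refine setLIntegral_mono' measurableSet_Ioo fun τ hτ => ?_
        exact (wnorm_mono (quadAmp_le T U h.measurable τ)).trans
          (wnorm_lconv_self_le (by omega) (measurable_amp h.measurable τ)
            (hMk (k + 6) τ (Ioo_subset_Ico_self hτ)))
      exact (mul_le_mul' le_rfl h2).trans_lt (by finiteness)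
    have hA : wnorm k (amp U a) < ⊤ := (hMk k a ⟨le_rfl, haT⟩).trans_lt ENNReal.coe_lt_top
    refine (wnorm_add_le hAm).trans_lt ?_
    rw [wnorm_const_mul (by finiteness)]
    finiteness
  · have h1 : ‖U j t ξ‖ₑ ≤ e ξ := by
      refine (Finset.single_le_sum (f := fun j => ‖U j t ξ‖ₑ) (fun _ _ => bot_le)
        (Finset.mem_univ j)).trans ((h.amp_le ha ht.1 ht.2 ξ).trans ?_)
      have h2 : heat μ (t - a) ξ ≤ 1 := heat_le_one hμ.le (by linarith [ht.1]) ξ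
      refine add_le_add (mul_le_of_le_one_left' h2) ?_
      gcongr
      calc _ ≤ ∫⁻ τ in Ioo a t, quadAmp T U τ ξ :=
            setLIntegral_mono' measurableSet_Ioo fun τ hτ =>
              mul_le_of_le_one_left' (heat_le_one hμ.le (by linarith [hτ.2]) ξ)
        _ ≤ _ := lintegral_mono_set (Ioo_subset_Ioo_right ht.2.le)
    rw [← ofReal_norm] at h1
    exact (ENNReal.ofReal_le_iff_le_toReal (hefin ξ)).1 h1

/-- If the `H²`-type norm stays bounded up to time `T`, the flow extends to time `T`, as a rapidly
decaying solution on every interval `[a,T]` with `a > 0`. -/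
theorem exists_closedFlow (h : FourierFlow μ T U) (hμ : 0 < μ)
    (hM : ∀ a, 0 < a → ∃ M : ℝ≥0, ∀ t ∈ Ico a T, wnorm 4 (amp U t) ≤ M) :
    ∃ V, (∀ j, ∀ t < T, V j t = U j t) ∧ ∀ a ∈ Ioo 0 T, ClosedFlow μ a T V := by
  rcases le_or_gt T 0 with hT | hT
  · exact ⟨U, fun _ _ _ => rfl, fun a ha => absurd (ha.1.trans ha.2) (not_lt.2 hT)⟩
  have ht₀ : T / 2 ∈ Ioo 0 T := ⟨by linarith, by linarith⟩
  -- the quadratic term, extended by `0` so that it is jointly measurable; Duhamel's formula with this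
  -- forcing makes sense at time `T` and defines `V T`
  let B : Fin 3 → ℝ → E3 → ℂ := fun j t ξ => nonlin (fun k l => (Ioo 0 T ×ˢ univ).indicator
    (fun z : ℝ × E3 => cconv (U k z.1) (U l z.1) z.2) (t, ξ)) j ξ
  have hBm : ∀ j, Measurable (Function.uncurry (B j)) := by
    intro j
    have hN : ∀ k l, Measurable ((Ioo 0 T ×ˢ univ).indicator
        (fun z : ℝ × E3 => cconv (U k z.1) (U l z.1) z.2)) := fun k l => by
      have := (h.continuousOn_conv k l).measurable_piecewise (g := fun _ => 0)
        continuousOn_const (measurableSet_Ioo.prod MeasurableSet.univ)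
      rw [← piecewise_eq_indicator]
      exact this
    have hs := measurable_symb
    have hr := measurable_riesz
    simp only [B]
    unfold nonlin Function.uncurry
    fun_prop
  have hBeq : ∀ j, ∀ t ∈ Ioo 0 T, ∀ ξ, B j t ξ = nonlin (fun k l => cconv (U k t) (U l t) ξ) j ξ := by
    intro j t ht ξ
    simp only [B]
    congr 1; ext k l
    rw [indicator_of_mem (show (t, ξ) ∈ Ioo 0 T ×ˢ univ from ⟨ht, mem_univ _⟩)]
  obtain ⟨M, hM0⟩ := h.exists_wnorm_le hμ hM 0 ht₀.1
  have hBint : ∀ j ξ, IntegrableOn (fun s => (Real.exp (damp μ ξ * (s - T / 2)) : ℂ) * B j s ξ)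
      (Icc (T / 2) T) volume := by
    intro j ξ
    have h1 : IntegrableOn (fun s => B j s ξ) (Ioo (T / 2) T) volume := by
      refine ⟨(Measurable.of_uncurry_right (hBm j)).aestronglyMeasurable, ?_⟩
      rw [HasFiniteIntegral]
      have h2 : ∫⁻ s in Ioo (T / 2) T, ‖B j s ξ‖ₑ ≤
          (ENNReal.ofReal (4 * Real.pi) * ‖ξ‖ₑ * M) * volume (Ioo (T / 2) T) := by
        rw [← setLIntegral_const]
        refine setLIntegral_mono' measurableSet_Ioo fun s hs => ?_
        have hs' : s ∈ Ioo 0 T := ⟨by linarith [hs.1], hs.2⟩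
        rw [hBeq j s hs']
        refine (enorm_nonlin_le _ j ξ).trans ?_
        gcongr
        rw [← quadAmp_eq U hs']
        exact h.quadAmp_le_of_wnorm (hM0 s (Ioo_subset_Ico_self hs)) ξ
      refine h2.trans_lt ?_
      have : volume (Ioo (T / 2) T) ≠ ⊤ := by simp
      finiteness
    have h2 : IntegrableOn (fun s => B j s ξ) (Icc (T / 2) T) volume := by
      rwa [integrableOn_Icc_iff_integrableOn_Ioo]
    exact h2.continuousOn_mul (Continuous.continuousOn (by fun_prop)) isCompact_Icc
  let V : Fin 3 → ℝ → E3 → ℂ := fun j t =>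
    if t < T then U j t else duhamel μ (T / 2) (U j (T / 2)) (B j) t
  have hVU : ∀ j, ∀ t < T, V j t = U j t := fun j t ht => if_pos ht
  have hVm : ∀ j t, Measurable (V j t) := by
    intro j t
    simp only [V]
    split_ifs
    · exact h.measurable j t
    · exact measurable_duhamel (h.measurable j _) (hBm j) t
  have hUd : ∀ j, ∀ t ∈ Ico (T / 2) T, ∀ ξ,
      U j t ξ = duhamel μ (T / 2) (U j (T / 2)) (B j) t ξ := by
    intro j t ht ξ
    have ht' : t ∈ Ioo 0 T := ⟨ht₀.1.trans_le ht.1, ht.2⟩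
    rw [h.duhamel_eq ht₀ ht' j ξ, duhamel, mul_add, ← intervalIntegral.integral_const_mul]
    congr 1
    refine intervalIntegral.integral_congr fun s hs => ?_
    have hs' := uIcc_subset_Ioo_of_mem ht' ht₀ hs
    rw [hBeq j s hs', ← mul_assoc, ← Complex.ofReal_mul, ← Real.exp_add]
    congr 3; ring
  have hVd : ∀ j, ∀ t ∈ Icc (T / 2) T, ∀ ξ,
      V j t ξ = duhamel μ (T / 2) (U j (T / 2)) (B j) t ξ := by
    intro j t ht ξ
    simp only [V]
    split_ifs with h1
    · exact hUd j t ⟨ht.1, h1⟩ ξ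
    · rfl
  -- each frequency is continuous up to time `T`, as an integral with varying end point
  have hVcont : ∀ j ξ, Tendsto (fun t => V j t ξ) (𝓝[<] T) (𝓝 (V j T ξ)) := by
    intro j ξ
    have hc : ContinuousOn (fun t => duhamel μ (T / 2) (U j (T / 2)) (B j) t ξ) (Icc (T / 2) T) := by
      unfold duhamel
      have h1 := intervalIntegral.continuousOn_primitive_interval (a := T / 2) (b := T)
        (f := fun s => (Real.exp (damp μ ξ * (s - T / 2)) : ℂ) * B j s ξ) (μ := volume)
        (by rw [uIcc_of_le ht₀.2.le]; exact hBint j ξ)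
      rw [uIcc_of_le ht₀.2.le] at h1
      exact (Continuous.continuousOn (by fun_prop)).mul (continuousOn_const.add h1)
    have h2 := (hc.congr fun t ht => hVd j t ht ξ) T (right_mem_Icc.2 ht₀.2.le)
    have h3 : 𝓝[<] T ≤ 𝓝[Icc (T / 2) T] T := by
      rw [← nhdsWithin_Ico_eq_nhdsLT ht₀.2]
      exact nhdsWithin_mono _ Ico_subset_Icc_self
    exact h2.mono_left h3
  refine ⟨V, hVU, fun a ha => ?_⟩
  have hev : ∀ a < T, ∀ᶠ t in 𝓝[<] T, t ∈ Ioo a T := fun a ha => Ioo_mem_nhdsLT ha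
  obtain ⟨E, hE, hEb⟩ := h.exists_envelope hμ hM ha.1 ha.2
  have hEV : ∀ t ∈ Icc a T, ∀ j ξ, ‖V j t ξ‖ ≤ E ξ := by
    intro t ht j ξ
    rcases ht.2.lt_or_eq with h1 | rfl
    · rw [hVU j t h1]; exact hEb t ⟨ht.1, h1⟩ j ξ
    · refine le_of_tendsto (hVcont j ξ).norm ?_
      filter_upwards [hev a ha.2] with s hs
      rw [hVU j s hs.2]
      exact hEb s (Ioo_subset_Ico_self hs) j ξ
  have hconv : ∀ k l ξ, Tendsto (fun t => cconv (V k t) (V l t) ξ) (𝓝[<] T)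
      (𝓝 (cconv (V k T) (V l T) ξ)) := by
    intro k l ξ
    refine tendsto_integral_filter_of_dominated_convergence (fun η => E η * E (ξ - η))
      (Eventually.of_forall fun t => ?_) ?_ (hE.integrable_mul_sub hE ξ) (ae_of_all _ fun η => ?_)
    · have h1 := hVm k t
      have h2 := hVm l t
      exact Measurable.aestronglyMeasurable (by fun_prop)
    · filter_upwards [hev a ha.2] with t ht
      refine ae_of_all _ fun η => ?_
      rw [norm_mul]
      exact mul_le_mul (hEV t (Ioo_subset_Icc_self ht) k η) (hEV t (Ioo_subset_Icc_self ht) l _)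
        (norm_nonneg _) (hE.nonneg η)
    · exact (hVcont k η).mul (hVcont l (ξ - η))
  have hderU : ∀ t ∈ Ioo 0 T, ∀ ξ j, HasDerivAt (fun t => V j t ξ)
      (-damp μ ξ * V j t ξ + nonlin (fun k l => cconv (V k t) (V l t) ξ) j ξ) t := by
    intro t ht ξ j
    simp_rw [hVU _ t ht.2]
    refine (h.hasDerivAt t ht ξ j).congr_of_eventuallyEq ?_
    filter_upwards [Iio_mem_nhds ht.2] with s hs
    rw [hVU j s hs]
  refine ⟨hVm, ⟨E, hE, hEV⟩, fun t ht ξ j => ?_, fun t ht ξ => ?_⟩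
  · rcases ht.2.lt_or_eq with h1 | rfl
    · exact (hderU t ⟨ha.1.trans_le ht.1, h1⟩ ξ j).hasDerivWithinAt
    -- at the final time the one-sided derivative is the limit of the derivatives
    · refine (hasDerivWithinAt_Iic_of_tendsto_deriv (s := Ioo 0 t) (fun s hs =>
        (hderU s hs ξ j).differentiableAt.differentiableWithinAt) ?_ (Ioo_mem_nhdsLT hT) ?_).mono
        Icc_subset_Iic_self
      · exact (hVcont j ξ).mono_left (nhdsWithin_mono _ Ioo_subset_Iio_self)
      · have h2 : Tendsto (fun s => -damp μ ξ * V j s ξ +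
            nonlin (fun k l => cconv (V k s) (V l s) ξ) j ξ) (𝓝[<] t)
            (𝓝 (-damp μ ξ * V j t ξ + nonlin (fun k l => cconv (V k t) (V l t) ξ) j ξ)) := by
          refine ((hVcont j ξ).const_mul _).add ?_
          unfold nonlin
          exact (tendsto_finsetSum _ fun k _ => ((hconv k j ξ).sub
            (tendsto_finsetSum _ fun l _ => (hconv k l ξ).const_mul _)).const_mul _).neg
        refine h2.congr' ?_
        filter_upwards [hev 0 hT] with s hs
        exact (hderU s hs ξ j).deriv.symm
  · rcases ht.2.lt_or_eq with h1 | rfl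
    · simp_rw [hVU _ t h1]
      exact h.div_free t ⟨ha.1.trans_le ht.1, h1⟩ ξ
    · have h2 : Tendsto (fun s => ∑ j, symb j ξ * V j s ξ) (𝓝[<] t)
          (𝓝 (∑ j, symb j ξ * V j t ξ)) :=
        tendsto_finsetSum _ fun j _ => (hVcont j ξ).const_mul _
      refine tendsto_nhds_unique h2 (tendsto_const_nhds.congr' ?_)
      filter_upwards [hev 0 hT] with s hs
      simp_rw [hVU _ s hs.2]
      exact (h.div_free s hs ξ).symm

/-- On time intervals inside `(0,T)` a Fourier flow is rapidly decaying. -/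
theorem closedFlow (h : FourierFlow μ T U) (hμ : 0 < μ) {a b : ℝ} (ha : 0 < a) (hab : a < b)
    (hb : b < T) : ClosedFlow μ a b U := by
  -- on `(0,T')` with `b < T' < T` the `H²`-type norm is bounded up to the final time `T'`
  obtain ⟨T', hbT', hT'T⟩ := exists_between hb
  have hsub : Ioo 0 T' ⊆ Ioo 0 T := Ioo_subset_Ioo_right hT'T.le
  have h' : FourierFlow μ T' U := ⟨h.measurable, fun a b ha hb => h.bound a b ha (hb.trans hT'T),
    fun t ht => h.hasDerivAt t (hsub ht), fun k l => (h.continuousOn_conv k l).mono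
      (prod_mono hsub Subset.rfl), fun t ht => h.div_free t (hsub ht)⟩
  obtain ⟨V, hV, hVc⟩ := h'.exists_closedFlow hμ (by
    intro a ha
    obtain ⟨M, hM⟩ := h.bound a T' ha hT'T
    exact ⟨12 * M, fun t ht => wnorm_amp_le h.measurable (hM t (Ico_subset_Icc_self ht))⟩)
  exact ((hVc a ⟨ha, hab.trans hbT'⟩).mono (Icc_subset_Icc_right hbT'.le)).congr h.measurable
    fun j t ht => (hV j t (ht.2.trans_lt hbT')).symm

end FourierFlow

/-! ### Joint smoothness of inverse Fourier transforms -/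

/-- The exponential `e^{2πi ξ·x}`. -/
noncomputable def echar (ξ x : E3) : ℂ := Complex.exp (∑ i, symb i ξ * (x i : ℝ))

lemma echar_eq (ξ x : E3) : echar ξ x = Complex.exp (↑(2 * Real.pi * inner ℝ ξ x) * Complex.I) := by
  rw [echar]
  congr 1
  simp only [symb, PiLp.inner_apply, Fin.sum_univ_three, RCLike.inner_apply, conj_trivial]
  push_cast; ring

lemma norm_echar (ξ x : E3) : ‖echar ξ x‖ = 1 := by
  rw [echar_eq, Complex.norm_exp_ofReal_mul_I]

lemma continuous_echar : Continuous fun p : E3 × E3 => echar p.1 p.2 := by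
  have := continuous_symb
  unfold echar
  fun_prop

lemma fourierInv_eq_integral_echar (F : E3 → ℂ) (x : E3) : 𝓕⁻ F x = ∫ ξ, echar ξ x * F ξ := by
  rw [Real.fourierInv_eq']
  simp_rw [echar_eq, smul_eq_mul]

lemma hasFDerivAt_echar (ξ x : E3) : HasFDerivAt (echar ξ)
    (∑ i, (echar ξ x * symb i ξ) • coordC i) x := by
  have h1 : HasFDerivAt (fun x : E3 => ∑ i, symb i ξ * coordC i x) (∑ i, symb i ξ • coordC i) x :=
    HasFDerivAt.fun_sum fun i _ => ((coordC i).hasFDerivAt).const_mul (symb i ξ)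
  refine h1.cexp.congr_fderiv ?_
  rw [Finset.smul_sum]
  simp_rw [smul_smul]
  rfl

/-- The differential `dt` on space-time. -/
noncomputable def dtime : ℝ × E3 →L[ℝ] ℂ := Complex.ofRealCLM.comp (ContinuousLinearMap.fst ℝ ℝ E3)

/-- The differential `dx_i` on space-time. -/
noncomputable def dspace (i : Fin 3) : ℝ × E3 →L[ℝ] ℂ := (coordC i).comp (ContinuousLinearMap.snd ℝ ℝ E3)

lemma norm_dtime_le : ‖dtime‖ ≤ 1 := by
  refine ContinuousLinearMap.opNorm_le_bound _ zero_le_one fun z => ?_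
  rw [one_mul]
  have : ‖dtime z‖ = ‖z.1‖ := Complex.norm_real z.1
  rw [this]
  exact norm_fst_le z

lemma norm_dspace_le (i : Fin 3) : ‖dspace i‖ ≤ 1 := by
  refine ContinuousLinearMap.opNorm_le_bound _ zero_le_one fun z => ?_
  rw [one_mul]
  exact (norm_coordC_apply_le i z.2).trans (norm_snd_le z)

/-- The differential of `(t, x) ↦ 𝓕⁻ (F t) x`, where `G` is the time derivative of `F`. -/
noncomputable def fourierInvDeriv (F G : ℝ → E3 → ℂ) (z : ℝ × E3) : ℝ × E3 →L[ℝ] ℂ :=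
  𝓕⁻ (G z.1) z.2 • dtime + ∑ i, 𝓕⁻ (fun ξ => symb i ξ * F z.1 ξ) z.2 • dspace i

lemma RapidEnvelope.integrable_of_le {E : E3 → ℝ} (hE : RapidEnvelope E) {F : E3 → ℂ}
    (hF : Measurable F) (hFE : ∀ ξ, ‖F ξ‖ ≤ E ξ) : Integrable F volume :=
  hE.integrable.mono' hF.aestronglyMeasurable (ae_of_all _ hFE)

lemma norm_symb_mul_le {E : E3 → ℝ} {z : ℂ} (i : Fin 3) {ξ : E3} (hz : ‖z‖ ≤ E ξ) :
    ‖symb i ξ * z‖ ≤ 2 * Real.pi * ((1 + ‖ξ‖) ^ 1 * E ξ) := by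
  have hE : 0 ≤ E ξ := (norm_nonneg _).trans hz
  have hp := Real.pi_pos
  rw [norm_mul, pow_one]
  calc ‖symb i ξ‖ * ‖z‖ ≤ (2 * Real.pi * (1 + ‖ξ‖)) * E ξ := by
        gcongr
        exact (norm_symb_le i ξ).trans (by gcongr; linarith)
    _ = _ := by ring

/-- The differential of `(t, x) ↦ e^{2πi ξ·x} F(t, ξ)`, where `G` is the time derivative of `F`. -/
noncomputable def echarDeriv (F G : ℝ → E3 → ℂ) (z : ℝ × E3) (ξ : E3) : ℝ × E3 →L[ℝ] ℂ :=
  (echar ξ z.2 * G z.1 ξ) • dtime + ∑ i, (echar ξ z.2 * (symb i ξ * F z.1 ξ)) • dspace i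

lemma integrable_echar_mul {H : E3 → ℂ} {E : E3 → ℝ} (hE : RapidEnvelope E) (hH : Measurable H)
    (hHE : ∀ ξ, ‖H ξ‖ ≤ E ξ) (x : E3) : Integrable (fun ξ => echar ξ x * H ξ) volume := by
  have h : Measurable fun ξ => echar ξ x :=
    (continuous_echar.comp (Continuous.prodMk_left x)).measurable
  exact hE.integrable_of_le (h.mul hH) fun ξ => by
    rw [norm_mul, norm_echar, one_mul]; exact hHE ξ

lemma RapidEnvelope.symb_bound {E : E3 → ℝ} (hE : RapidEnvelope E) :
    RapidEnvelope fun ξ => 2 * Real.pi * ((1 + ‖ξ‖) ^ 1 * E ξ) :=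
  (hE.wt_mul 1).const_mul (mul_nonneg zero_le_two Real.pi_pos.le)

lemma hasFDerivWithinAt_echar_mul {F G : ℝ → E3 → ℂ} {s : Set ℝ} {z : ℝ × E3} {ξ : E3}
    (hd : HasDerivWithinAt (fun t => F t ξ) (G z.1 ξ) s z.1) :
    HasFDerivWithinAt (fun z : ℝ × E3 => echar ξ z.2 * F z.1 ξ) (echarDeriv F G z ξ)
      (s ×ˢ univ) z := by
  have h1 : HasFDerivWithinAt (fun z : ℝ × E3 => echar ξ z.2)
      ((∑ i, (echar ξ z.2 * symb i ξ) • coordC i).comp (ContinuousLinearMap.snd ℝ ℝ E3))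
      (s ×ˢ univ) z :=
    ((hasFDerivAt_echar ξ z.2).comp z hasFDerivAt_snd).hasFDerivWithinAt
  have h2 : HasFDerivWithinAt (fun z : ℝ × E3 => F z.1 ξ)
      ((ContinuousLinearMap.toSpanSingleton ℝ (G z.1 ξ)).comp (ContinuousLinearMap.fst ℝ ℝ E3))
      (s ×ˢ univ) z :=
    hd.hasFDerivWithinAt.comp z hasFDerivWithinAt_fst fun w hw => hw.1
  refine (h1.mul h2).congr_fderiv ?_
  ext w
  · simp [dtime, dspace, echarDeriv]
  · simp [dtime, dspace, echarDeriv, Finset.mul_sum]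
    refine Finset.sum_congr rfl fun i _ => ?_
    ring

lemma integrable_smul_add_sum_smul {W : Type*} [NormedAddCommGroup W] [NormedSpace ℝ W]
    [NormedSpace ℂ W] [CompleteSpace W] {ι : Type*} [Fintype ι] {f : E3 → ℂ} {g : ι → E3 → ℂ}
    (hf : Integrable f volume) (hg : ∀ i, Integrable (g i) volume) (w : W) (v : ι → W) :
    Integrable (fun ξ => f ξ • w + ∑ i, g i ξ • v i) volume ∧
      ∫ ξ, f ξ • w + ∑ i, g i ξ • v i = (∫ ξ, f ξ) • w + ∑ i, (∫ ξ, g i ξ) • v i := by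
  have h1 : Integrable (fun ξ => f ξ • w) volume := hf.smul_const _
  have h2 : ∀ i, Integrable (fun ξ => g i ξ • v i) volume := fun i => (hg i).smul_const _
  have h3 : Integrable (fun ξ => ∑ i, g i ξ • v i) volume := integrable_finsetSum _ fun i _ => h2 i
  refine ⟨h1.add h3, ?_⟩
  rw [integral_add h1 h3, integral_finsetSum _ fun i _ => h2 i]
  simp_rw [integral_smul_const]

lemma integrable_echarDeriv {F G : ℝ → E3 → ℂ} {E : E3 → ℝ} {z : ℝ × E3}
    (hE : RapidEnvelope E) (hFm : Measurable (F z.1)) (hGm : Measurable (G z.1))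
    (hF : ∀ ξ, ‖F z.1 ξ‖ ≤ E ξ) (hG : ∀ ξ, ‖G z.1 ξ‖ ≤ E ξ) :
    Integrable (echarDeriv F G z) volume ∧
      ∫ ξ, echarDeriv F G z ξ = fourierInvDeriv F G z := by
  have iG := integrable_echar_mul hE hGm hG z.2
  have iS : ∀ i, Integrable (fun ξ => echar ξ z.2 * (symb i ξ * F z.1 ξ)) volume := fun i =>
    integrable_echar_mul hE.symb_bound ((measurable_symb i).mul hFm)
      (fun ξ => norm_symb_mul_le i (hF ξ)) z.2
  have h := integrable_smul_add_sum_smul iG iS dtime dspace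
  refine ⟨h.1, h.2.trans ?_⟩
  simp_rw [fourierInvDeriv, fourierInv_eq_integral_echar]

lemma norm_echarDeriv_le {F G : ℝ → E3 → ℂ} {E : E3 → ℝ} {z : ℝ × E3} {ξ : E3}
    (hF : ‖F z.1 ξ‖ ≤ E ξ) (hG : ‖G z.1 ξ‖ ≤ E ξ) :
    ‖echarDeriv F G z ξ‖ ≤ E ξ + ∑ _i : Fin 3, 2 * Real.pi * ((1 + ‖ξ‖) ^ 1 * E ξ) := by
  refine (norm_add_le _ _).trans (add_le_add ?_ (norm_sum_le_of_le _ fun i _ => ?_))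
  · rw [norm_smul, norm_mul, norm_echar, one_mul]
    exact (mul_le_of_le_one_right (norm_nonneg _) norm_dtime_le).trans hG
  · rw [norm_smul, norm_mul, norm_echar, one_mul]
    exact (mul_le_of_le_one_right (norm_nonneg _) (norm_dspace_le i)).trans
      (norm_symb_mul_le i hF)

/-- Differentiation of `(t, x) ↦ 𝓕⁻ (F t) x` in space-time, one-sidedly at the ends of `[a,b]`. -/
lemma hasFDerivWithinAt_fourierInv {F G : ℝ → E3 → ℂ} {a b : ℝ} {E : E3 → ℝ}
    (hE : RapidEnvelope E) (hFm : ∀ t, Measurable (F t)) (hGm : ∀ t, Measurable (G t))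
    (hF : ∀ t ∈ Icc a b, ∀ ξ, ‖F t ξ‖ ≤ E ξ) (hG : ∀ t ∈ Icc a b, ∀ ξ, ‖G t ξ‖ ≤ E ξ)
    (hd : ∀ t ∈ Icc a b, ∀ ξ, HasDerivWithinAt (fun t => F t ξ) (G t ξ) (Icc a b) t)
    {z : ℝ × E3} (hz : z ∈ Icc a b ×ˢ (univ : Set E3)) :
    HasFDerivWithinAt (fun z : ℝ × E3 => 𝓕⁻ (F z.1) z.2) (fourierInvDeriv F G z)
      (Icc a b ×ˢ univ) z := by
  have hi := integrable_echarDeriv (z := z) hE (hFm _) (hGm _) (hF _ hz.1) (hG _ hz.1)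
  have hb : Integrable (fun ξ => E ξ + ∑ _i : Fin 3, 2 * Real.pi * ((1 + ‖ξ‖) ^ 1 * E ξ)) volume :=
    hE.integrable.add (integrable_finsetSum _ fun i _ => hE.symb_bound.integrable)
  have h := hasFDerivWithinAt_integral_of_dominated (ν := (volume : Measure E3))
    (F := fun (z : ℝ × E3) ξ => echar ξ z.2 * F z.1 ξ) (F' := echarDeriv F G)
    (s := Icc a b ×ˢ (univ : Set E3)) (x₀ := z) ((convex_Icc a b).prod convex_univ) hz
    (fun z hz => integrable_echar_mul hE (hFm z.1) (hF z.1 hz.1) z.2) hi.1.1 hb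
    (fun z hz ξ => norm_echarDeriv_le (hF z.1 hz.1 ξ) (hG z.1 hz.1 ξ))
    (fun z hz ξ => hasFDerivWithinAt_echar_mul (hd z.1 hz.1 ξ))
  rw [hi.2] at h
  simp_rw [fourierInv_eq_integral_echar]
  exact h

/-! ### Time-smooth families with rapid decay -/

/-- A family of rapidly decaying functions on frequency space, continuous in time on `[a,b]`, with a
uniform envelope. -/
structure TimeRapid (a b : ℝ) (F : ℝ → E3 → ℂ) : Prop where
  measurable : ∀ t, Measurable (F t)
  continuousOn : ∀ ξ, ContinuousOn (fun t => F t ξ) (Icc a b)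
  envelope : ∃ E, RapidEnvelope E ∧ ∀ t ∈ Icc a b, ∀ ξ, ‖F t ξ‖ ≤ E ξ

/-- A family of rapidly decaying functions on frequency space that is `m` times differentiable in
time on `[a,b]`, all derivatives being rapidly decaying families. -/
def TimeSmooth (a b : ℝ) : ℕ → (ℝ → E3 → ℂ) → Prop
  | 0, F => TimeRapid a b F
  | m + 1, F => TimeRapid a b F ∧ ∃ G, TimeSmooth a b m G ∧ ∀ t ∈ Icc a b, ∀ ξ,
      HasDerivWithinAt (fun t => F t ξ) (G t ξ) (Icc a b) t

section

variable {a b : ℝ} {F G : ℝ → E3 → ℂ} {m : ℕ}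

lemma TimeSmooth.timeRapid (h : TimeSmooth a b m F) : TimeRapid a b F := by
  cases m with
  | zero => exact h
  | succ m => exact h.1

lemma TimeSmooth.of_succ (h : TimeSmooth a b (m + 1) F) : TimeSmooth a b m F := by
  induction m generalizing F with
  | zero => exact h.1
  | succ m ih =>
    obtain ⟨h1, G, hG, hd⟩ := h
    exact ⟨h1, G, ih hG, hd⟩

lemma TimeRapid.add (hF : TimeRapid a b F) (hG : TimeRapid a b G) :
    TimeRapid a b fun t ξ => F t ξ + G t ξ where
  measurable t := (hF.measurable t).add (hG.measurable t)
  continuousOn ξ := (hF.continuousOn ξ).add (hG.continuousOn ξ)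
  envelope := by
    obtain ⟨E, hE, h1⟩ := hF.envelope
    obtain ⟨E', hE', h2⟩ := hG.envelope
    exact ⟨_, hE.add hE', fun t ht ξ => (norm_add_le _ _).trans (add_le_add (h1 t ht ξ) (h2 t ht ξ))⟩

lemma TimeSmooth.add (hF : TimeSmooth a b m F) (hG : TimeSmooth a b m G) :
    TimeSmooth a b m fun t ξ => F t ξ + G t ξ := by
  induction m generalizing F G with
  | zero => exact TimeRapid.add hF hG
  | succ m ih =>
    obtain ⟨h1, F', hF', hd⟩ := hF
    obtain ⟨h2, G', hG', hd'⟩ := hG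
    exact ⟨h1.add h2, _, ih hF' hG', fun t ht ξ => (hd t ht ξ).add (hd' t ht ξ)⟩

/-- A measurable function of polynomial growth. -/
def IsMultiplier (c : E3 → ℂ) : Prop :=
  Measurable c ∧ ∃ C l, 0 ≤ C ∧ ∀ ξ, ‖c ξ‖ ≤ C * (1 + ‖ξ‖) ^ (l : ℕ)

lemma TimeRapid.mul {c : E3 → ℂ} (hc : IsMultiplier c) (hF : TimeRapid a b F) :
    TimeRapid a b fun t ξ => c ξ * F t ξ where
  measurable t := hc.1.mul (hF.measurable t)
  continuousOn ξ := continuousOn_const.mul (hF.continuousOn ξ)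
  envelope := by
    obtain ⟨E, hE, h1⟩ := hF.envelope
    obtain ⟨C, l, hC, hcl⟩ := hc.2
    refine ⟨_, (hE.wt_mul l).const_mul hC, fun t ht ξ => ?_⟩
    rw [norm_mul, ← mul_assoc]
    exact mul_le_mul (hcl ξ) (h1 t ht ξ) (norm_nonneg _) (by positivity)

lemma TimeSmooth.mul {c : E3 → ℂ} (hc : IsMultiplier c) (hF : TimeSmooth a b m F) :
    TimeSmooth a b m fun t ξ => c ξ * F t ξ := by
  induction m generalizing F with
  | zero => exact TimeRapid.mul hc hF
  | succ m ih =>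
    obtain ⟨h1, F', hF', hd⟩ := hF
    exact ⟨h1.mul hc, _, ih hF', fun t ht ξ => (hd t ht ξ).const_mul _⟩

lemma isMultiplier_const (c : ℂ) : IsMultiplier fun _ => c :=
  ⟨measurable_const, ‖c‖, 0, norm_nonneg _, fun ξ => by simp⟩

lemma isMultiplier_symb (i : Fin 3) : IsMultiplier (symb i) := by
  refine ⟨measurable_symb i, 2 * Real.pi, 1, by positivity, fun ξ => ?_⟩
  have := Real.pi_pos
  refine (norm_symb_le i ξ).trans ?_
  rw [pow_one]; gcongr; linarith

lemma isMultiplier_riesz (j l : Fin 3) : IsMultiplier fun ξ => (riesz j l ξ : ℂ) := by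
  refine ⟨Complex.measurable_ofReal.comp (measurable_riesz j l), 1, 0, zero_le_one, fun ξ => ?_⟩
  rw [Complex.norm_real]; simpa using abs_riesz_le j l ξ

lemma IsMultiplier.mul {c d : E3 → ℂ} (hc : IsMultiplier c) (hd : IsMultiplier d) :
    IsMultiplier fun ξ => c ξ * d ξ := by
  obtain ⟨h1, C, l, hC, hcl⟩ := hc
  obtain ⟨h2, D, k, hD, hdk⟩ := hd
  refine ⟨h1.mul h2, C * D, l + k, by positivity, fun ξ => ?_⟩
  rw [norm_mul]
  calc ‖c ξ‖ * ‖d ξ‖ ≤ (C * (1 + ‖ξ‖) ^ l) * (D * (1 + ‖ξ‖) ^ k) :=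
        mul_le_mul (hcl ξ) (hdk ξ) (norm_nonneg _) (by positivity)
    _ = _ := by ring

lemma isMultiplier_damp (μ : ℝ) : IsMultiplier fun ξ => (damp μ ξ : ℂ) := by
  refine ⟨Complex.measurable_ofReal.comp (continuous_damp μ).measurable, |4 * Real.pi ^ 2 * μ|, 2,
    abs_nonneg _, fun ξ => ?_⟩
  rw [Complex.norm_real, damp, norm_mul, Real.norm_eq_abs, norm_pow, norm_norm]
  gcongr; linarith

lemma TimeRapid.cconv (hF : TimeRapid a b F) (hG : TimeRapid a b G) :
    TimeRapid a b fun t => cconv (F t) (G t) := by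
  obtain ⟨E, hE, h1⟩ := hF.envelope
  obtain ⟨E', hE', h2⟩ := hG.envelope
  have hb : ∀ t ∈ Icc a b, ∀ ξ η, ‖F t η * G t (ξ - η)‖ ≤ E η * E' (ξ - η) := by
    intro t ht ξ η
    rw [norm_mul]
    exact mul_le_mul (h1 t ht η) (h2 t ht _) (norm_nonneg _) (hE.nonneg η)
  refine ⟨fun t => ?_, fun ξ => ?_, _, hE.conv hE', fun t ht ξ => ?_⟩
  · have hm1 := hF.measurable t
    have hm2 := hG.measurable t
    have h3 : StronglyMeasurable fun p : E3 × E3 => F t p.2 * G t (p.1 - p.2) :=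
      Measurable.stronglyMeasurable (by fun_prop)
    exact h3.integral_prod_right'.measurable
  · refine continuousOn_of_dominated (bound := fun η => E η * E' (ξ - η)) (fun t ht => ?_)
      (fun t ht => ae_of_all _ (hb t ht ξ)) (hE.integrable_mul_sub hE' ξ) (ae_of_all _ fun η => ?_)
    · have hm1 := hF.measurable t
      have hm2 := hG.measurable t
      exact Measurable.aestronglyMeasurable (by fun_prop)
    · exact (hF.continuousOn η).mul (hG.continuousOn (ξ - η))
  · exact norm_integral_le_of_norm_le (hE.integrable_mul_sub hE' ξ) (ae_of_all _ (hb t ht ξ))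

lemma TimeSmooth.cconv (hF : TimeSmooth a b m F) (hG : TimeSmooth a b m G) :
    TimeSmooth a b m fun t => cconv (F t) (G t) := by
  induction m generalizing F G with
  | zero => exact TimeRapid.cconv hF hG
  | succ m ih =>
    have hF0 := hF.of_succ
    have hG0 := hG.of_succ
    obtain ⟨h1, F', hF', hd⟩ := hF
    obtain ⟨h2, G', hG', hd'⟩ := hG
    refine ⟨h1.cconv h2, _, (ih hF' hG0).add (ih hF0 hG'), fun t ht ξ => ?_⟩
    obtain ⟨E, hE, b1⟩ := h1.envelope
    obtain ⟨D, hD, b2⟩ := h2.envelope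
    obtain ⟨E', hE', b1'⟩ := hF'.timeRapid.envelope
    obtain ⟨D', hD', b2'⟩ := hG'.timeRapid.envelope
    have hint : ∀ {H K : ℝ → E3 → ℂ}, TimeRapid a b H → TimeRapid a b K → ∀ t ∈ Icc a b,
        Integrable (fun η => H t η * K t (ξ - η)) volume := by
      intro H K hH hK t ht
      obtain ⟨E, hE, b1⟩ := hH.envelope
      obtain ⟨D, hD, b2⟩ := hK.envelope
      have hm1 := hH.measurable t
      have hm2 := hK.measurable t
      refine (hE.integrable_mul_sub hD ξ).mono' (Measurable.aestronglyMeasurable (by fun_prop))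
        (ae_of_all _ fun η => ?_)
      rw [norm_mul]
      exact mul_le_mul (b1 t ht η) (b2 t ht _) (norm_nonneg _) (hE.nonneg η)
    have i1 := hint hF'.timeRapid h2 t ht
    have i2 := hint h1 hG'.timeRapid t ht
    have h := hasDerivWithinAt_integral_of_dominated (ν := (volume : Measure E3)) (s := Icc a b)
      (x₀ := t) (F := fun t η => F t η * G t (ξ - η))
      (F' := fun t η => F' t η * G t (ξ - η) + F t η * G' t (ξ - η))
      (bound := fun η => E' η * D (ξ - η) + E η * D' (ξ - η)) (convex_Icc a b) ht
      (fun t ht => hint h1 h2 t ht) (i1.add i2).1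
      ((hE'.integrable_mul_sub hD ξ).add (hE.integrable_mul_sub hD' ξ))
      (fun t ht η => by
        refine (norm_add_le _ _).trans (add_le_add ?_ ?_) <;> rw [norm_mul]
        · exact mul_le_mul (b1' t ht η) (b2 t ht _) (norm_nonneg _) (hE'.nonneg η)
        · exact mul_le_mul (b1 t ht η) (b2' t ht _) (norm_nonneg _) (hE.nonneg η))
      (fun t ht η => (hd t ht η).mul (hd' t ht (ξ - η)))
    refine h.congr_deriv ?_
    rw [integral_add i1 i2]
    rfl

lemma TimeSmooth.nonlin {N : Fin 3 → Fin 3 → ℝ → E3 → ℂ} (hN : ∀ k l, TimeSmooth a b m (N k l))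
    (j : Fin 3) : TimeSmooth a b m fun t ξ => nonlin (fun k l => N k l t ξ) j ξ := by
  have e : (fun (t : ℝ) (ξ : E3) => _root_.nonlin (fun k l => N k l t ξ) j ξ) = fun t ξ =>
      ((fun k ξ => (-1 * symb k ξ)) 0 ξ * (N 0 j t ξ + (-1) * (riesz j 0 ξ * N 0 0 t ξ +
        riesz j 1 ξ * N 0 1 t ξ + riesz j 2 ξ * N 0 2 t ξ)) +
      (fun k ξ => (-1 * symb k ξ)) 1 ξ * (N 1 j t ξ + (-1) * (riesz j 0 ξ * N 1 0 t ξ +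
        riesz j 1 ξ * N 1 1 t ξ + riesz j 2 ξ * N 1 2 t ξ))) +
      (fun k ξ => (-1 * symb k ξ)) 2 ξ * (N 2 j t ξ + (-1) * (riesz j 0 ξ * N 2 0 t ξ +
        riesz j 1 ξ * N 2 1 t ξ + riesz j 2 ξ * N 2 2 t ξ)) := by
    ext t ξ
    simp only [_root_.nonlin, Fin.sum_univ_three]
    ring
  rw [e]
  have hr := fun l => isMultiplier_riesz j l
  have h1 : ∀ k, TimeSmooth a b m fun t ξ => N k j t ξ + (-1) * (riesz j 0 ξ * N k 0 t ξ +
      riesz j 1 ξ * N k 1 t ξ + riesz j 2 ξ * N k 2 t ξ) := fun k =>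
    (hN k j).add (TimeSmooth.mul (isMultiplier_const (-1))
      ((((hN k 0).mul (hr 0)).add ((hN k 1).mul (hr 1))).add ((hN k 2).mul (hr 2))))
  have h2 : ∀ k, IsMultiplier fun ξ => -1 * symb k ξ := fun k =>
    (isMultiplier_const (-1)).mul (isMultiplier_symb k)
  exact (((h1 0).mul (h2 0)).add ((h1 1).mul (h2 1))).add ((h1 2).mul (h2 2))

/-- A flow on a closed time interval is infinitely differentiable in time. -/
theorem ClosedFlow.timeSmooth {μ : ℝ} {V : Fin 3 → ℝ → E3 → ℂ} (h : ClosedFlow μ a b V) (m : ℕ) :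
    ∀ j, TimeSmooth a b m (V j) := by
  obtain ⟨E, hE, hb⟩ := h.envelope
  have h0 : ∀ j, TimeRapid a b (V j) := fun j =>
    ⟨h.measurable j, fun ξ t ht => (h.hasDeriv t ht ξ j).continuousWithinAt,
      E, hE, fun t ht => hb t ht j⟩
  induction m with
  | zero => exact h0
  | succ m ih =>
    intro j
    refine ⟨h0 j, _, (TimeSmooth.mul ((isMultiplier_const (-1)).mul (isMultiplier_damp μ)) (ih j)).add
      (TimeSmooth.nonlin (N := fun k l t => _root_.cconv (V k t) (V l t))
        (fun k l => (ih k).cconv (ih l)) j), fun t ht ξ => ?_⟩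
    refine (h.hasDeriv t ht ξ j).congr_deriv ?_
    ring

lemma TimeRapid.continuousOn_fourierInv (hF : TimeRapid a b F) :
    ContinuousOn (fun z : ℝ × E3 => 𝓕⁻ (F z.1) z.2) (Icc a b ×ˢ univ) := by
  obtain ⟨E, hE, hb⟩ := hF.envelope
  simp_rw [fourierInv_eq_integral_echar]
  refine continuousOn_of_dominated (bound := E) (fun z hz => ?_) (fun z hz => ae_of_all _ fun ξ => ?_)
    hE.integrable (ae_of_all _ fun ξ => ?_)
  · exact ((continuous_echar.comp (Continuous.prodMk_left z.2)).measurable.mul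
      (hF.measurable z.1)).aestronglyMeasurable
  · rw [norm_mul, norm_echar, one_mul]; exact hb z.1 hz.1 ξ
  · refine ContinuousOn.mul (Continuous.continuousOn ?_) ?_
    · exact continuous_echar.comp (continuous_const.prodMk continuous_snd)
    · exact (hF.continuousOn ξ).comp continuousOn_fst fun z hz => hz.1

/-- The inverse Fourier transform of a time-smooth family is smooth in space-time, up to the end points. -/
theorem TimeSmooth.contDiffOn_fourierInv (hab : a < b) (hF : TimeSmooth a b m F) :
    ContDiffOn ℝ m (fun z : ℝ × E3 => 𝓕⁻ (F z.1) z.2) (Icc a b ×ˢ univ) := by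
  induction m generalizing F with
  | zero => exact contDiffOn_zero.2 (TimeRapid.continuousOn_fourierInv hF)
  | succ m ih =>
    have hF0 := hF.of_succ
    obtain ⟨h1, G, hG, hd⟩ := hF
    obtain ⟨E, hE, b1⟩ := h1.envelope
    obtain ⟨E', hE', b2⟩ := hG.timeRapid.envelope
    have hu : UniqueDiffOn ℝ (Icc a b ×ˢ (univ : Set E3)) :=
      (uniqueDiffOn_Icc hab).prod uniqueDiffOn_univ
    have hder : ∀ z ∈ Icc a b ×ˢ (univ : Set E3), HasFDerivWithinAt
        (fun z : ℝ × E3 => 𝓕⁻ (F z.1) z.2) (fourierInvDeriv F G z) (Icc a b ×ˢ univ) z :=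
      fun z hz => hasFDerivWithinAt_fourierInv (hE.add hE') h1.measurable hG.timeRapid.measurable
        (fun t ht ξ => (b1 t ht ξ).trans (le_add_of_nonneg_right (hE'.nonneg ξ)))
        (fun t ht ξ => (b2 t ht ξ).trans (le_add_of_nonneg_left (hE.nonneg ξ))) hd hz
    push_cast
    rw [contDiffOn_succ_iff_fderivWithin hu]
    refine ⟨fun z hz => (hder z hz).differentiableWithinAt, by simp, ?_⟩
    refine ContDiffOn.congr (f := fourierInvDeriv F G) ?_ fun z hz => (hder z hz).fderivWithin (hu z hz)
    unfold fourierInvDeriv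
    refine ((ih hG).smul contDiffOn_const).add (ContDiffOn.sum fun i _ => ?_)
    exact (ih (hF0.mul (isMultiplier_symb i))).smul contDiffOn_const

end

/-! ### Inverse Fourier transforms of rapidly decaying functions -/

/-- A measurable function on frequency space with a rapidly decaying envelope. -/
structure RapidDecay (F : E3 → ℂ) : Prop where
  measurable : Measurable F
  envelope : ∃ E, RapidEnvelope E ∧ ∀ ξ, ‖F ξ‖ ≤ E ξ

namespace RapidDecay

variable {F G : E3 → ℂ}

lemma timeRapid (hF : RapidDecay F) (a b : ℝ) : TimeRapid a b fun _ => F :=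
  ⟨fun _ => hF.measurable, fun _ => continuousOn_const,
    hF.envelope.imp fun _ h => ⟨h.1, fun _ _ => h.2⟩⟩

lemma _root_.TimeRapid.rapidDecay {a b : ℝ} {F : ℝ → E3 → ℂ} (h : TimeRapid a b F) {t : ℝ}
    (ht : t ∈ Icc a b) : RapidDecay (F t) :=
  ⟨h.measurable t, h.envelope.imp fun _ h => ⟨h.1, h.2 t ht⟩⟩

lemma mul {c : E3 → ℂ} (hc : IsMultiplier c) (hF : RapidDecay F) :
    RapidDecay fun ξ => c ξ * F ξ :=
  (TimeRapid.mul hc (hF.timeRapid 0 0)).rapidDecay (left_mem_Icc.2 le_rfl)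

lemma symb (hF : RapidDecay F) (a : Fin 3) : RapidDecay fun ξ => symb a ξ * F ξ :=
  hF.mul (isMultiplier_symb a)

lemma add (hF : RapidDecay F) (hG : RapidDecay G) : RapidDecay fun ξ => F ξ + G ξ :=
  ((hF.timeRapid 0 0).add (hG.timeRapid 0 0)).rapidDecay (left_mem_Icc.2 le_rfl)

lemma cconv (hF : RapidDecay F) (hG : RapidDecay G) : RapidDecay (cconv F G) :=
  ((hF.timeRapid 0 0).cconv (hG.timeRapid 0 0)).rapidDecay (left_mem_Icc.2 le_rfl)

lemma integrable (hF : RapidDecay F) : Integrable F volume := by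
  obtain ⟨E, hE, h⟩ := hF.envelope
  exact hE.integrable_of_le hF.measurable h

lemma memLp (hF : RapidDecay F) : MemLp F 2 volume := by
  obtain ⟨E, hE, h⟩ := hF.envelope
  exact hE.memLp.mono' hF.measurable.aestronglyMeasurable (ae_of_all _ h)

lemma isFourierPair (hF : RapidDecay F) : IsFourierPair (𝓕⁻ F) F :=
  IsFourierPair.fourierInv hF.integrable hF.memLp

lemma memLp_fourierInv (hF : RapidDecay F) : MemLp (𝓕⁻ F) 2 volume := hF.isFourierPair.memLp_left

lemma hasFDerivAt_fourierInv (hF : RapidDecay F) (x : E3) :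
    HasFDerivAt (𝓕⁻ F) (∑ i, 𝓕⁻ (fun ξ => _root_.symb i ξ * F ξ) x • coordC i) x := by
  obtain ⟨E, hE, hb⟩ := hF.envelope
  have h := hasFDerivWithinAt_fourierInv (F := fun _ => F) (G := fun _ _ => 0) (a := 0) (b := 0)
    (z := (0, x)) hE (fun _ => hF.measurable) (fun _ => measurable_const) (fun _ _ => hb)
    (fun _ _ ξ => by simpa using hE.nonneg ξ) (fun _ _ ξ => hasDerivWithinAt_const _ _ _)
    ⟨by simp, mem_univ _⟩
  have h1 : HasFDerivWithinAt (fun x : E3 => ((0 : ℝ), x)) (ContinuousLinearMap.inr ℝ ℝ E3) univ x :=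
    (ContinuousLinearMap.inr ℝ ℝ E3).hasFDerivWithinAt
  have h2 := h.comp x h1 (fun y _ => ⟨by simp, mem_univ _⟩)
  rw [hasFDerivWithinAt_univ] at h2
  refine h2.congr_fderiv ?_
  ext w
  simp [fourierInvDeriv, dtime, dspace]

lemma pderiv_fourierInv (hF : RapidDecay F) (a : Fin 3) :
    pderiv a (𝓕⁻ F) = 𝓕⁻ fun ξ => _root_.symb a ξ * F ξ := by
  ext x
  rw [pderiv, (hF.hasFDerivAt_fourierInv x).fderiv]
  simp only [sum_apply, smul_apply, coordC_apply, smul_eq_mul]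
  rw [Finset.sum_eq_single a]
  · simp
  · intro i _ hi; simp [hi]
  · simp

lemma contDiff_fourierInv (hF : RapidDecay F) (n : ℕ) : ContDiff ℝ n (𝓕⁻ F) := by
  induction n generalizing F with
  | zero => exact contDiff_zero.2 (continuous_fourierInv hF.integrable)
  | succ n ih =>
    push_cast
    rw [contDiff_succ_iff_fderiv]
    refine ⟨fun x => (hF.hasFDerivAt_fourierInv x).differentiableAt, by simp, ?_⟩
    have : fderiv ℝ (𝓕⁻ F) = fun x => ∑ i, 𝓕⁻ (fun ξ => _root_.symb i ξ * F ξ) x • coordC i :=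
      funext fun x => (hF.hasFDerivAt_fourierInv x).fderiv
    rw [this]
    exact ContDiff.sum fun i _ => (ih (hF.symb i)).smul contDiff_const

lemma differentiable_fourierInv (hF : RapidDecay F) : Differentiable ℝ (𝓕⁻ F) :=
  fun x => (hF.hasFDerivAt_fourierInv x).differentiableAt

lemma eLpNorm_fderiv_le (hF : RapidDecay F) :
    eLpNorm (fderiv ℝ (𝓕⁻ F)) 2 volume ≤ ∑ i, eLpNorm (pderiv i (𝓕⁻ F)) 2 volume := by
  have hc : ∀ i, Continuous (pderiv i (𝓕⁻ F)) := fun i => by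
    rw [hF.pderiv_fourierInv]; exact continuous_fourierInv (hF.symb i).integrable
  have h1 : ∀ x, ‖fderiv ℝ (𝓕⁻ F) x‖ ≤ (∑ i, fun x => ‖pderiv i (𝓕⁻ F) x‖) x := by
    intro x
    rw [(hF.hasFDerivAt_fourierInv x).fderiv, Finset.sum_apply]
    refine norm_sum_le_of_le _ fun i _ => ?_
    rw [hF.pderiv_fourierInv, norm_smul]
    exact mul_le_of_le_one_right (norm_nonneg _) (norm_coordC_le i)
  refine (eLpNorm_mono_real h1).trans ((eLpNorm_sum_le (fun i _ =>
    (hc i).norm.aestronglyMeasurable) one_le_two).trans_eq ?_)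
  simp_rw [eLpNorm_norm]

lemma memLp_mul_fourierInv (hF : RapidDecay F) {g : E3 → ℂ} (hg : MemLp g 2 volume) :
    MemLp (fun x => 𝓕⁻ F x * g x) 2 volume := by
  have hc := continuous_fourierInv hF.integrable
  refine (hg.norm.const_mul (∫ ξ, ‖F ξ‖)).mono' (hc.aestronglyMeasurable.mul hg.1)
    (ae_of_all _ fun x => ?_)
  rw [norm_mul]
  exact mul_le_mul_of_nonneg_right (norm_fourierInv_le F x) (norm_nonneg _)

/-- The product of two inverse Fourier transforms is the inverse transform of the convolution. -/
lemma fourierInv_mul (hF : RapidDecay F) (hG : RapidDecay G) :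
    (fun x => 𝓕⁻ F x * 𝓕⁻ G x) = 𝓕⁻ (_root_.cconv F G) := by
  have h : 𝓕 (fun x => 𝓕⁻ F x * 𝓕⁻ G x) = _root_.cconv F G := by
    ext ξ
    exact fourier_fourierInv_mul hF.integrable hF.memLp hG.integrable hG.memLp ξ
  have hc : Continuous fun x => 𝓕⁻ F x * 𝓕⁻ G x :=
    (continuous_fourierInv hF.integrable).mul (continuous_fourierInv hG.integrable)
  have hi : Integrable (fun x => 𝓕⁻ F x * 𝓕⁻ G x) volume :=
    hF.memLp_fourierInv.integrable_mul hG.memLp_fourierInv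
  have h2 := hc.fourierInv_fourier_eq hi (by rw [h]; exact (hF.cconv hG).integrable)
  rw [h] at h2
  exact h2.symm

/-- The second derivatives of a product, on the Fourier side. -/
lemma fourierInv_symb_symb_cconv (hF : RapidDecay F) (hG : RapidDecay G) (a : Fin 3) (x : E3) :
    𝓕⁻ (fun ξ => _root_.symb a ξ * (_root_.symb a ξ * _root_.cconv F G ξ)) x =
      pderiv a (pderiv a (𝓕⁻ F)) x * 𝓕⁻ G x + 2 * (pderiv a (𝓕⁻ F) x * pderiv a (𝓕⁻ G) x)
        + 𝓕⁻ F x * pderiv a (pderiv a (𝓕⁻ G)) x := by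
  have hN := hF.cconv hG
  rw [← (hN.symb a).pderiv_fourierInv, ← hN.pderiv_fourierInv, ← hF.fourierInv_mul hG]
  have hm : ∀ {H K : E3 → ℂ}, RapidDecay H → RapidDecay K →
      pderiv a (fun x => 𝓕⁻ H x * 𝓕⁻ K x) =
        fun x => 𝓕⁻ H x * pderiv a (𝓕⁻ K) x + 𝓕⁻ K x * pderiv a (𝓕⁻ H) x := by
    intro H K hH hK
    ext x
    rw [pderiv, fderiv_fun_mul (hH.differentiable_fourierInv x) (hK.differentiable_fourierInv x)]
    rfl
  have hd : ∀ {H K : E3 → ℂ}, RapidDecay H → RapidDecay K →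
      Differentiable ℝ fun x => 𝓕⁻ H x * 𝓕⁻ K x := fun hH hK =>
    hH.differentiable_fourierInv.mul hK.differentiable_fourierInv
  rw [hm hF hG, hF.pderiv_fourierInv, hG.pderiv_fourierInv]
  have h3 : ∀ {u v : E3 → ℂ}, Differentiable ℝ u → Differentiable ℝ v →
      pderiv a (fun x => u x + v x) x = pderiv a u x + pderiv a v x := by
    intro u v hu hv
    rw [pderiv, fderiv_fun_add (hu x) (hv x)]; rfl
  rw [h3 (hd hF (hG.symb a)) (hd hG (hF.symb a)), hm hF (hG.symb a), hm hG (hF.symb a)]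
  simp only [hF.pderiv_fourierInv, hG.pderiv_fourierInv]
  ring

end RapidDecay

/-! ### Sobolev and Gagliardo–Nirenberg inequalities -/

/-- The Sobolev inequality `‖v‖_6 ≤ C ‖∇v‖_2`, from compactly supported functions by cutoff. -/
lemma exists_eLpNorm_six_le : ∃ C : ℝ≥0, ∀ v : E3 → ℂ, ContDiff ℝ 1 v → MemLp v 2 volume →
    eLpNorm v 6 volume ≤ C * eLpNorm (fderiv ℝ v) 2 volume := by
  refine ⟨SNormLESNormFDerivOfEqConst ℂ (volume : Measure E3) 2, fun v hv hv2 => ?_⟩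
  set C := SNormLESNormFDerivOfEqConst ℂ (volume : Measure E3) 2
  obtain ⟨θ, hθ, hθc, hθ1, hθb⟩ := exists_smooth_cutoff
  obtain ⟨D, hD⟩ : ∃ D, ∀ x, ‖fderiv ℝ θ x‖ ≤ D :=
    (hθ.continuous_fderiv (by simp)).bounded_above_of_compact_support (hθc.fderiv ℝ)
  have hD0 : 0 ≤ D := (norm_nonneg _).trans (hD 0)
  set c : ℕ → ℝ := fun n => 1 / ((n : ℝ) + 1)
  have hc0 : ∀ n, 0 < c n := fun n => by positivity
  -- the cutoffs `w n` tend to `v`; their gradients differ from `∇v` by `O(1/n)` in `L²`; Fatou's lemma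
  -- gives the inequality in the limit
  set w : ℕ → E3 → ℂ := fun n x => θ (c n • x) • v x
  have hθn : ∀ n, ContDiff ℝ 1 fun x => θ (c n • x) := fun n =>
    (hθ.of_le (by simp)).comp (contDiff_const_smul (c n))
  have hw : ∀ n, ContDiff ℝ 1 (w n) := fun n => (hθn n).smul hv
  have hwc : ∀ n, HasCompactSupport (w n) := fun n => (hθc.comp_smul (hc0 n).ne').smul_right
  have hdθ : ∀ n x, ‖fderiv ℝ (fun x => θ (c n • x)) x‖ ≤ c n * D := by
    intro n x
    have h1 : HasFDerivAt (fun x : E3 => c n • x) (c n • ContinuousLinearMap.id ℝ E3) x :=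
      (hasFDerivAt_id x).const_smul (c n)
    have h2 := ((hθ.differentiable (by simp) (c n • x)).hasFDerivAt.comp x h1).fderiv
    change fderiv ℝ (θ ∘ fun x => c n • x) x = _ at h2
    change ‖fderiv ℝ (θ ∘ fun x => c n • x) x‖ ≤ _
    rw [h2, ContinuousLinearMap.comp_smul, norm_smul, ContinuousLinearMap.comp_id,
      Real.norm_of_nonneg (hc0 n).le]
    exact mul_le_mul_of_nonneg_left (hD _) (hc0 n).le
  have hdw : ∀ n x, ‖fderiv ℝ (w n) x‖ ≤ ‖fderiv ℝ v x‖ + c n * D * ‖v x‖ := by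
    intro n x
    rw [fderiv_fun_smul ((hθn n).differentiable one_ne_zero x) (hv.differentiable one_ne_zero x)]
    refine (norm_add_le _ _).trans (add_le_add ?_ ?_)
    · rw [norm_smul]
      exact mul_le_of_le_one_left (norm_nonneg _) (hθb _)
    · rw [ContinuousLinearMap.norm_smulRight_apply]
      exact mul_le_mul_of_nonneg_right (hdθ n x) (norm_nonneg _)
  have hfin : Module.finrank ℝ E3 = 3 := by simp
  have hS : ∀ n, eLpNorm (w n) 6 volume ≤ C * (eLpNorm (fderiv ℝ v) 2 volume
      + ENNReal.ofReal (c n * D) * eLpNorm v 2 volume) := by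
    intro n
    have h1 := eLpNorm_le_eLpNorm_fderiv_of_eq (F := ℂ) (volume : Measure E3) (hw n) (hwc n)
      (p := 2) (p' := 6) one_le_two (by rw [hfin]; norm_num) (by rw [hfin]; norm_num)
    refine h1.trans (mul_le_mul' le_rfl ?_)
    have h2 : eLpNorm (fderiv ℝ (w n)) 2 volume
        ≤ eLpNorm (fun x => ‖fderiv ℝ v x‖ + c n * D * ‖v x‖) 2 volume :=
      eLpNorm_mono_real (hdw n)
    refine h2.trans ((eLpNorm_add_le (hv.continuous_fderiv one_ne_zero).norm.aestronglyMeasurable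
      (continuous_const.mul hv.continuous.norm).aestronglyMeasurable one_le_two).trans ?_)
    rw [eLpNorm_norm]
    refine add_le_add le_rfl ?_
    have h3 := eLpNorm_const_smul_le (c := c n * D) (f := fun x => ‖v x‖) (p := 2)
      (μ := (volume : Measure E3))
    rw [eLpNorm_norm, Real.enorm_of_nonneg (mul_nonneg (hc0 n).le hD0)] at h3
    exact h3
  have hlim : ∀ x, Tendsto (fun n => w n x) atTop (𝓝 (v x)) := by
    intro x
    have h1 : Tendsto (fun n => c n • x) atTop (𝓝 ((0 : ℝ) • x)) :=
      tendsto_one_div_add_atTop_nhds_zero_nat.smul_const x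
    have h2 := (hθ.continuous.tendsto _).comp h1
    rw [zero_smul, hθ1 0 (by simp)] at h2
    simpa [w] using h2.smul_const (v x)
  have h1 := Lp.eLpNorm_lim_le_liminf_eLpNorm (p := 6) (μ := (volume : Measure E3))
    (fun n => (hw n).continuous.aestronglyMeasurable) v (ae_of_all _ hlim)
  refine h1.trans ((liminf_le_liminf (Eventually.of_forall hS)).trans_eq ?_)
  refine Tendsto.liminf_eq ?_
  have h2 : Tendsto (fun n => ENNReal.ofReal (c n * D) * eLpNorm v 2 volume) atTop
      (𝓝 (0 * eLpNorm v 2 volume)) := by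
    refine ENNReal.Tendsto.mul_const ?_ (Or.inr hv2.2.ne)
    have := ENNReal.tendsto_ofReal
      (tendsto_one_div_add_atTop_nhds_zero_nat (𝕜 := ℝ).mul_const D)
    simpa [c] using this
  have h3 := ENNReal.Tendsto.const_mul (a := (C : ℝ≥0∞))
    (tendsto_const_nhds (x := eLpNorm (fderiv ℝ v) 2 volume).add h2) (Or.inr ENNReal.coe_ne_top)
  simpa using h3

/-- Hölder's inequality combined with the interpolation of `L^q`, `1/p + 1/q = 1/2`, between `L^2`
and `L^6`. For `p = ∞` the exponent `3 / p.toReal` is `0`. -/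
lemma eLpNorm_mul_le_interpolate {p : ℝ≥0∞} (hp : 3 < p) {f v : E3 → ℂ}
    (hf : AEStronglyMeasurable f volume) (hv : AEStronglyMeasurable v volume) :
    eLpNorm (fun x => f x * v x) 2 volume ≤ eLpNorm f p volume *
      (eLpNorm v 2 volume ^ (1 - 3 / p.toReal) * eLpNorm v 6 volume ^ (3 / p.toReal)) := by
  rcases eq_or_ne p ⊤ with rfl | hpt
  · have := eLpNorm_smul_le_eLpNorm_top_mul_eLpNorm 2 hv f
    simpa using (show eLpNorm (fun x => f x * v x) 2 volume ≤ _ from this)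
  set P := p.toReal with hP
  have hP3 : 3 < P := by
    rw [hP]
    simpa using (ENNReal.toReal_lt_toReal (by simp) hpt).2 hp
  have hP0 : 0 < P := by linarith
  have hp0 : p ≠ 0 := (lt_trans (by norm_num) hp).ne'
  have hmf : AEMeasurable (fun x => ‖f x‖ₑ ^ P) volume := hf.enorm.pow_const P
  have hmv : ∀ r : ℝ, AEMeasurable (fun x => ‖v x‖ₑ ^ r) volume := fun r => hv.enorm.pow_const r
  have hθ : 3 / P ≤ 1 := by rw [div_le_one hP0]; exact hP3.le
  -- Hölder's inequality for `|f v|² = (|f|^P)^{2/P} (|v|²)^{1-3/P} (|v|⁶)^{1/P}`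
  have key := ENNReal.lintegral_prod_norm_pow_le (μ := (volume : Measure E3)) Finset.univ
    (f := ![fun x => ‖f x‖ₑ ^ P, fun x => ‖v x‖ₑ ^ (2 : ℝ), fun x => ‖v x‖ₑ ^ (6 : ℝ)])
    (p := ![2 / P, 1 - 3 / P, 1 / P]) (by
      intro i _
      fin_cases i
      · exact hmf
      · exact hmv 2
      · exact hmv 6)
    (by simp only [Fin.sum_univ_three]; simp; field_simp; ring) (by
      intro i _
      fin_cases i
      · exact (div_pos two_pos hP0).le
      · exact sub_nonneg.2 hθ
      · exact (div_pos one_pos hP0).le)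
  simp only [Fin.prod_univ_three] at key
  simp only [Matrix.cons_val_zero, Matrix.cons_val_one, Matrix.cons_val] at key
  have e1 : ∀ x, ‖f x * v x‖ₑ ^ (2 : ℝ) = (‖f x‖ₑ ^ P) ^ (2 / P) *
      (‖v x‖ₑ ^ (2 : ℝ)) ^ (1 - 3 / P) * (‖v x‖ₑ ^ (6 : ℝ)) ^ (1 / P) := by
    intro x
    rw [enorm_mul, ENNReal.mul_rpow_of_nonneg _ _ two_pos.le, ← ENNReal.rpow_mul,
      ← ENNReal.rpow_mul, ← ENNReal.rpow_mul, mul_assoc,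
      ← ENNReal.rpow_add_of_nonneg _ _ (by have := sub_nonneg.2 hθ; positivity) (by positivity)]
    congr 2
    · field_simp
    · field_simp; ring
  rw [← lintegral_congr e1] at key
  rw [eLpNorm_eq_lintegral_rpow_enorm_toReal two_ne_zero ENNReal.ofNat_ne_top,
    eLpNorm_eq_lintegral_rpow_enorm_toReal two_ne_zero ENNReal.ofNat_ne_top,
    eLpNorm_eq_lintegral_rpow_enorm_toReal (p := 6) (by norm_num) ENNReal.ofNat_ne_top,
    eLpNorm_eq_lintegral_rpow_enorm_toReal hp0 hpt, ← hP]
  simp only [ENNReal.toReal_ofNat]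
  refine (ENNReal.rpow_le_rpow key (by norm_num : (0 : ℝ) ≤ 1 / 2)).trans_eq ?_
  rw [ENNReal.mul_rpow_of_nonneg _ _ (by norm_num), ENNReal.mul_rpow_of_nonneg _ _ (by norm_num),
    mul_assoc]
  simp only [← ENNReal.rpow_mul]
  rw [show 2 / P * (1 / 2) = 1 / P by field_simp,
    show (1 - 3 / P) * (1 / 2) = 1 / 2 * (1 - 3 / P) by ring,
    show 1 / P * (1 / 2) = 1 / 6 * (3 / P) by field_simp; norm_num]

lemma enorm_integral_mul_conj_self {k : E3 → ℂ} (hk : MemLp k 2 volume) :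
    ‖∫ x, k x * (starRingEnd ℂ) (k x)‖ₑ = eLpNorm k 2 volume ^ 2 := by
  have h1 : ∀ x, k x * (starRingEnd ℂ) (k x) = ((‖k x‖ ^ 2 : ℝ) : ℂ) := by
    intro x; rw [Complex.mul_conj, Complex.normSq_eq_norm_sq]
  simp_rw [h1]
  have hi : Integrable (fun x => ‖k x‖ ^ 2) volume := hk.integrable_norm_pow two_ne_zero
  rw [integral_complex_ofReal, eLpNorm_two_sq]
  have h2 := ofReal_integral_eq_lintegral_ofReal hi (ae_of_all _ fun x => by positivity)
  have h3 : ∀ x, ENNReal.ofReal (‖k x‖ ^ 2) = ‖k x‖ₑ ^ 2 := by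
    intro x; rw [ENNReal.ofReal_pow (norm_nonneg _), ofReal_norm]
  simp_rw [h3] at h2
  rw [← h2, ← ofReal_norm, Complex.norm_real, Real.norm_of_nonneg (integral_nonneg fun x => by positivity)]

namespace RapidDecay

variable {F G : E3 → ℂ}

/-- The partial derivatives of a real function are real. -/
lemma conj_pderiv {f : E3 → ℂ} (hf : Differentiable ℝ f)
    (hr : ∀ x, (starRingEnd ℂ) (f x) = f x) (a : Fin 3) (x : E3) :
    (starRingEnd ℂ) (pderiv a f x) = pderiv a f x := by
  have h1 := (Complex.conjCLE.toContinuousLinearMap.hasFDerivAt.comp x (hf x).hasFDerivAt).fderiv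
  have h2 : (Complex.conjCLE.toContinuousLinearMap : ℂ → ℂ) ∘ f = f := funext hr
  rw [h2] at h1
  conv_rhs => rw [pderiv, h1]
  rfl

/-- For real `f`, an integration by parts gives `∫ (∂f)⁴ = -3 ∫ f (∂f)² ∂²f`. -/
lemma eLpNorm_pderiv_sq_le (hF : RapidDecay F) (hr : ∀ x, (starRingEnd ℂ) (𝓕⁻ F x) = 𝓕⁻ F x)
    (a : Fin 3) : eLpNorm (fun x => pderiv a (𝓕⁻ F) x * pderiv a (𝓕⁻ F) x) 2 volume ≤
      3 * eLpNorm (fun x => 𝓕⁻ F x * pderiv a (pderiv a (𝓕⁻ F)) x) 2 volume := by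
  have hgr := conj_pderiv hF.differentiable_fourierInv hr a
  rw [hF.pderiv_fourierInv] at hgr ⊢
  set G := fun ξ => _root_.symb a ξ * F ξ with hG
  have hGd : RapidDecay G := hF.symb a
  have hG2 := hGd.cconv hGd
  have hG3 := hGd.cconv hG2
  have hg2 := hGd.fourierInv_mul hGd
  have hg3 := hGd.fourierInv_mul hG2
  have hdd := hGd.symb a
  have ed := hGd.pderiv_fourierInv a
  have hm2 : MemLp (fun x => 𝓕⁻ G x * 𝓕⁻ G x) 2 volume := by rw [hg2]; exact hG2.memLp_fourierInv
  have hmf : MemLp (fun x => 𝓕⁻ F x * pderiv a (𝓕⁻ G) x) 2 volume := by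
    rw [ed]; exact hF.memLp_mul_fourierInv hdd.memLp_fourierInv
  -- the cube of `g = ∂f` and its derivative
  have hd3 : ∀ x, pderiv a (fun x => 𝓕⁻ G x * (𝓕⁻ G x * 𝓕⁻ G x)) x
      = 3 * ((𝓕⁻ G x * 𝓕⁻ G x) * pderiv a (𝓕⁻ G) x) := by
    intro x
    have hd := hGd.differentiable_fourierInv
    rw [pderiv, fderiv_fun_mul (hd x) ((hd x).fun_mul (hd x)), fderiv_fun_mul (hd x) (hd x)]
    simp only [pderiv, add_apply, smul_apply, smul_eq_mul]
    ring
  have h3eq : (fun x => 𝓕⁻ G x * (𝓕⁻ G x * 𝓕⁻ G x)) = 𝓕⁻ (_root_.cconv G (_root_.cconv G G)) := by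
    rw [← hg3]; ext x; rw [← congrFun hg2 x]
  have i1 : Integrable (fun x => pderiv a (fun x => 𝓕⁻ G x * (𝓕⁻ G x * 𝓕⁻ G x)) x * 𝓕⁻ F x)
      volume := by
    rw [h3eq, hG3.pderiv_fourierInv]
    exact (hG3.symb a).memLp_fourierInv.integrable_mul hF.memLp_fourierInv
  have i2 : Integrable (fun x => (𝓕⁻ G x * (𝓕⁻ G x * 𝓕⁻ G x)) * pderiv a (𝓕⁻ F) x) volume := by
    rw [hF.pderiv_fourierInv]
    have : MemLp (fun x => 𝓕⁻ G x * (𝓕⁻ G x * 𝓕⁻ G x)) 2 volume := by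
      rw [h3eq]; exact hG3.memLp_fourierInv
    exact this.integrable_mul hGd.memLp_fourierInv
  have i3 : Integrable (fun x => (𝓕⁻ G x * (𝓕⁻ G x * 𝓕⁻ G x)) * 𝓕⁻ F x) volume := by
    have : MemLp (fun x => 𝓕⁻ G x * (𝓕⁻ G x * 𝓕⁻ G x)) 2 volume := by
      rw [h3eq]; exact hG3.memLp_fourierInv
    exact this.integrable_mul hF.memLp_fourierInv
  have hd3' : Differentiable ℝ fun x => 𝓕⁻ G x * (𝓕⁻ G x * 𝓕⁻ G x) := by
    rw [h3eq]; exact hG3.differentiable_fourierInv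
  have hibp := integral_mul_fderiv_eq_neg_fderiv_mul_of_integrable i1 i2 i3
    (fun x _ => hd3' x) (fun x _ => hF.differentiable_fourierInv x)
  have e1 : ∫ x, (𝓕⁻ G x * 𝓕⁻ G x) * (starRingEnd ℂ) (𝓕⁻ G x * 𝓕⁻ G x)
      = -3 * ∫ x, (𝓕⁻ G x * 𝓕⁻ G x) * (𝓕⁻ F x * pderiv a (𝓕⁻ G) x) := by
    calc _ = ∫ x, (𝓕⁻ G x * (𝓕⁻ G x * 𝓕⁻ G x)) * pderiv a (𝓕⁻ F) x := by
          congr 1; ext x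
          rw [map_mul, hgr, hF.pderiv_fourierInv]; ring
      _ = - ∫ x, pderiv a (fun x => 𝓕⁻ G x * (𝓕⁻ G x * 𝓕⁻ G x)) x * 𝓕⁻ F x := hibp
      _ = _ := by
          rw [neg_mul, ← integral_const_mul]
          congr 2; ext x
          rw [hd3]; ring
  have h1 := enorm_integral_mul_conj_self hm2
  rw [e1, enorm_mul] at h1
  have h2 := enorm_integral_mul_le hm2 hmf
  have h3 : ‖(-3 : ℂ)‖ₑ = 3 := by
    rw [← ofReal_norm]; simp
  rw [h3] at h1
  set A := eLpNorm (fun x => 𝓕⁻ G x * 𝓕⁻ G x) 2 volume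
  set B := eLpNorm (fun x => 𝓕⁻ F x * pderiv a (𝓕⁻ G) x) 2 volume
  -- `A² ≤ 3 A B`, and `A` can be cancelled since it is finite
  rcases eq_or_ne A 0 with h0 | h0
  · rw [h0]; exact bot_le
  have h4 : A * A ≤ A * (3 * B) := by
    rw [← sq, ← h1, mul_left_comm]
    exact mul_le_mul' le_rfl h2
  exact (ENNReal.mul_le_mul_iff_right h0 hm2.2.ne).1 h4

/-- The second derivatives of a product of real functions are controlled, in `L²`, by products of
an undifferentiated and a twice differentiated factor. -/
lemma eLpNorm_symb_symb_cconv_le (hF : RapidDecay F) (hG : RapidDecay G)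
    (hFr : ∀ x, (starRingEnd ℂ) (𝓕⁻ F x) = 𝓕⁻ F x) (hGr : ∀ x, (starRingEnd ℂ) (𝓕⁻ G x) = 𝓕⁻ G x)
    (a : Fin 3) :
    eLpNorm (fun ξ => _root_.symb a ξ * (_root_.symb a ξ * _root_.cconv F G ξ)) 2 volume ≤
      eLpNorm (fun x => 𝓕⁻ G x * pderiv a (pderiv a (𝓕⁻ F)) x) 2 volume +
      (3 * eLpNorm (fun x => 𝓕⁻ F x * pderiv a (pderiv a (𝓕⁻ F)) x) 2 volume +
       3 * eLpNorm (fun x => 𝓕⁻ G x * pderiv a (pderiv a (𝓕⁻ G)) x) 2 volume) +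
      eLpNorm (fun x => 𝓕⁻ F x * pderiv a (pderiv a (𝓕⁻ G)) x) 2 volume := by
  rw [← (((hF.cconv hG).symb a).symb a).isFourierPair.eLpNorm_eq]
  have e : 𝓕⁻ (fun ξ => _root_.symb a ξ * (_root_.symb a ξ * _root_.cconv F G ξ)) = fun x =>
      𝓕⁻ G x * pderiv a (pderiv a (𝓕⁻ F)) x + 2 * (pderiv a (𝓕⁻ F) x * pderiv a (𝓕⁻ G) x)
        + 𝓕⁻ F x * pderiv a (pderiv a (𝓕⁻ G)) x := by
    ext x; rw [hF.fourierInv_symb_symb_cconv hG]; ring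
  rw [e]
  have hc : ∀ {H : E3 → ℂ}, RapidDecay H → Continuous (𝓕⁻ H) := fun hH =>
    continuous_fourierInv hH.integrable
  have c1 : ∀ {H : E3 → ℂ}, RapidDecay H → Continuous (pderiv a (𝓕⁻ H)) := fun hH => by
    rw [hH.pderiv_fourierInv]; exact hc (hH.symb a)
  have c2 : ∀ {H : E3 → ℂ}, RapidDecay H → Continuous (pderiv a (pderiv a (𝓕⁻ H))) := fun hH => by
    rw [hH.pderiv_fourierInv]; exact c1 (hH.symb a)
  have m1 := ((hc hG).mul (c2 hF)).aestronglyMeasurable (μ := volume)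
  have m2 := (continuous_const (y := (2 : ℂ)).mul ((c1 hF).mul (c1 hG))).aestronglyMeasurable
    (μ := volume)
  have m3 := ((hc hF).mul (c2 hG)).aestronglyMeasurable (μ := volume)
  refine (eLpNorm_add_le (m1.add m2) m3 one_le_two).trans (add_le_add ?_ le_rfl)
  refine (eLpNorm_add_le m1 m2 one_le_two).trans (add_le_add le_rfl ?_)
  have h2 : eLpNorm (fun x => 2 * (pderiv a (𝓕⁻ F) x * pderiv a (𝓕⁻ G) x)) 2 volume ≤
      eLpNorm (fun x => ‖pderiv a (𝓕⁻ F) x * pderiv a (𝓕⁻ F) x‖ +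
        ‖pderiv a (𝓕⁻ G) x * pderiv a (𝓕⁻ G) x‖) 2 volume := by
    refine eLpNorm_mono_real fun x => ?_
    simp only [norm_mul, Complex.norm_ofNat]
    nlinarith [sq_nonneg (‖pderiv a (𝓕⁻ F) x‖ - ‖pderiv a (𝓕⁻ G) x‖)]
  refine h2.trans ((eLpNorm_add_le ((c1 hF).mul (c1 hF)).norm.aestronglyMeasurable
    ((c1 hG).mul (c1 hG)).norm.aestronglyMeasurable one_le_two).trans ?_)
  rw [eLpNorm_norm, eLpNorm_norm]
  exact add_le_add (hF.eLpNorm_pderiv_sq_le hFr a) (hG.eLpNorm_pderiv_sq_le hGr a)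

end RapidDecay

/-! ### The energy estimate -/

/-- The symbol `4π²|ξ|²` of `-Δ`. -/
noncomputable def lapSymb (ξ : E3) : ℝ := 4 * Real.pi ^ 2 * ‖ξ‖ ^ 2

lemma lapSymb_nonneg (ξ : E3) : 0 ≤ lapSymb ξ := by unfold lapSymb; positivity

lemma damp_eq_mul_lapSymb (μ : ℝ) (ξ : E3) : damp μ ξ = μ * lapSymb ξ := by
  unfold damp lapSymb; ring

lemma sum_norm_symb_sq (ξ : E3) : ∑ a, ‖symb a ξ‖ ^ 2 = lapSymb ξ := by
  rw [lapSymb, EuclideanSpace.norm_sq_eq, Finset.mul_sum]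
  refine Finset.sum_congr rfl fun a _ => ?_
  simp only [symb, norm_mul, Complex.norm_ofNat, Complex.norm_I, Complex.norm_real, mul_one]
  rw [Real.norm_of_nonneg Real.pi_pos.le]; ring

lemma norm_symb_sq_le (a : Fin 3) (ξ : E3) : ‖symb a ξ‖ ^ 2 ≤ lapSymb ξ := by
  rw [← sum_norm_symb_sq]
  exact Finset.single_le_sum (f := fun a => ‖symb a ξ‖ ^ 2) (fun i _ => by positivity)
    (Finset.mem_univ a)

lemma lapSymb_eq (ξ : E3) : (lapSymb ξ : ℂ) = -∑ a, symb a ξ * symb a ξ := by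
  rw [sum_symb_sq, neg_neg, lapSymb]

/-- The weight `1 + (4π²|ξ|²)²` of the `H²` norm. -/
noncomputable def sobWeight (ξ : E3) : ℝ := 1 + lapSymb ξ ^ 2

lemma sobWeight_pos (ξ : E3) : 0 < sobWeight ξ := by unfold sobWeight; positivity

lemma isMultiplier_lapSymb : IsMultiplier fun ξ => (lapSymb ξ : ℂ) := by
  have h := isMultiplier_damp 1
  simpa [damp_eq_mul_lapSymb] using h

lemma IsMultiplier.add {c d : E3 → ℂ} (hc : IsMultiplier c) (hd : IsMultiplier d) :
    IsMultiplier fun ξ => c ξ + d ξ := by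
  obtain ⟨h1, C, l, hC, hcl⟩ := hc
  obtain ⟨h2, D, k, hD, hdk⟩ := hd
  refine ⟨h1.add h2, C + D, l + k, by positivity, fun ξ => (norm_add_le _ _).trans ?_⟩
  have h : 1 ≤ 1 + ‖ξ‖ := by linarith [norm_nonneg ξ]
  rw [add_mul]
  gcongr
  · exact (hcl ξ).trans (by gcongr; first | exact h | omega)
  · exact (hdk ξ).trans (by gcongr; first | exact h | omega)

lemma isMultiplier_sobWeight : IsMultiplier fun ξ => (sobWeight ξ : ℂ) := by
  have h := (isMultiplier_const 1).add (isMultiplier_lapSymb.mul isMultiplier_lapSymb)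
  have e : (fun ξ => (sobWeight ξ : ℂ)) = fun ξ => 1 + (lapSymb ξ : ℂ) * lapSymb ξ := by
    ext ξ; rw [sobWeight]; push_cast; ring
  rwa [e]

/-- The squared `H²` norm of a velocity field, on the Fourier side. -/
noncomputable def energy (V : Fin 3 → E3 → ℂ) : ℝ := ∫ ξ, sobWeight ξ * ∑ j, ‖V j ξ‖ ^ 2

/-- The squared `H²` norm of the gradient of a velocity field, on the Fourier side. -/
noncomputable def dissipation (V : Fin 3 → E3 → ℂ) : ℝ :=
  ∫ ξ, sobWeight ξ * lapSymb ξ * ∑ j, ‖V j ξ‖ ^ 2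

/-- The time derivative of the energy along a flow. -/
noncomputable def energyRate (μ : ℝ) (V : Fin 3 → E3 → ℂ) : ℝ :=
  ∫ ξ, sobWeight ξ * ∑ j, 2 * ((starRingEnd ℂ) (V j ξ) *
    (-damp μ ξ * V j ξ + nonlin (fun k l => cconv (V k) (V l) ξ) j ξ)).re

/-- By incompressibility the pressure does no work. -/
lemma sum_conj_mul_nonlin {v : Fin 3 → ℂ} {ξ : E3} (N : Fin 3 → Fin 3 → ℂ)
    (hv : ∑ j, symb j ξ * v j = 0) :
    ∑ j, (starRingEnd ℂ) (v j) * nonlin N j ξ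
      = -∑ j, ∑ k, (starRingEnd ℂ) (v j) * (symb k ξ * N k j) := by
  have hpi : (Real.pi : ℂ) ≠ 0 := by exact_mod_cast Real.pi_ne_zero
  have h1 : ∑ j, ((ξ j : ℝ) : ℂ) * (starRingEnd ℂ) (v j) = 0 := by
    have h := congrArg (starRingEnd ℂ) hv
    rw [map_sum, Fin.sum_univ_three] at h
    rw [Fin.sum_univ_three]
    simp only [map_mul, symb, Complex.conj_I, Complex.conj_ofReal, map_zero, map_ofNat] at h
    have h2 : (2 * (Real.pi : ℂ) * -Complex.I) * (((ξ 0 : ℝ) : ℂ) * (starRingEnd ℂ) (v 0) +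
      ((ξ 1 : ℝ) : ℂ) * (starRingEnd ℂ) (v 1) + ((ξ 2 : ℝ) : ℂ) * (starRingEnd ℂ) (v 2)) = 0 := by
      linear_combination h
    refine (mul_eq_zero.1 h2).resolve_left ?_
    simp [hpi]
  have h3 : ∀ l, ∑ j, (starRingEnd ℂ) (v j) * (riesz j l ξ : ℂ) = 0 := by
    intro l
    have : ∀ j, (starRingEnd ℂ) (v j) * (riesz j l ξ : ℂ)
        = (((ξ l : ℝ) : ℂ) / (‖ξ‖ : ℂ) ^ 2) * (((ξ j : ℝ) : ℂ) * (starRingEnd ℂ) (v j)) := by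
      intro j; rw [riesz]; push_cast; ring
    simp_rw [this]
    rw [← Finset.mul_sum, h1, mul_zero]
  simp only [nonlin, Fin.sum_univ_three] at h3 ⊢
  linear_combination (symb 0 ξ * N 0 0 + symb 1 ξ * N 1 0 + symb 2 ξ * N 2 0) * h3 0 +
    (symb 0 ξ * N 0 1 + symb 1 ξ * N 1 1 + symb 2 ξ * N 2 1) * h3 1 +
    (symb 0 ξ * N 0 2 + symb 1 ξ * N 1 2 + symb 2 ξ * N 2 2) * h3 2

lemma sum_re_conj_mul_le {μ : ℝ} {v : Fin 3 → ℂ} {ξ : E3} (N : Fin 3 → Fin 3 → ℂ)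
    (hv : ∑ j, symb j ξ * v j = 0) :
    ∑ j, 2 * ((starRingEnd ℂ) (v j) * (-damp μ ξ * v j + nonlin N j ξ)).re ≤
      -(2 * μ) * (lapSymb ξ * ∑ j, ‖v j‖ ^ 2) + 2 * ∑ j, ∑ k, ‖symb k ξ * v j‖ * ‖N k j‖ := by
  have h1 : ∑ j, 2 * ((starRingEnd ℂ) (v j) * (-damp μ ξ * v j + nonlin N j ξ)).re
      = -(2 * μ) * (lapSymb ξ * ∑ j, ‖v j‖ ^ 2)
        + 2 * (∑ j, (starRingEnd ℂ) (v j) * nonlin N j ξ).re := by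
    rw [Complex.re_sum, Finset.mul_sum, Finset.mul_sum, Finset.mul_sum, ← Finset.sum_add_distrib]
    refine Finset.sum_congr rfl fun j _ => ?_
    have e : (starRingEnd ℂ) (v j) * (-damp μ ξ * v j + nonlin N j ξ)
        = ((-(μ * lapSymb ξ * ‖v j‖ ^ 2) : ℝ) : ℂ) + (starRingEnd ℂ) (v j) * nonlin N j ξ := by
      have := Complex.conj_mul' (v j)
      rw [damp_eq_mul_lapSymb]; push_cast
      linear_combination (-(μ : ℂ) * lapSymb ξ) * this
    rw [e, Complex.add_re, Complex.ofReal_re]; ring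
  rw [h1, sum_conj_mul_nonlin N hv]
  refine add_le_add le_rfl (mul_le_mul_of_nonneg_left ?_ two_pos.le)
  refine (Complex.re_le_norm _).trans ?_
  rw [norm_neg]
  refine norm_sum_le_of_le _ fun j _ => norm_sum_le_of_le _ fun k _ => ?_
  simp only [norm_mul, RCLike.norm_conj]
  exact le_of_eq (by ring)

lemma eLpNorm_le_of_norm_sq_le {G : E3 → ℂ} {q : E3 → ℝ} (hq : Integrable q volume)
    (h : ∀ ξ, ‖G ξ‖ ^ 2 ≤ q ξ) :
    eLpNorm G 2 volume ≤ ENNReal.ofReal (∫ ξ, q ξ) ^ (1 / 2 : ℝ) := by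
  have h1 : eLpNorm G 2 volume ^ 2 ≤ ENNReal.ofReal (∫ ξ, q ξ) := by
    rw [eLpNorm_two_sq, ofReal_integral_eq_lintegral_ofReal hq
      (ae_of_all _ fun ξ => (sq_nonneg _).trans (h ξ))]
    refine lintegral_mono fun ξ => ?_
    rw [← ofReal_norm, ← ENNReal.ofReal_pow (norm_nonneg _)]
    exact ENNReal.ofReal_le_ofReal (h ξ)
  have h2 := ENNReal.rpow_le_rpow h1 (by norm_num : (0 : ℝ) ≤ 1 / 2)
  rwa [← ENNReal.rpow_natCast, ← ENNReal.rpow_mul, Nat.cast_ofNat, mul_one_div_cancel two_ne_zero,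
    ENNReal.rpow_one] at h2

lemma RapidDecay.integrable_norm_mul {F G : E3 → ℂ} (hF : RapidDecay F) (hG : RapidDecay G) :
    Integrable (fun ξ => ‖F ξ‖ * ‖G ξ‖) volume := by
  have := (hF.memLp.integrable_mul hG.memLp).norm
  simpa using this

lemma RapidDecay.integrable_sobWeight_mul {F G : E3 → ℂ} (hF : RapidDecay F) (hG : RapidDecay G) :
    Integrable (fun ξ => sobWeight ξ * (‖F ξ‖ * ‖G ξ‖)) volume := by
  have := (hF.mul isMultiplier_sobWeight).integrable_norm_mul hG
  refine this.congr (ae_of_all _ fun ξ => ?_)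
  simp only [norm_mul, Complex.norm_real, Real.norm_of_nonneg (sobWeight_pos ξ).le]
  ring

lemma integrable_energy {V : Fin 3 → E3 → ℂ} (hV : ∀ j, RapidDecay (V j)) :
    Integrable (fun ξ => sobWeight ξ * ∑ j, ‖V j ξ‖ ^ 2) volume := by
  simp_rw [Finset.mul_sum, sq]
  exact integrable_finsetSum _ fun j _ => (hV j).integrable_sobWeight_mul (hV j)

lemma integrable_dissipation {V : Fin 3 → E3 → ℂ} (hV : ∀ j, RapidDecay (V j)) :
    Integrable (fun ξ => sobWeight ξ * lapSymb ξ * ∑ j, ‖V j ξ‖ ^ 2) volume := by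
  have h : ∀ j, Integrable (fun ξ => sobWeight ξ * (‖(lapSymb ξ : ℂ) * V j ξ‖ * ‖V j ξ‖)) volume :=
    fun j => ((hV j).mul isMultiplier_lapSymb).integrable_sobWeight_mul (hV j)
  simp_rw [Finset.mul_sum]
  refine integrable_finsetSum _ fun j _ => (h j).congr (ae_of_all _ fun ξ => ?_)
  simp only [norm_mul, Complex.norm_real, Real.norm_of_nonneg (lapSymb_nonneg ξ)]
  ring

lemma energy_nonneg (V : Fin 3 → E3 → ℂ) : 0 ≤ energy V :=
  integral_nonneg fun ξ => mul_nonneg (sobWeight_pos ξ).le (Finset.sum_nonneg fun j _ => by positivity)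

lemma dissipation_nonneg (V : Fin 3 → E3 → ℂ) : 0 ≤ dissipation V :=
  integral_nonneg fun ξ => mul_nonneg (mul_nonneg (sobWeight_pos ξ).le (lapSymb_nonneg ξ))
    (Finset.sum_nonneg fun j _ => by positivity)

section

variable {V : Fin 3 → E3 → ℂ}

lemma eLpNorm_le_energy (hV : ∀ j, RapidDecay (V j)) {G : E3 → ℂ} (j : Fin 3)
    (h : ∀ ξ, ‖G ξ‖ ^ 2 ≤ sobWeight ξ * ‖V j ξ‖ ^ 2) :
    eLpNorm G 2 volume ≤ ENNReal.ofReal (energy V) ^ (1 / 2 : ℝ) :=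
  eLpNorm_le_of_norm_sq_le (integrable_energy hV) fun ξ => (h ξ).trans
    (mul_le_mul_of_nonneg_left (Finset.single_le_sum (f := fun j => ‖V j ξ‖ ^ 2)
      (fun i _ => by positivity) (Finset.mem_univ j)) (sobWeight_pos ξ).le)

lemma eLpNorm_le_dissipation (hV : ∀ j, RapidDecay (V j)) {G : E3 → ℂ} (j : Fin 3)
    (h : ∀ ξ, ‖G ξ‖ ^ 2 ≤ sobWeight ξ * lapSymb ξ * ‖V j ξ‖ ^ 2) :
    eLpNorm G 2 volume ≤ ENNReal.ofReal (dissipation V) ^ (1 / 2 : ℝ) :=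
  eLpNorm_le_of_norm_sq_le (integrable_dissipation hV) fun ξ => (h ξ).trans
    (mul_le_mul_of_nonneg_left (Finset.single_le_sum (f := fun j => ‖V j ξ‖ ^ 2)
      (fun i _ => by positivity) (Finset.mem_univ j))
      (mul_nonneg (sobWeight_pos ξ).le (lapSymb_nonneg ξ)))

lemma one_le_sobWeight (ξ : E3) : 1 ≤ sobWeight ξ := by
  unfold sobWeight; nlinarith [sq_nonneg (lapSymb ξ)]

lemma lapSymb_sq_le (ξ : E3) : lapSymb ξ ^ 2 ≤ sobWeight ξ := by unfold sobWeight; linarith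

lemma eLpNorm_zero_le_energy (hV : ∀ j, RapidDecay (V j)) (j : Fin 3) :
    eLpNorm (V j) 2 volume ≤ ENNReal.ofReal (energy V) ^ (1 / 2 : ℝ) :=
  eLpNorm_le_energy hV j fun ξ => le_mul_of_one_le_left (sq_nonneg _) (one_le_sobWeight ξ)

lemma norm_symb_mul_symb_sq_le (a b : Fin 3) (ξ : E3) :
    (‖symb a ξ‖ * ‖symb b ξ‖) ^ 2 ≤ lapSymb ξ ^ 2 := by
  rw [mul_pow, sq (lapSymb ξ)]
  exact mul_le_mul (norm_symb_sq_le a ξ) (norm_symb_sq_le b ξ) (sq_nonneg _) (lapSymb_nonneg ξ)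

lemma eLpNorm_two_le_energy (hV : ∀ j, RapidDecay (V j)) (j a b : Fin 3) :
    eLpNorm (fun ξ => symb a ξ * (symb b ξ * V j ξ)) 2 volume
      ≤ ENNReal.ofReal (energy V) ^ (1 / 2 : ℝ) :=
  eLpNorm_le_energy hV j fun ξ => by
    rw [← mul_assoc, norm_mul, norm_mul, mul_pow]
    exact mul_le_mul_of_nonneg_right ((norm_symb_mul_symb_sq_le a b ξ).trans (lapSymb_sq_le ξ))
      (sq_nonneg _)

lemma eLpNorm_one_le_dissipation (hV : ∀ j, RapidDecay (V j)) (j a : Fin 3) :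
    eLpNorm (fun ξ => symb a ξ * V j ξ) 2 volume
      ≤ ENNReal.ofReal (dissipation V) ^ (1 / 2 : ℝ) :=
  eLpNorm_le_dissipation hV j fun ξ => by
    rw [norm_mul, mul_pow]
    refine mul_le_mul_of_nonneg_right ((norm_symb_sq_le a ξ).trans ?_) (sq_nonneg _)
    exact le_mul_of_one_le_left (lapSymb_nonneg ξ) (one_le_sobWeight ξ)

lemma eLpNorm_three_le_dissipation (hV : ∀ j, RapidDecay (V j)) (j i a b : Fin 3) :
    eLpNorm (fun ξ => symb i ξ * (symb a ξ * (symb b ξ * V j ξ))) 2 volume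
      ≤ ENNReal.ofReal (dissipation V) ^ (1 / 2 : ℝ) :=
  eLpNorm_le_dissipation hV j fun ξ => by
    rw [norm_mul, mul_pow, ← mul_assoc, norm_mul, norm_mul, mul_pow, ← mul_assoc, mul_comm (sobWeight ξ)]
    exact mul_le_mul_of_nonneg_right (mul_le_mul (norm_symb_sq_le i ξ)
      ((norm_symb_mul_symb_sq_le a b ξ).trans (lapSymb_sq_le ξ)) (sq_nonneg _) (lapSymb_nonneg ξ))
      (sq_nonneg _)

lemma eLpNorm_lapSymb_symb_le_dissipation (hV : ∀ j, RapidDecay (V j)) (j k : Fin 3) :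
    eLpNorm (fun ξ => (lapSymb ξ : ℂ) * (symb k ξ * V j ξ)) 2 volume
      ≤ ENNReal.ofReal (dissipation V) ^ (1 / 2 : ℝ) :=
  eLpNorm_le_dissipation hV j fun ξ => by
    rw [norm_mul, norm_mul, Complex.norm_real, Real.norm_of_nonneg (lapSymb_nonneg ξ), mul_pow,
      mul_pow, ← mul_assoc]
    exact mul_le_mul_of_nonneg_right (mul_le_mul (lapSymb_sq_le ξ) (norm_symb_sq_le k ξ)
      (sq_nonneg _) (sobWeight_pos ξ).le) (sq_nonneg _)

end

lemma rapidDecay_rate {V : Fin 3 → E3 → ℂ} (hV : ∀ j, RapidDecay (V j)) (μ : ℝ) (j : Fin 3) :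
    RapidDecay fun ξ => -damp μ ξ * V j ξ + nonlin (fun k l => cconv (V k) (V l) ξ) j ξ := by
  have h1 : TimeSmooth 0 0 0 fun (_ : ℝ) ξ => nonlin (fun k l => cconv (V k) (V l) ξ) j ξ :=
    TimeSmooth.nonlin (m := 0) (N := fun k l _ => cconv (V k) (V l))
      (fun k l => ((hV k).cconv (hV l)).timeRapid 0 0) j
  have h2 : RapidDecay fun ξ => (-1 * (damp μ ξ : ℂ)) * V j ξ :=
    (hV j).mul ((isMultiplier_const (-1)).mul (isMultiplier_damp μ))
  have h3 := h2.add (TimeRapid.rapidDecay h1 (left_mem_Icc.2 le_rfl))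
  simpa only [neg_one_mul] using h3

lemma integrable_energyRate {V : Fin 3 → E3 → ℂ} (hV : ∀ j, RapidDecay (V j)) (μ : ℝ) :
    Integrable (fun ξ => sobWeight ξ * ∑ j, 2 * ((starRingEnd ℂ) (V j ξ) *
      (-damp μ ξ * V j ξ + nonlin (fun k l => cconv (V k) (V l) ξ) j ξ)).re) volume := by
  simp_rw [Finset.mul_sum]
  refine integrable_finsetSum _ fun j _ => ?_
  have hW := rapidDecay_rate hV μ j
  have h2 := (hV j).memLp.star.integrable_mul (hW.mul isMultiplier_sobWeight).memLp
  refine (h2.re.const_mul 2).congr (ae_of_all _ fun ξ => ?_)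
  have e : star (V j) ξ * ((sobWeight ξ : ℂ) *
      (-damp μ ξ * V j ξ + nonlin (fun k l => cconv (V k) (V l) ξ) j ξ)) =
      (sobWeight ξ : ℂ) * ((starRingEnd ℂ) (V j ξ) *
      (-damp μ ξ * V j ξ + nonlin (fun k l => cconv (V k) (V l) ξ) j ξ)) := by
    rw [Pi.star_apply, RCLike.star_def]; ring
  simp only [Pi.mul_apply]
  rw [e, RCLike.re_to_complex, Complex.re_ofReal_mul]
  ring

/-- Young's inequality in the form that absorbs the dissipation. -/
lemma mul_rpow_mul_rpow_le {θ μ b k Y Z : ℝ} (hθ0 : 0 ≤ θ) (hθ1 : θ < 1) (hμ : 0 < μ) (hb : 0 ≤ b)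
    (hk : 0 ≤ k) (hY : 0 ≤ Y) (hZ : 0 ≤ Z) :
    b * k * (Y ^ ((1 - θ) / 2) * Z ^ ((1 + θ) / 2)) ≤
      2 * μ * Z + (b * (2 * μ) ^ (-((1 + θ) / 2))) ^ (2 / (1 - θ)) * k ^ (2 / (1 - θ)) * Y := by
  set c := b * (2 * μ) ^ (-((1 + θ) / 2)) with hc
  have hm : 0 < 2 * μ := by linarith
  have hc0 : 0 ≤ c := by positivity
  have h1θ : 0 < 1 - θ := by linarith
  have hpow : ∀ x : ℝ, 0 ≤ x → (x ^ (2 / (1 - θ))) ^ ((1 - θ) / 2) = x := by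
    intro x hx
    rw [← Real.rpow_mul hx, show 2 / (1 - θ) * ((1 - θ) / 2) = 1 by field_simp, Real.rpow_one]
  -- weighted AM–GM for `P` and `2μZ`, with weights `(1 - θ)/2` and `(1 + θ)/2`
  set P := c ^ (2 / (1 - θ)) * k ^ (2 / (1 - θ)) * Y with hP
  have hP0 : 0 ≤ P := by positivity
  have h := Real.geom_mean_le_arith_mean2_weighted (w₁ := (1 - θ) / 2) (w₂ := (1 + θ) / 2)
    (by positivity) (by positivity) hP0 (by positivity : 0 ≤ 2 * μ * Z) (by ring)
  have e : P ^ ((1 - θ) / 2) * (2 * μ * Z) ^ ((1 + θ) / 2)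
      = b * k * (Y ^ ((1 - θ) / 2) * Z ^ ((1 + θ) / 2)) := by
    rw [hP, Real.mul_rpow (by positivity) hY, Real.mul_rpow (by positivity) (by positivity),
      hpow c hc0, hpow k hk, Real.mul_rpow hm.le hZ, hc]
    have : (2 * μ) ^ (-((1 + θ) / 2)) * (2 * μ) ^ ((1 + θ) / 2) = 1 := by
      rw [← Real.rpow_add hm, neg_add_cancel, Real.rpow_zero]
    linear_combination (b * k * Y ^ ((1 - θ) / 2) * Z ^ ((1 + θ) / 2)) * this
  rw [← e]
  refine h.trans ?_
  have hz0 : 0 ≤ 2 * μ * Z := by positivity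
  nlinarith [mul_nonneg hθ0 hP0, mul_nonneg h1θ.le hz0]

/-- The convolution products of the velocity are bounded in the `H²` norm by the `L^p` norm of the
velocity and an interpolation between energy and dissipation. -/
lemma exists_eLpNorm_cconv_le : ∃ C : ℝ≥0, ∀ (p : ℝ≥0∞), 3 < p → ∀ (V : Fin 3 → E3 → ℂ) (K : ℝ≥0∞),
    (∀ j, RapidDecay (V j)) → (∀ j x, (starRingEnd ℂ) (𝓕⁻ (V j) x) = 𝓕⁻ (V j) x) →
    (∀ j, eLpNorm (𝓕⁻ (V j)) p volume ≤ K) → ∀ k j,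
    eLpNorm (cconv (V k) (V j)) 2 volume + eLpNorm (fun ξ => (lapSymb ξ : ℂ) * cconv (V k) (V j) ξ) 2 volume
      ≤ 25 * (K * ((ENNReal.ofReal (energy V) ^ (1 / 2 : ℝ)) ^ (1 - 3 / p.toReal) *
        (C * ENNReal.ofReal (dissipation V) ^ (1 / 2 : ℝ)) ^ (3 / p.toReal))) := by
  obtain ⟨C, hC⟩ := exists_eLpNorm_six_le
  refine ⟨C * 3, fun p hp V K hV hr hK k j => ?_⟩
  set y := ENNReal.ofReal (energy V) ^ (1 / 2 : ℝ)
  set z := ENNReal.ofReal (dissipation V) ^ (1 / 2 : ℝ)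
  set M := K * (y ^ (1 - 3 / p.toReal) * (((C * 3 : ℝ≥0) : ℝ≥0∞) * z) ^ (3 / p.toReal)) with hM
  have hθ0 : 0 ≤ 3 / p.toReal := by positivity
  have hθ1 : 3 / p.toReal ≤ 1 := by
    rcases eq_or_ne p ⊤ with rfl | hpt
    · simp
    · have : 3 < p.toReal := by simpa using (ENNReal.toReal_lt_toReal (by simp) hpt).2 hp
      rw [div_le_one (by linarith)]; exact this.le
  -- every product of `u_k` with a function that is controlled, along with its gradient, by energy and
  -- dissipation is bounded by `M`
  have key : ∀ (k : Fin 3) {G : E3 → ℂ}, RapidDecay G → eLpNorm G 2 volume ≤ y →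
      (∀ i, eLpNorm (fun ξ => symb i ξ * G ξ) 2 volume ≤ z) →
      eLpNorm (fun x => 𝓕⁻ (V k) x * 𝓕⁻ G x) 2 volume ≤ M := by
    intro k G hG hy hz
    refine (eLpNorm_mul_le_interpolate hp
      (continuous_fourierInv (hV k).integrable).aestronglyMeasurable
      (continuous_fourierInv hG.integrable).aestronglyMeasurable).trans ?_
    refine mul_le_mul' (hK k) (mul_le_mul' (ENNReal.rpow_le_rpow ?_ (by linarith))
      (ENNReal.rpow_le_rpow ?_ hθ0))
    · rwa [hG.isFourierPair.eLpNorm_eq]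
    · refine (hC _ (by exact_mod_cast hG.contDiff_fourierInv 1) hG.memLp_fourierInv).trans ?_
      push_cast
      rw [mul_assoc]
      refine mul_le_mul' le_rfl (hG.eLpNorm_fderiv_le.trans ?_)
      refine (Finset.sum_le_sum (g := fun _ => z) fun i _ => ?_).trans_eq (by simp)
      rw [hG.pderiv_fourierInv, (hG.symb i).isFourierPair.eLpNorm_eq]
      exact hz i
  have h0 : ∀ k j, eLpNorm (cconv (V k) (V j)) 2 volume ≤ M := by
    intro k j
    rw [← ((hV k).cconv (hV j)).isFourierPair.eLpNorm_eq, ← (hV k).fourierInv_mul (hV j)]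
    exact key k (hV j) (eLpNorm_zero_le_energy hV j) (eLpNorm_one_le_dissipation hV j)
  have h2 : ∀ k j a, eLpNorm (fun x => 𝓕⁻ (V k) x * pderiv a (pderiv a (𝓕⁻ (V j))) x) 2 volume
      ≤ M := by
    intro k j a
    rw [(hV j).pderiv_fourierInv, ((hV j).symb a).pderiv_fourierInv]
    exact key k (((hV j).symb a).symb a) (eLpNorm_two_le_energy hV j a a)
      (fun i => eLpNorm_three_le_dissipation hV j i a a)
  -- the four products in `eLpNorm_symb_symb_cconv_le` come with coefficients `1 + 3 + 3 + 1 = 8`, and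
  -- the Laplacian is a sum of three terms
  have h3 : ∀ a, eLpNorm (fun ξ => symb a ξ * (symb a ξ * cconv (V k) (V j) ξ)) 2 volume
      ≤ 8 * M := by
    intro a
    refine ((hV k).eLpNorm_symb_symb_cconv_le (hV j) (hr k) (hr j) a).trans ?_
    calc _ ≤ M + (3 * M + 3 * M) + M := by gcongr <;> apply h2
      _ = 8 * M := by ring
  have h4 : eLpNorm (fun ξ => (lapSymb ξ : ℂ) * cconv (V k) (V j) ξ) 2 volume ≤ 24 * M := by
    have e : (fun ξ => (lapSymb ξ : ℂ) * cconv (V k) (V j) ξ) =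
        -∑ a, fun ξ => symb a ξ * (symb a ξ * cconv (V k) (V j) ξ) := by
      ext ξ
      rw [lapSymb_eq, Pi.neg_apply, Finset.sum_apply, neg_mul, Finset.sum_mul]
      simp_rw [mul_assoc]
    rw [e, eLpNorm_neg]
    refine (eLpNorm_sum_le (fun a _ => ((((hV k).cconv (hV j)).symb a).symb a).memLp.1)
      one_le_two).trans ((Finset.sum_le_sum fun a _ => h3 a).trans_eq ?_)
    rw [Finset.sum_const, Finset.card_univ, Fintype.card_fin, nsmul_eq_mul]
    push_cast; ring
  calc _ ≤ M + 24 * M := add_le_add (h0 k j) h4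
    _ = 25 * M := by ring

lemma integral_norm_mul_le {F G : E3 → ℂ} (hF : RapidDecay F) (hG : RapidDecay G) :
    ∫ ξ, ‖F ξ‖ * ‖G ξ‖ ≤ (eLpNorm F 2 volume * eLpNorm G 2 volume).toReal := by
  have h := eLpNorm_smul_le_mul_eLpNorm (p := 2) (q := 2) (r := 1) hG.memLp.1 hF.memLp.1
  rw [eLpNorm_one_eq_lintegral_enorm] at h
  have h2 : ∫ ξ, ‖F ξ‖ * ‖G ξ‖ = (∫⁻ ξ, ‖(F • G) ξ‖ₑ).toReal := by
    have := integral_norm_eq_lintegral_enorm (hF.memLp.1.smul hG.memLp.1)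
    rw [← this]
    congr 1; ext ξ
    simp
  rw [h2]
  exact ENNReal.toReal_mono (ENNReal.mul_ne_top hF.memLp.2.ne hG.memLp.2.ne) h

/-- The energy inequality: the viscous term gives the dissipation, and one derivative of the convective
term is moved to the velocity. -/
lemma energyRate_le {μ : ℝ} {V : Fin 3 → E3 → ℂ} (hV : ∀ j, RapidDecay (V j))
    (hdiv : ∀ ξ, ∑ j, symb j ξ * V j ξ = 0) {A : ℝ≥0∞} (hA : A ≠ ⊤)
    (hN : ∀ k j, eLpNorm (cconv (V k) (V j)) 2 volume +
      eLpNorm (fun ξ => (lapSymb ξ : ℂ) * cconv (V k) (V j) ξ) 2 volume ≤ A) :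
    energyRate μ V ≤ -(2 * μ) * dissipation V +
      18 * (A.toReal * dissipation V ^ (1 / 2 : ℝ)) := by
  have hNr := fun k j => (hV k).cconv (hV j)
  have hint : ∀ j k, Integrable (fun ξ => sobWeight ξ *
      (‖symb k ξ * V j ξ‖ * ‖cconv (V k) (V j) ξ‖)) volume := fun j k =>
    ((hV j).symb k).integrable_sobWeight_mul (hNr k j)
  have hs : Integrable (fun ξ => ∑ j, ∑ k, sobWeight ξ *
      (‖symb k ξ * V j ξ‖ * ‖cconv (V k) (V j) ξ‖)) volume :=
    integrable_finsetSum _ fun j _ => integrable_finsetSum _ fun k _ => hint j k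
  set z := ENNReal.ofReal (dissipation V) ^ (1 / 2 : ℝ) with hz
  have hzt : z ≠ ⊤ := ENNReal.rpow_ne_top_of_nonneg (by norm_num) ENNReal.ofReal_ne_top
  have hzr : z.toReal = dissipation V ^ (1 / 2 : ℝ) := by
    rw [hz, ← ENNReal.toReal_rpow, ENNReal.toReal_ofReal (dissipation_nonneg V)]
  have hterm : ∀ j k, ∫ ξ, sobWeight ξ * (‖symb k ξ * V j ξ‖ * ‖cconv (V k) (V j) ξ‖)
      ≤ A.toReal * dissipation V ^ (1 / 2 : ℝ) := by
    intro j k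
    have i1 := ((hV j).symb k).integrable_norm_mul (hNr k j)
    have r1 := ((hV j).symb k).mul isMultiplier_lapSymb
    have r2 := (hNr k j).mul isMultiplier_lapSymb
    have i2 := r1.integrable_norm_mul r2
    have e : ∀ ξ, sobWeight ξ * (‖symb k ξ * V j ξ‖ * ‖cconv (V k) (V j) ξ‖) =
        ‖symb k ξ * V j ξ‖ * ‖cconv (V k) (V j) ξ‖ + ‖(lapSymb ξ : ℂ) * (symb k ξ * V j ξ)‖ *
          ‖(lapSymb ξ : ℂ) * cconv (V k) (V j) ξ‖ := by
      intro ξ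
      rw [norm_mul (lapSymb ξ : ℂ), norm_mul (lapSymb ξ : ℂ), Complex.norm_real,
        Real.norm_of_nonneg (lapSymb_nonneg ξ), sobWeight]
      ring
    simp_rw [e]
    rw [integral_add i1 i2]
    have b1 := integral_norm_mul_le ((hV j).symb k) (hNr k j)
    have b2 := integral_norm_mul_le r1 r2
    refine (add_le_add b1 b2).trans ?_
    rw [← hzr, ← ENNReal.toReal_mul, ← ENNReal.toReal_add
      (ENNReal.mul_ne_top ((hV j).symb k).memLp.2.ne (hNr k j).memLp.2.ne)
      (ENNReal.mul_ne_top r1.memLp.2.ne r2.memLp.2.ne)]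
    refine ENNReal.toReal_mono (ENNReal.mul_ne_top hA hzt) ?_
    calc _ ≤ z * eLpNorm (cconv (V k) (V j)) 2 volume
          + z * eLpNorm (fun ξ => (lapSymb ξ : ℂ) * cconv (V k) (V j) ξ) 2 volume :=
          add_le_add (mul_le_mul' (eLpNorm_one_le_dissipation hV j k) le_rfl)
            (mul_le_mul' (eLpNorm_lapSymb_symb_le_dissipation hV j k) le_rfl)
      _ ≤ A * z := by rw [← mul_add, mul_comm]; exact mul_le_mul' (hN k j) le_rfl
  have hle : energyRate μ V ≤ ∫ ξ, -(2 * μ) * (sobWeight ξ * lapSymb ξ * ∑ j, ‖V j ξ‖ ^ 2) +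
      2 * ∑ j, ∑ k, sobWeight ξ * (‖symb k ξ * V j ξ‖ * ‖cconv (V k) (V j) ξ‖) := by
    refine integral_mono (integrable_energyRate hV μ)
      (((integrable_dissipation hV).const_mul (-(2 * μ))).add (hs.const_mul 2)) fun ξ => ?_
    refine (mul_le_mul_of_nonneg_left (sum_re_conj_mul_le
      (fun k l => cconv (V k) (V l) ξ) (hdiv ξ)) (sobWeight_pos ξ).le).trans_eq ?_
    simp only [mul_add, Finset.mul_sum]
    congr 1
    · refine Finset.sum_congr rfl fun j _ => ?_
      ring
    · refine Finset.sum_congr rfl fun j _ => Finset.sum_congr rfl fun k _ => ?_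
      ring
  refine hle.trans ?_
  rw [integral_add ((integrable_dissipation hV).const_mul _) (hs.const_mul 2), integral_const_mul,
    integral_const_mul, integral_finsetSum _ fun j _ => integrable_finsetSum _ fun k _ => hint j k]
  refine add_le_add le_rfl ?_
  -- `9` is the number of pairs of components
  rw [show (18 : ℝ) = 2 * 9 by norm_num, mul_assoc]
  refine mul_le_mul_of_nonneg_left ?_ two_pos.le
  simp_rw [integral_finsetSum _ fun k _ => hint _ k]
  refine (Finset.sum_le_sum fun j _ => Finset.sum_le_sum fun k _ => hterm j k).trans_eq ?_
  simp only [Finset.sum_const, Finset.card_univ, Fintype.card_fin, nsmul_eq_mul]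
  push_cast; ring

/-- The energy grows at most at the rate `K^r` with `K` the `L^p` norm of the velocity and
`r = 2 / (1 - 3/p)` the Serrin exponent. -/
theorem exists_energyRate_le {μ : ℝ} (hμ : 0 < μ) {p : ℝ≥0∞} (hp : 3 < p) : ∃ C : ℝ, 0 ≤ C ∧
    ∀ (V : Fin 3 → E3 → ℂ) (K : ℝ≥0∞), (∀ j, RapidDecay (V j)) →
    (∀ j x, (starRingEnd ℂ) (𝓕⁻ (V j) x) = 𝓕⁻ (V j) x) → (∀ ξ, ∑ j, symb j ξ * V j ξ = 0) →
    K ≠ ⊤ → (∀ j, eLpNorm (𝓕⁻ (V j)) p volume ≤ K) →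
    energyRate μ V ≤ C * K.toReal ^ (2 / (1 - 3 / p.toReal)) * energy V := by
  obtain ⟨C, hC⟩ := exists_eLpNorm_cconv_le
  have hθ0 : 0 ≤ 3 / p.toReal := by positivity
  have hθ1 : 3 / p.toReal < 1 := by
    rcases eq_or_ne p ⊤ with rfl | hpt
    · simp
    · have : 3 < p.toReal := by simpa using (ENNReal.toReal_lt_toReal (by simp) hpt).2 hp
      rw [div_lt_one (by linarith)]; exact this
  have hC' := hC p hp
  set θ := 3 / p.toReal
  refine ⟨(450 * (C : ℝ) ^ θ * (2 * μ) ^ (-((1 + θ) / 2))) ^ (2 / (1 - θ)), by positivity,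
    fun V K hV hr hdiv hKt hK => ?_⟩
  have hY := energy_nonneg V
  have hZ := dissipation_nonneg V
  set A := 25 * (K * ((ENNReal.ofReal (energy V) ^ (1 / 2 : ℝ)) ^ (1 - θ) *
        (C * ENNReal.ofReal (dissipation V) ^ (1 / 2 : ℝ)) ^ θ)) with hA
  have hAt : A ≠ ⊤ := by
    have h1θ : 0 ≤ 1 - θ := by linarith
    refine ENNReal.mul_ne_top (by simp) (ENNReal.mul_ne_top hKt (ENNReal.mul_ne_top ?_ ?_))
    · exact ENNReal.rpow_ne_top_of_nonneg h1θ
        (ENNReal.rpow_ne_top_of_nonneg (by norm_num) ENNReal.ofReal_ne_top)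
    · exact ENNReal.rpow_ne_top_of_nonneg hθ0 (ENNReal.mul_ne_top ENNReal.coe_ne_top
        (ENNReal.rpow_ne_top_of_nonneg (by norm_num) ENNReal.ofReal_ne_top))
  have h1 := energyRate_le (μ := μ) hV hdiv hAt (hC' V K hV hr hK)
  have e : A.toReal = 25 * (K.toReal * (energy V ^ ((1 - θ) / 2) *
      ((C : ℝ) ^ θ * dissipation V ^ (θ / 2)))) := by
    rw [hA]
    simp only [ENNReal.toReal_mul, ← ENNReal.toReal_rpow, ENNReal.toReal_ofReal hY,
      ENNReal.toReal_ofReal hZ, ENNReal.toReal_ofNat, ENNReal.coe_toReal]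
    rw [Real.mul_rpow C.coe_nonneg (by positivity), ← Real.rpow_mul hY, ← Real.rpow_mul hZ,
      show 1 / 2 * (1 - θ) = (1 - θ) / 2 by ring, show 1 / 2 * θ = θ / 2 by ring]
  have e2 : dissipation V ^ ((1 + θ) / 2) = dissipation V ^ (θ / 2) * dissipation V ^ (1 / 2 : ℝ) := by
    rw [← Real.rpow_add_of_nonneg hZ (by positivity) (by norm_num)]; congr 1; ring
  have h2 := mul_rpow_mul_rpow_le (b := 450 * (C : ℝ) ^ θ) (k := K.toReal) hθ0 hθ1 hμ (by positivity)
    ENNReal.toReal_nonneg hY hZ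
  rw [e2] at h2
  rw [e] at h1
  linarith

/-! ### Differentiating the energy in time -/

lemma RapidEnvelope.rapidDecay {E : E3 → ℝ} (hE : RapidEnvelope E) :
    RapidDecay fun ξ => (E ξ : ℂ) :=
  ⟨Complex.measurable_ofReal.comp hE.measurable, E, hE, fun ξ => by
    rw [Complex.norm_real, Real.norm_of_nonneg (hE.nonneg ξ)]⟩

lemma ClosedFlow.rapidDecay {μ a b t : ℝ} {V : Fin 3 → ℝ → E3 → ℂ} (h : ClosedFlow μ a b V)
    (ht : t ∈ Icc a b) (j : Fin 3) : RapidDecay (V j t) :=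
  TimeRapid.rapidDecay (h.timeSmooth 0 j) ht

lemma FourierFlow.rapidDecay {μ T t : ℝ} {U : Fin 3 → ℝ → E3 → ℂ} (h : FourierFlow μ T U)
    (hμ : 0 < μ) (ht : t ∈ Ioo 0 T) (j : Fin 3) : RapidDecay (U j t) := by
  obtain ⟨b, hb⟩ := exists_between ht.2
  exact (h.closedFlow hμ (half_pos ht.1) (by linarith [ht.1, hb.1] : t / 2 < b) hb.2).rapidDecay
    ⟨by linarith [ht.1], hb.1.le⟩ j

/-- The energy of a flow is differentiable in time, with a bounded derivative. -/
lemma ClosedFlow.hasDerivWithinAt_energy {μ a b : ℝ} {V : Fin 3 → ℝ → E3 → ℂ}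
    (h : ClosedFlow μ a b V) (hab : a < b) :
    ∃ B : ℝ, ∀ t ∈ Icc a b, HasDerivWithinAt (fun t => energy fun j => V j t)
      (energyRate μ fun j => V j t) (Icc a b) t ∧ |energyRate μ fun j => V j t| ≤ B := by
  obtain ⟨E, hE, hb⟩ := h.envelope
  -- the time derivative of the flow has an envelope too, by time-smoothness
  have hex : ∀ j, ∃ E', RapidEnvelope E' ∧ ∀ t ∈ Icc a b, ∀ ξ,
      ‖-damp μ ξ * V j t ξ + nonlin (fun k l => cconv (V k t) (V l t) ξ) j ξ‖ ≤ E' ξ := by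
    intro j
    obtain ⟨-, G, hG, hd⟩ := h.timeSmooth 1 j
    obtain ⟨E', hE', hb'⟩ := TimeRapid.envelope hG
    refine ⟨E', hE', fun t ht ξ => ?_⟩
    have := UniqueDiffWithinAt.eq_deriv (Icc a b) (uniqueDiffOn_Icc hab t ht)
      (h.hasDeriv t ht ξ j) (hd t ht ξ)
    rw [this]
    exact hb' t ht ξ
  choose E' hE' hb' using hex
  have hbi : Integrable (fun ξ => sobWeight ξ * ∑ j, 2 * (E ξ * E' j ξ)) volume := by
    simp_rw [Finset.mul_sum]
    refine integrable_finsetSum _ fun j _ => ?_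
    refine ((hE.rapidDecay.integrable_sobWeight_mul (hE' j).rapidDecay).const_mul 2).congr
      (ae_of_all _ fun ξ => ?_)
    simp only [Complex.norm_real, Real.norm_of_nonneg (hE.nonneg ξ),
      Real.norm_of_nonneg ((hE' j).nonneg ξ)]
    ring
  have hbound : ∀ t ∈ Icc a b, ∀ ξ, ‖sobWeight ξ * ∑ j, 2 * ((starRingEnd ℂ) (V j t ξ) *
      (-damp μ ξ * V j t ξ + nonlin (fun k l => cconv (V k t) (V l t) ξ) j ξ)).re‖ ≤
      sobWeight ξ * ∑ j, 2 * (E ξ * E' j ξ) := by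
    intro t ht ξ
    rw [norm_mul, Real.norm_of_nonneg (sobWeight_pos ξ).le]
    refine mul_le_mul_of_nonneg_left (norm_sum_le_of_le _ fun j _ => ?_) (sobWeight_pos ξ).le
    rw [norm_mul, Real.norm_two]
    refine mul_le_mul_of_nonneg_left ((Complex.abs_re_le_norm _).trans ?_) two_pos.le
    rw [norm_mul, RCLike.norm_conj]
    exact mul_le_mul (hb t ht j ξ) (hb' j t ht ξ) (norm_nonneg _) (hE.nonneg ξ)
  refine ⟨∫ ξ, sobWeight ξ * ∑ j, 2 * (E ξ * E' j ξ), fun t ht => ⟨?_, ?_⟩⟩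
  · refine hasDerivWithinAt_integral_of_dominated (ν := (volume : Measure E3))
      (F := fun t ξ => sobWeight ξ * ∑ j, ‖V j t ξ‖ ^ 2)
      (F' := fun t ξ => sobWeight ξ * ∑ j, 2 * ((starRingEnd ℂ) (V j t ξ) *
        (-damp μ ξ * V j t ξ + nonlin (fun k l => cconv (V k t) (V l t) ξ) j ξ)).re)
      (convex_Icc a b) ht (fun t ht => integrable_energy fun j => h.rapidDecay ht j)
      (integrable_energyRate (fun j => h.rapidDecay ht j) μ).1 hbi hbound fun t ht ξ => ?_
    refine HasDerivWithinAt.const_mul _ (HasDerivWithinAt.fun_sum fun j _ => ?_)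
    have := (h.hasDeriv t ht ξ j).norm_sq
    rw [Complex.inner] at this
    rwa [mul_comm ((starRingEnd ℂ) (V j t ξ))]
  · exact norm_integral_le_of_norm_le hbi (ae_of_all _ (hbound t ht))

/-! ### Sup norm and weighted norms in terms of the energy -/

lemma wnorm_four_le_energy {V : Fin 3 → E3 → ℂ} (hV : ∀ j, RapidDecay (V j)) (j : Fin 3) :
    wnorm 4 (fun ξ => ‖V j ξ‖ₑ) ≤ 80 * ENNReal.ofReal (energy V) := by
  have hsq : ∀ {G : E3 → ℂ}, eLpNorm G 2 volume ≤ ENNReal.ofReal (energy V) ^ (1 / 2 : ℝ) →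
      ∫⁻ ξ, ‖G ξ‖ₑ ^ 2 ≤ ENNReal.ofReal (energy V) := by
    intro G hG
    rw [← eLpNorm_two_sq]
    refine (pow_le_pow_left₀ bot_le hG 2).trans_eq ?_
    rw [← ENNReal.rpow_natCast, ← ENNReal.rpow_mul]
    norm_num
  refine (wnorm_four_le (V j) (hV j).measurable).trans ?_
  calc _ ≤ 8 * (ENNReal.ofReal (energy V) + ∑ _a : Fin 3, ∑ _b : Fin 3,
        ENNReal.ofReal (energy V)) := by
        refine mul_le_mul' le_rfl (add_le_add (hsq (eLpNorm_zero_le_energy hV j))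
          (Finset.sum_le_sum fun a _ => Finset.sum_le_sum fun b _ =>
            hsq (eLpNorm_two_le_energy hV j a b)))
    _ = _ := by
        simp only [Finset.sum_const, Finset.card_univ, Fintype.card_fin, nsmul_eq_mul]
        push_cast; ring

/-- The embedding of `H²` in `L^∞`. The energy is a squared norm, and `x ≤ 1 + x²`. -/
lemma exists_norm_fourierInv_le : ∃ D : ℝ, 0 ≤ D ∧ ∀ V : Fin 3 → E3 → ℂ, (∀ j, RapidDecay (V j)) →
    ∀ j x, ‖𝓕⁻ (V j) x‖ ≤ 1 + D * energy V := by
  refine ⟨(wtConst * 80).toReal, ENNReal.toReal_nonneg, fun V hV j x => ?_⟩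
  have hY := energy_nonneg V
  have h1 := (sq_lintegral_le (hV j).measurable.enorm).trans
    (mul_le_mul' le_rfl (wnorm_four_le_energy hV j))
  have h2 : ∫ ξ, ‖V j ξ‖ = (∫⁻ ξ, ‖V j ξ‖ₑ).toReal :=
    integral_norm_eq_lintegral_enorm (hV j).integrable.1
  have h3 : (∫ ξ, ‖V j ξ‖) ^ 2 ≤ (wtConst * 80).toReal * energy V := by
    have e : (wtConst * 80).toReal * energy V
        = (wtConst * 80 * ENNReal.ofReal (energy V)).toReal := by
      rw [ENNReal.toReal_mul (a := wtConst * 80), ENNReal.toReal_ofReal hY]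
    rw [h2, ← ENNReal.toReal_pow, e]
    refine ENNReal.toReal_mono (ENNReal.mul_ne_top (ENNReal.mul_ne_top wtConst_ne_top (by simp))
      ENNReal.ofReal_ne_top) ?_
    rwa [mul_assoc]
  refine (norm_fourierInv_le _ x).trans ?_
  have h4 : 0 ≤ ∫ ξ, ‖V j ξ‖ := integral_nonneg fun ξ => norm_nonneg (V j ξ)
  nlinarith [sq_nonneg ((∫ ξ, ‖V j ξ‖) - 1)]

/-! ### A logarithmic Gronwall inequality -/

/-- If the positive part of `ψ'` is dominated by `C (1 + α)` with `α` integrable on `(0, T)`, then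
`ψ` is bounded above near `T`. No measurability of `α` is needed. -/
lemma exists_le_of_deriv_le {T t₁ : ℝ} (ht₁ : t₁ ∈ Ioo 0 T) {ψ ψ' : ℝ → ℝ} {α : ℝ → ℝ≥0∞} {C : ℝ≥0∞}
    (hC : C ≠ ⊤) (hα : ∫⁻ t in Ioo 0 T, α t < ⊤)
    (hd : ∀ t ∈ Ioo 0 T, HasDerivAt ψ (ψ' t) t)
    (hb : ∀ b < T, ∃ B : ℝ, ∀ t ∈ Icc t₁ b, |ψ' t| ≤ B)
    (hle : ∀ t ∈ Ioo 0 T, ENNReal.ofReal (ψ' t) ≤ C * (1 + α t)) :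
    ∃ M : ℝ, ∀ t ∈ Ico t₁ T, ψ t ≤ M := by
  set A := C * (ENNReal.ofReal T + ∫⁻ t in Ioo 0 T, α t)
  have hA : A ≠ ⊤ := ENNReal.mul_ne_top hC (ENNReal.add_ne_top.2 ⟨ENNReal.ofReal_ne_top, hα.ne⟩)
  refine ⟨ψ t₁ + A.toReal, fun t ht => ?_⟩
  have hsub : Icc t₁ t ⊆ Ioo 0 T := fun τ hτ => ⟨ht₁.1.trans_le hτ.1, hτ.2.trans_lt ht.2⟩
  obtain ⟨B, hB⟩ := hb t ht.2
  have hderiv : ∀ τ ∈ Icc t₁ t, deriv ψ τ = ψ' τ := fun τ hτ => (hd τ (hsub hτ)).deriv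
  have hi : IntegrableOn (deriv ψ) (Ioc t₁ t) volume := by
    refine Measure.integrableOn_of_bounded (M := B) (by simp) (measurable_deriv ψ).aestronglyMeasurable ?_
    refine (ae_restrict_iff' measurableSet_Ioc).2 (ae_of_all _ fun τ hτ => ?_)
    rw [hderiv τ (Ioc_subset_Icc_self hτ)]
    exact hB τ (Ioc_subset_Icc_self hτ)
  have hftc : ∫ τ in t₁..t, deriv ψ τ = ψ t - ψ t₁ := by
    refine intervalIntegral.integral_eq_sub_of_hasDerivAt (fun τ hτ => ?_)
      ((intervalIntegrable_iff_integrableOn_Ioc_of_le ht.1).2 hi)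
    rw [uIcc_of_le ht.1] at hτ
    rw [hderiv τ hτ]
    exact hd τ (hsub hτ)
  have h1 : ∫ τ in t₁..t, deriv ψ τ ≤ (∫⁻ τ in Ioc t₁ t, ENNReal.ofReal (deriv ψ τ)).toReal := by
    rw [intervalIntegral.integral_of_le ht.1,
      integral_eq_lintegral_pos_part_sub_lintegral_neg_part hi]
    linarith [ENNReal.toReal_nonneg (a := ∫⁻ τ in Ioc t₁ t, ENNReal.ofReal (-deriv ψ τ))]
  have h2 : ∫⁻ τ in Ioc t₁ t, ENNReal.ofReal (deriv ψ τ) ≤ A := by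
    calc ∫⁻ τ in Ioc t₁ t, ENNReal.ofReal (deriv ψ τ)
        ≤ ∫⁻ τ in Ioc t₁ t, C * (1 + α τ) := by
          refine setLIntegral_mono' measurableSet_Ioc fun τ hτ => ?_
          rw [hderiv τ (Ioc_subset_Icc_self hτ)]
          exact hle τ (hsub (Ioc_subset_Icc_self hτ))
      _ ≤ ∫⁻ τ in Ioo 0 T, C * (1 + α τ) :=
          lintegral_mono_set fun τ hτ => hsub (Ioc_subset_Icc_self hτ)
      _ = A := by
          rw [lintegral_const_mul' _ _ hC, lintegral_add_left measurable_const]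
          simp [A]
  have h3 := ENNReal.toReal_mono hA h2
  linarith

/-- The Serrin condition says that `s` is at least the exponent in the energy estimate. For `p = ∞` the
junk values `p.toReal = 0` and `3 / 0 = 0` give the right exponent `2`. -/
lemma exponent_le {p : ℝ≥0∞} {s : ℝ} (hs : 0 < s) (hp : 3 < p)
    (hps : 3 / p + 2 / ENNReal.ofReal s ≤ 1) :
    0 ≤ 2 / (1 - 3 / p.toReal) ∧ 2 / (1 - 3 / p.toReal) ≤ s := by
  have hp0 : p ≠ 0 := (lt_trans (by norm_num) hp).ne'
  have hs0 : ENNReal.ofReal s ≠ 0 := by simpa using hs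
  have h := ENNReal.toReal_mono ENNReal.one_ne_top hps
  rw [ENNReal.toReal_add (ENNReal.div_ne_top (by simp) hp0) (ENNReal.div_ne_top (by simp) hs0),
    ENNReal.toReal_div, ENNReal.toReal_div, ENNReal.toReal_ofReal hs.le] at h
  simp only [ENNReal.toReal_ofNat, ENNReal.toReal_one] at h
  have h2 : 0 < 2 / s := by positivity
  have h3 : 0 < 1 - 3 / p.toReal := by linarith
  refine ⟨by positivity, ?_⟩
  rw [div_le_iff₀ h3]
  have h4 : 2 / s * s = 2 := by field_simp
  nlinarith

/-- The pointwise inequality behind the logarithmic Gronwall argument: `y` is the energy, `k` the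
`L^p` norm and `m` the sup norm of the velocity. -/
lemma div_mul_log_le {C D y y' k m r s : ℝ} (hC : 0 ≤ C) (hD : 0 ≤ D) (hy : 0 ≤ y) (hk : 0 ≤ k)
    (hm : 0 ≤ m) (hr : 0 ≤ r) (hrs : r ≤ s) (hy' : y' ≤ C * k ^ r * y) (hmy : m ≤ D * (1 + y)) :
    y' / ((Real.exp 1 + y) * Real.log (Real.exp 1 + y)) ≤
      C * (3 + D) * (1 + k ^ s / (1 + Real.log (Real.exp 1 + m))) := by
  have he : 1 < Real.exp 1 := by simp
  set L := Real.log (Real.exp 1 + y) with hL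
  set l := Real.log (Real.exp 1 + m) with hl
  have hL1 : 1 ≤ L := by
    rw [hL, Real.le_log_iff_exp_le (by linarith)]; linarith
  have hl1 : 1 ≤ l := by
    rw [hl, Real.le_log_iff_exp_le (by linarith)]; linarith
  -- the logarithm of the sup norm is bounded by that of the energy, up to a constant
  have hlL : l ≤ D + L := by
    have h1 : Real.exp 1 + m ≤ (1 + D) * (Real.exp 1 + y) := by nlinarith
    refine (Real.log_le_log (by linarith) h1).trans ?_
    rw [Real.log_mul (by linarith) (by linarith)]
    linarith [Real.log_le_sub_one_of_pos (by linarith : 0 < 1 + D)]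
  -- the Serrin exponent `r` may be smaller than `s`
  have hks : k ^ r ≤ 1 + k ^ s := by
    rcases le_total k 1 with h | h
    · exact (Real.rpow_le_one hk h hr).trans (by linarith [Real.rpow_nonneg hk s])
    · exact (Real.rpow_le_rpow_of_exponent_le h hrs).trans (by linarith)
  have hks0 := Real.rpow_nonneg hk s
  have h1 : y' / ((Real.exp 1 + y) * L) ≤ C * (1 + k ^ s) / L := by
    rw [div_le_div_iff₀ (by positivity) (by positivity)]
    have h2 : y' ≤ C * (1 + k ^ s) * y := hy'.trans (by gcongr)
    have h3 : C * (1 + k ^ s) * y ≤ C * (1 + k ^ s) * (Real.exp 1 + y) := by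
      gcongr; linarith
    calc y' * L ≤ C * (1 + k ^ s) * (Real.exp 1 + y) * L := by gcongr; exact h2.trans h3
      _ = _ := by ring
  refine h1.trans ?_
  have h4 : 1 / L ≤ 1 := by rw [div_le_one (by linarith)]; exact hL1
  have h5 : 1 / L ≤ (2 + D) / (1 + l) := by
    rw [div_le_div_iff₀ (by linarith) (by linarith)]
    nlinarith
  calc C * (1 + k ^ s) / L = C * (1 / L + k ^ s * (1 / L)) := by ring
    _ ≤ C * (1 + k ^ s * ((2 + D) / (1 + l))) := by gcongr
    _ = C * (1 + (2 + D) * (k ^ s / (1 + l))) := by ring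
    _ ≤ C * (3 + D) * (1 + k ^ s / (1 + l)) := by
        have : 0 ≤ k ^ s / (1 + l) := by positivity
        nlinarith [mul_nonneg hC this, mul_nonneg hC hD]

/-- Under the logarithmically improved Serrin condition, the energy stays bounded up to `T`. -/
theorem FourierFlow.exists_energy_le {μ T : ℝ} {U : Fin 3 → ℝ → E3 → ℂ} (h : FourierFlow μ T U)
    (hμ : 0 < μ) {u : ℝ → E3 → E3} (hu : ∀ t ∈ Ioo 0 T, ∀ j x, 𝓕⁻ (U j t) x = coordC j (u t x))
    {p : ℝ≥0∞} {s : ℝ} (hs : 0 < s) (hp : 3 < p) (hps : 3 / p + 2 / ENNReal.ofReal s ≤ 1)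
    (hint : logSerrinIntegral T p s u < ⊤) {t₁ : ℝ} (ht₁ : t₁ ∈ Ioo 0 T) :
    ∃ M : ℝ, ∀ t ∈ Ico t₁ T, energy (fun j => U j t) ≤ M := by
  have hUr : ∀ t ∈ Ioo 0 T, ∀ j, RapidDecay (U j t) := fun t ht => h.rapidDecay hμ ht
  obtain ⟨C, hC, hrate⟩ := exists_energyRate_le hμ hp
  obtain ⟨D, hD, hsup⟩ := exists_norm_fourierInv_le
  obtain ⟨hr0, hrs⟩ := exponent_le hs hp hps
  set y : ℝ → ℝ := fun t => energy fun j => U j t with hy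
  set y' : ℝ → ℝ := fun t => energyRate μ fun j => U j t with hy'
  have hy0 : ∀ t, 0 ≤ y t := fun t => energy_nonneg _
  have he : 1 < Real.exp 1 := by simp
  have hL1 : ∀ t, 1 ≤ Real.log (Real.exp 1 + y t) := fun t => by
    rw [Real.le_log_iff_exp_le (by linarith [hy0 t])]; linarith [hy0 t]
  have hyd : ∀ t ∈ Ioo 0 T, HasDerivAt y (y' t) t := by
    intro t ht
    obtain ⟨b, hb⟩ := exists_between ht.2
    obtain ⟨B, hB⟩ := (h.closedFlow hμ (half_pos ht.1)
      (by linarith [ht.1, hb.1] : t / 2 < b) hb.2).hasDerivWithinAt_energy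
      (by linarith [ht.1, hb.1])
    exact (hB t ⟨by linarith [ht.1], hb.1.le⟩).1.hasDerivAt
      (Icc_mem_nhds (by linarith [ht.1]) hb.1)
  -- the differential inequality for the energy bounds the derivative of its double logarithm by the
  -- integrand of the Serrin condition
  set ψ : ℝ → ℝ := fun t => Real.log (Real.log (Real.exp 1 + y t)) with hψ
  have hψd : ∀ t ∈ Ioo 0 T, HasDerivAt ψ
      (y' t / ((Real.exp 1 + y t) * Real.log (Real.exp 1 + y t))) t := by
    intro t ht
    have h1 := (((hyd t ht).const_add (Real.exp 1)).log (by linarith [hy0 t])).log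
      (by linarith [hL1 t])
    refine h1.congr_deriv ?_
    rw [div_div]
  have hbd : ∀ b < T, ∃ B : ℝ, ∀ t ∈ Icc t₁ b,
      |y' t / ((Real.exp 1 + y t) * Real.log (Real.exp 1 + y t))| ≤ B := by
    intro b hb
    rcases le_or_gt b t₁ with hbt | hbt
    · refine ⟨|y' t₁ / ((Real.exp 1 + y t₁) * Real.log (Real.exp 1 + y t₁))|, fun t ht => ?_⟩
      have : t = t₁ := le_antisymm (ht.2.trans hbt) ht.1
      rw [this]
    obtain ⟨B, hB⟩ := (h.closedFlow hμ ht₁.1 hbt hb).hasDerivWithinAt_energy hbt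
    refine ⟨B, fun t ht => ?_⟩
    have h1 : 1 ≤ (Real.exp 1 + y t) * Real.log (Real.exp 1 + y t) :=
      one_le_mul_of_one_le_of_one_le (by linarith [hy0 t]) (hL1 t)
    rw [abs_div, abs_of_pos (by linarith : 0 < (Real.exp 1 + y t) * Real.log (Real.exp 1 + y t))]
    exact (div_le_self (abs_nonneg _) h1).trans (hB t ht).2
  have hle : ∀ t ∈ Ioo 0 T,
      ENNReal.ofReal (y' t / ((Real.exp 1 + y t) * Real.log (Real.exp 1 + y t))) ≤
      (ENNReal.ofReal (C * (3 + 3 * (1 + D))) + 1) * (1 + eLpNorm (u t) p volume ^ s /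
        ENNReal.ofReal (1 + Real.log (Real.exp 1 + (eLpNorm (u t) ⊤ volume).toReal))) := by
    intro t ht
    have hsupn : ∀ x, ‖u t x‖ ≤ 3 * (1 + D * y t) := by
      intro x
      have h1 : ‖u t x‖ ≤ ∑ j, ‖u t x j‖ := by
        have h2 : u t x = ∑ j, EuclideanSpace.single j (u t x j) := by
          ext i; simp [Finset.sum_apply, Pi.single_apply]
        conv_lhs => rw [h2]
        exact norm_sum_le_of_le _ fun j _ => by simp
      refine h1.trans ((Finset.sum_le_sum (g := fun _ => 1 + D * y t) fun j _ => ?_).trans_eq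
        (by simp; ring))
      have h3 := hsup (fun j => U j t) (hUr t ht) j x
      rw [hu t ht j x, coordC_apply, Complex.norm_real] at h3
      exact h3
    have hm : (eLpNorm (u t) ⊤ volume).toReal ≤ 3 * (1 + D) * (1 + y t) := by
      have h1 : eLpNorm (u t) ⊤ volume ≤ ENNReal.ofReal (3 * (1 + D * y t)) := by
        rw [eLpNorm_exponent_top]
        exact eLpNormEssSup_le_of_ae_bound (ae_of_all _ hsupn)
      refine (ENNReal.toReal_mono ENNReal.ofReal_ne_top h1).trans ?_
      rw [ENNReal.toReal_ofReal (by have := hy0 t; positivity)]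
      nlinarith [hy0 t, mul_nonneg hD (hy0 t)]
    set l := 1 + Real.log (Real.exp 1 + (eLpNorm (u t) ⊤ volume).toReal) with hl
    have hl0 : 0 < l := by
      have : 0 ≤ Real.log (Real.exp 1 + (eLpNorm (u t) ⊤ volume).toReal) :=
        Real.log_nonneg (by linarith [ENNReal.toReal_nonneg (a := eLpNorm (u t) ⊤ volume)])
      linarith
    have hC3 : 0 ≤ C * (3 + 3 * (1 + D)) := by positivity
    -- the integrand is `∞` where the `L^p` norm is infinite, so there is nothing to prove there
    rcases eq_or_ne (eLpNorm (u t) p volume) ⊤ with hK | hK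
    · have h1 : eLpNorm (u t) p volume ^ s / ENNReal.ofReal l = ⊤ := by
        rw [hK, ENNReal.top_rpow_of_pos hs, ENNReal.top_div_of_ne_top ENNReal.ofReal_ne_top]
      rw [h1, add_top, ENNReal.mul_top (by simp)]
      exact le_top
    have hrt := hrate (fun j => U j t) (eLpNorm (u t) p volume) (hUr t ht)
      (fun j x => by rw [hu t ht j x, coordC_apply, Complex.conj_ofReal])
      (h.div_free t ht) hK (fun j => by
        have : 𝓕⁻ (U j t) = fun x => coordC j (u t x) := funext (hu t ht j)
        rw [this]
        exact eLpNorm_mono fun x => norm_coordC_apply_le j _)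
    have h2 := div_mul_log_le hC (by positivity : 0 ≤ 3 * (1 + D)) (hy0 t)
      (ENNReal.toReal_nonneg (a := eLpNorm (u t) p volume)) ENNReal.toReal_nonneg hr0 hrs hrt hm
    refine (ENNReal.ofReal_le_ofReal h2).trans (le_trans (le_of_eq ?_)
      (mul_le_mul' le_self_add le_rfl))
    rw [ENNReal.ofReal_mul hC3, ENNReal.ofReal_add zero_le_one (by positivity),
      ENNReal.ofReal_div_of_pos hl0, ENNReal.ofReal_one, ENNReal.toReal_rpow,
      ENNReal.ofReal_toReal (ENNReal.rpow_ne_top_of_nonneg hs.le hK)]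
  obtain ⟨M, hM⟩ := exists_le_of_deriv_le ht₁ (by simp) hint hψd hbd hle
  refine ⟨Real.exp (Real.exp M), fun t ht => ?_⟩
  have h1 := hM t ht
  rw [hψ] at h1
  have h2 := (Real.log_le_iff_le_exp (by linarith [hL1 t])).1 h1
  have h3 := (Real.log_le_iff_le_exp (by linarith [hy0 t])).1 h2
  change y t ≤ _
  linarith

/-! ### From frequency space back to the Navier–Stokes equations -/

/-- A bound on the energy is a bound on the `H²`-type weighted norm, which extends the flow to time `T`. -/
lemma FourierFlow.exists_closedFlow_of_energy_le {μ T : ℝ} {U : Fin 3 → ℝ → E3 → ℂ}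
    (h : FourierFlow μ T U) (hμ : 0 < μ)
    (hE : ∀ a ∈ Ioo 0 T, ∃ M : ℝ, ∀ t ∈ Ico a T, energy (fun j => U j t) ≤ M) :
    ∃ V, (∀ j, ∀ t < T, V j t = U j t) ∧ ∀ a ∈ Ioo 0 T, ClosedFlow μ a T V := by
  refine h.exists_closedFlow hμ fun a ha => ?_
  rcases le_or_gt T a with hTa | hTa
  · exact ⟨0, fun t ht => absurd (ht.1.trans_lt ht.2) hTa.not_gt⟩
  obtain ⟨M', hM'⟩ := hE a ⟨ha, hTa⟩
  set M : ℝ≥0 := 80 * M'.toNNReal with hMdef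
  refine ⟨12 * M, fun t ht =>
    (wnorm_amp_le (M := M) h.measurable fun j => ?_).trans_eq (by push_cast; rfl)⟩
  refine (wnorm_four_le_energy (h.rapidDecay hμ ⟨ha.trans_le ht.1, ht.2⟩) j).trans ?_
  rw [hMdef, ENNReal.coe_mul]
  exact mul_le_mul' (by norm_num) (ENNReal.ofReal_le_ofReal (hM' t ht))

lemma RapidDecay.fourierInv_add {F G : E3 → ℂ} (hF : RapidDecay F) (hG : RapidDecay G) (x : E3) :
    𝓕⁻ (fun ξ => F ξ + G ξ) x = 𝓕⁻ F x + 𝓕⁻ G x := by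
  obtain ⟨E, hE, h⟩ := hF.envelope
  obtain ⟨E', hE', h'⟩ := hG.envelope
  have h1 := integrable_echar_mul hE hF.measurable h x
  have h2 := integrable_echar_mul hE' hG.measurable h' x
  simp_rw [fourierInv_eq_integral_echar, mul_add]
  exact integral_add h1 h2

lemma fourierInv_const_mul (c : ℂ) (F : E3 → ℂ) (x : E3) :
    𝓕⁻ (fun ξ => c * F ξ) x = c * 𝓕⁻ F x := by
  simp_rw [fourierInv_eq_integral_echar]
  rw [← integral_const_mul]
  congr 1; ext ξ; ring

lemma rapidDecay_sum {F : Fin 3 → E3 → ℂ} (hF : ∀ i, RapidDecay (F i)) :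
    RapidDecay fun ξ => ∑ i, F i ξ := by
  simp_rw [Fin.sum_univ_three]
  exact ((hF 0).add (hF 1)).add (hF 2)

lemma fourierInv_sum {F : Fin 3 → E3 → ℂ} (hF : ∀ i, RapidDecay (F i)) (x : E3) :
    𝓕⁻ (fun ξ => ∑ i, F i ξ) x = ∑ i, 𝓕⁻ (F i) x := by
  simp_rw [Fin.sum_univ_three]
  rw [((hF 0).add (hF 1)).fourierInv_add (hF 2), (hF 0).fourierInv_add (hF 1)]

lemma RapidDecay.const_mul {F : E3 → ℂ} (hF : RapidDecay F) (c : ℂ) :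
    RapidDecay fun ξ => c * F ξ :=
  hF.mul (isMultiplier_const c)

/-- The Fourier transform of the pressure: `-Σ_{k,l} ξ_k ξ_l |ξ|⁻² 𝓕(u_k u_l)`. -/
noncomputable def pressureFourier (V : Fin 3 → E3 → ℂ) (ξ : E3) : ℂ :=
  -1 * ∑ k, ∑ l, (riesz k l ξ : ℂ) * cconv (V k) (V l) ξ

lemma rapidDecay_pressureFourier {V : Fin 3 → E3 → ℂ} (hV : ∀ j, RapidDecay (V j)) :
    RapidDecay (pressureFourier V) :=
  (rapidDecay_sum fun k => rapidDecay_sum fun l =>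
    ((hV k).cconv (hV l)).mul (isMultiplier_riesz k l)).const_mul (-1)

/-- The Leray projection splits the right-hand side into viscous, convective and pressure terms. -/
lemma rate_eq (μ : ℝ) (V : Fin 3 → E3 → ℂ) (j : Fin 3) (ξ : E3) :
    -damp μ ξ * V j ξ + nonlin (fun k l => cconv (V k) (V l) ξ) j ξ =
      μ * ∑ a, symb a ξ * (symb a ξ * V j ξ) +
        (-1 * ∑ k, symb k ξ * cconv (V k) (V j) ξ + -1 * (symb j ξ * pressureFourier V ξ)) := by
  have hr : ∀ k l, symb k ξ * (riesz j l ξ : ℂ) = symb j ξ * (riesz k l ξ : ℂ) := by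
    intro k l
    simp only [symb, riesz]; push_cast; ring
  rw [damp_eq, nonlin, pressureFourier]
  have h1 : ∑ k, symb k ξ * (cconv (V k) (V j) ξ - ∑ l, (riesz j l ξ : ℂ) * cconv (V k) (V l) ξ)
      = ∑ k, symb k ξ * cconv (V k) (V j) ξ
        - symb j ξ * ∑ k, ∑ l, (riesz k l ξ : ℂ) * cconv (V k) (V l) ξ := by
    simp_rw [mul_sub, Finset.sum_sub_distrib, Finset.mul_sum, ← mul_assoc, hr]
  rw [h1]
  have h2 : ∑ a, symb a ξ * (symb a ξ * V j ξ) = (∑ a, symb a ξ * symb a ξ) * V j ξ := by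
    rw [Finset.sum_mul]; simp_rw [mul_assoc]
  rw [h2]
  ring

/-- The right-hand side of the equation in frequency space is the Fourier transform of
`μ Δu_j - u·∇u_j - ∂_j q`. -/
lemma fourierInv_rate {μ : ℝ} {V : Fin 3 → E3 → ℂ} (hV : ∀ j, RapidDecay (V j))
    (hdiv : ∀ ξ, ∑ j, symb j ξ * V j ξ = 0) (j : Fin 3) (x : E3) :
    𝓕⁻ (fun ξ => -damp μ ξ * V j ξ + nonlin (fun k l => cconv (V k) (V l) ξ) j ξ) x =
      μ * ∑ a, pderiv a (pderiv a (𝓕⁻ (V j))) x - ∑ k, 𝓕⁻ (V k) x * pderiv k (𝓕⁻ (V j)) x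
        - pderiv j (𝓕⁻ (pressureFourier V)) x := by
  have hN := fun k => (hV k).cconv (hV j)
  have hP := rapidDecay_pressureFourier hV
  have hS := rapidDecay_sum fun a => ((hV j).symb a).symb a
  have hT := rapidDecay_sum fun k => (hN k).symb k
  simp_rw [rate_eq]
  rw [(hS.const_mul μ).fourierInv_add ((hT.const_mul (-1)).add ((hP.symb j).const_mul (-1))),
    (hT.const_mul (-1)).fourierInv_add ((hP.symb j).const_mul (-1))]
  rw [fourierInv_const_mul, fourierInv_const_mul, fourierInv_const_mul,
    fourierInv_sum fun a => ((hV j).symb a).symb a, fourierInv_sum fun k => (hN k).symb k]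
  have e1 : ∀ a, 𝓕⁻ (fun ξ => symb a ξ * (symb a ξ * V j ξ)) = pderiv a (pderiv a (𝓕⁻ (V j))) := by
    intro a
    rw [(hV j).pderiv_fourierInv, ((hV j).symb a).pderiv_fourierInv]
  have e2 : ∀ k, 𝓕⁻ (fun ξ => symb k ξ * cconv (V k) (V j) ξ) x =
      𝓕⁻ (V k) x * pderiv k (𝓕⁻ (V j)) x + 𝓕⁻ (V j) x * pderiv k (𝓕⁻ (V k)) x := by
    intro k
    rw [← (hN k).pderiv_fourierInv, ← (hV k).fourierInv_mul (hV j), pderiv,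
      fderiv_fun_mul ((hV k).differentiable_fourierInv x) ((hV j).differentiable_fourierInv x)]
    rfl
  have e3 : ∑ k, pderiv k (𝓕⁻ (V k)) x = 0 := by
    simp_rw [fun k => (hV k).pderiv_fourierInv k]
    rw [← fourierInv_sum fun k => (hV k).symb k]
    simp_rw [hdiv, fourierInv_eq_integral_echar, mul_zero, integral_zero]
  simp_rw [e1, e2, Finset.sum_add_distrib, ← Finset.mul_sum, e3, ← hP.pderiv_fourierInv]
  ring

lemma ClosedFlow.hasDerivWithinAt_fourierInv {μ a b t : ℝ} {V : Fin 3 → ℝ → E3 → ℂ}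
    (h : ClosedFlow μ a b V) (hab : a < b) (ht : t ∈ Icc a b) (j : Fin 3) (x : E3) :
    HasDerivWithinAt (fun t => 𝓕⁻ (V j t) x) (𝓕⁻ (fun ξ => -damp μ ξ * V j t ξ +
      nonlin (fun k l => cconv (V k t) (V l t) ξ) j ξ) x) (Icc a b) t := by
  obtain ⟨h0, G, hG, hd⟩ := h.timeSmooth 1 j
  obtain ⟨E, hE, hb⟩ := TimeRapid.envelope h0
  obtain ⟨E', hE', hb'⟩ := TimeRapid.envelope hG
  have hGt : G t = fun ξ => -damp μ ξ * V j t ξ +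
      nonlin (fun k l => cconv (V k t) (V l t) ξ) j ξ := by
    ext ξ
    exact UniqueDiffWithinAt.eq_deriv (Icc a b) (uniqueDiffOn_Icc hab t ht) (hd t ht ξ)
      (h.hasDeriv t ht ξ j)
  have h1 := hasFDerivWithinAt_fourierInv (z := (t, x)) (hE.add hE') h0.measurable
    (TimeRapid.measurable hG) (fun t ht ξ => (hb t ht ξ).trans (le_add_of_nonneg_right (hE'.nonneg ξ)))
    (fun t ht ξ => (hb' t ht ξ).trans (le_add_of_nonneg_left (hE.nonneg ξ))) hd ⟨ht, mem_univ x⟩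
  have h2 : HasDerivWithinAt (fun τ : ℝ => (τ, x)) ((1 : ℝ), (0 : E3)) (Icc a b) t :=
    (hasDerivWithinAt_id t _).prodMk (hasDerivWithinAt_const t _ x)
  have hmaps : MapsTo (fun τ : ℝ => (τ, x)) (Icc a b) (Icc a b ×ˢ univ) :=
    fun τ hτ => ⟨hτ, mem_univ x⟩
  have h3 := h1.comp_hasDerivWithinAt t h2 hmaps
  refine h3.congr_deriv ?_
  rw [← hGt]
  simp [fourierInvDeriv, dtime, dspace]

/-- A flow that is closed on `[a, T]` for all `a > 0` gives functions that are smooth in space-time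
up to `t = T`. -/
lemma contDiffOn_fourierInv_Ioc {T : ℝ} {F : ℝ → E3 → ℂ}
    (hF : ∀ a ∈ Ioo 0 T, ∀ m, TimeSmooth a T m F) :
    ContDiffOn ℝ ∞ (fun z : ℝ × E3 => 𝓕⁻ (F z.1) z.2) (Ioc 0 T ×ˢ univ) := by
  rw [contDiffOn_infty]
  intro m z hz
  have ha : z.1 / 2 ∈ Ioo 0 T := ⟨half_pos hz.1.1, by linarith [hz.1.1, hz.1.2]⟩
  refine ((hF _ ha m).contDiffOn_fourierInv ha.2 z
    ⟨⟨by linarith [hz.1.1], hz.1.2⟩, mem_univ _⟩).mono_of_mem_nhdsWithin ?_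
  have h1 : Ioi (z.1 / 2) ×ˢ (univ : Set E3) ∈ 𝓝 z :=
    (isOpen_Ioi.prod isOpen_univ).mem_nhds ⟨by simpa using hz.1.1, mem_univ _⟩
  filter_upwards [mem_nhdsWithin_of_mem_nhds h1, self_mem_nhdsWithin] with w hw hw'
  exact ⟨⟨le_of_lt hw.1, hw'.1.2⟩, mem_univ _⟩

lemma TimeSmooth.sum {a b : ℝ} {m : ℕ} {F : Fin 3 → ℝ → E3 → ℂ} (hF : ∀ i, TimeSmooth a b m (F i)) :
    TimeSmooth a b m fun t ξ => ∑ i, F i t ξ := by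
  simp_rw [Fin.sum_univ_three]
  exact ((hF 0).add (hF 1)).add (hF 2)

lemma TimeSmooth.pressureFourier {a b : ℝ} {m : ℕ} {V : Fin 3 → ℝ → E3 → ℂ}
    (hV : ∀ i, TimeSmooth a b m (V i)) :
    TimeSmooth a b m fun t => pressureFourier fun j => V j t :=
  TimeSmooth.mul (isMultiplier_const (-1)) <| TimeSmooth.sum fun k => TimeSmooth.sum fun l =>
    TimeSmooth.mul (isMultiplier_riesz k l) ((hV k).cconv (hV l))

lemma coordC_ext {w w' : E3} (h : ∀ j, coordC j w = coordC j w') : w = w' := by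
  ext j
  exact Complex.ofReal_injective (h j)

section

variable {μ T : ℝ} {V : Fin 3 → ℝ → E3 → ℂ} {v : ℝ → E3 → E3}

/-- If the gradient of a complex function is real, it is the gradient of the real part. -/
lemma gradient_re_eq {q : E3 → ℂ} {x W : E3} (hq : DifferentiableAt ℝ q x)
    (h : ∀ j, pderiv j q x = coordC j W) : gradient (fun y => (q y).re) x = W := by
  refine coordC_ext fun j => ?_
  rw [coordC_gradient]
  have h1 := (Complex.reCLM.hasFDerivAt.comp x hq.hasFDerivAt).fderiv
  have h2 : fderiv ℝ (fun y => (q y).re) x (EuclideanSpace.single j 1) = (pderiv j q x).re :=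
    congrArg (fun L : E3 →L[ℝ] ℝ => L (EuclideanSpace.single j 1)) h1
  rw [h2, h, coordC_apply, Complex.ofReal_re]

lemma rapidDecay_of_closedFlow (hV : ∀ a ∈ Ioo 0 T, ClosedFlow μ a T V) {t : ℝ} (ht : t ∈ Ioc 0 T)
    (j : Fin 3) : RapidDecay (V j t) :=
  (hV (t / 2) ⟨half_pos ht.1, by linarith [ht.1, ht.2]⟩).rapidDecay ⟨by linarith [ht.1], ht.2⟩ j

lemma contDiffOn_of_closedFlow (hV : ∀ a ∈ Ioo 0 T, ClosedFlow μ a T V)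
    (hv : ∀ t ∈ Ioc 0 T, ∀ j x, coordC j (v t x) = 𝓕⁻ (V j t) x) :
    ContDiffOn ℝ ∞ (fun z : ℝ × E3 => v z.1 z.2) (Ioc 0 T ×ˢ univ) := by
  refine contDiffOn_euclidean.2 fun j => ?_
  have h1 := contDiffOn_fourierInv_Ioc (T := T) fun a ha m => (hV a ha).timeSmooth m j
  refine (Complex.reCLM.contDiff.comp_contDiffOn h1).congr fun z hz => ?_
  simp [← hv z.1 hz.1 j z.2]

lemma contDiffOn_pressure (hV : ∀ a ∈ Ioo 0 T, ClosedFlow μ a T V) :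
    ContDiffOn ℝ ∞ (fun z : ℝ × E3 => (𝓕⁻ (pressureFourier fun j => V j z.1) z.2).re)
      (Ioc 0 T ×ˢ univ) :=
  Complex.reCLM.contDiff.comp_contDiffOn <|
    contDiffOn_fourierInv_Ioc (F := fun t => pressureFourier fun j => V j t)
      fun a ha m => TimeSmooth.pressureFourier fun j => (hV a ha).timeSmooth m j

lemma coordC_derivWithin_of_closedFlow (hV : ∀ a ∈ Ioo 0 T, ClosedFlow μ a T V)
    (hv : ∀ t ∈ Ioc 0 T, ∀ j x, coordC j (v t x) = 𝓕⁻ (V j t) x) {t : ℝ} (ht : t ∈ Ioc 0 T)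
    (j : Fin 3) (x : E3) : coordC j (derivWithin (fun τ => v τ x) (Ioc 0 T) t) =
      𝓕⁻ (fun ξ => -damp μ ξ * V j t ξ + nonlin (fun k l => cconv (V k t) (V l t) ξ) j ξ) x := by
  have hsm := contDiffOn_of_closedFlow hV hv
  have ha : t / 2 ∈ Ioo 0 T := ⟨half_pos ht.1, by linarith [ht.1, ht.2]⟩
  have hdt : DifferentiableWithinAt ℝ (fun τ => v τ x) (Ioc 0 T) t :=
    ((hsm.differentiableOn (by simp)) (t, x) ⟨ht, mem_univ x⟩).comp (f := fun τ : ℝ => (τ, x)) t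
      (by fun_prop) fun τ hτ => ⟨hτ, mem_univ x⟩
  have h1 : HasDerivWithinAt (fun τ => coordC j (v τ x))
      (coordC j (derivWithin (fun τ => v τ x) (Ioc 0 T) t)) (Ioc 0 T) t :=
    (coordC j).hasFDerivAt.comp_hasDerivWithinAt t hdt.hasDerivWithinAt
  have h2 := (hV _ ha).hasDerivWithinAt_fourierInv ha.2 ⟨by linarith [ht.1], ht.2⟩ j x
  have hnhds : Icc (t / 2) T ∈ 𝓝[Ioc 0 T] t := by
    filter_upwards [mem_nhdsWithin_of_mem_nhds (Ioi_mem_nhds (by linarith [ht.1] : t / 2 < t)),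
      self_mem_nhdsWithin] with τ h1 h2
    exact ⟨le_of_lt h1, h2.2⟩
  have h3 := h2.mono_of_mem_nhdsWithin hnhds
  exact UniqueDiffWithinAt.eq_deriv _ (uniqueDiffOn_Ioc 0 T t ht) h1
    (h3.congr (fun τ hτ => hv τ hτ j x) (hv t ht j x))

lemma solvesNavierStokes_of_closedFlow (hV : ∀ a ∈ Ioo 0 T, ClosedFlow μ a T V)
    (hv : ∀ t ∈ Ioc 0 T, ∀ j x, coordC j (v t x) = 𝓕⁻ (V j t) x) :
    SolvesNavierStokes μ (Ioc 0 T) v fun t x => (𝓕⁻ (pressureFourier fun j => V j t) x).re := by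
  intro t ht x
  have hsl : ContDiff ℝ ∞ (v t) := slice_contDiff (contDiffOn_of_closedFlow hV hv) ht
  have hd : DifferentiableAt ℝ (v t) x := hsl.differentiable (by simp) x
  have hr := rapidDecay_of_closedFlow hV ht
  have hfun : ∀ j, (fun y => coordC j (v t y)) = 𝓕⁻ (V j t) := fun j => funext (hv t ht j)
  have ha : t / 2 ∈ Ioo 0 T := ⟨half_pos ht.1, by linarith [ht.1, ht.2]⟩
  have hdiv : ∀ ξ, ∑ j, symb j ξ * V j t ξ = 0 :=
    (hV _ ha).div_free t ⟨by linarith [ht.1], ht.2⟩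
  constructor
  · have hg := gradient_re_eq (W := μ • Laplacian.laplacian (v t) x - fderiv ℝ (v t) x (v t x)
      - derivWithin (fun τ => v τ x) (Ioc 0 T) t)
      ((rapidDecay_pressureFourier hr).differentiable_fourierInv x) (by
        intro j
        have h1 := coordC_derivWithin_of_closedFlow hV hv ht j x
        rw [fourierInv_rate hr hdiv] at h1
        have h2 := coordC_smul_laplacian (hsl.of_le two_le_infty) μ j x
        have h3 := sum_coordC_mul_pderiv hd j
        simp_rw [hfun, hv t ht] at h2 h3
        rw [map_sub, map_sub, h1, h2, ← h3]
        ring)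
    rw [hg]
    abel
  · have h1 := coordC_sum_eq_divergence hd
    simp_rw [hfun, fun k => (hr k).pderiv_fourierInv k] at h1
    rw [← fourierInv_sum fun k => (hr k).symb k] at h1
    simp_rw [hdiv, fourierInv_eq_integral_echar, mul_zero, integral_zero] at h1
    exact_mod_cast h1.symm

end

/-! ### Continuity up to the final time in `H²` -/

/-- Pointwise continuity in time under a fixed envelope gives continuity in `L²`. -/
lemma TimeRapid.tendsto_eLpNorm_sub {a b : ℝ} {F : ℝ → E3 → ℂ} (hF : TimeRapid a b F) {t₀ : ℝ}
    (ht₀ : t₀ ∈ Icc a b) :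
    Tendsto (fun t => eLpNorm (fun ξ => F t ξ - F t₀ ξ) 2 volume) (𝓝[Icc a b] t₀) (𝓝 0) := by
  obtain ⟨E, hE, hb⟩ := hF.envelope
  have hE2 := hE.add hE
  have hfin : ∫⁻ ξ, ENNReal.ofReal (E ξ + E ξ) ^ 2 ≠ ⊤ := by
    simpa [wnorm] using (hE2.wnorm_lt_top 0).ne
  have h1 : Tendsto (fun t => ∫⁻ ξ, ‖F t ξ - F t₀ ξ‖ₑ ^ 2) (𝓝[Icc a b] t₀)
      (𝓝 (∫⁻ _ : E3, (0 : ℝ≥0∞))) := by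
    refine tendsto_lintegral_filter_of_dominated_convergence
      (fun ξ => ENNReal.ofReal (E ξ + E ξ) ^ 2) (Eventually.of_forall fun t => ?_) ?_ hfin
      (ae_of_all _ fun ξ => ?_)
    · have h1 := hF.measurable t
      have h2 := hF.measurable t₀
      fun_prop
    · filter_upwards [self_mem_nhdsWithin] with t ht
      refine ae_of_all _ fun ξ => pow_le_pow_left₀ bot_le ?_ 2
      rw [← ofReal_norm]
      exact ENNReal.ofReal_le_ofReal ((norm_sub_le _ _).trans (add_le_add (hb t ht ξ) (hb t₀ ht₀ ξ)))
    · have h2 : Tendsto (fun t => F t ξ - F t₀ ξ) (𝓝[Icc a b] t₀) (𝓝 (F t₀ ξ - F t₀ ξ)) :=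
        (hF.continuousOn ξ t₀ ht₀).tendsto.sub_const _
      rw [sub_self] at h2
      have h3 := (ENNReal.continuous_pow 2).tendsto _ |>.comp h2.enorm
      simpa [Function.comp_def] using h3
  have h2 := (ENNReal.continuous_rpow_const (y := 1 / 2)).tendsto _ |>.comp h1
  have e : ∀ t, eLpNorm (fun ξ => F t ξ - F t₀ ξ) 2 volume
      = (∫⁻ ξ, ‖F t ξ - F t₀ ξ‖ₑ ^ 2) ^ (1 / 2 : ℝ) := by
    intro t
    rw [← eLpNorm_two_sq, ← ENNReal.rpow_natCast, ← ENNReal.rpow_mul]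
    norm_num
  simp_rw [e]
  simpa [Function.comp_def] using h2

lemma norm_le_sum_coordC (w : E3) : ‖w‖ ≤ ∑ j, ‖coordC j w‖ := by
  have h2 : w = ∑ j, EuclideanSpace.single j (w j) := by
    ext i; simp [Finset.sum_apply, Pi.single_apply]
  conv_lhs => rw [h2]
  exact norm_sum_le_of_le _ fun j _ => by simp

lemma norm_clm_le_sum {G : Type*} [NormedAddCommGroup G] [NormedSpace ℝ G] (L : E3 →L[ℝ] G) :
    ‖L‖ ≤ ∑ a, ‖L (EuclideanSpace.single a 1)‖ := by
  refine L.opNorm_le_bound (Finset.sum_nonneg fun _ _ => norm_nonneg _) fun w => ?_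
  have h2 : w = ∑ k, (w k) • (EuclideanSpace.single k (1 : ℝ) : E3) := by
    ext i; simp [Finset.sum_apply, Pi.single_apply]
  conv_lhs => rw [h2, map_sum]
  rw [Finset.sum_mul]
  refine norm_sum_le_of_le _ fun a _ => ?_
  rw [map_smul, norm_smul, mul_comm]
  exact mul_le_mul_of_nonneg_left (PiLp.norm_apply_le w a) (norm_nonneg _)

lemma norm_fderiv_sub_le {w w' : E3 → E3} {x : E3} (hw : DifferentiableAt ℝ w x)
    (hw' : DifferentiableAt ℝ w' x) : ‖fderiv ℝ w x - fderiv ℝ w' x‖ ≤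
      ∑ a, ∑ j, ‖pderiv a (fun y => coordC j (w y)) x - pderiv a (fun y => coordC j (w' y)) x‖ := by
  refine (norm_clm_le_sum _).trans (Finset.sum_le_sum fun a _ => (norm_le_sum_coordC _).trans_eq ?_)
  refine Finset.sum_congr rfl fun j _ => ?_
  rw [pderiv_coordC hw, pderiv_coordC hw', ← map_sub]
  rfl

lemma norm_fderiv_fderiv_sub_le {w w' : E3 → E3} {x : E3} (hw : ContDiff ℝ 2 w)
    (hw' : ContDiff ℝ 2 w') : ‖fderiv ℝ (fderiv ℝ w) x - fderiv ℝ (fderiv ℝ w') x‖ ≤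
      ∑ a, ∑ b, ∑ j, ‖pderiv a (pderiv b (fun y => coordC j (w y))) x
        - pderiv a (pderiv b (fun y => coordC j (w' y))) x‖ := by
  refine (norm_clm_le_sum _).trans (Finset.sum_le_sum fun a _ => (norm_clm_le_sum _).trans
    (Finset.sum_le_sum fun b _ => (norm_le_sum_coordC _).trans_eq ?_))
  refine Finset.sum_congr rfl fun j _ => ?_
  rw [pderiv_pderiv_coordC hw, pderiv_pderiv_coordC hw', ← map_sub]
  rfl

section

variable {μ T : ℝ} {V : Fin 3 → ℝ → E3 → ℂ} {v : ℝ → E3 → E3}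

/-- A finite sum of `L²` distances of inverse Fourier transforms tends to zero at the final time. -/
lemma tendsto_eLpNorm_of_norm_le {ι : Type*} [Fintype ι] {T : ℝ} (hT : 0 < T) {F : ι → ℝ → E3 → ℂ}
    (hF : ∀ i, ∀ a ∈ Ioo 0 T, TimeRapid a T (F i)) {G : Type*} [NormedAddCommGroup G]
    {w : ℝ → E3 → G}
    (hw : ∀ t ∈ Ioc 0 T, ∀ᵐ x, ‖w t x‖ ≤ ∑ i, ‖𝓕⁻ (F i t) x - 𝓕⁻ (F i T) x‖) :
    Tendsto (fun t => eLpNorm (w t) 2 volume) (𝓝[Icc 0 T] T) (𝓝 0) := by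
  have ha : T / 2 ∈ Ioo 0 T := ⟨half_pos hT, by linarith⟩
  have hnhds : Icc (T / 2) T ∈ 𝓝[Icc 0 T] T := by
    filter_upwards [mem_nhdsWithin_of_mem_nhds (Ioi_mem_nhds ha.2), self_mem_nhdsWithin] with τ h1 h2
    exact ⟨le_of_lt h1, h2.2⟩
  have hTm : T ∈ Icc (T / 2) T := right_mem_Icc.2 ha.2.le
  have hle : 𝓝[Icc 0 T] T ≤ 𝓝[Icc (T / 2) T] T :=
    le_inf inf_le_left (le_principal_iff.2 hnhds)
  have h1 : Tendsto (fun t => ∑ i, eLpNorm (fun ξ => F i t ξ - F i T ξ) 2 volume)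
      (𝓝[Icc 0 T] T) (𝓝 (∑ _i : ι, 0)) :=
    tendsto_finsetSum _ fun i _ => ((hF i _ ha).tendsto_eLpNorm_sub hTm).mono_left hle
  rw [Finset.sum_const_zero] at h1
  refine tendsto_of_tendsto_of_tendsto_of_le_of_le' tendsto_const_nhds h1
    (Eventually.of_forall fun _ => bot_le) ?_
  filter_upwards [hnhds] with t ht
  have hr : ∀ i, ∀ τ ∈ Icc (T / 2) T, RapidDecay (F i τ) := fun i τ hτ => (hF i _ ha).rapidDecay hτ
  have hsub : ∀ i, RapidDecay fun ξ => F i t ξ + -1 * F i T ξ := fun i =>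
    (hr i t ht).add ((hr i T hTm).const_mul (-1))
  have he : ∀ i, (fun ξ => F i t ξ + -1 * F i T ξ) = fun ξ => F i t ξ - F i T ξ := fun i => by
    ext ξ; ring
  have hf : ∀ i x, 𝓕⁻ (fun ξ => F i t ξ + -1 * F i T ξ) x = 𝓕⁻ (F i t) x - 𝓕⁻ (F i T) x := by
    intro i x
    rw [(hr i t ht).fourierInv_add ((hr i T hTm).const_mul (-1)), fourierInv_const_mul]; ring
  have h2 : ∀ᵐ x, ‖w t x‖ ≤ (∑ i, fun x => ‖𝓕⁻ (fun ξ => F i t ξ + -1 * F i T ξ) x‖) x := by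
    filter_upwards [hw t ⟨ha.1.trans_le ht.1, ht.2⟩] with x hx
    rw [Finset.sum_apply]
    simpa only [hf] using hx
  refine (eLpNorm_mono_ae_real h2).trans ((eLpNorm_sum_le (fun i _ =>
    (hsub i).memLp_fourierInv.1.norm) one_le_two).trans_eq ?_)
  refine Finset.sum_congr rfl fun i _ => ?_
  rw [eLpNorm_norm, (hsub i).isFourierPair.eLpNorm_eq, he]

lemma isH2Jet_of_rapidDecay {w : E3 → E3} {F : Fin 3 → E3 → ℂ} (hF : ∀ j, RapidDecay (F j))
    (hw : ContDiff ℝ 2 w) (h : ∀ j, (fun x => coordC j (w x)) = 𝓕⁻ (F j)) :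
    IsH2Jet w (fderiv ℝ w) (fderiv ℝ (fderiv ℝ w)) := by
  have hw1 : ContDiff ℝ 1 (fderiv ℝ w) := hw.fderiv_right (by norm_num)
  have z : ContDiff ℝ 2 (fun _ : E3 => (0 : E3)) := contDiff_const
  have hz : ∀ j, (fun y : E3 => coordC j (0 : E3)) = fun _ => 0 := fun j => by simp
  have hp0 : ∀ a x, pderiv a (fun _ : E3 => (0 : ℂ)) x = 0 := fun a x => by simp [pderiv]
  have hp0' : ∀ a, pderiv a (fun _ : E3 => (0 : ℂ)) = fun _ => 0 := fun a => funext (hp0 a)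
  have hd0 : ∀ x, fderiv ℝ (fderiv ℝ fun _ : E3 => (0 : E3)) x = 0 := fun x => by
    rw [fderiv_fun_const]; exact fderiv_const_apply (0 : E3 →L[ℝ] E3)
  have m0 : MemLp (fun x => ∑ j, ‖𝓕⁻ (F j) x‖) 2 volume :=
    memLp_finsetSum _ fun j _ => (hF j).memLp_fourierInv.norm
  have m1 : MemLp (fun x => ∑ a, ∑ j, ‖pderiv a (𝓕⁻ (F j)) x‖) 2 volume :=
    memLp_finsetSum _ fun a _ => memLp_finsetSum _ fun j _ => by
      rw [(hF j).pderiv_fourierInv]; exact ((hF j).symb a).memLp_fourierInv.norm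
  have m2 : MemLp (fun x => ∑ a, ∑ b, ∑ j, ‖pderiv a (pderiv b (𝓕⁻ (F j))) x‖) 2 volume :=
    memLp_finsetSum _ fun a _ => memLp_finsetSum _ fun b _ => memLp_finsetSum _ fun j _ => by
      rw [(hF j).pderiv_fourierInv, ((hF j).symb b).pderiv_fourierInv]
      exact (((hF j).symb b).symb a).memLp_fourierInv.norm
  refine ⟨m0.mono' hw.continuous.aestronglyMeasurable (ae_of_all _ fun x => ?_),
    m1.mono' (hw.continuous_fderiv (by norm_num)).aestronglyMeasurable (ae_of_all _ fun x => ?_),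
    MemLp.mono' (E := E3 →L[ℝ] E3 →L[ℝ] E3) m2 (hw1.continuous_fderiv one_ne_zero).aestronglyMeasurable
      (ae_of_all _ fun x => ?_),
    IsWeakFDeriv.of_contDiff (hw.of_le (by norm_num)), IsWeakFDeriv.of_contDiff hw1⟩
  · simpa only [fun j => congrFun (h j) x] using norm_le_sum_coordC (w x)
  · have := norm_fderiv_sub_le (hw.differentiable (by norm_num) x) (z.differentiable (by norm_num) x)
    simp_rw [h, hz, hp0] at this
    simpa only [fderiv_fun_const, Pi.zero_apply, sub_zero] using this
  · have := norm_fderiv_fderiv_sub_le (x := x) hw z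
    simp_rw [h, hz, hp0'] at this
    simp only [sub_zero] at this
    refine le_trans (le_of_eq ?_) this
    rw [hd0]
    exact congrArg norm (ContinuousLinearMap.ext fun a => (sub_zero _).symm)

/-- Away from the final time continuity in `H²` is that of `u`; at the final time it comes from the
rapidly decaying continuous family `V`. -/
lemma continuousOnH2_extend (hT : 0 < T) {u : ℝ → E3 → E3} (hu : ContinuousOnH2 u (Ico 0 T))
    (hvu : ∀ t < T, v t = u t) (hV : ∀ a ∈ Ioo 0 T, ClosedFlow μ a T V)
    (hv : ∀ t ∈ Ioc 0 T, ∀ j x, coordC j (v t x) = 𝓕⁻ (V j t) x) :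
    ContinuousOnH2 v (Icc 0 T) := by
  obtain ⟨g, h, hj, hc⟩ := hu
  have hsl : ∀ t ∈ Ioc 0 T, ContDiff ℝ 2 (v t) := fun t ht =>
    (slice_contDiff (contDiffOn_of_closedFlow hV hv) ht).of_le two_le_infty
  have hfun : ∀ t ∈ Ioc 0 T, ∀ j, (fun y => coordC j (v t y)) = 𝓕⁻ (V j t) :=
    fun t ht j => funext (hv t ht j)
  have hr := fun t (ht : t ∈ Ioc 0 T) => rapidDecay_of_closedFlow hV ht
  have hTm : T ∈ Ioc 0 T := right_mem_Ioc.2 hT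
  have hjet : IsH2Jet (v T) (fderiv ℝ (v T)) (fderiv ℝ (fderiv ℝ (v T))) :=
    isH2Jet_of_rapidDecay (hr T hTm) (hsl T hTm) (hfun T hTm)
  have hae : ∀ t ∈ Ioo 0 T, g t =ᵐ[volume] fderiv ℝ (v t) ∧
      h t =ᵐ[volume] fderiv ℝ (fderiv ℝ (v t)) := by
    intro t ht
    have h1 := hj t ⟨ht.1.le, ht.2⟩
    rw [← hvu t ht.2] at h1
    exact h1.ae_eq_fderiv (hsl t ⟨ht.1, ht.2.le⟩)
  refine ⟨fun t => if t < T then g t else fderiv ℝ (v t),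
    fun t => if t < T then h t else fderiv ℝ (fderiv ℝ (v t)), fun t ht => ?_, fun t₀ ht₀ => ?_⟩
  · rcases ht.2.lt_or_eq with htT | rfl
    · simp only [if_pos htT, hvu t htT]
      exact hj t ⟨ht.1, htT⟩
    · simpa using hjet
  rcases ht₀.2.lt_or_eq with htT | rfl
  -- before the final time, neighbourhoods in `[0,T]` and `[0,T)` agree
  · have hn : 𝓝[Icc 0 T] t₀ = 𝓝[Ico 0 T] t₀ := by
      rw [← nhdsWithin_inter_of_mem' (mem_nhdsWithin_of_mem_nhds (Iio_mem_nhds htT))]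
      congr 1
      ext t
      simp only [mem_inter_iff, mem_Icc, mem_Iio, mem_Ico]
      exact ⟨fun h => ⟨h.1.1, h.2⟩, fun h => ⟨⟨h.1, h.2.le⟩, h.2⟩⟩
    have hev : ∀ᶠ t in 𝓝[Ico 0 T] t₀, t < T := by
      filter_upwards [self_mem_nhdsWithin] with t ht using ht.2
    obtain ⟨c0, c1, c2⟩ := hc t₀ ⟨ht₀.1, htT⟩
    rw [hn]
    refine ⟨c0.congr' ?_, c1.congr' ?_, c2.congr' ?_⟩
    · filter_upwards [hev] with t ht
      rw [hvu t ht, hvu t₀ htT]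
    · filter_upwards [hev] with t ht
      simp only [if_pos ht, if_pos htT]
    · filter_upwards [hev] with t ht
      simp only [if_pos ht, if_pos htT]
  · have hV1 : ∀ j a, ∀ a' ∈ Ioo 0 t₀, TimeRapid a' t₀ fun t ξ => symb a ξ * V j t ξ :=
      fun j a a' ha' => TimeRapid.mul (isMultiplier_symb a) ((hV a' ha').timeSmooth 0 j)
    have hV2 : ∀ j a b, ∀ a' ∈ Ioo 0 t₀, TimeRapid a' t₀ fun t ξ => symb a ξ * (symb b ξ * V j t ξ) :=
      fun j a b a' ha' => TimeRapid.mul (isMultiplier_symb a) (hV1 j b a' ha')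
    have hp1 : ∀ t ∈ Ioc 0 t₀, ∀ j a, pderiv a (fun y => coordC j (v t y))
        = 𝓕⁻ fun ξ => symb a ξ * V j t ξ := fun t ht j a => by
      rw [hfun t ht, (hr t ht j).pderiv_fourierInv]
    have hp2 : ∀ t ∈ Ioc 0 t₀, ∀ j a b, pderiv a (pderiv b (fun y => coordC j (v t y)))
        = 𝓕⁻ fun ξ => symb a ξ * (symb b ξ * V j t ξ) := fun t ht j a b => by
      rw [hp1 t ht, ((hr t ht j).symb b).pderiv_fourierInv]
    simp only [lt_irrefl, if_false]
    refine ⟨?_, ?_, ?_⟩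
    · refine tendsto_eLpNorm_of_norm_le hT (F := fun j => V j)
        (fun j a ha => (hV a ha).timeSmooth 0 j) fun t ht => ae_of_all _ fun x => ?_
      simp only [← hv t ht, ← hv t₀ hTm, ← map_sub]
      exact norm_le_sum_coordC _
    · refine tendsto_eLpNorm_of_norm_le hT (ι := Fin 3 × Fin 3)
        (F := fun i t ξ => symb i.1 ξ * V i.2 t ξ) (fun i => hV1 i.2 i.1) fun t ht => ?_
      have key : ∀ x, ‖fderiv ℝ (v t) x - fderiv ℝ (v t₀) x‖ ≤ ∑ i : Fin 3 × Fin 3,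
          ‖𝓕⁻ (fun ξ => symb i.1 ξ * V i.2 t ξ) x - 𝓕⁻ (fun ξ => symb i.1 ξ * V i.2 t₀ ξ) x‖ := by
        intro x
        have h1 := norm_fderiv_sub_le ((hsl t ht).differentiable (by norm_num) x)
          ((hsl t₀ hTm).differentiable (by norm_num) x)
        simp_rw [hp1 t ht, hp1 t₀ hTm] at h1
        rwa [Fintype.sum_prod_type]
      rcases ht.2.lt_or_eq with htT | rfl
      · filter_upwards [(hae t ⟨ht.1, htT⟩).1] with x hx
        simp only [if_pos htT, hx]
        exact key x
      · exact ae_of_all _ fun x => by simp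
    · refine tendsto_eLpNorm_of_norm_le hT (ι := Fin 3 × Fin 3 × Fin 3)
        (F := fun i t ξ => symb i.1 ξ * (symb i.2.1 ξ * V i.2.2 t ξ))
        (G := E3 →L[ℝ] E3 →L[ℝ] E3) (fun i => hV2 i.2.2 i.1 i.2.1) fun t ht => ?_
      have key : ∀ x, ‖fderiv ℝ (fderiv ℝ (v t)) x - fderiv ℝ (fderiv ℝ (v t₀)) x‖ ≤
          ∑ i : Fin 3 × Fin 3 × Fin 3, ‖𝓕⁻ (fun ξ => symb i.1 ξ * (symb i.2.1 ξ * V i.2.2 t ξ)) x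
            - 𝓕⁻ (fun ξ => symb i.1 ξ * (symb i.2.1 ξ * V i.2.2 t₀ ξ)) x‖ := by
        intro x
        have h1 := norm_fderiv_fderiv_sub_le (x := x) (hsl t ht) (hsl t₀ hTm)
        simp_rw [hp2 t ht, hp2 t₀ hTm] at h1
        simp_rw [Fintype.sum_prod_type]
        exact h1
      rcases ht.2.lt_or_eq with htT | rfl
      · filter_upwards [(hae t ⟨ht.1, htT⟩).2] with x hx
        simp only [if_pos htT, hx]
        exact key x
      · exact ae_of_all _ fun x => by simp only [lt_irrefl, if_false]; exact key x

end

/-! ### The extension -/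

/-- The extension is defined at time `T` as the real vector field with Fourier transform `V T`, the
limit of the Fourier transforms at earlier times. -/
theorem IsSmoothSolution.exists_extension {μ T : ℝ} (hμ : 0 < μ) (hT : 0 < T) {u₀ : E3 → E3}
    {u : ℝ → E3 → E3} (hu : IsSmoothSolution μ u₀ (Ico 0 T) u) {p : ℝ≥0∞} {s : ℝ} (hs : 0 < s)
    (hp : 3 < p) (hps : 3 / p + 2 / ENNReal.ofReal s ≤ 1) (hint : logSerrinIntegral T p s u < ⊤) :
    ∃ v : ℝ → E3 → E3, (∀ t < T, v t = u t) ∧ IsSmoothSolution μ u₀ (Icc 0 T) v := by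
  obtain ⟨q, hq⟩ := hu.flowData
  obtain ⟨U, hU, hfU⟩ := hq.exists_fourierFlow hμ hT
  have huU : ∀ t ∈ Ioo 0 T, ∀ j x, 𝓕⁻ (U j t) x = coordC j (u t x) := fun t ht j x => by
    rw [← hfU j t ht]
  obtain ⟨V, hVU, hV⟩ := hU.exists_closedFlow_of_energy_le hμ fun a ha =>
    hU.exists_energy_le hμ huU hs hp hps hint ha
  -- the limit at the final time is real, being a limit of real functions
  have hreal : ∀ j x, (((𝓕⁻ (V j T) x).re : ℝ) : ℂ) = 𝓕⁻ (V j T) x := by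
    intro j x
    have ha : T / 2 ∈ Ioo 0 T := ⟨half_pos hT, by linarith⟩
    have hcont : ContinuousOn (fun t => 𝓕⁻ (V j t) x) (Icc (T / 2) T) :=
      (TimeRapid.continuousOn_fourierInv ((hV _ ha).timeSmooth 0 j)).comp
        (f := fun t : ℝ => (t, x)) (by fun_prop) fun t ht => ⟨ht, mem_univ x⟩
    have h1 : Tendsto (fun t => 𝓕⁻ (V j t) x) (𝓝[Ico (T / 2) T] T) (𝓝 (𝓕⁻ (V j T) x)) :=
      (hcont T (right_mem_Icc.2 ha.2.le)).mono_left (nhdsWithin_mono _ Ico_subset_Icc_self)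
    have h2 : Tendsto (fun t => (((𝓕⁻ (V j t) x).re : ℝ) : ℂ)) (𝓝[Ico (T / 2) T] T)
        (𝓝 (((𝓕⁻ (V j T) x).re : ℝ) : ℂ)) :=
      ((Complex.continuous_ofReal.comp Complex.continuous_re).tendsto _).comp h1
    have hne : (𝓝[Ico (T / 2) T] T).NeBot := by
      rw [← mem_closure_iff_nhdsWithin_neBot, closure_Ico ha.2.ne]
      exact right_mem_Icc.2 ha.2.le
    refine tendsto_nhds_unique (h2.congr' ?_) h1
    filter_upwards [self_mem_nhdsWithin] with t ht
    rw [hVU j t ht.2, huU t ⟨ha.1.trans_le ht.1, ht.2⟩, coordC_apply, Complex.ofReal_re]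
  set v : ℝ → E3 → E3 := fun t =>
    if t < T then u t else fun x => WithLp.toLp 2 fun j => (𝓕⁻ (V j T) x).re
  have hvu : ∀ t < T, v t = u t := fun t ht => if_pos ht
  have hvT : v T = fun x => WithLp.toLp 2 fun j => (𝓕⁻ (V j T) x).re := if_neg (lt_irrefl T)
  have hvV : ∀ t ∈ Ioc 0 T, ∀ j x, coordC j (v t x) = 𝓕⁻ (V j t) x := by
    intro t ht j x
    rcases ht.2.lt_or_eq with htT | rfl
    · rw [hvu t htT, hVU j t htT, huU t ⟨ht.1, htT⟩]
    · rw [← hreal, hvT]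
      rfl
  have hI : Icc 0 T ∩ Ioi 0 = Ioc 0 T := by
    ext t
    simp only [mem_inter_iff, mem_Icc, mem_Ioi, mem_Ioc]
    exact ⟨fun h => ⟨h.2, h.1.2⟩, fun h => ⟨⟨h.1.le, h.2⟩, h.1⟩⟩
  refine ⟨v, hvu, continuousOnH2_extend hT hu.continuousOnH2 hvu hV hvV, ?_,
    fun t x => (𝓕⁻ (pressureFourier fun j => V j t) x).re, ?_, ?_, ?_⟩
  · rw [hvu 0 hT]; exact hu.initial
  · rw [hI]; exact contDiffOn_of_closedFlow hV hvV
  · rw [hI]; exact contDiffOn_pressure hV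
  · rw [hI]; exact solvesNavierStokes_of_closedFlow hV hvV

theorem theorem1 (μ T : ℝ) (hμ : 0 < μ) (hT : 0 < T)
    (u₀ : E3 → E3) (hu₀ : MemH2 u₀)
    (u : ℝ → E3 → E3) (hu : IsSmoothSolution μ u₀ (Ico 0 T) u)
    (p : ℝ≥0∞) (s : ℝ) (hs : 0 < s) (hp : 3 < p) (hps : 3 / p + 2 / ENNReal.ofReal s ≤ 1)
    (hint : logSerrinIntegral T p s u < ⊤) :
    (∃ M : ℝ≥0, ∀ t ∈ Ioo 0 T,
      eLpNorm (fun x => fderiv ℝ (fderiv ℝ (u t)) x) 2 volume ≤ M) ∧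
    (∃ v : ℝ → E3 → E3, (∀ t ∈ Ico 0 T, v t = u t) ∧ IsSmoothSolution μ u₀ (Icc 0 T) v) := by
  obtain ⟨v, hvu, hv⟩ := hu.exists_extension hμ hT hs hp hps hint
  refine ⟨?_, v, fun t ht => hvu t ht.2, hv⟩
  -- `∇²v` is continuous in `L²` on the compact interval `[0, T]`, hence bounded there
  obtain ⟨g, h, hj, hc⟩ := hv.continuousOnH2
  obtain ⟨M, hM⟩ := ContinuousOnH2.exists_bound hj hc isCompact_Icc le_rfl
  refine ⟨M, fun t ht => ?_⟩
  obtain ⟨q, hsm, -⟩ := hu.smooth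
  have hut : ContDiff ℝ 2 (u t) :=
    (slice_contDiff hsm ⟨⟨ht.1.le, ht.2⟩, ht.1⟩).of_le two_le_infty
  have hjt := hj t ⟨ht.1.le, ht.2.le⟩
  rw [hvu t ht.2] at hjt
  rw [← eLpNorm_congr_ae (hjt.ae_eq_fderiv hut).2]
  exact (hM t ⟨ht.1.le, ht.2.le⟩).2.2
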